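/- **Quantum access to the normalized incidence matrix.** *Model.* Circuits consist of arbitrary unitary gates on at most three qubits (time $1$ each) and calls of black-box unitaries or their inverses (time $T_S\ge 1$ each); the running time is the sum of the times of all gates. Let $S\in\mathbb R^{n\times d}$, $n\ge 3$, have rows $s_1,\dots,s_n$ with $\min_i\|s_i\|=1$, and put $\eta(S)=\max_i\|s_i\|^2/\min_i\|s_i\|^2$. Quantum access to $S$ in time $T_S$ means: black boxes that perform $|i\rangle|0\rangle\mapsto|i\rangle|s_i\rangle$, where $|s_i\rangle=\|s_i\|^{-1}\sum_j S_{ij}|j\rangle$ (on $\lceil\log_2 n\rceil$ index qubits, $\lceil\log_2 d\rceil$ data qubits and $w\le T_S$ ancillas that start and end in $|0\rangle$), and $|i\rangle|0\rangle\mapsto|i\rangle|\|s_i\|\rangle$, where the norm is written as a binary number with $f$ fractional digits, correct up to $2^{-f}$. *The matrix.* Let $d_{min}>0$, $\epsilon_{dist}>0$ and $0<\epsilon_B\le 1$. The similarity graph has nodes $1,\dots,n$ and, for $p\ne q$, $a_{pq}=1$ if $\|s_p-s_q\|\le d_{min}$ and $a_{pq}=0$ otherwise. Its incidence matrix, of size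 $n\times\frac{n(n-1)}2$ with columns indexed by the pairs $p<q$, has the entries $a_{pq}$ if $i=p$, $-a_{pq}$ if $i=q$, and $0$ if $i\notin\{p,q\}$; then every zero entry is replaced by $\epsilon_B$. A matrix $B$ is called an incidence matrix of $S$ with distance precision $\epsilon_{dist}$ if its column $(p,q)$ is exactly that of this modified matrix whenever $\bigl|\|s_p-s_q\|^2-d_{min}^2\bigr|>\epsilon_{dist}$, and every other column $(p,q)$ is a convex combination of the modified column for an edge ($a_{pq}=1$) and the one for a non-edge ($a_{pq}=0$). The normalized incidence matrix $\mathcal B$ is obtained from $B$ by dividing each row by its norm. *Theorem.* There are universal constants $C$ and $K$ such that the following holds for all $n\ge3$, $d$, $w$, $f$, $T_S\ge\max(1,w)$, $\eta$, $d_{min}>0$, $0<\epsilon_{dist}\le4\eta$, $0<\epsilon_B\le1$, $0<\delta<1$ with $2^{-f}\cdot 32\sqrt\eta\le\epsilon_{dist}$. There are two circuits, independent of $S$ and of the black boxes, with total running time $$T_{\mathcal B}\le C\; T_S\cdot\frac{\eta}{\epsilon_{dist}}\cdot\frac1{\epsilon_B}\cdot\log^K\!\Bigl(n+d+\eta+\frac1{\epsilon_{dist}}+\frac1{\epsilon_B}+\frac1\delta\Bigr)=\widetilde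 O\Bigl(T_S\,\frac{\eta}{\epsilon_{dist}}\,\frac1{\epsilon_B}\Bigr),$$ such that, for every $S\in\mathbb R^{n\times d}$ with $\min_i\|s_i\|=1$ and $\eta(S)\le\eta$ and all black boxes that give quantum access to $S$, there is an incidence matrix $B$ of $S$ with distance precision $\epsilon_{dist}$ for whose normalization $\mathcal B$ all rows have norm exactly $1$ and the circuits, using these black boxes, perform the two mappings of quantum access $$|i\rangle|0\rangle\mapsto|i\rangle|\mathcal B_i\rangle\quad(1\le i\le n),\qquad |0\rangle\mapsto\frac1{\|\mathcal B\|_F}\sum_i\|\mathcal B_i\||i\rangle,$$ with an error of norm at most $\delta$ (for each $i$ in the first mapping). Here $|\mathcal B_i\rangle=\|\mathcal B_i\|^{-1}\sum_{p<q}\mathcal B_{i,(p,q)}|p\rangle|q\rangle$, and all ancillas start and end in $|0\rangle$, up to that error. In particular, if no squared distance $\|s_p-s_q\|^2$ lies within $\epsilon_{dist}$ of $d_{min}^2$, this is quantum access to the exact normalized incidence matrix of the similarity graph, with zeros replaced by $\epsilon_B$. -/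

import Mathlib

noncomputable section

/-! Qubit registers and circuits with oracle calls -/

/-- State vectors of a register with one qubit for every element of `W`. -/
abbrev QState (W : Type) [Fintype W] [DecidableEq W] : Type := EuclideanSpace ℂ (W → Bool)

/-- Unitary operators on the register `W`. -/
abbrev QUnitary (W : Type) [Fintype W] [DecidableEq W] : Type := QState W ≃ₗᵢ[ℂ] QState W

/-- The computational basis state `|x⟩`. -/
def ket {W : Type} [Fintype W] [DecidableEq W] (x : W → Bool) : QState W :=
  EuclideanSpace.single x 1

/-- The operator `U` applied to the qubits `e v` (`v : V`) of the register `W`, tensored with the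
identity on all other qubits. `Function.extend e y x` is the bit string `x` with its bits at the
positions `e v` replaced by `y v`. -/
def applyOn {V W : Type} [Fintype V] [DecidableEq V] [Fintype W] [DecidableEq W]
    (e : V ↪ W) (U : QUnitary V) (ψ : QState W) : QState W :=
  WithLp.toLp 2 fun x : W → Bool =>
    U (WithLp.toLp 2 fun y : V → Bool => ψ (Function.extend e y x)) (fun v => x (e v))

/-- A gate of a circuit on the wires `W`: either an arbitrary unitary on at most three qubits, or a
call of one of two black boxes (on wires `Vr` and `Vn`) or of its inverse (`inv = true`). -/
inductive QGate (Vr Vn W : Type) : Type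
  | elementary (k : ℕ) (hk : k ≤ 3) (U : QUnitary (Fin k)) (e : Fin k ↪ W) : QGate Vr Vn W
  | rowCall (inv : Bool) (e : Vr ↪ W) : QGate Vr Vn W
  | normCall (inv : Bool) (e : Vn ↪ W) : QGate Vr Vn W

/-- The time of a gate, when an elementary gate takes time `1` and a call of a black box takes
time `T`. -/
def QGate.time {Vr Vn W : Type} (T : ℝ) : QGate Vr Vn W → ℝ
  | .elementary _ _ _ _ => 1
  | .rowCall _ _ => T
  | .normCall _ _ => T

/-- The action of a gate on a state when the black boxes are `R` and `N`. -/
def QGate.run {Vr Vn W : Type} [Fintype Vr] [DecidableEq Vr] [Fintype Vn] [DecidableEq Vn]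
    [Fintype W] [DecidableEq W] (R : QUnitary Vr) (N : QUnitary Vn) :
    QGate Vr Vn W → QState W → QState W
  | .elementary _ _ U e, ψ => applyOn e U ψ
  | .rowCall inv e, ψ => applyOn e (if inv then R.symm else R) ψ
  | .normCall inv e, ψ => applyOn e (if inv then N.symm else N) ψ

/-- A circuit is a list of gates; the head of the list is applied first. -/
abbrev QCircuit (Vr Vn W : Type) : Type := List (QGate Vr Vn W)

/-- The running time of a circuit. -/
def QCircuit.time {Vr Vn W : Type} (T : ℝ) (c : QCircuit Vr Vn W) : ℝ :=
  (List.map (QGate.time T) c).sum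

/-- The action of a circuit. -/
def QCircuit.run {Vr Vn W : Type} [Fintype Vr] [DecidableEq Vr] [Fintype Vn] [DecidableEq Vn]
    [Fintype W] [DecidableEq W] (R : QUnitary Vr) (N : QUnitary Vn) (c : QCircuit Vr Vn W)
    (ψ : QState W) : QState W :=
  List.foldl (fun φ g => QGate.run R N g φ) ψ c

/-! Matrices and their rows -/

/-- Row `i` of a matrix as a vector with the Euclidean norm. -/
def rowVec {n : ℕ} {κ : Type} (A : Matrix (Fin n) κ ℝ) (i : Fin n) : EuclideanSpace ℝ κ :=
  WithLp.toLp 2 (A i)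

/-- The Frobenius norm. -/
def frobNorm {n : ℕ} {κ : Type} [Fintype κ] (A : Matrix (Fin n) κ ℝ) : ℝ :=
  √(∑ i, ∑ j, A i j ^ 2)

/-- Every row is divided by its norm. -/
def normalizeRows {n : ℕ} {κ : Type} [Fintype κ] (A : Matrix (Fin n) κ ℝ) :
    Matrix (Fin n) κ ℝ :=
  fun i j => A i j / ‖rowVec A i‖

/-- The data parameter `η(A) = max_i ‖A_i‖² / min_i ‖A_i‖²`. -/
def eta {n : ℕ} {κ : Type} [Fintype κ] (A : Matrix (Fin n) κ ℝ) : ℝ :=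
  (⨆ i, ‖rowVec A i‖ ^ 2) / (⨅ i, ‖rowVec A i‖ ^ 2)

/-! Quantum access to a matrix -/

/-- The binary digits of `x`, least significant first, in a register of `k` bits. -/
def bits (k x : ℕ) : Fin k → Bool := fun j => x.testBit j

/-- The number of qubits of a register that holds an element of `{0, …, n - 1}`. -/
abbrev width (n : ℕ) : ℕ := Nat.clog 2 n

/-- Wires for an index register for `n` rows, a register `D`, and `w` ancillary qubits. -/
abbrev AccessWires (n : ℕ) (D : Type) (w : ℕ) : Type := Fin (width n) ⊕ D ⊕ Fin w

/-- The basis state `|i⟩|x⟩|0⟩`: index `i`, second register `x`, ancillas `0`. -/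
def accessKet {n : ℕ} {D : Type} [Fintype D] [DecidableEq D] (w : ℕ) (i : Fin n) (x : D → Bool) :
    QState (AccessWires n D w) :=
  ket (Sum.elim (bits (width n) i) (Sum.elim x (fun _ => false)))

/-- `F` performs `|i⟩|0⟩ ↦ |i⟩|A_i⟩` for every row index `i`, up to an error of norm at most `δ`,
where `|A_i⟩ = ‖A_i‖⁻¹ ∑ⱼ A_{ij} |j⟩` and the column index `j` is encoded as the bit string `enc j`.
The ancillas start and end in `|0⟩`. -/
def PreparesRows {n : ℕ} {κ D : Type} [Fintype κ] [Fintype D] [DecidableEq D] {w : ℕ}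
    (F : QState (AccessWires n D w) → QState (AccessWires n D w))
    (A : Matrix (Fin n) κ ℝ) (enc : κ → D → Bool) (δ : ℝ) : Prop :=
  ∀ i : Fin n,
    ‖F (accessKet w i fun _ => false)
      - ∑ j, ((A i j / ‖rowVec A i‖ : ℝ) : ℂ) • accessKet w i (enc j)‖ ≤ δ

/-- `F` performs `|i⟩|0⟩ ↦ |i⟩|‖A_i‖⟩` for every row index `i`; the second register holds `‖A_i‖`
as a binary number with `f` fractional digits, correct up to one unit of the last digit. -/
def WritesNorms {n : ℕ} {κ : Type} [Fintype κ] {r : ℕ}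
    (F : QState (AccessWires n (Fin r) 0) → QState (AccessWires n (Fin r) 0))
    (A : Matrix (Fin n) κ ℝ) (f : ℕ) : Prop :=
  ∀ i : Fin n, ∃ x : ℕ, x < 2 ^ r ∧ |(x : ℝ) / 2 ^ f - ‖rowVec A i‖| ≤ 1 / 2 ^ f ∧
    F (accessKet 0 i fun _ => false) = accessKet 0 i (bits r x)

/-- `F` performs `|0⟩ ↦ ‖A‖_F⁻¹ ∑ᵢ ‖A_i‖ |i⟩` up to an error of norm at most `δ`. The register for
`i` is accompanied by ancillas that start and end in `|0⟩`. -/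
def PreparesNormState {n : ℕ} {κ : Type} [Fintype κ] {w : ℕ}
    (F : QState (AccessWires n (Fin 0) w) → QState (AccessWires n (Fin 0) w))
    (A : Matrix (Fin n) κ ℝ) (δ : ℝ) : Prop :=
  ‖F (ket fun _ => false)
    - ∑ i, ((‖rowVec A i‖ / frobNorm A : ℝ) : ℂ) • accessKet w i Fin.elim0‖ ≤ δ

/-! The similarity graph and its incidence matrix -/

/-- The possible edges: pairs `(p, q)` of nodes with `p < q`. -/
abbrev NodePair (n : ℕ) : Type := {e : Fin n × Fin n // e.1 < e.2}

/-- The pair `(p, q)` written as `|p⟩|q⟩` in two index registers. -/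
def pairBits {n : ℕ} (e : NodePair n) : Fin (width n) ⊕ Fin (width n) → Bool :=
  Sum.elim (bits (width n) e.1.1) (bits (width n) e.1.2)

/-- The adjacency matrix of the similarity graph with threshold `dmin`. -/
def similarity {n d : ℕ} (S : Matrix (Fin n) (Fin d) ℝ) (dmin : ℝ) : Matrix (Fin n) (Fin n) ℝ :=
  open Classical in
  fun p q => if p ≠ q ∧ dist (rowVec S p) (rowVec S q) ≤ dmin then 1 else 0

/-- The incidence matrix of a graph with adjacency matrix `a`. -/
def incidence {n : ℕ} (a : Matrix (Fin n) (Fin n) ℝ) : Matrix (Fin n) (NodePair n) ℝ :=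
  fun i e => if i = e.1.1 then a e.1.1 e.1.2 else if i = e.1.2 then -a e.1.1 e.1.2 else 0

/-- The zero entries of a matrix are replaced by `ε`. -/
def fillZeros {n : ℕ} {κ : Type} (ε : ℝ) (M : Matrix (Fin n) κ ℝ) : Matrix (Fin n) κ ℝ :=
  open Classical in
  fun i j => if M i j = 0 then ε else M i j

/-- `B` is the incidence matrix of the similarity graph of `S` with threshold `dmin`, with zeros
replaced by `εB`, when squared distances are only known with precision `εdist`. In the columns of
the pairs whose squared distance differs from `dmin ^ 2` by more than `εdist`, it is exactly that
matrix. In any other column it is a convex combination `(1 - t) • (column of a non-edge) +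
t • (column of an edge)`. (The all-zero and the all-one matrix `a` give these two columns.) -/
def IsSimilarityIncidence {n d : ℕ} (S : Matrix (Fin n) (Fin d) ℝ) (dmin εdist εB : ℝ)
    (B : Matrix (Fin n) (NodePair n) ℝ) : Prop :=
  ∀ e : NodePair n,
    (εdist < |dist (rowVec S e.1.1) (rowVec S e.1.2) ^ 2 - dmin ^ 2| →
      ∀ i, B i e = fillZeros εB (incidence (similarity S dmin)) i e) ∧
    ∃ t : ℝ, 0 ≤ t ∧ t ≤ 1 ∧
      ∀ i, B i e = (1 - t) * fillZeros εB (incidence fun _ _ => 0) i e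
        + t * fillZeros εB (incidence fun _ _ => 1) i e

end

/-!
The circuits read the squared distance of two rows off the angle of a Grover iterate, decide by a
polynomial of this iterate whether the pair is an edge, and normalize the rows by a second
polynomial.

*The edges.* For a pair `(p, q)` of nodes, `diffC` prepares a state whose part with zeros on a few
flag qubits is half of the difference of the two rows, divided by a common bound `Λ` of the norms: a
selection qubit picks one of the two rows, the row is loaded by the first black box, and its norm,
written as a binary number by the second one, is turned into an amplitude. The square of the norm of
this part is `‖s_p - s_q‖² / (4 Λ²)` up to the precision of the numbers, so the angle of the Grover
iterate of `diffC` encodes the squared distance (`projOp_diffC`, `groverCos_diffC`).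

*Polynomials of a Grover iterate.* The states that the powers of a Grover iterate produce satisfy
the recurrence of the Chebyshev polynomials (`groverOp_pow_recurrence`). A cosine polynomial of the
angle is therefore a linear combination of these powers. It is implemented in Horner form, with the
flag qubits in unary (`chainC`, `lcuC`), up to a factor `s` such that `s` times the sum of the
absolute values of the coefficients is at most `1`.

*The polynomials.* The convolution of the indicator function of an interval with a power of the
Fejér kernel is a cosine polynomial with values in `[0, 1]`; it is close to `1` inside and close to
`0` outside, except in windows of width about `Δ` around the end points. Its degree is `Õ(1 / Δ)`,
and the sum of the absolute values of its coefficients only grows like the logarithm of the degree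
(`exists_step`). For the angles of pairs, `Δ` is of the order of `εdist / η`. The value of the
polynomial serves as the weight `t` of the convex combination in the column of the pair; rounding it
to `0` or `1` in the columns of pairs with a clear distance changes the matrix only slightly
(`exists_isSimilarityIncidence`).

*A row.* Applied to the uniform superposition of all pairs, `entryC` multiplies each amplitude by
the entry of the row. The part of the resulting state with zeros on the ancillas is the row,
multiplied by a factor that does not depend on the row. The entries of row `i` in the columns of the
pairs that do not contain `i` are `εB`, so the norm of the row is at least `n * εB / 3`
(`le_norm_mixRows`), while there are at most `(2 n)²` strings in the superposition: the amplitude of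
the row is at least `εB` up to logarithms. A second polynomial, which approximates the sign function
and has degree `Õ(1 / εB)`, makes this unknown amplitude almost constant, and `Õ(1)` rounds of
amplitude amplification bring it to `1` (`normalizeC`, `exists_amplify_params`). The degrees of the
two polynomials multiply, which gives the running time.

*The norms.* All rows of the normalized matrix have norm `1`, so the second circuit only has to
prepare the uniform superposition of the indices below `n`, without any call of a black box. It
dampens the amplitude of these indices to `sin (π / 10)`, and two rounds of amplitude amplification
then prepare the state exactly (`cOp_normC`).
-/

noncomputable section

set_option linter.unusedSectionVars false

/-! ### Circuits as unitary operators -/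

section Bits

variable {V W : Type}

theorem extend_extend (e : V ↪ W) (y y' : V → Bool) (x : W → Bool) :
    Function.extend e y (Function.extend e y' x) = Function.extend e y x := by
  funext w
  by_cases h : ∃ v, e v = w
  · obtain ⟨v, rfl⟩ := h
    simp [e.injective.extend_apply]
  · simp [Function.extend_apply' _ _ _ h]

theorem extend_restrict (e : V ↪ W) (x : W → Bool) :
    Function.extend e (fun v => x (e v)) x = x := by
  funext w
  by_cases h : ∃ v, e v = w
  · obtain ⟨v, rfl⟩ := h
    simp [e.injective.extend_apply]
  · simp [Function.extend_apply' _ _ _ h]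

/-- Summing a function of bit strings over all changes of the bits in the range of `e` counts every
string `2 ^ |V|` times. -/
theorem sum_sum_extend [Fintype V] [DecidableEq V] [Fintype W] [DecidableEq W] (e : V ↪ W)
    (f : (W → Bool) → ℝ) :
    ∑ x : W → Bool, ∑ y : V → Bool, f (Function.extend e y x)
      = Fintype.card (V → Bool) * ∑ x : W → Bool, f x := by
  let g : (W → Bool) × (V → Bool) → (W → Bool) × (V → Bool) :=
    fun p => (Function.extend e p.2 p.1, fun v => p.1 (e v))
  have hg : Function.Involutive g := by
    rintro ⟨x, y⟩
    refine Prod.ext ?_ ?_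
    · simp only [g, extend_extend, extend_restrict]
    · funext v
      simp only [g, e.injective.extend_apply]
  rw [← Fintype.sum_prod_type' (f := fun x y => f (Function.extend e y x)),
    Fintype.sum_equiv hg.toPerm (fun p => f (Function.extend e p.2 p.1)) (fun p => f p.1)
      (fun p => rfl), Fintype.sum_prod_type, Finset.mul_sum]
  simp

theorem sum_sum_update [Fintype W] [DecidableEq W] (t : W) (f : (W → Bool) → ℝ) :
    ∑ x : W → Bool, ∑ s : Bool, f (Function.update x t s) = 2 * ∑ x : W → Bool, f x := by
  let g : (W → Bool) × Bool → (W → Bool) × Bool := fun p => (Function.update p.1 t p.2, p.1 t)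
  have hg : Function.Involutive g := by
    rintro ⟨x, y⟩
    simp [g]
  rw [← Fintype.sum_prod_type' (f := fun x y => f (Function.update x t y)),
    Fintype.sum_equiv hg.toPerm (fun p => f (Function.update p.1 t p.2)) (fun p => f p.1)
      (fun p => rfl), Fintype.sum_prod_type, Finset.mul_sum]
  simp

end Bits

section Operators

variable {V W : Type} [Fintype V] [DecidableEq V] [Fintype W] [DecidableEq W]

theorem ket_apply (x z : W → Bool) : ket x z = if z = x then 1 else 0 := by
  simp [ket]

theorem applyOn_apply (e : V ↪ W) (U : QUnitary V) (ψ : QState W) (x : W → Bool) :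
    applyOn e U ψ x
      = U (WithLp.toLp 2 fun y : V → Bool => ψ (Function.extend e y x)) (fun v => x (e v)) := rfl

/-- `applyOn` acts on every slice of a state, that is, for fixed bits off the range of `e`. -/
theorem slice_applyOn (e : V ↪ W) (U : QUnitary V) (ψ : QState W) (x : W → Bool) :
    (WithLp.toLp 2 fun y : V → Bool => applyOn e U ψ (Function.extend e y x) : QState V)
      = U (WithLp.toLp 2 fun y : V → Bool => ψ (Function.extend e y x)) := by
  ext y
  simp only [applyOn_apply, extend_extend, e.injective.extend_apply]

theorem applyOn_trans (e : V ↪ W) (U U' : QUnitary V) (ψ : QState W) :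
    applyOn e U' (applyOn e U ψ) = applyOn e (U.trans U') ψ := by
  ext x
  rw [applyOn_apply, slice_applyOn]
  rfl

theorem applyOn_refl (e : V ↪ W) (ψ : QState W) :
    applyOn e (LinearIsometryEquiv.refl ℂ _) ψ = ψ := by
  ext x
  simp [applyOn_apply, extend_restrict]

theorem norm_applyOn (e : V ↪ W) (U : QUnitary V) (ψ : QState W) : ‖applyOn e U ψ‖ = ‖ψ‖ := by
  have key : ∀ φ : QState W, (Fintype.card (V → Bool) : ℝ) * ‖φ‖ ^ 2
      = ∑ x : W → Bool,
        ‖(WithLp.toLp 2 fun y : V → Bool => φ (Function.extend e y x) : QState V)‖ ^ 2 := by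
    intro φ
    simp only [EuclideanSpace.norm_sq_eq]
    exact (sum_sum_extend e fun x => ‖φ x‖ ^ 2).symm
  have h := key (applyOn e U ψ)
  simp only [slice_applyOn, LinearIsometryEquiv.norm_map] at h
  rw [← key ψ] at h
  have hc : (Fintype.card (V → Bool) : ℝ) ≠ 0 := by positivity
  have := mul_left_cancel₀ hc h
  exact (pow_left_inj₀ (norm_nonneg _) (norm_nonneg _) two_ne_zero).1 this

/-- `applyOn e U` as a unitary operator on the whole register. -/
def applyOnEquiv (e : V ↪ W) (U : QUnitary V) : QUnitary W where
  toFun := applyOn e U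
  invFun := applyOn e U.symm
  left_inv ψ := by rw [applyOn_trans, LinearIsometryEquiv.self_trans_symm, applyOn_refl]
  right_inv ψ := by rw [applyOn_trans, LinearIsometryEquiv.symm_trans_self, applyOn_refl]
  map_add' ψ φ := by
    ext x
    simp only [applyOn_apply, PiLp.add_apply]
    rw [← PiLp.add_apply, ← map_add]
    rfl
  map_smul' a ψ := by
    ext x
    simp only [applyOn_apply, PiLp.smul_apply, RingHom.id_apply]
    rw [← PiLp.smul_apply, ← map_smul]
    rfl
  norm_map' := norm_applyOn e U

theorem slice_ket (e : V ↪ W) (x : W → Bool) (z : W → Bool) :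
    (WithLp.toLp 2 fun y : V → Bool => ket x (Function.extend e y z) : QState V)
      = if Function.extend e (fun v => x (e v)) z = x then ket (fun v => x (e v)) else 0 := by
  ext y
  split_ifs with h
  · simp only [ket_apply]
    congr 1
    rw [eq_iff_iff]
    constructor
    · intro h'
      funext v
      rw [← h', e.injective.extend_apply]
    · rintro rfl
      exact h
  · simp only [ket_apply, PiLp.zero_apply, ite_eq_right_iff, one_ne_zero, imp_false]
    intro h'
    apply h
    rw [← h']
    simp only [e.injective.extend_apply]

theorem state_eq_sum (ψ : QState W) : ψ = ∑ z, ψ z • ket z := by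
  ext x
  simp [ket_apply, Finset.sum_ite_eq]

/-- On a basis state, `applyOn e U` replaces the bits at the positions `e v` by `U` of them. -/
theorem applyOn_ket (e : V ↪ W) (U : QUnitary V) (x : W → Bool) :
    applyOn e U (ket x)
      = ∑ y, U (ket fun v => x (e v)) y • ket (Function.extend e y x) := by
  ext z
  rw [applyOn_apply, slice_ket]
  have hz : ∀ y : V → Bool, z = Function.extend e y x ↔
      (y = fun v => z (e v)) ∧ Function.extend e (fun v => x (e v)) z = x := by
    intro y
    constructor
    · rintro rfl
      refine ⟨?_, ?_⟩
      · funext v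
        rw [e.injective.extend_apply]
      · rw [extend_extend, extend_restrict]
    · rintro ⟨rfl, h⟩
      rw [← h, extend_extend, extend_restrict]
  split_ifs with h
  · simp [ket_apply, hz, h]
  · simp [ket_apply, hz, h]

end Operators

section CircuitLists

variable {Vr Vn W : Type}

/-- The inverse of a gate. -/
def gateInv : QGate Vr Vn W → QGate Vr Vn W
  | .elementary k hk U e => .elementary k hk U.symm e
  | .rowCall inv e => .rowCall (!inv) e
  | .normCall inv e => .normCall (!inv) e

/-- The inverse circuit. -/
def cInv (c : QCircuit Vr Vn W) : QCircuit Vr Vn W := (c.map gateInv).reverse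

theorem time_append (T : ℝ) (c c' : QCircuit Vr Vn W) :
    QCircuit.time T (c ++ c') = QCircuit.time T c + QCircuit.time T c' := by
  simp [QCircuit.time]

theorem time_cInv (T : ℝ) (c : QCircuit Vr Vn W) :
    QCircuit.time T (cInv c) = QCircuit.time T c := by
  have : ∀ g : QGate Vr Vn W, QGate.time T (gateInv g) = QGate.time T g := by
    intro g
    cases g <;> rfl
  simp [QCircuit.time, cInv, List.sum_reverse, Function.comp_def, this]

/-- The wires of a gate. -/
def gateWires : QGate Vr Vn W → Set W
  | .elementary _ _ _ e => Set.range e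
  | .rowCall _ e => Set.range e
  | .normCall _ e => Set.range e

/-- The circuit has no gate on a wire of `M`. -/
def Avoids (c : QCircuit Vr Vn W) (M : Set W) : Prop := ∀ g ∈ c, Disjoint (gateWires g) M

end CircuitLists

section Circuits

variable {Vr Vn W : Type} [Fintype Vr] [DecidableEq Vr] [Fintype Vn] [DecidableEq Vn]
  [Fintype W] [DecidableEq W]

/-- A gate as a unitary operator. -/
def gateOp (R : QUnitary Vr) (N : QUnitary Vn) : QGate Vr Vn W → QUnitary W
  | .elementary _ _ U e => applyOnEquiv e U
  | .rowCall inv e => applyOnEquiv e (if inv then R.symm else R)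
  | .normCall inv e => applyOnEquiv e (if inv then N.symm else N)

/-- A circuit as a unitary operator. -/
def cOp (R : QUnitary Vr) (N : QUnitary Vn) : QCircuit Vr Vn W → QUnitary W
  | [] => LinearIsometryEquiv.refl ℂ _
  | g :: c => (gateOp R N g).trans (cOp R N c)

variable (R : QUnitary Vr) (N : QUnitary Vn)

theorem run_eq_cOp (c : QCircuit Vr Vn W) (ψ : QState W) : c.run R N ψ = cOp R N c ψ := by
  induction c generalizing ψ with
  | nil => rfl
  | cons g c ih =>
    have : g.run R N ψ = gateOp R N g ψ := by cases g <;> rfl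
    change QCircuit.run R N c (g.run R N ψ) = cOp R N c (gateOp R N g ψ)
    rw [this, ih]

@[simp] theorem cOp_nil (ψ : QState W) : cOp R N [] ψ = ψ := rfl

theorem cOp_cons (g : QGate Vr Vn W) (c : QCircuit Vr Vn W) (ψ : QState W) :
    cOp R N (g :: c) ψ = cOp R N c (gateOp R N g ψ) := rfl

@[simp] theorem cOp_append (c c' : QCircuit Vr Vn W) (ψ : QState W) :
    cOp R N (c ++ c') ψ = cOp R N c' (cOp R N c ψ) := by
  induction c generalizing ψ with
  | nil => rfl
  | cons g c ih => exact ih _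

theorem gateOp_gateInv (g : QGate Vr Vn W) : gateOp R N (gateInv g) = (gateOp R N g).symm := by
  cases g with
  | elementary k hk U e => rfl
  | rowCall inv e => cases inv <;> rfl
  | normCall inv e => cases inv <;> rfl

theorem cOp_cInv (c : QCircuit Vr Vn W) (ψ : QState W) :
    cOp R N (cInv c) ψ = (cOp R N c).symm ψ := by
  induction c generalizing ψ with
  | nil => rfl
  | cons g c ih =>
    have : cInv (g :: c) = cInv c ++ [gateInv g] := by simp [cInv]
    rw [this, cOp_append, ih, cOp_cons, gateOp_gateInv]
    rfl

@[simp] theorem cOp_cInv_cOp (c : QCircuit Vr Vn W) (ψ : QState W) :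
    cOp R N (cInv c) (cOp R N c ψ) = ψ := by
  rw [cOp_cInv, LinearIsometryEquiv.symm_apply_apply]

@[simp] theorem cOp_cOp_cInv (c : QCircuit Vr Vn W) (ψ : QState W) :
    cOp R N c (cOp R N (cInv c) ψ) = ψ := by
  rw [cOp_cInv, LinearIsometryEquiv.apply_symm_apply]

end Circuits

/-! ### Controlled one-qubit gates -/

section Controlled

variable {W : Type} [Fintype W] [DecidableEq W]

theorem sum_norm_sq_unitary (A : Matrix.unitaryGroup Bool ℂ) (v : Bool → ℂ) :
    ∑ s, ‖∑ s', A.1 s s' * v s'‖ ^ 2 = ∑ s, ‖v s‖ ^ 2 := by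
  have h := Matrix.UnitaryGroup.star_mul_self A
  have h2 : ∀ a b, ∑ s, star (A.1 s a) * A.1 s b = if a = b then 1 else 0 := by
    intro a b
    have := congrFun (congrFun h a) b
    simpa [Matrix.mul_apply, Matrix.one_apply, Matrix.star_apply] using this
  have h00 := h2 false false
  have h01 := h2 false true
  have h10 := h2 true false
  have h11 := h2 true true
  simp only [Fintype.sum_bool] at *
  have key : ∀ z : ℂ, ((‖z‖ ^ 2 : ℝ) : ℂ) = star z * z := by
    intro z
    rw [← Complex.normSq_eq_norm_sq, Complex.normSq_eq_conj_mul_self]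
    rfl
  apply Complex.ofReal_injective
  rw [Complex.ofReal_add, Complex.ofReal_add, key, key, key, key]
  simp only [star_add, star_mul', if_true, reduceCtorEq, if_false] at *
  linear_combination (star (v false) * v false) * h00 + (star (v false) * v true) * h01
    + (star (v true) * v false) * h10 + (star (v true) * v true) * h11

/-- The action of a one-qubit gate on wire `t` that depends on the bits on the wires `a` and `b`. -/
def ctrlFun (a b t : W) (G : Bool → Bool → Matrix.unitaryGroup Bool ℂ) (ψ : QState W) : QState W :=
  WithLp.toLp 2 fun x : W → Bool =>
    ∑ s, (G (x a) (x b)).1 (x t) s * ψ (Function.update x t s)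

theorem ctrlFun_apply (a b t : W) (G : Bool → Bool → Matrix.unitaryGroup Bool ℂ) (ψ : QState W)
    (x : W → Bool) :
    ctrlFun a b t G ψ x = ∑ s, (G (x a) (x b)).1 (x t) s * ψ (Function.update x t s) := rfl

theorem norm_ctrlFun {a b t : W} (hat : a ≠ t) (hbt : b ≠ t)
    (G : Bool → Bool → Matrix.unitaryGroup Bool ℂ) (ψ : QState W) :
    ‖ctrlFun a b t G ψ‖ = ‖ψ‖ := by
  have key : ∀ φ : QState W, 2 * ‖φ‖ ^ 2
      = ∑ x : W → Bool, ∑ s : Bool, ‖φ (Function.update x t s)‖ ^ 2 := by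
    intro φ
    rw [EuclideanSpace.norm_sq_eq]
    exact (sum_sum_update t fun x => ‖φ x‖ ^ 2).symm
  have h : 2 * ‖ctrlFun a b t G ψ‖ ^ 2 = 2 * ‖ψ‖ ^ 2 := by
    rw [key, key]
    refine Finset.sum_congr rfl fun x _ => ?_
    refine Eq.trans (Finset.sum_congr rfl fun s _ => ?_)
      (sum_norm_sq_unitary (G (x a) (x b)) fun s => ψ (Function.update x t s))
    simp [ctrlFun_apply, Function.update_of_ne hat, Function.update_of_ne hbt]
  have := mul_left_cancel₀ two_ne_zero h
  exact (pow_left_inj₀ (norm_nonneg _) (norm_nonneg _) two_ne_zero).1 this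

/-- `ctrlFun` on three qubits as a unitary operator. -/
def ctrlUnitary (G : Bool → Bool → Matrix.unitaryGroup Bool ℂ) : QUnitary (Fin 3) :=
  LinearIsometry.toLinearIsometryEquiv
    { toFun := ctrlFun 0 1 2 G
      map_add' := fun ψ φ => by
        ext x
        simp only [ctrlFun_apply, PiLp.add_apply, mul_add, Finset.sum_add_distrib]
      map_smul' := fun c ψ => by
        ext x
        simp only [ctrlFun_apply, PiLp.smul_apply, smul_eq_mul, RingHom.id_apply, Finset.mul_sum]
        refine Finset.sum_congr rfl fun s _ => ?_
        ring
      norm_map' := norm_ctrlFun (by decide) (by decide) G } rfl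

/-- Three distinct wires as an embedding. -/
def wires3 (a b t : W) (h : a ≠ b ∧ a ≠ t ∧ b ≠ t) : Fin 3 ↪ W where
  toFun := ![a, b, t]
  inj' := by
    obtain ⟨h1, h2, h3⟩ := h
    intro i j
    fin_cases i <;> fin_cases j <;> simp_all [eq_comm]

variable {Vr Vn : Type}

/-- The gate that applies the one-qubit unitary `G u v` to wire `t`, where `u` and `v` are the bits
on the wires `a` and `b`. (No gate, if the wires are not distinct.) -/
def cg (a b t : W) (G : Bool → Bool → Matrix.unitaryGroup Bool ℂ) : QCircuit Vr Vn W :=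
  if h : a ≠ b ∧ a ≠ t ∧ b ≠ t then
    [QGate.elementary 3 le_rfl (ctrlUnitary G) (wires3 a b t h)]
  else []

theorem cg_avoids {a b t : W} {G : Bool → Bool → Matrix.unitaryGroup Bool ℂ} {M : Set W}
    (ha : a ∉ M) (hb : b ∉ M) (ht : t ∉ M) : Avoids (cg a b t G : QCircuit Vr Vn W) M := by
  intro g hg
  unfold cg at hg
  split_ifs at hg with h
  · rw [List.mem_singleton] at hg
    subst hg
    rw [Set.disjoint_left]
    rintro _ ⟨i, rfl⟩
    fin_cases i <;> simpa [wires3]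
  · simp at hg

theorem time_cg_le (T : ℝ) (a b t : W) (G : Bool → Bool → Matrix.unitaryGroup Bool ℂ) :
    QCircuit.time T (cg a b t G : QCircuit Vr Vn W) ≤ 1 := by
  unfold cg
  split_ifs <;> simp [QCircuit.time, QGate.time]

variable [Fintype Vr] [DecidableEq Vr] [Fintype Vn] [DecidableEq Vn]
  (R : QUnitary Vr) (N : QUnitary Vn)

theorem cOp_cg {a b t : W} (h : a ≠ b ∧ a ≠ t ∧ b ≠ t)
    (G : Bool → Bool → Matrix.unitaryGroup Bool ℂ) (ψ : QState W) :
    cOp R N (cg a b t G) ψ = ctrlFun a b t G ψ := by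
  ext x
  simp only [cg, dif_pos h, cOp_cons, cOp_nil, gateOp]
  change applyOn _ _ _ _ = _
  rw [applyOn_apply, ctrlFun_apply]
  change ctrlFun _ _ _ _ _ _ = _
  rw [ctrlFun_apply]
  have hx : ∀ s, Function.extend (wires3 a b t h)
      (Function.update (fun v => x (wires3 a b t h v)) 2 s) x = Function.update x t s := by
    intro s
    funext w
    by_cases hw : ∃ v, wires3 a b t h v = w
    · obtain ⟨v, rfl⟩ := hw
      rw [(wires3 a b t h).injective.extend_apply]
      obtain ⟨h1, h2, h3⟩ := h
      fin_cases v <;> simp_all [wires3, Function.update]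
    · rw [Function.extend_apply' _ _ _ hw, Function.update_of_ne]
      rintro rfl
      exact hw ⟨2, rfl⟩
  refine Finset.sum_congr rfl fun s _ => ?_
  simp only [hx]
  rfl

theorem cOp_cg_ket {a b t : W} (h : a ≠ b ∧ a ≠ t ∧ b ≠ t)
    (G : Bool → Bool → Matrix.unitaryGroup Bool ℂ) (x : W → Bool) :
    cOp R N (cg a b t G) (ket x)
      = ∑ s, (G (x a) (x b)).1 s (x t) • ket (Function.update x t s) := by
  ext z
  rw [cOp_cg R N h, ctrlFun_apply]
  obtain ⟨h1, h2, h3⟩ := h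
  simp only [WithLp.ofLp_sum, WithLp.ofLp_smul, Finset.sum_apply, Pi.smul_apply, ket_apply,
    smul_eq_mul, mul_ite, mul_one, mul_zero]
  by_cases hz : ∀ w, w ≠ t → z w = x w
  · have e1 : ∀ s, (Function.update z t s = x ↔ x t = s) := by
      intro s
      constructor
      · intro e
        simp [← e]
      · rintro rfl
        funext w
        by_cases hw : w = t
        · simp [hw]
        · simp [hw, hz w hw]
    have e2 : ∀ s, (z = Function.update x t s ↔ z t = s) := by
      intro s
      constructor
      · intro e
        simp [e]
      · rintro rfl
        funext w
        by_cases hw : w = t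
        · simp [hw]
        · simp [hw, hz w hw]
    simp only [e1, e2, Finset.sum_ite_eq, Finset.mem_univ, if_true, hz a h2, hz b h3]
  · push Not at hz
    obtain ⟨w, hw, hne⟩ := hz
    have e1 : ∀ s, Function.update z t s ≠ x := by
      rintro s rfl
      exact hne (by simp [hw])
    have e2 : ∀ s, z ≠ Function.update x t s := by
      rintro s rfl
      exact hne (by simp [hw])
    simp [e1, e2]

/-- The rotation with columns `(cos θ, sin θ)` and `(-sin θ, cos θ)`. -/
def rot (θ : ℝ) : Matrix.unitaryGroup Bool ℂ :=
  ⟨Matrix.of fun a b => if a = b then (Real.cos θ : ℂ) else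
    if a then (Real.sin θ : ℂ) else -(Real.sin θ : ℂ), by
    have h : ((Real.cos θ : ℝ) : ℂ) ^ 2 + ((Real.sin θ : ℝ) : ℂ) ^ 2 = 1 := by
      rw [← Complex.ofReal_pow, ← Complex.ofReal_pow, ← Complex.ofReal_add, Real.cos_sq_add_sin_sq,
        Complex.ofReal_one]
    rw [Matrix.mem_unitaryGroup_iff]
    ext a b
    cases a <;> cases b <;>
      simp only [Matrix.mul_apply, Matrix.star_apply, Matrix.of_apply, Fintype.sum_bool,
        Matrix.one_apply] <;> simp [-Complex.ofReal_cos, -Complex.ofReal_sin] <;>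
      first | linear_combination h | linear_combination (0 : ℂ) * h⟩

/-- The bit flip, if `b` is true. -/
def notGate (b : Bool) : Matrix.unitaryGroup Bool ℂ :=
  ⟨Matrix.of fun s s' => if s = xor s' b then 1 else 0, by
    rw [Matrix.mem_unitaryGroup_iff]
    ext s s'
    cases b <;> cases s <;> cases s' <;> simp [Matrix.mul_apply]⟩

/-- The scalar `-1`, if `b` is true. -/
def signGate (b : Bool) : Matrix.unitaryGroup Bool ℂ :=
  ⟨Matrix.of fun s s' => if s = s' then (if b then -1 else 1) else 0, by
    rw [Matrix.mem_unitaryGroup_iff]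
    ext s s'
    cases b <;> cases s <;> cases s' <;> simp [Matrix.mul_apply]⟩

/-- The classical gate that adds `g u v` to the bit on wire `t`, where `u` and `v` are the bits on
the wires `a` and `b`. -/
def xg (a b t : W) (g : Bool → Bool → Bool) : QCircuit Vr Vn W :=
  cg a b t fun u v => notGate (g u v)

theorem cOp_xg_ket {a b t : W} (h : a ≠ b ∧ a ≠ t ∧ b ≠ t) (g : Bool → Bool → Bool)
    (x : W → Bool) :
    cOp R N (xg a b t g) (ket x) = ket (Function.update x t (xor (x t) (g (x a) (x b)))) := by
  rw [xg, cOp_cg_ket R N h]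
  simp [notGate, ite_smul]

end Controlled

/-! ### Supports of states and locality of circuits -/

section Avoids

variable {W Vr Vn : Type}

theorem Avoids.append {c c' : QCircuit Vr Vn W} {M : Set W} (h : Avoids c M) (h' : Avoids c' M) :
    Avoids (c ++ c') M := by
  intro g hg
  rcases List.mem_append.1 hg with hg | hg
  · exact h g hg
  · exact h' g hg

theorem Avoids.mono {c : QCircuit Vr Vn W} {M M' : Set W} (h : Avoids c M) (hM : M' ⊆ M) :
    Avoids c M' := fun g hg => (h g hg).mono_right hM

theorem Avoids.cInv {c : QCircuit Vr Vn W} {M : Set W} (h : Avoids c M) : Avoids (cInv c) M := by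
  intro g hg
  simp only [_root_.cInv, List.mem_reverse, List.mem_map] at hg
  obtain ⟨g', hg', rfl⟩ := hg
  have := h g' hg'
  cases g' <;> exact this

theorem Avoids.flatMap {ι : Type} {l : List ι} {f : ι → QCircuit Vr Vn W} {M : Set W}
    (h : ∀ a ∈ l, Avoids (f a) M) : Avoids (l.flatMap f) M := by
  intro g hg
  obtain ⟨a, ha, hg⟩ := List.mem_flatMap.1 hg
  exact h a ha g hg

end Avoids

section Support

variable {W : Type} [Fintype W] [DecidableEq W]

/-- Bitwise addition of the mask `m`. -/
def xorMask (m x : W → Bool) : W → Bool := fun w => xor (x w) (m w)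

theorem xorMask_xorMask (m x : W → Bool) : xorMask m (xorMask m x) = x := by
  funext w
  simp [xorMask]

theorem xorMask_diff (x z : W → Bool) : xorMask (fun w => xor (x w) (z w)) x = z := by
  funext w
  simp [xorMask]

/-- The operator that flips all bits in the mask `m`. -/
def flipOp (m : W → Bool) : QUnitary W :=
  LinearIsometryEquiv.piLpCongrLeft 2 ℂ ℂ (Function.Involutive.toPerm (xorMask m)
    (xorMask_xorMask m))

theorem flipOp_apply (m : W → Bool) (ψ : QState W) (x : W → Bool) :
    flipOp m ψ x = ψ (xorMask m x) := rfl

theorem xorMask_eq_iff (m x z : W → Bool) : xorMask m z = x ↔ z = xorMask m x := by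
  constructor
  · rintro rfl
    rw [xorMask_xorMask]
  · rintro rfl
    rw [xorMask_xorMask]

theorem flipOp_ket (m x : W → Bool) : flipOp m (ket x) = ket (xorMask m x) := by
  ext z
  simp only [flipOp_apply, ket_apply, xorMask_eq_iff]

theorem flipOp_flipOp (m : W → Bool) (ψ : QState W) : flipOp m (flipOp m ψ) = ψ := by
  ext z
  simp only [flipOp_apply, xorMask_xorMask]

/-- The states that are combinations of basis states `|z⟩` with `P z`. -/
def Supp (P : (W → Bool) → Prop) : Submodule ℂ (QState W) where
  carrier := {ψ | ∀ z, ψ z ≠ 0 → P z}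
  zero_mem' := fun z hz => absurd rfl hz
  add_mem' := fun {ψ φ} hψ hφ z hz => by
    by_cases h : ψ z = 0
    · exact hφ z (by simpa [h] using hz)
    · exact hψ z h
  smul_mem' := fun c ψ hψ z hz => hψ z (by
    intro h
    exact hz (by simp [h]))

theorem ket_mem_Supp {P : (W → Bool) → Prop} {x : W → Bool} (h : P x) : ket x ∈ Supp P := by
  intro z hz
  rw [ket_apply] at hz
  split_ifs at hz with h'
  · rwa [h']
  · exact absurd rfl hz

/-- A linear statement on the states supported in `P` has to be checked only on basis states. -/
theorem Supp_le {P : (W → Bool) → Prop} {S : Submodule ℂ (QState W)}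
    (h : ∀ z, P z → ket z ∈ S) : Supp P ≤ S := by
  intro ψ hψ
  rw [state_eq_sum ψ]
  refine Submodule.sum_mem _ fun z _ => ?_
  by_cases hz : ψ z = 0
  · simp [hz]
  · exact S.smul_mem _ (h z (hψ z hz))

theorem Supp_mono {P Q : (W → Bool) → Prop} (h : ∀ z, P z → Q z) : Supp P ≤ Supp Q :=
  fun _ hψ z hz => h z (hψ z hz)

/-- The states in which all qubits off `M` are in the basis state given by `x`, while the qubits in
`M` are arbitrary. -/
def Agr (M : Set W) (x : W → Bool) : Submodule ℂ (QState W) := Supp fun z => ∀ w, w ∉ M → z w = x w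

theorem ket_mem_Agr (M : Set W) (x : W → Bool) : ket x ∈ Agr M x :=
  ket_mem_Supp fun _ _ => rfl

theorem Agr_congr {M : Set W} {x x' : W → Bool} (h : ∀ w, w ∉ M → x w = x' w) :
    Agr M x = Agr M x' := by
  unfold Agr
  congr 1
  funext z
  refine propext (forall₂_congr fun w hw => ?_)
  rw [h w hw]

theorem Agr_mono {M M' : Set W} (h : M ⊆ M') (x : W → Bool) : Agr M x ≤ Agr M' x :=
  Supp_mono fun _ hz w hw => hz w fun hw' => hw (h hw')

theorem flipOp_mem_Agr {M : Set W} {x m : W → Bool} (hm : ∀ w, m w = true → w ∈ M) {ψ : QState W}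
    (hψ : ψ ∈ Agr M x) : flipOp m ψ ∈ Agr M x := by
  intro z hz w hw
  have : xorMask m z w = x w := hψ _ hz w hw
  have hmw : m w = false := by
    by_contra h
    exact hw (hm w (by simpa using h))
  simpa [xorMask, hmw] using this

variable {Vr Vn : Type} [Fintype Vr] [DecidableEq Vr] [Fintype Vn] [DecidableEq Vn]
  (R : QUnitary Vr) (N : QUnitary Vn)

theorem applyOn_flip {V : Type} [Fintype V] [DecidableEq V] (e : V ↪ W) (U : QUnitary V)
    {m : W → Bool} (hm : Disjoint (Set.range e) {w | m w = true}) (ψ : QState W) :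
    applyOn e U (flipOp m ψ) = flipOp m (applyOn e U ψ) := by
  have hm' : ∀ v, m (e v) = false := by
    intro v
    by_contra h
    exact Set.disjoint_left.1 hm ⟨v, rfl⟩ (by simpa using h)
  ext x
  simp only [applyOn_apply, flipOp_apply]
  have h1 : ∀ y, xorMask m (Function.extend e y x) = Function.extend e y (xorMask m x) := by
    intro y
    funext w
    by_cases hw : ∃ v, e v = w
    · obtain ⟨v, rfl⟩ := hw
      simp [xorMask, e.injective.extend_apply, hm' v]
    · simp [xorMask, Function.extend_apply' _ _ _ hw]
  have h2 : (fun v => xorMask m x (e v)) = fun v => x (e v) := by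
    funext v
    simp [xorMask, hm' v]
  simp only [h1, h2]

/-- A circuit commutes with flips of qubits that it avoids. -/
theorem cOp_flip {c : QCircuit Vr Vn W} {m : W → Bool} (hm : Avoids c {w | m w = true})
    (ψ : QState W) : cOp R N c (flipOp m ψ) = flipOp m (cOp R N c ψ) := by
  induction c generalizing ψ with
  | nil => rfl
  | cons g c ih =>
    have h1 := hm g (by simp)
    rw [cOp_cons, cOp_cons, ← ih fun g hg => hm g (by simp [hg])]
    congr 1
    cases g <;> exact applyOn_flip _ _ h1 _

/-- The circuit `c` preserves the subspace `Agr M x`. -/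
def Pres (c : QCircuit Vr Vn W) (M : Set W) (x : W → Bool) : Prop :=
  ∀ ψ ∈ Agr M x, cOp R N c ψ ∈ Agr M x

/-- The circuit `c` changes only the qubits in `M` (others may act as controls). -/
def Local (c : QCircuit Vr Vn W) (M : Set W) : Prop := ∀ x, Pres R N c M x

variable {R N}

theorem Pres.append {c c' : QCircuit Vr Vn W} {M : Set W} {x : W → Bool} (h : Pres R N c M x)
    (h' : Pres R N c' M x) : Pres R N (c ++ c') M x := by
  intro ψ hψ
  rw [cOp_append]
  exact h' _ (h _ hψ)

theorem Pres.inv {c : QCircuit Vr Vn W} {M : Set W} {x : W → Bool} (h : Pres R N c M x) :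
    Pres R N (cInv c) M x := by
  have h1 : (Agr M x).map (cOp R N c).toLinearEquiv.toLinearMap ≤ Agr M x := by
    rintro _ ⟨ψ, hψ, rfl⟩
    exact h ψ hψ
  have h2 := Submodule.eq_of_le_of_finrank_eq h1
    (LinearEquiv.finrank_map_eq (cOp R N c).toLinearEquiv _)
  intro ψ hψ
  rw [← h2] at hψ
  obtain ⟨φ, hφ, rfl⟩ := hψ
  change cOp R N (cInv c) (cOp R N c φ) ∈ _
  rwa [cOp_cInv_cOp]

theorem Local.append {c c' : QCircuit Vr Vn W} {M : Set W} (h : Local R N c M)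
    (h' : Local R N c' M) : Local R N (c ++ c') M := fun x => (h x).append (h' x)

theorem Local.inv {c : QCircuit Vr Vn W} {M : Set W} (h : Local R N c M) :
    Local R N (cInv c) M := fun x => (h x).inv

theorem Local.nil (M : Set W) : Local R N [] M := fun _ _ h => h

theorem Local.flatMap {ι : Type} {l : List ι} {f : ι → QCircuit Vr Vn W} {M : Set W}
    (h : ∀ a ∈ l, Local R N (f a) M) : Local R N (l.flatMap f) M := by
  induction l with
  | nil => exact Local.nil M
  | cons a l ih =>
    rw [List.flatMap_cons]
    exact (h a (by simp)).append (ih fun a ha => h a (by simp [ha]))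

theorem Local.of_wires {c : QCircuit Vr Vn W} {M : Set W} (h : ∀ g ∈ c, gateWires g ⊆ M) :
    Local R N c M := by
  induction c with
  | nil => exact Local.nil M
  | cons g c ih =>
    intro x ψ hψ
    rw [cOp_cons]
    refine ih (fun g hg => h g (by simp [hg])) x _ ?_
    have key : ∀ {V : Type} [Fintype V] [DecidableEq V] (e : V ↪ W) (U : QUnitary V),
        Set.range e ⊆ M → applyOn e U ψ ∈ Agr M x := by
      intro V _ _ e U he z hz w hw
      by_contra hne
      apply hz
      have : (WithLp.toLp 2 fun y : V → Bool => ψ (Function.extend e y z) : QState V) = 0 := by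
        ext y
        by_contra h0
        apply hne
        rw [← hψ _ h0 w hw, Function.extend_apply']
        rintro ⟨v, rfl⟩
        exact hw (he ⟨v, rfl⟩)
      rw [applyOn_apply, this, map_zero]
      rfl
    have hg := h g (by simp)
    cases g <;> exact key _ _ hg

theorem Local.cg {a b t : W} {G : Bool → Bool → Matrix.unitaryGroup Bool ℂ} {M : Set W}
    (ht : t ∈ M) : Local R N (cg a b t G) M := by
  intro x ψ hψ z hz w hw
  by_cases h : a ≠ b ∧ a ≠ t ∧ b ≠ t
  · rw [cOp_cg R N h, ctrlFun_apply] at hz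
    obtain ⟨s, -, hs⟩ := Finset.exists_ne_zero_of_sum_ne_zero hz
    have := hψ _ (right_ne_zero_of_mul hs) w hw
    rwa [Function.update_of_ne (by rintro rfl; exact hw ht)] at this
  · rw [_root_.cg, dif_neg h] at hz
    exact hψ _ hz w hw

/-- A circuit that preserves `Agr M x` and avoids `V` also preserves `Agr (M ∪ V) x`. -/
theorem Pres.union {c : QCircuit Vr Vn W} {M V : Set W} {x : W → Bool} (h : Pres R N c M x)
    (hV : Avoids c V) : Pres R N c (M ∪ V) x := by
  classical
  have : Agr (M ∪ V) x ≤ (Agr (M ∪ V) x).comap (cOp R N c).toLinearEquiv.toLinearMap := by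
    refine Supp_le fun z hz => ?_
    change cOp R N c (ket z) ∈ Agr (M ∪ V) x
    let m : W → Bool := fun w => if w ∈ V then xor (x w) (z w) else false
    have hm : ∀ w, m w = true → w ∈ V := by
      intro w hw
      by_contra h
      simp [m, h] at hw
    have hz' : ket z = flipOp m (ket (xorMask m z)) := by
      rw [flipOp_ket, xorMask_xorMask]
    rw [hz', cOp_flip R N (hV.mono hm)]
    refine flipOp_mem_Agr (fun w hw => Or.inr (hm w hw)) (Agr_mono Set.subset_union_left x (h _ ?_))
    refine ket_mem_Supp fun w hw => ?_
    by_cases hwV : w ∈ V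
    · simp only [xorMask, m, hwV, if_true]
      cases x w <;> cases z w <;> rfl
    · simp only [xorMask, m, hwV, if_false, Bool.xor_false]
      exact hz w (by simp [hw, hwV])
  exact fun ψ hψ => this hψ

/-- A circuit that avoids `M` and maps `|x⟩` to `|x'⟩` acts in the same way on all states in which
the qubits off `M` are in the basis state `x`. -/
theorem cOp_transfer {c : QCircuit Vr Vn W} {M : Set W} {x x' : W → Bool} (hc : Avoids c M)
    (hx : cOp R N c (ket x) = ket x') {ψ : QState W} (hψ : ψ ∈ Agr M x) :
    cOp R N c ψ = flipOp (fun w => xor (x w) (x' w)) ψ := by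
  let S : Submodule ℂ (QState W) := LinearMap.eqLocus (cOp R N c).toLinearEquiv.toLinearMap
    (flipOp (fun w => xor (x w) (x' w))).toLinearEquiv.toLinearMap
  have : Agr M x ≤ S := by
    refine Supp_le fun z hz => ?_
    change cOp R N c (ket z) = flipOp _ (ket z)
    have h1 : ket z = flipOp (fun w => xor (x w) (z w)) (ket x) := by
      rw [flipOp_ket, xorMask_diff]
    have hm : ∀ w, xor (x w) (z w) = true → w ∈ M := by
      intro w hw
      by_contra h
      simp [hz w h] at hw
    rw [h1, cOp_flip R N (hc.mono hm), hx, flipOp_ket, flipOp_ket, flipOp_ket]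
    congr 1
    funext w
    simp only [xorMask]
    cases x w <;> cases x' w <;> cases z w <;> rfl
  exact this hψ

theorem Agr_flip {M : Set W} {x x' : W → Bool} {ψ : QState W} (hψ : ψ ∈ Agr M x) :
    flipOp (fun w => xor (x w) (x' w)) ψ ∈ Agr M x' := by
  intro z hz w hw
  have : xorMask (fun w => xor (x w) (x' w)) z w = x w := hψ _ hz w hw
  simp only [xorMask] at this
  revert this
  cases x w <;> cases x' w <;> cases z w <;> simp

/-- A property of bit strings that does not depend on the bits in `M` is preserved by circuits that
change only the qubits in `M`. -/
theorem Local.supp {c : QCircuit Vr Vn W} {M : Set W} (h : Local R N c M)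
    {P : (W → Bool) → Prop} (hP : ∀ x z, (∀ w, w ∉ M → z w = x w) → P x → P z) {ψ : QState W}
    (hψ : ψ ∈ Supp P) : cOp R N c ψ ∈ Supp P := by
  have : Supp P ≤ (Supp P).comap (cOp R N c).toLinearEquiv.toLinearMap := by
    refine Supp_le fun x hx => ?_
    exact fun z hz => hP x z (h x _ (ket_mem_Agr M x) z hz) hx
  exact this hψ

theorem Local.of_avoids {c : QCircuit Vr Vn W} {M : Set W} (h : Avoids c Mᶜ) : Local R N c M := by
  refine Local.of_wires fun g hg w hw => ?_
  by_contra hM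
  exact Set.disjoint_left.1 (h g hg) hw hM

/-- A property of bit strings that depends only on the bits in `V` is preserved by circuits that
avoid `V`. -/
theorem Avoids.supp {c : QCircuit Vr Vn W} {V : Set W} (h : Avoids c V)
    {P : (W → Bool) → Prop} (hP : ∀ x z, (∀ w ∈ V, z w = x w) → P x → P z) {ψ : QState W}
    (hψ : ψ ∈ Supp P) : cOp R N c ψ ∈ Supp P := by
  refine (Local.of_avoids (M := Vᶜ) (by rwa [compl_compl])).supp ?_ hψ
  exact fun x z hz => hP x z fun w hw => hz w (by simpa using hw)

end Support

/-! ### Classical sub-circuits and controlled phases -/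

section Fold

variable {W : Type}

/-- A step of a finite automaton that scans qubits: the state bit `s` is replaced by `F s u v`,
where `u` and `v` are the bits on two wires. -/
abbrev ScanStep (W : Type) : Type := W × W × (Bool → Bool → Bool → Bool)

/-- The final state of an automaton that starts in `s` and reads the bit string `x`. -/
def scanVal (x : W → Bool) (s : Bool) (l : List (ScanStep W)) : Bool :=
  l.foldl (fun s p => p.2.2 s (x p.1) (x p.2.1)) s

/-- The scan that records whether one of the wires in `l` carries the bit `1`. The second wire of
each step, `d`, is not read. -/
def anyScan (d : W) (l : List W) : List (ScanStep W) :=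
  l.map fun w => (w, d, fun s a _ => s || a)

theorem scanVal_anyScan (x : W → Bool) (d : W) (l : List W) (s : Bool) :
    scanVal x s (anyScan d l) = (s || l.any x) := by
  induction l generalizing s with
  | nil => simp [scanVal, anyScan]
  | cons w l ih =>
    have := ih (s || x w)
    simp only [scanVal, anyScan, List.map_cons, List.foldl_cons, List.any_cons] at this ⊢
    rw [this, Bool.or_assoc]

variable [Fintype W] [DecidableEq W] {Vr Vn : Type}

/-- The circuit of an automaton. The successive states of the automaton are written to the scratch
wires `sc j`, `sc (j + 2)`, `sc (j + 4)`, …; the wires in between hold intermediate results: the new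
state is the sum of `F 0 u v` and of the product of the old state with `F 1 u v + F 0 u v`. -/
def scanC (sc : ℕ → W) : ℕ → List (ScanStep W) → QCircuit Vr Vn W
  | _, [] => []
  | j, p :: l =>
    xg p.1 p.2.1 (sc (j + 1)) (fun u v => xor (p.2.2 true u v) (p.2.2 false u v)) ++
    (xg p.1 p.2.1 (sc (j + 2)) (fun u v => p.2.2 false u v) ++
    (xg (sc j) (sc (j + 1)) (sc (j + 2)) and ++ scanC sc (j + 2) l))

theorem time_scanC_le (T : ℝ) (sc : ℕ → W) (j : ℕ) (l : List (ScanStep W)) :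
    QCircuit.time T (scanC sc j l : QCircuit Vr Vn W) ≤ 3 * l.length := by
  induction l generalizing j with
  | nil => simp [scanC, QCircuit.time]
  | cons p l ih =>
    simp only [scanC, time_append, List.length_cons, Nat.cast_add, Nat.cast_one]
    have h1 := ih (j + 2)
    have h2 := @time_cg_le W _ _ Vr Vn T
    have e1 := h2 p.1 p.2.1 (sc (j + 1))
      (fun u v => notGate (xor (p.2.2 true u v) (p.2.2 false u v)))
    have e2 := h2 p.1 p.2.1 (sc (j + 2)) (fun u v => notGate (p.2.2 false u v))
    have e3 := h2 (sc j) (sc (j + 1)) (sc (j + 2)) (fun u v => notGate (and u v))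
    simp only [xg]
    linarith

theorem scanC_avoids {V : Set W} {sc : ℕ → W} (hsc : ∀ k, sc k ∉ V) (j : ℕ)
    {l : List (ScanStep W)} (hl : ∀ p ∈ l, p.1 ∉ V ∧ p.2.1 ∉ V) :
    Avoids (scanC sc j l : QCircuit Vr Vn W) V := by
  induction l generalizing j with
  | nil => exact fun g hg => absurd hg (by simp [scanC])
  | cons p l ih =>
    obtain ⟨h1, h2⟩ := hl p (by simp)
    exact (cg_avoids h1 h2 (hsc _)).append ((cg_avoids h1 h2 (hsc _)).append
      ((cg_avoids (hsc _) (hsc _) (hsc _)).append (ih _ fun p hp => hl p (by simp [hp]))))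

variable [Fintype Vr] [DecidableEq Vr] [Fintype Vn] [DecidableEq Vn]
  (R : QUnitary Vr) (N : QUnitary Vn)

theorem cOp_scanC_ket {sc : ℕ → W} {S : ℕ} (hsc : Set.InjOn sc (Set.Iic S))
    (l : List (ScanStep W)) (j : ℕ) (hj : j + 2 * l.length ≤ S)
    (hl : ∀ p ∈ l, p.1 ≠ p.2.1 ∧ ∀ k ≤ S, p.1 ≠ sc k ∧ p.2.1 ≠ sc k) (x : W → Bool)
    (hx : ∀ k ≤ S, j < k → x (sc k) = false) :
    ∃ x' : W → Bool, (∀ w, (∀ k ≤ S, j < k → w ≠ sc k) → x' w = x w) ∧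
      x' (sc (j + 2 * l.length)) = scanVal x (x (sc j)) l ∧
      cOp R N (scanC sc j l) (ket x) = ket x' := by
  induction l generalizing j x with
  | nil => exact ⟨x, fun _ _ => rfl, rfl, rfl⟩
  | cons p l ih =>
    obtain ⟨a, b, F⟩ := p
    simp only [List.length_cons] at hj
    obtain ⟨hab, hk⟩ := hl (a, b, F) (by simp)
    simp only at hab hk
    have hne : ∀ i k, i ≤ S → k ≤ S → i ≠ k → sc i ≠ sc k := fun i k hi hk hik h =>
      hik (hsc hi hk h)
    have n01 := hne j (j + 1) (by omega) (by omega) (by omega)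
    have n02 := hne j (j + 2) (by omega) (by omega) (by omega)
    have n12 := hne (j + 1) (j + 2) (by omega) (by omega) (by omega)
    obtain ⟨a1, b1⟩ := hk (j + 1) (by omega)
    obtain ⟨a2, b2⟩ := hk (j + 2) (by omega)
    set y : W → Bool := Function.update (Function.update x (sc (j + 1))
      (xor (F true (x a) (x b)) (F false (x a) (x b)))) (sc (j + 2)) (F (x (sc j)) (x a) (x b))
      with hy
    have hyoff : ∀ w, w ≠ sc (j + 1) → w ≠ sc (j + 2) → y w = x w := by
      intro w h1 h2
      simp [hy, h1, h2]
    obtain ⟨x', h1, h2, h3⟩ := ih (j + 2) (by omega) (fun p hp => hl p (by simp [hp])) y (by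
      intro k hk hjk
      rw [hyoff _ (hne k (j + 1) hk (by omega) (by omega))
        (hne k (j + 2) hk (by omega) (by omega))]
      exact hx k hk (by omega))
    refine ⟨x', ?_, ?_, ?_⟩
    · intro w hw
      rw [h1 w fun k hk hjk => hw k hk (by omega)]
      exact hyoff w (hw _ (by omega) (by omega)) (hw _ (by omega) (by omega))
    · have e : j + 2 * (l.length + 1) = j + 2 + 2 * l.length := by ring
      rw [List.length_cons, e, h2]
      have e1 : y (sc (j + 2)) = F (x (sc j)) (x a) (x b) := by simp [hy]
      have e2 : ∀ s, scanVal y s l = scanVal x s l := by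
        intro s
        unfold scanVal
        refine List.foldl_ext _ _ _ fun s p hp => ?_
        obtain ⟨-, hpk⟩ := hl p (by simp [hp])
        rw [hyoff _ (hpk _ (by omega)).1 (hpk _ (by omega)).1,
          hyoff _ (hpk _ (by omega)).2 (hpk _ (by omega)).2]
      rw [e1, e2]
      rfl
    · rw [← h3]
      simp only [scanC, cOp_append]
      rw [cOp_xg_ket R N ⟨hab, a1, b1⟩, cOp_xg_ket R N ⟨hab, a2, b2⟩,
        cOp_xg_ket R N ⟨n01, n02, n12⟩]
      congr 2
      rw [hy]
      have z1 := hx (j + 1) (by omega) (by omega)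
      have z2 := hx (j + 2) (by omega) (by omega)
      funext w
      by_cases hw2 : w = sc (j + 2)
      · subst hw2
        simp only [Function.update_self, Function.update_of_ne n12.symm, Function.update_of_ne n12,
          Function.update_of_ne n01, Function.update_of_ne n02, Function.update_of_ne a1,
          Function.update_of_ne b1, z1, z2]
        cases x (sc j) <;> cases x a <;> cases x b <;> simp [Bool.xor_comm]
      · simp only [Function.update_of_ne hw2]
        by_cases hw1 : w = sc (j + 1)
        · subst hw1
          simp [z1]
        · simp [hw1]

end Fold

section Phase

variable {W : Type} [Fintype W] [DecidableEq W]

/-- The diagonal operator with the phase `-1` on the basis states `|z⟩` with `P z`. -/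
def phaseOp (P : (W → Bool) → Bool) : QState W →ₗ[ℂ] QState W where
  toFun ψ := WithLp.toLp 2 fun z => if P z then -ψ z else ψ z
  map_add' ψ φ := by
    ext z
    by_cases h : P z <;> simp [h, add_comm]
  map_smul' c ψ := by
    ext z
    by_cases h : P z <;> simp [h]

theorem phaseOp_apply (P : (W → Bool) → Bool) (ψ : QState W) (z : W → Bool) :
    phaseOp P ψ z = if P z then -ψ z else ψ z := rfl

theorem phaseOp_phaseOp (P : (W → Bool) → Bool) (ψ : QState W) :
    phaseOp P (phaseOp P ψ) = ψ := by
  ext z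
  by_cases h : P z <;> simp [phaseOp_apply, h]

theorem phaseOp_ket (P : (W → Bool) → Bool) (x : W → Bool) :
    phaseOp P (ket x) = (if P x then (-1 : ℂ) else 1) • ket x := by
  ext z
  by_cases hz : z = x
  · subst hz
    by_cases h : P z <;> simp [phaseOp_apply, h]
  · by_cases h : P x <;> simp [phaseOp_apply, ket_apply, hz, h]

theorem phaseOp_mem_Supp (P : (W → Bool) → Bool) {Q : (W → Bool) → Prop} {ψ : QState W}
    (hψ : ψ ∈ Supp Q) : phaseOp P ψ ∈ Supp Q := by
  intro z hz
  apply hψ z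
  intro h
  apply hz
  simp [phaseOp_apply, h]

theorem phaseOp_eq_self {P : (W → Bool) → Bool} {ψ : QState W}
    (hψ : ∀ z, ψ z ≠ 0 → P z = false) : phaseOp P ψ = ψ := by
  ext z
  by_cases h : ψ z = 0
  · simp [phaseOp_apply, h]
  · simp [phaseOp_apply, hψ z h]

theorem phaseOp_flipOp (P : (W → Bool) → Bool) {m : W → Bool} (hm : ∀ z, P (xorMask m z) = P z)
    (ψ : QState W) : phaseOp P (flipOp m ψ) = flipOp m (phaseOp P ψ) := by
  ext z
  simp only [phaseOp_apply, flipOp_apply, hm]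

variable {Vr Vn : Type}

/-- The circuit that multiplies `|z⟩` by `-1`, if `g f v` is true, where `f` tells whether `z` has a
nonzero bit on the wires in `l`, and `v` is the bit of `z` on the wire `u`. The wire `d` is only a
dummy. -/
def phaseC (sc : ℕ → W) (d : W) (l : List W) (u : W) (g : Bool → Bool → Bool) :
    QCircuit Vr Vn W :=
  scanC sc 0 (anyScan d l) ++ (cg (sc (2 * l.length)) u d (fun f v => signGate (g f v)) ++
    cInv (scanC sc 0 (anyScan d l)))

theorem time_phaseC_le (T : ℝ) (sc : ℕ → W) (d : W) (l : List W) (u : W)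
    (g : Bool → Bool → Bool) :
    QCircuit.time T (phaseC sc d l u g : QCircuit Vr Vn W) ≤ 6 * l.length + 1 := by
  simp only [phaseC, time_append, time_cInv]
  have h1 := time_scanC_le (Vr := Vr) (Vn := Vn) T sc 0 (anyScan d l)
  have h2 := time_cg_le (Vr := Vr) (Vn := Vn) T (sc (2 * l.length)) u d
    (fun f v => signGate (g f v))
  have h3 : (anyScan d l).length = l.length := by simp [anyScan]
  rw [h3] at h1
  linarith

theorem phaseC_avoids {V : Set W} {sc : ℕ → W} (hsc : ∀ k, sc k ∉ V) {d u : W} {l : List W}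
    (hd : d ∉ V) (hu : u ∉ V) (hl : ∀ w ∈ l, w ∉ V) (g : Bool → Bool → Bool) :
    Avoids (phaseC sc d l u g : QCircuit Vr Vn W) V := by
  have h : Avoids (scanC sc 0 (anyScan d l) : QCircuit Vr Vn W) V := by
    refine scanC_avoids hsc 0 fun p hp => ?_
    simp only [anyScan, List.mem_map] at hp
    obtain ⟨w, hw, rfl⟩ := hp
    exact ⟨hl w hw, hd⟩
  exact h.append ((cg_avoids (hsc _) hu hd).append h.cInv)

variable [Fintype Vr] [DecidableEq Vr] [Fintype Vn] [DecidableEq Vn]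
  (R : QUnitary Vr) (N : QUnitary Vn)

theorem cOp_phaseC_ket {sc : ℕ → W} {S : ℕ} (hsc : Set.InjOn sc (Set.Iic S)) {d u : W}
    {l : List W} (hS : 2 * l.length ≤ S) (hd : ∀ k ≤ S, d ≠ sc k) (hu : ∀ k ≤ S, u ≠ sc k)
    (hud : u ≠ d) (hl : ∀ w ∈ l, w ≠ d ∧ ∀ k ≤ S, w ≠ sc k) (g : Bool → Bool → Bool)
    {x : W → Bool} (hx : ∀ k ≤ S, x (sc k) = false) :
    cOp R N (phaseC sc d l u g) (ket x)
      = (if g (l.any x) (x u) then (-1 : ℂ) else 1) • ket x := by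
  have hlen : (anyScan d l).length = l.length := by simp [anyScan]
  obtain ⟨x', h1, h2, h3⟩ := cOp_scanC_ket R N hsc (anyScan d l) 0 (by omega) (by
    intro p hp
    simp only [anyScan, List.mem_map] at hp
    obtain ⟨w, hw, rfl⟩ := hp
    exact ⟨(hl w hw).1, fun k hk => ⟨(hl w hw).2 k hk, hd k hk⟩⟩) x (fun k hk _ => hx k hk)
  rw [hlen, zero_add, scanVal_anyScan, hx 0 (Nat.zero_le _), Bool.false_or] at h2
  have hxu : x' u = x u := h1 u fun k hk _ => hu k hk
  simp only [phaseC, cOp_append]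
  rw [h3, cOp_cg_ket R N ⟨(hu _ hS).symm, (hd _ hS).symm, hud⟩, h2, hxu]
  have e : ∀ s, (signGate (g (l.any x) (x u))).1 s (x' d) • ket (Function.update x' d s)
      = if s = x' d then (if g (l.any x) (x u) then (-1 : ℂ) else 1) • ket x' else 0 := by
    intro s
    by_cases hs : s = x' d
    · subst hs
      simp [signGate]
    · simp [signGate, hs]
  simp only [e, Finset.sum_ite_eq', Finset.mem_univ, if_true, map_smul]
  rw [← h3, cOp_cInv_cOp]

theorem cOp_phaseC {sc : ℕ → W} {S : ℕ} (hsc : Set.InjOn sc (Set.Iic S)) {d u : W}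
    {l : List W} (hS : 2 * l.length ≤ S) (hd : ∀ k ≤ S, d ≠ sc k) (hu : ∀ k ≤ S, u ≠ sc k)
    (hud : u ≠ d) (hl : ∀ w ∈ l, w ≠ d ∧ ∀ k ≤ S, w ≠ sc k) (g : Bool → Bool → Bool)
    {M : Set W} {x : W → Bool} (hx : ∀ k ≤ S, sc k ∉ M ∧ x (sc k) = false) {ψ : QState W}
    (hψ : ψ ∈ Agr M x) :
    cOp R N (phaseC sc d l u g) ψ = phaseOp (fun z => g (l.any z) (z u)) ψ := by
  let S' : Submodule ℂ (QState W) := LinearMap.eqLocus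
    (cOp R N (phaseC sc d l u g)).toLinearEquiv.toLinearMap (phaseOp fun z => g (l.any z) (z u))
  have : Agr M x ≤ S' := by
    refine Supp_le fun z hz => ?_
    change cOp R N (phaseC sc d l u g) (ket z) = phaseOp _ (ket z)
    rw [phaseOp_ket, cOp_phaseC_ket R N hsc hS hd hu hud hl g]
    intro k hk
    rw [hz _ (hx k hk).1, (hx k hk).2]
  exact this hψ

end Phase

section Uniform

variable {W : Type} [Fintype W] [DecidableEq W] {Vr Vn : Type}

/-- The circuit that maps `|0…0⟩` on the wires in `l` to the uniform superposition of all bit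
strings. The wires `a` and `b` are dummies. -/
def uniformC (a b : W) (l : List W) : QCircuit Vr Vn W :=
  l.flatMap fun w => cg a b w fun _ _ => rot (Real.pi / 4)

theorem time_uniformC_le (T : ℝ) (a b : W) (l : List W) :
    QCircuit.time T (uniformC a b l : QCircuit Vr Vn W) ≤ l.length := by
  induction l with
  | nil => simp [uniformC, QCircuit.time]
  | cons w l ih =>
    have h := time_cg_le (Vr := Vr) (Vn := Vn) T a b w (fun _ _ => rot (Real.pi / 4))
    simp only [uniformC, List.flatMap_cons, time_append, List.length_cons, Nat.cast_add,
      Nat.cast_one] at ih ⊢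
    linarith

variable [Fintype Vr] [DecidableEq Vr] [Fintype Vn] [DecidableEq Vn]
  (R : QUnitary Vr) (N : QUnitary Vn)

theorem Local.uniformC {R : QUnitary Vr} {N : QUnitary Vn} {a b : W} {l : List W} {M : Set W}
    (hl : ∀ w ∈ l, w ∈ M) : Local R N (uniformC a b l) M :=
  Local.flatMap fun w hw => Local.cg (hl w hw)

theorem uniformC_avoids {a b : W} {l : List W} {V : Set W} (ha : a ∉ V) (hb : b ∉ V)
    (hl : ∀ w ∈ l, w ∉ V) : Avoids (uniformC a b l : QCircuit Vr Vn W) V :=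
  Avoids.flatMap fun w hw => cg_avoids ha hb (hl w hw)

theorem cOp_uniformC_apply {a b : W} (hab : a ≠ b) {l : List W} (hl : l.Nodup)
    (h : ∀ w ∈ l, a ≠ w ∧ b ≠ w) (x : W → Bool) (hx : ∀ w ∈ l, x w = false) (z : W → Bool) :
    cOp R N (uniformC a b l) (ket x) z
      = if ∀ w, w ∉ l → z w = x w then ((1 / √2 : ℝ) : ℂ) ^ l.length else 0 := by
  induction l generalizing x with
  | nil => simp [uniformC, ket_apply, funext_iff]
  | cons w l ih =>
    obtain ⟨hwl, hl⟩ := List.nodup_cons.1 hl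
    obtain ⟨h1, h2⟩ := h w (by simp)
    have hu : uniformC a b (w :: l) = (cg a b w (fun _ _ => rot (Real.pi / 4)) ++
      uniformC a b l : QCircuit Vr Vn W) := rfl
    have hs : ∀ s, ∀ v ∈ l, Function.update x w s v = false := by
      intro s v hv
      rw [Function.update_of_ne (by rintro rfl; exact hwl hv)]
      exact hx v (by simp [hv])
    have hs2 : √2 / 2 = 1 / √2 := by
      rw [div_eq_div_iff (by norm_num) (by positivity), Real.mul_self_sqrt (by norm_num), one_mul]
    rw [hu, cOp_append, cOp_cg_ket R N ⟨hab, h1, h2⟩, hx w (by simp), map_sum]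
    simp only [map_smul, Fintype.sum_bool, PiLp.add_apply, PiLp.smul_apply, smul_eq_mul,
        ih hl (fun v hv => h v (by simp [hv])) _ (hs _)]
    have r1 : (rot (Real.pi / 4)).1 true false = ((1 / √2 : ℝ) : ℂ) := by
      simp only [rot, Matrix.of_apply, Real.sin_pi_div_four, hs2]
      simp
    have r0 : (rot (Real.pi / 4)).1 false false = ((1 / √2 : ℝ) : ℂ) := by
      simp only [rot, Matrix.of_apply, Real.cos_pi_div_four, hs2]
      simp
    have key : ∀ s, (∀ v, v ∉ l → z v = Function.update x w s v) ↔
        (z w = s ∧ ∀ v, v ∉ w :: l → z v = x v) := by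
      intro s
      constructor
      · intro H
        refine ⟨by simpa using H w hwl, fun v hv => ?_⟩
        simp only [List.mem_cons, not_or] at hv
        simpa [hv.1] using H v hv.2
      · rintro ⟨H1, H2⟩ v hv
        by_cases hvw : v = w
        · subst hvw
          simpa using H1
        · simpa [hvw] using H2 v (by simp [hvw, hv])
    simp only [key, r1, r0]
    by_cases H : ∀ v, v ∉ w :: l → z v = x v
    · simp only [if_pos H, and_iff_left H, List.length_cons, pow_succ']
      cases z w <;> simp
    · simp only [iff_false_intro H, and_false, if_false, mul_zero, add_zero]

end Uniform

/-! ### Linear combinations of powers of a unitary operator -/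

section Mix

/-- The rotation that precedes the operator in a combination with weights `xy`. -/
def mixIn (xy : ℝ × ℝ) : Matrix.unitaryGroup Bool ℂ :=
  rot ((Real.arccos (xy.1 - xy.2) + Real.arccos (xy.1 + xy.2)) / 2)

/-- The rotation that follows the operator in a combination with weights `xy`. -/
def mixOut (xy : ℝ × ℝ) : Matrix.unitaryGroup Bool ℂ :=
  rot (-((Real.arccos (xy.1 - xy.2) - Real.arccos (xy.1 + xy.2)) / 2))

theorem mix_fst {xy : ℝ × ℝ} (h : |xy.1| + |xy.2| ≤ 1) :
    (mixOut xy).1 false false * (mixIn xy).1 false false = (xy.1 : ℂ) := by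
  obtain ⟨x, y⟩ := xy
  simp only at h
  obtain ⟨h1, h2⟩ := abs_le.1 ((abs_add_le x y).trans h)
  obtain ⟨h3, h4⟩ := abs_le.1 ((abs_sub x y).trans h)
  simp only [mixIn, mixOut, rot, Matrix.of_apply, if_true, ← Complex.ofReal_mul]
  congr 1
  have e1 := Real.cos_arccos h1 h2
  have e2 := Real.cos_arccos h3 h4
  rw [Real.cos_neg]
  set a := Real.arccos (x - y)
  set b := Real.arccos (x + y)
  have h5 := Real.cos_add ((a + b) / 2) ((a - b) / 2)
  have h6 := Real.cos_sub ((a + b) / 2) ((a - b) / 2)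
  rw [show (a + b) / 2 + (a - b) / 2 = a by ring, e2] at h5
  rw [show (a + b) / 2 - (a - b) / 2 = b by ring, e1] at h6
  linarith

theorem mix_snd {xy : ℝ × ℝ} (h : |xy.1| + |xy.2| ≤ 1) :
    (mixOut xy).1 false true * (mixIn xy).1 true false = (xy.2 : ℂ) := by
  obtain ⟨x, y⟩ := xy
  simp only at h
  obtain ⟨h1, h2⟩ := abs_le.1 ((abs_add_le x y).trans h)
  obtain ⟨h3, h4⟩ := abs_le.1 ((abs_sub x y).trans h)
  simp only [mixIn, mixOut, rot, Matrix.of_apply, if_true, if_false, reduceCtorEq,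
    Bool.false_eq_true, ← Complex.ofReal_neg, ← Complex.ofReal_mul]
  congr 1
  have e1 := Real.cos_arccos h1 h2
  have e2 := Real.cos_arccos h3 h4
  rw [Real.sin_neg, neg_neg]
  set a := Real.arccos (x - y)
  set b := Real.arccos (x + y)
  have h5 := Real.cos_add ((a + b) / 2) ((a - b) / 2)
  have h6 := Real.cos_sub ((a + b) / 2) ((a - b) / 2)
  rw [show (a + b) / 2 + (a - b) / 2 = a by ring, e2] at h5
  rw [show (a + b) / 2 - (a - b) / 2 = b by ring, e1] at h6
  linarith

theorem rot_zero : rot 0 = 1 := by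
  ext a b
  cases a <;> cases b <;> simp [rot]

theorem mixIn_one : mixIn (1, 0) = 1 := by
  simp [mixIn, rot_zero]

theorem mixOut_one : mixOut (1, 0) = 1 := by
  simp [mixOut, rot_zero]

end Mix

section Chain

variable {W : Type} [Fintype W] [DecidableEq W]

/-- The mask of a single qubit. -/
def bitMask (u : W) : W → Bool := fun w => decide (w = u)

theorem xorMask_bitMask_self (u : W) (z : W → Bool) : xorMask (bitMask u) z u = !z u := by
  simp [xorMask, bitMask]

theorem xorMask_bitMask_of_ne {u w : W} (h : w ≠ u) (z : W → Bool) :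
    xorMask (bitMask u) z w = z w := by
  simp [xorMask, bitMask, h]

theorem update_eq_xorMask (u : W) (z : W → Bool) (s : Bool) :
    Function.update z u s = if s = z u then z else xorMask (bitMask u) z := by
  funext w
  by_cases hw : w = u
  · subst hw
    split_ifs with h
    · simp [h]
    · rw [xorMask_bitMask_self]
      cases s <;> cases hz : z w <;> simp_all
  · rw [Function.update_of_ne hw]
    split_ifs
    · rfl
    · rw [xorMask_bitMask_of_ne hw]

variable {Vr Vn : Type} [Fintype Vr] [DecidableEq Vr] [Fintype Vn] [DecidableEq Vn]
  (R : QUnitary Vr) (N : QUnitary Vn)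

theorem cOp_cg_of_supp {a b t : W} (h : a ≠ b ∧ a ≠ t ∧ b ≠ t)
    (G : Bool → Bool → Matrix.unitaryGroup Bool ℂ) {ba bb bt : Bool} {ψ : QState W}
    (hψ : ψ ∈ Supp fun z : W → Bool => z t = bt ∧ z a = ba ∧ z b = bb) :
    cOp R N (cg a b t G) ψ
      = (G ba bb).1 bt bt • ψ + (G ba bb).1 (!bt) bt • flipOp (bitMask t) ψ := by
  let S : Submodule ℂ (QState W) := LinearMap.eqLocus
    (cOp R N (cg a b t G)).toLinearEquiv.toLinearMap
    ((G ba bb).1 bt bt • LinearMap.id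
      + (G ba bb).1 (!bt) bt • (flipOp (bitMask t)).toLinearEquiv.toLinearMap)
  have : (Supp fun z : W → Bool => z t = bt ∧ z a = ba ∧ z b = bb) ≤ S := by
    refine Supp_le fun z hz => ?_
    change cOp R N (cg a b t G) (ket z)
      = (G ba bb).1 bt bt • ket z + (G ba bb).1 (!bt) bt • flipOp (bitMask t) (ket z)
    obtain ⟨h1, h2, h3⟩ := hz
    rw [cOp_cg_ket R N h, flipOp_ket, h1, h2, h3]
    simp only [update_eq_xorMask, h1]
    cases bt <;> simp [add_comm]
  exact this hψ

theorem cOp_cg_eq_self {a b t : W} (h : a ≠ b ∧ a ≠ t ∧ b ≠ t)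
    (G : Bool → Bool → Matrix.unitaryGroup Bool ℂ) {ba bb : Bool} (hG : G ba bb = 1)
    {ψ : QState W} (hψ : ψ ∈ Supp fun z : W → Bool => z t = false ∧ z a = ba ∧ z b = bb) :
    cOp R N (cg a b t G) ψ = ψ := by
  rw [cOp_cg_of_supp R N h G hψ, hG]
  simp

/-- The circuit `mid` between two rotations of the qubit `u`. If `mid` is controlled by `u`, it acts
as `x + y * mid` on the states with `u = 0`, up to a state with `u = 1`, where the weights `(x, y)`
may depend on the bits on the wires `d` and `k`. -/
def stepC (d k u : W) (xy : Bool → Bool → ℝ × ℝ) (mid : QCircuit Vr Vn W) : QCircuit Vr Vn W :=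
  cg d k u (fun a b => mixIn (xy a b)) ++ (mid ++ cg d k u (fun a b => mixOut (xy a b)))

theorem cOp_stepC {d k u : W} (hd : d ≠ k ∧ d ≠ u ∧ k ≠ u) {xy : Bool → Bool → ℝ × ℝ}
    {bd bk : Bool} (hxy : |(xy bd bk).1| + |(xy bd bk).2| ≤ 1) {mid : QCircuit Vr Vn W}
    {B : (W → Bool) → Prop} (hB : ∀ x z, (∀ w, w ≠ u → z w = x w) → B x → B z) {ψ φ r : QState W}
    (hψ : ψ ∈ Supp fun z : W → Bool => z u = false ∧ z d = bd ∧ z k = bk)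
    (hφ : φ ∈ Supp fun z : W → Bool => z u = false ∧ z d = bd ∧ z k = bk)
    (hr : r ∈ Supp B) (h0 : cOp R N mid ψ = ψ)
    (h1 : cOp R N mid (flipOp (bitMask u) ψ) = flipOp (bitMask u) φ + r) :
    ∃ r' ∈ Supp (fun z : W → Bool => z u = true ∨ B z), cOp R N (stepC d k u xy mid) ψ
      = ((xy bd bk).1 : ℂ) • ψ + ((xy bd bk).2 : ℂ) • φ + r' := by
  have flip_mem : ∀ χ : QState W, χ ∈ (Supp fun z : W → Bool => z u = false ∧ z d = bd ∧ z k = bk) →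
      flipOp (bitMask u) χ ∈ Supp fun z : W → Bool => z u = true ∧ z d = bd ∧ z k = bk := by
    intro χ hχ z hz
    obtain ⟨e1, e2, e3⟩ := hχ _ hz
    change xorMask (bitMask u) z u = false at e1
    change xorMask (bitMask u) z d = bd at e2
    change xorMask (bitMask u) z k = bk at e3
    rw [xorMask_bitMask_self] at e1
    rw [xorMask_bitMask_of_ne hd.2.1] at e2
    rw [xorMask_bitMask_of_ne hd.2.2] at e3
    exact ⟨by simpa using e1, e2, e3⟩
  have hflip : ∀ χ : QState W, χ ∈ (Supp fun z : W → Bool => z u = false ∧ z d = bd ∧ z k = bk) →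
      flipOp (bitMask u) χ ∈ Supp fun z : W → Bool => z u = true ∨ B z := fun χ hχ =>
    Supp_mono (fun z hz => Or.inl hz.1) (flip_mem χ hχ)
  have hr2 : cOp R N (cg d k u fun a b => mixOut (xy a b)) r ∈ Supp fun z => z u = true ∨ B z := by
    have hloc : Local R N (cg d k u fun a b => mixOut (xy a b)) {u} := Local.cg rfl
    refine Supp_mono (fun z hz => Or.inr hz) (hloc.supp (P := B) ?_ hr)
    exact fun x z hz => hB x z fun w hw => hz w hw
  refine ⟨((mixIn (xy bd bk)).1 false false * (mixOut (xy bd bk)).1 true false)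
      • flipOp (bitMask u) ψ + ((mixIn (xy bd bk)).1 true false * (mixOut (xy bd bk)).1 true true)
      • flipOp (bitMask u) φ + (mixIn (xy bd bk)).1 true false •
        cOp R N (cg d k u fun a b => mixOut (xy a b)) r, ?_, ?_⟩
  · exact add_mem (add_mem (Submodule.smul_mem _ _ (hflip ψ hψ))
      (Submodule.smul_mem _ _ (hflip φ hφ))) (Submodule.smul_mem _ _ hr2)
  · rw [stepC, cOp_append, cOp_append, cOp_cg_of_supp R N hd _ hψ]
    simp only [map_add, map_smul, h0, h1, Bool.not_false]
    rw [cOp_cg_of_supp R N hd _ hψ, cOp_cg_of_supp R N hd _ (flip_mem φ hφ), flipOp_flipOp]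
    simp only [Bool.not_false, Bool.not_true, smul_add, smul_smul, ← mix_fst hxy, ← mix_snd hxy]
    rw [mul_comm ((mixOut (xy bd bk)).1 false false), mul_comm ((mixOut (xy bd bk)).1 false true)]
    abel

/-- A link of a chain: a qubit `u`, a wire `d`, and the weights of the link, which may depend on the
bit on the wire `d`. -/
abbrev Link (W : Type) : Type := W × W × (Bool → ℝ × ℝ)

/-- A chain of nested combinations in Horner form. In a chain with qubits `u₁, u₂, …`, controlled by
the wire `k`, the operation between the rotations of `uⱼ` is `cW uⱼ`, followed by the rest of the
chain, which is controlled by `uⱼ`. -/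
def chainC (cW : W → QCircuit Vr Vn W) : W → List (Link W) → QCircuit Vr Vn W
  | _, [] => []
  | k, p :: l =>
    stepC p.2.1 k p.1 (fun a b => if b then p.2.2 a else (1, 0)) (cW p.1 ++ chainC cW p.1 l)

/-- The operator `x₁ + y₁ (x₂ + y₂ (⋯) T) T` of a chain of links with weights `(xⱼ, yⱼ)`. -/
def hornerOp (x : W → Bool) (T : Module.End ℂ (QState W)) :
    List (Link W) → Module.End ℂ (QState W)
  | [] => 1
  | p :: l => ((p.2.2 (x p.2.1)).1 : ℂ) • 1 + ((p.2.2 (x p.2.1)).2 : ℂ) • (hornerOp x T l * T)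

theorem hornerOp_mem {x : W → Bool} {T : Module.End ℂ (QState W)} {S : Submodule ℂ (QState W)}
    (hT : ∀ ψ ∈ S, T ψ ∈ S) (l : List (Link W)) {ψ : QState W} (hψ : ψ ∈ S) :
    hornerOp x T l ψ ∈ S := by
  induction l generalizing ψ with
  | nil => exact hψ
  | cons p l ih =>
    exact add_mem (Submodule.smul_mem _ _ hψ) (Submodule.smul_mem _ _ (ih (hT ψ hψ)))

theorem hornerOp_comm {x : W → Bool} {T : Module.End ℂ (QState W)} {S : Submodule ℂ (QState W)}
    (hT : ∀ ψ ∈ S, T ψ ∈ S) {F : QUnitary W} (hF : ∀ ψ ∈ S, T (F ψ) = F (T ψ)) (l : List (Link W))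
    {ψ : QState W} (hψ : ψ ∈ S) :
    hornerOp x T l (F ψ) = F (hornerOp x T l ψ) := by
  induction l generalizing ψ with
  | nil => rfl
  | cons p l ih =>
    simp only [hornerOp, LinearMap.add_apply, LinearMap.smul_apply, Module.End.one_apply,
      Module.End.mul_apply, map_add, map_smul]
    rw [hF ψ hψ, ih (hT ψ hψ)]

/-- The circuits `cW u`, for `u` in `V`, are the operator `T` controlled by `u`, on the states in
`Agr M x`, and `T` does not involve the qubits in `V`. -/
structure IsControlled (cW : W → QCircuit Vr Vn W) (T : Module.End ℂ (QState W)) (M : Set W)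
    (x : W → Bool) (V : Set W) : Prop where
  mem : V ⊆ M
  off : ∀ u ∈ V, ∀ ψ ∈ Agr M x, (ψ ∈ Supp fun z : W → Bool => z u = false) →
    cOp R N (cW u) ψ = ψ
  on : ∀ u ∈ V, ∀ ψ ∈ Agr M x, (ψ ∈ Supp fun z : W → Bool => z u = true) →
    cOp R N (cW u) ψ = T ψ
  pres : ∀ ψ ∈ Agr M x, T ψ ∈ Agr M x
  supp : ∀ u ∈ V, ∀ b, ∀ ψ ∈ Agr M x, (ψ ∈ Supp fun z : W → Bool => z u = b) →
    T ψ ∈ Supp fun z : W → Bool => z u = b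
  comm : ∀ u ∈ V, ∀ ψ ∈ Agr M x, T (flipOp (bitMask u) ψ) = flipOp (bitMask u) (T ψ)

variable {R N}

theorem flipOp_supp_of_ne {u v : W} (h : v ≠ u) {b : Bool} {ψ : QState W}
    (hψ : ψ ∈ Supp fun z : W → Bool => z v = b) :
    flipOp (bitMask u) ψ ∈ Supp fun z : W → Bool => z v = b := by
  intro z hz
  have : xorMask (bitMask u) z v = b := hψ _ hz
  rwa [xorMask_bitMask_of_ne h] at this

theorem flipOp_supp_self {u : W} {b : Bool} {ψ : QState W}
    (hψ : ψ ∈ Supp fun z : W → Bool => z u = b) :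
    flipOp (bitMask u) ψ ∈ Supp fun z : W → Bool => z u = !b := by
  intro z hz
  have : xorMask (bitMask u) z u = b := hψ _ hz
  rw [xorMask_bitMask_self] at this
  simp [← this]

theorem cOp_chainC_off {cW : W → QCircuit Vr Vn W} {T : Module.End ℂ (QState W)} {M : Set W}
    {x : W → Bool} {V : Set W} (h : IsControlled R N cW T M x V) (l : List (Link W)) (k : W)
    (hl : ∀ p ∈ l, p.1 ∈ V ∧ p.2.1 ∉ M ∧ p.2.1 ≠ k) (hk : (k :: l.map Prod.fst).Nodup)
    {ψ : QState W} (hψ : ψ ∈ Agr M x)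
    (hz : ∀ p ∈ l, ψ ∈ Supp fun z : W → Bool => z p.1 = false)
    (hkz : ψ ∈ Supp fun z : W → Bool => z k = false) :
    cOp R N (chainC cW k l) ψ = ψ := by
  induction l generalizing k with
  | nil => rfl
  | cons p l ih =>
    obtain ⟨u, d, xy⟩ := p
    obtain ⟨hu, hd, hdk⟩ := hl (u, d, xy) (by simp)
    simp only at hu hd hdk
    rw [List.map_cons, List.nodup_cons, List.nodup_cons] at hk
    obtain ⟨hk1, hk2, hk3⟩ := hk
    have hdu : d ≠ u := fun e => hd (e ▸ h.mem hu)
    have hku : k ≠ u := fun e => hk1 (by simp [e])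
    have h3 : ψ ∈ Supp fun z : W → Bool => z u = false ∧ z d = x d ∧ z k = false :=
      fun z hz' => ⟨hz (u, d, xy) (by simp) z hz', hψ z hz' d hd, hkz z hz'⟩
    rw [chainC, stepC, cOp_append, cOp_append, cOp_append]
    simp only
    rw [cOp_cg_eq_self R N ⟨hdk, hdu, hku⟩ _ (by simp [mixIn_one]) h3,
      h.off u hu ψ hψ (hz (u, d, xy) (by simp)),
      ih u (fun p hp => ⟨(hl p (by simp [hp])).1, (hl p (by simp [hp])).2.1,
          fun e => (hl p (by simp [hp])).2.1 (e ▸ h.mem hu)⟩)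
        (List.nodup_cons.2 ⟨hk2, hk3⟩) (fun p hp => hz p (by simp [hp]))
        (hz (u, d, xy) (by simp)),
      cOp_cg_eq_self R N ⟨hdk, hdu, hku⟩ _ (by simp [mixOut_one]) h3]

/-- A chain whose control is `1` acts as the operator `hornerOp`, up to a state in which some qubit
of the chain is `1`. -/
theorem cOp_chainC_on {cW : W → QCircuit Vr Vn W} {T : Module.End ℂ (QState W)} {M : Set W}
    {x : W → Bool} {V : Set W} (h : IsControlled R N cW T M x V) (l : List (Link W)) (k : W)
    (hkV : k ∈ V)
    (hl : ∀ p ∈ l, p.1 ∈ V ∧ p.2.1 ∉ M) (hk : (k :: l.map Prod.fst).Nodup)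
    (hxy : ∀ p ∈ l, |(p.2.2 (x p.2.1)).1| + |(p.2.2 (x p.2.1)).2| ≤ 1)
    {ψ : QState W} (hψ : ψ ∈ Agr M x)
    (hz : ∀ p ∈ l, ψ ∈ Supp fun z : W → Bool => z p.1 = false)
    (hkz : ψ ∈ Supp fun z : W → Bool => z k = true) :
    ∃ r ∈ Supp (fun z : W → Bool => ∃ p ∈ l, z p.1 = true),
      cOp R N (chainC cW k l) ψ = hornerOp x T l ψ + r := by
  induction l generalizing k ψ with
  | nil => exact ⟨0, Submodule.zero_mem _, by simp [chainC, hornerOp]⟩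
  | cons p l ih =>
    obtain ⟨u, d, xy⟩ := p
    obtain ⟨hu, hd⟩ := hl (u, d, xy) (by simp)
    simp only at hu hd
    rw [List.map_cons, List.nodup_cons, List.nodup_cons] at hk
    obtain ⟨hk1, hk2, hk3⟩ := hk
    have hdu : d ≠ u := fun e => hd (e ▸ h.mem hu)
    have hdk : d ≠ k := fun e => hd (e ▸ h.mem hkV)
    have hku : k ≠ u := fun e => hk1 (by simp [e])
    have hnu : ∀ p ∈ l, p.1 ≠ u := fun p hp e => hk2 (List.mem_map.2 ⟨p, hp, e⟩)
    have hl' : ∀ p ∈ l, p.1 ∈ V ∧ p.2.1 ∉ M := fun p hp => hl p (by simp [hp])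
    have hnu' : ∀ p ∈ l, p.2.1 ≠ u := fun p hp e => (hl' p hp).2 (e ▸ h.mem hu)
    have hzu := hz (u, d, xy) (by simp)
    simp only at hzu
    have hmask : ∀ w, bitMask u w = true → w ∈ M := by
      intro w hw
      simp only [bitMask, decide_eq_true_eq] at hw
      exact hw ▸ h.mem hu
    have hfψ := flipOp_mem_Agr hmask hψ
    have hTψ := h.pres ψ hψ
    have hfT := flipOp_mem_Agr hmask hTψ
    obtain ⟨r, hr, hr'⟩ := ih u hu hl' (List.nodup_cons.2 ⟨hk2, hk3⟩)
      (fun p hp => hxy p (by simp [hp])) hfT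
      (fun p hp => flipOp_supp_of_ne (hnu p hp)
        (h.supp _ (hl' p hp).1 _ ψ hψ (hz p (by simp [hp]))))
      (flipOp_supp_self (h.supp u hu _ ψ hψ hzu))
    have hS : ∀ φ ∈ (Agr M x ⊓ Supp fun z : W → Bool => z u = false) ⊓
        (Supp fun z : W → Bool => z k = true), T φ ∈ (Agr M x ⊓ Supp fun z : W → Bool =>
          z u = false)
          ⊓ (Supp fun z : W → Bool => z k = true) := fun φ hφ =>
      ⟨⟨h.pres φ hφ.1.1, h.supp u hu _ φ hφ.1.1 hφ.1.2⟩, h.supp k hkV _ φ hφ.1.1 hφ.2⟩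
    have hmem := hornerOp_mem (x := x) hS l (hS ψ ⟨⟨hψ, hzu⟩, hkz⟩)
    have hmid1 : cOp R N (cW u ++ chainC cW u l) ψ = ψ := by
      rw [cOp_append, h.off u hu ψ hψ hzu]
      exact cOp_chainC_off h l u (fun p hp => ⟨(hl' p hp).1, (hl' p hp).2, hnu' p hp⟩)
        (List.nodup_cons.2 ⟨hk2, hk3⟩) hψ (fun p hp => hz p (by simp [hp])) hzu
    have hmid2 : cOp R N (cW u ++ chainC cW u l) (flipOp (bitMask u) ψ)
        = flipOp (bitMask u) (hornerOp x T l (T ψ)) + r := by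
      rw [cOp_append, h.on u hu _ hfψ (flipOp_supp_self hzu), h.comm u hu ψ hψ, hr',
        hornerOp_comm h.pres (fun φ hφ => h.comm u hu φ hφ) l hTψ]
    obtain ⟨r', h1, h2⟩ := cOp_stepC (R := R) (N := N) (d := d) (k := k) (u := u)
      ⟨hdk, hdu, hku⟩ (xy := fun a b => if b then xy a else (1, 0)) (bd := x d) (bk := true)
      (by simpa using hxy (u, d, xy) (by simp)) (mid := cW u ++ chainC cW u l)
      (B := fun z : W → Bool => ∃ p ∈ l, z p.1 = true)
      (by
        rintro y z hyz ⟨p, hp, h1⟩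
        exact ⟨p, hp, by rw [hyz _ (hnu p hp), h1]⟩)
      (ψ := ψ) (φ := hornerOp x T l (T ψ)) (r := r)
      (fun z hz' => ⟨hzu z hz', hψ z hz' d hd, hkz z hz'⟩)
      (fun z hz' => ⟨hmem.1.2 z hz', hmem.1.1 z hz' d hd, hmem.2 z hz'⟩) hr hmid1 hmid2
    refine ⟨r', Supp_mono ?_ h1, ?_⟩
    · rintro z (hz' | ⟨p, hp, hz'⟩)
      · exact ⟨(u, d, xy), by simp, hz'⟩
      · exact ⟨p, by simp [hp], hz'⟩
    · rw [chainC]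
      exact h2

/-- A chain, controlled by a further qubit `u`, between two rotations of `u` that may depend on the
bits on the wires `d` and `k`. -/
theorem cOp_stepC_chainC {cW : W → QCircuit Vr Vn W} {T : Module.End ℂ (QState W)} {M : Set W}
    {x : W → Bool} {V : Set W} (h : IsControlled R N cW T M x V) (l : List (Link W)) {d k u : W}
    (hdk : d ≠ k) (hdM : d ∉ M) (hkM : k ∉ M) (huV : u ∈ V)
    (hl : ∀ p ∈ l, p.1 ∈ V ∧ p.2.1 ∉ M) (hu : (u :: l.map Prod.fst).Nodup)
    (hxy : ∀ p ∈ l, |(p.2.2 (x p.2.1)).1| + |(p.2.2 (x p.2.1)).2| ≤ 1)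
    {xy : Bool → Bool → ℝ × ℝ} (hxy' : |(xy (x d) (x k)).1| + |(xy (x d) (x k)).2| ≤ 1)
    {ψ : QState W} (hψ : ψ ∈ Agr M x)
    (hz : ∀ p ∈ l, ψ ∈ Supp fun z : W → Bool => z p.1 = false)
    (huz : ψ ∈ Supp fun z : W → Bool => z u = false) :
    ∃ r ∈ Supp (fun z : W → Bool => z u = true ∨ ∃ p ∈ l, z p.1 = true),
      cOp R N (stepC d k u xy (chainC cW u l)) ψ
        = ((xy (x d) (x k)).1 : ℂ) • ψ + ((xy (x d) (x k)).2 : ℂ) • hornerOp x T l ψ + r := by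
  have hdu : d ≠ u := fun e => hdM (e ▸ h.mem huV)
  have hku : k ≠ u := fun e => hkM (e ▸ h.mem huV)
  obtain ⟨hu1, hu2⟩ := List.nodup_cons.1 hu
  have hnu : ∀ p ∈ l, p.1 ≠ u := fun p hp e => hu1 (List.mem_map.2 ⟨p, hp, e⟩)
  have hmask : ∀ w, bitMask u w = true → w ∈ M := by
    intro w hw
    simp only [bitMask, decide_eq_true_eq] at hw
    exact hw ▸ h.mem huV
  have hfψ := flipOp_mem_Agr hmask hψ
  obtain ⟨r, hr, hr'⟩ := cOp_chainC_on h l u huV hl hu hxy hfψ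
    (fun p hp => flipOp_supp_of_ne (hnu p hp) (hz p hp)) (flipOp_supp_self huz)
  have hS : ∀ φ ∈ (Agr M x ⊓ Supp fun z : W → Bool => z u = false),
      T φ ∈ (Agr M x ⊓ Supp fun z : W → Bool => z u = false) := fun φ hφ =>
    ⟨h.pres φ hφ.1, h.supp u huV _ φ hφ.1 hφ.2⟩
  have hmem := hornerOp_mem (x := x) hS l ⟨hψ, huz⟩
  rw [hornerOp_comm h.pres (fun φ hφ => h.comm u huV φ hφ) l hψ] at hr'
  exact cOp_stepC (R := R) (N := N) ⟨hdk, hdu, hku⟩ hxy'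
    (B := fun z : W → Bool => ∃ p ∈ l, z p.1 = true)
    (by
      rintro y z hyz ⟨p, hp, h1⟩
      exact ⟨p, hp, by rw [hyz _ (hnu p hp), h1]⟩)
    (fun z hz' => ⟨huz z hz', hψ z hz' d hdM, hψ z hz' k hkM⟩)
    (fun z hz' => ⟨hmem.2 z hz', hmem.1 z hz' d hdM, hmem.1 z hz' k hkM⟩) hr
    (cOp_chainC_off h l u (fun p hp => ⟨(hl p hp).1, (hl p hp).2,
      fun e => (hl p hp).2 (e ▸ h.mem huV)⟩) hu hψ hz huz) hr'

theorem Pres.stepC {d k u : W} {xy : Bool → Bool → ℝ × ℝ} {mid : QCircuit Vr Vn W} {M : Set W}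
    {x : W → Bool} (hu : u ∈ M) (h : Pres R N mid M x) : Pres R N (stepC d k u xy mid) M x :=
  Pres.append (Local.cg hu x) (h.append (Local.cg hu x))

theorem Pres.chainC {cW : W → QCircuit Vr Vn W} {M : Set W} {x : W → Bool} (l : List (Link W))
    (k : W) (hl : ∀ p ∈ l, p.1 ∈ M) (hc : ∀ p ∈ l, Pres R N (cW p.1) M x) :
    Pres R N (chainC cW k l) M x := by
  induction l generalizing k with
  | nil => exact fun _ h => h
  | cons p l ih =>
    exact Pres.stepC (hl p (by simp)) ((hc p (by simp)).append
      (ih _ (fun p hp => hl p (by simp [hp])) fun p hp => hc p (by simp [hp])))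

end Chain

section ChainSyntax

variable {W : Type} [DecidableEq W] {Vr Vn : Type}

theorem Avoids.stepC [Fintype W] {d k u : W} {xy : Bool → Bool → ℝ × ℝ} {mid : QCircuit Vr Vn W}
    {V : Set W} (hd : d ∉ V) (hk : k ∉ V) (hu : u ∉ V) (h : Avoids mid V) :
    Avoids (stepC d k u xy mid) V :=
  (cg_avoids hd hk hu).append (h.append (cg_avoids hd hk hu))

theorem Avoids.chainC [Fintype W] {cW : W → QCircuit Vr Vn W} {V : Set W} (l : List (Link W))
    {k : W} (hk : k ∉ V) (hl : ∀ p ∈ l, p.1 ∉ V ∧ p.2.1 ∉ V) (hc : ∀ p ∈ l, Avoids (cW p.1) V) :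
    Avoids (chainC cW k l) V := by
  induction l generalizing k with
  | nil => exact fun g hg => absurd hg (by simp [_root_.chainC])
  | cons p l ih =>
    obtain ⟨h1, h2⟩ := hl p (by simp)
    exact Avoids.stepC h2 hk h1 ((hc p (by simp)).append
      (ih h1 (fun p hp => hl p (by simp [hp])) fun p hp => hc p (by simp [hp])))

theorem time_stepC_le [Fintype W] (T : ℝ) (d k u : W) (xy : Bool → Bool → ℝ × ℝ)
    (mid : QCircuit Vr Vn W) :
    QCircuit.time T (stepC d k u xy mid) ≤ 2 + QCircuit.time T mid := by
  simp only [stepC, time_append]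
  have h1 := time_cg_le (Vr := Vr) (Vn := Vn) T d k u (fun a b => mixIn (xy a b))
  have h2 := time_cg_le (Vr := Vr) (Vn := Vn) T d k u (fun a b => mixOut (xy a b))
  linarith

theorem time_chainC_le [Fintype W] (T : ℝ) {cW : W → QCircuit Vr Vn W} {τ : ℝ}
    (hτ : ∀ u, QCircuit.time T (cW u) ≤ τ) (k : W) (l : List (Link W)) :
    QCircuit.time T (chainC cW k l) ≤ l.length * (2 + τ) := by
  induction l generalizing k with
  | nil => simp [chainC, QCircuit.time]
  | cons p l ih =>
    have h1 := time_stepC_le T p.2.1 k p.1 (fun a b => if b then p.2.2 a else (1, 0))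
      (cW p.1 ++ chainC cW p.1 l)
    rw [time_append] at h1
    have h2 := ih p.1
    have h3 := hτ p.1
    rw [chainC, List.length_cons, Nat.cast_add, Nat.cast_one]
    linarith

end ChainSyntax

section Coefficients

/-- The weights of a chain for the polynomial with the coefficients `s * c`, `c ∈ l`. -/
def hornerWeights : ℝ → List ℝ → List (ℝ × ℝ)
  | _, [] => [(0, 0)]
  | s, c :: l => (s * c, 1 - |s * c|) :: hornerWeights (s / (1 - |s * c|)) l

theorem length_hornerWeights (s : ℝ) (l : List ℝ) : (hornerWeights s l).length = l.length + 1 := by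
  induction l generalizing s with
  | nil => rfl
  | cons c l ih => simp [hornerWeights, ih]

/-- The polynomial with the list of coefficients `l`, evaluated at an operator. -/
def polyOp {E : Type} [AddCommGroup E] [Module ℂ E] (T : Module.End ℂ E) :
    List ℝ → Module.End ℂ E
  | [] => 0
  | c :: l => (c : ℂ) • 1 + polyOp T l * T

theorem abs_sum_tail {s c : ℝ} {l : List ℝ} (h : |s| * ((c :: l).map abs).sum ≤ 1) :
    |s * c| + |s| * (l.map abs).sum ≤ 1 := by
  rw [List.map_cons, List.sum_cons, mul_add] at h
  rwa [abs_mul]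

theorem hornerWeights_scale {s c : ℝ} {l : List ℝ} (h : |s| * ((c :: l).map abs).sum ≤ 1) :
    |s / (1 - |s * c|)| * (l.map abs).sum ≤ 1 := by
  have h1 := abs_sum_tail h
  have h2 : 0 ≤ (l.map abs).sum := List.sum_nonneg (by simp)
  have h3 : 0 ≤ |s| * (l.map abs).sum := mul_nonneg (abs_nonneg _) h2
  rcases eq_or_ne (1 - |s * c|) 0 with h0 | h0
  · rw [h0]
    simp
  · have hpos : 0 < 1 - |s * c| := lt_of_le_of_ne (by linarith) h0.symm
    rw [abs_div, abs_of_pos hpos, div_mul_eq_mul_div, div_le_one hpos]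
    linarith

theorem abs_hornerWeights_le {s : ℝ} {l : List ℝ} (h : |s| * (l.map abs).sum ≤ 1) :
    ∀ p ∈ hornerWeights s l, |p.1| + |p.2| ≤ 1 := by
  induction l generalizing s with
  | nil => simp [hornerWeights]
  | cons c l ih =>
    intro p hp
    rcases List.mem_cons.1 hp with rfl | hp
    · have h1 := abs_sum_tail h
      have h3 : 0 ≤ |s| * (l.map abs).sum :=
        mul_nonneg (abs_nonneg _) (List.sum_nonneg (by simp))
      rw [abs_of_nonneg (a := 1 - |s * c|) (by linarith)]
      linarith
    · exact ih (hornerWeights_scale h) p hp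

/-- The chain with the weights `hornerWeights` implements the polynomial, multiplied by `s`. Each
step of
the chain splits off one coefficient and rescales the others, which are still small enough in sum.
-/
theorem hornerOp_hornerWeights {W : Type} [Fintype W] [DecidableEq W] (x : W → Bool)
    (T : Module.End ℂ (QState W)) (d : W) {s : ℝ} {l : List ℝ} (h : |s| * (l.map abs).sum ≤ 1)
    {us : List W} (hu : us.length = l.length + 1) :
    hornerOp x T (List.zipWith (fun u p => (u, d, fun _ => p)) us (hornerWeights s l))
      = (s : ℂ) • polyOp T l := by
  induction l generalizing s us with
  | nil =>
    obtain ⟨u, us, rfl⟩ := List.exists_cons_of_length_eq_add_one hu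
    simp [hornerWeights, hornerOp, polyOp]
  | cons c l ih =>
    obtain ⟨u, us, rfl⟩ := List.exists_cons_of_length_eq_add_one hu
    simp only [hornerWeights, List.zipWith_cons_cons, hornerOp, polyOp]
    rw [ih (hornerWeights_scale h) (by simpa using hu), smul_add, smul_smul, smul_mul_assoc,
      smul_smul, ← Complex.ofReal_mul, ← Complex.ofReal_mul]
    congr 1
    rcases eq_or_ne (1 - |s * c|) 0 with h0 | h0
    · -- The weights are exhausted, so all further coefficients vanish.
      rw [h0, zero_mul, Complex.ofReal_zero, zero_smul]
      have h1 := abs_sum_tail h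
      have h2 : |s| * (l.map abs).sum ≤ 0 := by linarith
      have key : ∀ l' : List ℝ, |s| * (l'.map abs).sum ≤ 0 → (s : ℂ) • polyOp T l' = 0 := by
        intro l'
        induction l' with
        | nil => simp [polyOp]
        | cons a l' ih' =>
          intro h'
          rw [List.map_cons, List.sum_cons, mul_add] at h'
          have ha : 0 ≤ |s| * |a| := by positivity
          have hl : 0 ≤ |s| * (l'.map abs).sum :=
            mul_nonneg (abs_nonneg _) (List.sum_nonneg (by simp))
          have hsa : s * a = 0 := by
            rw [← abs_eq_zero, abs_mul]
            linarith
          rw [polyOp, smul_add, smul_smul, ← Complex.ofReal_mul, hsa, ← smul_mul_assoc,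
            ih' (by linarith)]
          simp
      rw [← smul_mul_assoc, key l h2, zero_mul]
    · rw [mul_div_cancel₀ _ h0]

theorem polyOp_apply {E : Type} [AddCommGroup E] [Module ℂ E] (T : Module.End ℂ E) (l : List ℝ)
    (ψ : E) : polyOp T l ψ = ∑ k ∈ Finset.range l.length, (l.getD k 0 : ℂ) • (T ^ k) ψ := by
  induction l generalizing ψ with
  | nil => simp [polyOp]
  | cons c l ih =>
    rw [polyOp, LinearMap.add_apply, Module.End.mul_apply, ih, List.length_cons,
      Finset.sum_range_succ', add_comm]
    simp [pow_succ]

end Coefficients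

/-! ### Products of two reflections -/

section Reflection

variable {W : Type} [Fintype W] [DecidableEq W]

/-- The projection to the states in which the qubits in `l` are zero. -/
def projOp (l : List W) : QState W →ₗ[ℂ] QState W where
  toFun ψ := WithLp.toLp 2 fun z => if l.any z then 0 else ψ z
  map_add' ψ φ := by
    ext z
    change (if l.any z then 0 else ψ z + φ z)
      = (if l.any z then 0 else ψ z) + (if l.any z then 0 else φ z)
    split_ifs <;> simp
  map_smul' c ψ := by
    ext z
    change (if l.any z then 0 else c * ψ z) = c * (if l.any z then 0 else ψ z)
    split_ifs <;> simp

theorem projOp_apply (l : List W) (ψ : QState W) (z : W → Bool) :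
    projOp l ψ z = if l.any z then 0 else ψ z := rfl

/-- The reflection `2 P - 1`, where `P = projOp l`. -/
def reflOp (l : List W) : QState W →ₗ[ℂ] QState W := phaseOp fun z => l.any z

theorem reflOp_eq (l : List W) (ψ : QState W) : reflOp l ψ = (2 : ℂ) • projOp l ψ - ψ := by
  ext z
  simp only [reflOp, phaseOp_apply, PiLp.sub_apply, PiLp.smul_apply, projOp_apply, smul_eq_mul]
  split_ifs <;> ring

theorem projOp_projOp (l : List W) (ψ : QState W) : projOp l (projOp l ψ) = projOp l ψ := by
  ext z
  simp only [projOp_apply]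
  split_ifs <;> rfl

theorem inner_projOp (l : List W) (ψ : QState W) :
    inner ℂ ψ (projOp l ψ) = ((‖projOp l ψ‖ ^ 2 : ℝ) : ℂ) := by
  have h : inner ℂ ψ (projOp l ψ) = inner ℂ (projOp l ψ) (projOp l ψ) := by
    simp only [PiLp.inner_apply, projOp_apply]
    refine Finset.sum_congr rfl fun z _ => ?_
    split_ifs <;> simp
  rw [h, inner_self_eq_norm_sq_to_K]
  norm_cast

theorem norm_sq_projOp_add (l : List W) (ψ : QState W) :
    ‖projOp l ψ‖ ^ 2 + ‖ψ - projOp l ψ‖ ^ 2 = ‖ψ‖ ^ 2 := by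
  simp only [EuclideanSpace.norm_sq_eq, ← Finset.sum_add_distrib, PiLp.sub_apply, projOp_apply]
  refine Finset.sum_congr rfl fun z _ => ?_
  split_ifs <;> simp

theorem inner_ket_left (x : W → Bool) (ψ : QState W) : inner ℂ (ket x) ψ = ψ x := by
  simp [ket, EuclideanSpace.inner_single_left]

theorem norm_ket (x : W → Bool) : ‖ket x‖ = 1 := by
  simp [ket]

/-- On a state in which all qubits off `M` are in a basis state with zeros on `M`, the projection to
the states with zeros on `M` yields a multiple of this basis state. -/
theorem projOp_of_mem_Agr {l : List W} {M : Set W} (hl : ∀ w, w ∈ l ↔ w ∈ M) {x : W → Bool}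
    (hx : ∀ w ∈ M, x w = false) {ψ : QState W} (hψ : ψ ∈ Agr M x) :
    projOp l ψ = ψ x • ket x := by
  ext z
  simp only [projOp_apply, PiLp.smul_apply, ket_apply, smul_eq_mul]
  by_cases hz : z = x
  · subst hz
    have : l.any z = false := by
      simp only [List.any_eq_false]
      intro w hw
      simp [hx w ((hl w).1 hw)]
    simp [this]
  · simp only [hz, if_false, mul_zero]
    split_ifs with h
    · rfl
    · by_contra h0
      apply hz
      funext w
      by_cases hw : w ∈ M
      · rw [hx w hw]
        simp only [List.any_eq_true, not_exists, not_and, Bool.not_eq_true] at h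
        exact h w ((hl w).2 hw)
      · exact hψ z h0 w hw

variable {Vr Vn : Type} [Fintype Vr] [DecidableEq Vr] [Fintype Vn] [DecidableEq Vn]
  (R : QUnitary Vr) (N : QUnitary Vn)

/-- The Grover iterate `E (2 P₀ - 1) E⁻¹ (2 P₁ - 1)`, where `Pⱼ` projects to zeros on `lⱼ`. -/
def groverOp (E : QCircuit Vr Vn W) (l₀ l₁ : List W) : Module.End ℂ (QState W) :=
  (cOp R N E).toLinearEquiv.toLinearMap * reflOp l₀ *
    (cOp R N (cInv E)).toLinearEquiv.toLinearMap * reflOp l₁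

theorem groverOp_apply (E : QCircuit Vr Vn W) (l₀ l₁ : List W) (ψ : QState W) :
    groverOp R N E l₀ l₁ ψ = cOp R N E (reflOp l₀ (cOp R N (cInv E) (reflOp l₁ ψ))) := rfl

variable {R N}

section Recurrence

variable {E : QCircuit Vr Vn W} {l₀ l₁ : List W} {M : Set W} {x : W → Bool}

theorem groverOp_mem (hE : Pres R N E M x) {ψ : QState W} (hψ : ψ ∈ Agr M x) :
    groverOp R N E l₀ l₁ ψ ∈ Agr M x := by
  rw [groverOp_apply]
  exact hE _ (phaseOp_mem_Supp _ (hE.inv _ (phaseOp_mem_Supp _ hψ)))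

/-- The cosine of the angle of the Grover iterate. -/
def groverCos (R : QUnitary Vr) (N : QUnitary Vn) (E : QCircuit Vr Vn W) (l₁ : List W)
    (x : W → Bool) : ℝ :=
  2 * ‖projOp l₁ (cOp R N E (ket x))‖ ^ 2 - 1

theorem inner_reflOp :
    inner ℂ (cOp R N E (ket x)) (reflOp l₁ (cOp R N E (ket x)))
      = (groverCos R N E l₁ x : ℂ) := by
  rw [reflOp_eq, inner_sub_right, inner_smul_right, inner_projOp, inner_self_eq_norm_sq_to_K,
    LinearIsometryEquiv.norm_map, norm_ket, groverCos]
  push_cast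
  simp

theorem groverOp_start (hE : Pres R N E M x) (hl : ∀ w, w ∈ l₀ ↔ w ∈ M)
    (hx : ∀ w ∈ M, x w = false) :
    groverOp R N E l₀ l₁ (cOp R N E (ket x))
      = (2 * groverCos R N E l₁ x : ℂ) • cOp R N E (ket x) - reflOp l₁ (cOp R N E (ket x)) := by
  set ψ := cOp R N E (ket x) with hψ
  have hψM : ψ ∈ Agr M x := hE _ (ket_mem_Agr M x)
  have hχM : cOp R N (cInv E) (reflOp l₁ ψ) ∈ Agr M x := hE.inv _ (phaseOp_mem_Supp _ hψM)
  have hy : (cOp R N (cInv E) (reflOp l₁ ψ)) x = (groverCos R N E l₁ x : ℂ) := by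
    rw [← inner_ket_left, ← inner_reflOp, ← LinearIsometryEquiv.inner_map_map (cOp R N E),
      cOp_cOp_cInv]
  rw [groverOp_apply, reflOp_eq l₀, projOp_of_mem_Agr hl hx hχM, hy, map_sub, map_smul, map_smul,
    cOp_cOp_cInv, smul_smul]

theorem groverOp_reflOp (hl : ∀ w, w ∈ l₀ ↔ w ∈ M) (hx : ∀ w ∈ M, x w = false) :
    groverOp R N E l₀ l₁ (reflOp l₁ (cOp R N E (ket x))) = cOp R N E (ket x) := by
  have h : reflOp l₁ (reflOp l₁ (cOp R N E (ket x))) = cOp R N E (ket x) := phaseOp_phaseOp _ _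
  rw [groverOp_apply, h, cOp_cInv_cOp, reflOp_eq, projOp_of_mem_Agr hl hx (ket_mem_Agr M x)]
  congr 1
  rw [ket_apply, if_pos rfl, one_smul, two_smul, add_sub_cancel_right]

/-- The three-term recurrence of the Chebyshev polynomials, satisfied by the states that the Grover
iterate produces. -/
theorem groverOp_pow_recurrence (hE : Pres R N E M x) (hl : ∀ w, w ∈ l₀ ↔ w ∈ M)
    (hx : ∀ w ∈ M, x w = false) (k : ℕ) :
    (groverOp R N E l₀ l₁ ^ (k + 2)) (cOp R N E (ket x))
      = (2 * groverCos R N E l₁ x : ℂ) • (groverOp R N E l₀ l₁ ^ (k + 1)) (cOp R N E (ket x))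
        - (groverOp R N E l₀ l₁ ^ k) (cOp R N E (ket x)) := by
  rw [pow_succ, Module.End.mul_apply, groverOp_start hE hl hx, map_sub, map_smul]
  congr 1
  rw [pow_succ, Module.End.mul_apply, groverOp_reflOp hl hx]

/-- The component of the state after `k` iterates along the initial state `E |x⟩` is the Chebyshev
polynomial of the first kind `T_k` in `groverCos`. -/
theorem inner_groverOp_pow (hE : Pres R N E M x) (hl : ∀ w, w ∈ l₀ ↔ w ∈ M)
    (hx : ∀ w ∈ M, x w = false) {θ : ℝ} (hθ : Real.cos θ = groverCos R N E l₁ x) (k : ℕ) :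
    inner ℂ (cOp R N E (ket x)) ((groverOp R N E l₀ l₁ ^ k) (cOp R N E (ket x)))
      = (Real.cos (k * θ) : ℂ) := by
  induction k using Nat.twoStepInduction with
  | zero =>
    rw [pow_zero, Module.End.one_apply, inner_self_eq_norm_sq_to_K, LinearIsometryEquiv.norm_map,
      norm_ket]
    simp
  | one =>
    rw [pow_one, groverOp_start hE hl hx, inner_sub_right, inner_smul_right, inner_reflOp,
      inner_self_eq_norm_sq_to_K, LinearIsometryEquiv.norm_map, norm_ket, Nat.cast_one, one_mul, hθ]
    simp
    ring
  | more k h0 h1 =>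
    rw [groverOp_pow_recurrence hE hl hx, inner_sub_right, inner_smul_right, h0, h1, ← hθ]
    have e1 : Real.cos ((k + 2 : ℕ) * θ) = 2 * Real.cos θ * Real.cos ((k + 1 : ℕ) * θ)
        - Real.cos (k * θ) := by
      have a1 := Real.cos_add ((k + 1 : ℕ) * θ) θ
      have a2 := Real.cos_sub ((k + 1 : ℕ) * θ) θ
      rw [show ((k + 1 : ℕ) : ℝ) * θ + θ = (k + 2 : ℕ) * θ by push_cast; ring] at a1
      rw [show ((k + 1 : ℕ) : ℝ) * θ - θ = k * θ by push_cast; ring] at a2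
      linarith
    rw [e1]
    push_cast
    ring

/-- The part of the state with zeros on `l₁` keeps its direction under the iterates. Its length,
relative to `cos φ`, is written without division. -/
theorem projOp_groverOp_pow (hE : Pres R N E M x) (hl : ∀ w, w ∈ l₀ ↔ w ∈ M)
    (hx : ∀ w ∈ M, x w = false) {φ : ℝ}
    (hφ : Real.cos φ = ‖projOp l₁ (cOp R N E (ket x))‖) (k : ℕ) :
    (Real.cos φ : ℂ) • projOp l₁ ((groverOp R N E l₀ l₁ ^ k) (cOp R N E (ket x)))
      = (Real.cos ((2 * k + 1) * φ) : ℂ) • projOp l₁ (cOp R N E (ket x)) := by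
  have hy : groverCos R N E l₁ x = 2 * Real.cos φ ^ 2 - 1 := by rw [groverCos, hφ]
  induction k using Nat.twoStepInduction with
  | zero => simp
  | one =>
    have h : projOp l₁ (reflOp l₁ (cOp R N E (ket x))) = projOp l₁ (cOp R N E (ket x)) := by
      rw [reflOp_eq, map_sub, map_smul, projOp_projOp, two_smul, add_sub_cancel_right]
    rw [pow_one, groverOp_start hE hl hx, map_sub, map_smul, h, hy,
      show (2 * ((1 : ℕ) : ℝ) + 1) * φ = 3 * φ by push_cast; ring, Real.cos_three_mul]
    nth_rw 2 [← one_smul ℂ (projOp l₁ (cOp R N E (ket x)))]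
    rw [← sub_smul, smul_smul]
    congr 1
    push_cast
    ring
  | more k h0 h1 =>
    rw [groverOp_pow_recurrence hE hl hx, map_sub, map_smul, smul_sub, smul_comm, h0, h1, smul_smul,
      ← sub_smul, hy]
    congr 1
    have e1 : Real.cos ((2 * (k + 2 : ℕ) + 1) * φ)
        = 2 * (2 * Real.cos φ ^ 2 - 1) * Real.cos ((2 * (k + 1 : ℕ) + 1) * φ)
          - Real.cos ((2 * k + 1) * φ) := by
      have a1 := Real.cos_add ((2 * (k + 1 : ℕ) + 1) * φ) (2 * φ)
      have a2 := Real.cos_sub ((2 * (k + 1 : ℕ) + 1) * φ) (2 * φ)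
      rw [show (2 * ((k + 1 : ℕ) : ℝ) + 1) * φ + 2 * φ = (2 * (k + 2 : ℕ) + 1) * φ by
        push_cast; ring] at a1
      rw [show (2 * ((k + 1 : ℕ) : ℝ) + 1) * φ - 2 * φ = (2 * k + 1) * φ by push_cast; ring] at a2
      rw [← Real.cos_two_mul]
      linarith
    rw [e1]
    push_cast
    ring

/-- Amplitude amplification of an amplitude `α` that is almost `sin (π / (2 (2 r + 1)))`, with an
even number `r` of rounds. -/
theorem norm_groverOp_pow_sub_le (hE : Pres R N E M x) (hl : ∀ w, w ∈ l₀ ↔ w ∈ M)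
    (hx : ∀ w ∈ M, x w = false) {r : ℕ} (hr : Even r) (hr1 : 1 ≤ r) {α : ℝ} {g : QState W}
    (hg : ‖g‖ = 1) (hα : projOp l₁ (cOp R N E (ket x)) = (α : ℂ) • g) (hα0 : 0 < α)
    (hαs : α ≤ Real.sin (Real.pi / (2 * (2 * r + 1)))) :
    ‖(groverOp R N E l₀ l₁ ^ r) (cOp R N E (ket x)) - g‖
      ≤ 4 * (2 * r + 1) * (Real.sin (Real.pi / (2 * (2 * r + 1))) - α) := by
  have hπ := Real.pi_pos
  have hr1' : (1 : ℝ) ≤ r := by exact_mod_cast hr1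
  set β := Real.pi / (2 * (2 * r + 1)) with hβ
  have hβ0 : 0 < β := by positivity
  have hβ6 : β ≤ Real.pi / 6 := by
    rw [hβ]
    gcongr
    linarith
  set s := Real.sin β with hs
  have hs1 : s ≤ 1 := Real.sin_le_one _
  have has : Real.arcsin s = β := Real.arcsin_sin (by linarith) (by linarith)
  set a := Real.arcsin α with ha
  have ha0 : 0 ≤ a := Real.arcsin_nonneg.2 hα0.le
  have haβ : a ≤ β := by
    rw [← has]
    exact Real.monotone_arcsin hαs
  have hsa : Real.sin a = α := Real.sin_arcsin (by linarith) (by linarith)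
  have hφ : Real.cos (Real.pi / 2 - a) = α := by rw [Real.cos_pi_div_two_sub, hsa]
  have hnorm : ‖projOp l₁ (cOp R N E (ket x))‖ = α := by
    rw [hα, norm_smul, hg, mul_one, Complex.norm_real, Real.norm_eq_abs, abs_of_pos hα0]
  -- The angle between the amplified state and `g` is `(2 r + 1) (β - a)`.
  set c := Real.cos ((2 * r + 1) * (β - a)) with hc
  have hcc : Real.cos ((2 * r + 1) * (Real.pi / 2 - a)) = c := by
    obtain ⟨q, hq⟩ := hr
    have e : (2 * (r : ℝ) + 1) * (Real.pi / 2 - a) = (2 * r + 1) * (β - a) + q * (2 * Real.pi) := by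
      have e1 : (2 * (r : ℝ) + 1) * β = Real.pi / 2 := by
        rw [hβ]
        field_simp
      have e2 : (r : ℝ) = q + q := by exact_mod_cast hq
      have e3 : (r : ℝ) * Real.pi = (q + q) * Real.pi := by rw [e2]
      linarith
    rw [e, Real.cos_add_nat_mul_two_pi]
  set ψ := (groverOp R N E l₀ l₁ ^ r) (cOp R N E (ket x)) with hψ
  have hαc : (α : ℂ) ≠ 0 := by exact_mod_cast hα0.ne'
  have hP : projOp l₁ ψ = (c : ℂ) • g := by
    have := projOp_groverOp_pow hE hl hx (hφ.trans hnorm.symm) r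
    rw [hφ, hα, smul_comm, hcc] at this
    exact smul_right_injective _ hαc this
  have hψ1 : ‖ψ‖ = 1 := by
    have hT : ∀ χ : QState W, ‖groverOp R N E l₀ l₁ χ‖ = ‖χ‖ := by
      have hrefl : ∀ (l : List W) (χ : QState W), ‖reflOp l χ‖ = ‖χ‖ := by
        intro l χ
        rw [← pow_left_inj₀ (norm_nonneg _) (norm_nonneg _) two_ne_zero]
        simp only [EuclideanSpace.norm_sq_eq, reflOp, phaseOp_apply]
        refine Finset.sum_congr rfl fun z _ => ?_
        split_ifs <;> simp
      intro χ
      rw [groverOp_apply, LinearIsometryEquiv.norm_map, hrefl, LinearIsometryEquiv.norm_map, hrefl]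
    have : ∀ k : ℕ, ‖(groverOp R N E l₀ l₁ ^ k) (cOp R N E (ket x))‖ = 1 := by
      intro k
      induction k with
      | zero =>
        rw [pow_zero, Module.End.one_apply, LinearIsometryEquiv.norm_map, norm_ket]
      | succ k ih => rw [pow_succ', Module.End.mul_apply, hT, ih]
    exact this r
  have hPg : projOp l₁ g = g := by
    have : (α : ℂ) • projOp l₁ g = (α : ℂ) • g := by
      rw [← map_smul, ← hα, projOp_projOp]
    exact smul_right_injective _ hαc this
  have h1 := norm_sq_projOp_add l₁ ψ
  have h2 := norm_sq_projOp_add l₁ (ψ - g)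
  have h3 : ψ - g - (projOp l₁ ψ - g) = ψ - projOp l₁ ψ := by abel
  rw [map_sub, hPg, h3, hP] at h2
  have h4 : (c : ℂ) • g - g = ((c - 1 : ℝ) : ℂ) • g := by
    push_cast
    rw [sub_smul, one_smul]
  rw [h4, norm_smul, hg, mul_one, Complex.norm_real, Real.norm_eq_abs, sq_abs] at h2
  rw [hP, norm_smul, hg, mul_one, Complex.norm_real, Real.norm_eq_abs, sq_abs, hψ1] at h1
  have h5 : ‖ψ - g‖ ^ 2 = 2 * (1 - c) := by linarith
  have h6 := Real.one_sub_sq_div_two_le_cos (x := (2 * r + 1) * (β - a))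
  have h7 : ‖ψ - g‖ ^ 2 ≤ ((2 * r + 1) * (β - a)) ^ 2 := by
    rw [h5]
    linarith
  have h8 : 0 ≤ (2 * (r : ℝ) + 1) * (β - a) := mul_nonneg (by positivity) (by linarith)
  have h9 : ‖ψ - g‖ ≤ (2 * r + 1) * (β - a) := abs_le_of_sq_le_sq' h7 h8 |>.2
  refine h9.trans ?_
  have h10 : β - a ≤ 4 * (s - α) := by
    have e1 : s - α = 2 * Real.sin ((β - a) / 2) * Real.cos ((β + a) / 2) := by
      rw [← hsa, hs, Real.sin_sub_sin]
    have e2 : 1 / 2 ≤ Real.cos ((β + a) / 2) := by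
      rw [← Real.cos_pi_div_three]
      exact Real.cos_le_cos_of_nonneg_of_le_pi (by linarith) (by linarith) (by linarith)
    have e3 := Real.mul_le_sin (x := (β - a) / 2) (by linarith) (by linarith)
    have e4 : 1 / 2 ≤ 2 / Real.pi := by
      rw [div_le_div_iff₀ (by norm_num) hπ]
      linarith [Real.pi_le_four]
    have e5 : 1 / 2 * ((β - a) / 2) ≤ Real.sin ((β - a) / 2) :=
      (mul_le_mul_of_nonneg_right e4 (by linarith)).trans e3
    have e6 : (β - a) / 4 * (1 / 2) ≤ Real.sin ((β - a) / 2) * Real.cos ((β + a) / 2) :=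
      mul_le_mul (by linarith) e2 (by norm_num) (by linarith)
    rw [e1]
    linarith
  calc (2 * (r : ℝ) + 1) * (β - a) ≤ (2 * r + 1) * (4 * (s - α)) := by gcongr
    _ = _ := by ring

end Recurrence

end Reflection

section GroverCircuit

variable {W : Type} [Fintype W] [DecidableEq W] {Vr Vn : Type}

/-- The circuit of the Grover iterate. Its phases may be controlled by the wire `u`. -/
def groverC (sc : ℕ → W) (d : W) (E : QCircuit Vr Vn W) (l₀ l₁ : List W) (g : Bool → Bool → Bool)
    (u : W) : QCircuit Vr Vn W :=
  phaseC sc d l₁ u g ++ (cInv E ++ (phaseC sc d l₀ u g ++ E))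

theorem time_groverC_le (T : ℝ) (sc : ℕ → W) (d : W) (E : QCircuit Vr Vn W) (l₀ l₁ : List W)
    (g : Bool → Bool → Bool) (u : W) :
    QCircuit.time T (groverC sc d E l₀ l₁ g u)
      ≤ 2 * QCircuit.time T E + 6 * (l₀.length + l₁.length) + 2 := by
  simp only [groverC, time_append, time_cInv]
  have h0 := time_phaseC_le (Vr := Vr) (Vn := Vn) T sc d l₀ u g
  have h1 := time_phaseC_le (Vr := Vr) (Vn := Vn) T sc d l₁ u g
  linarith

theorem groverC_avoids {V : Set W} {sc : ℕ → W} (hsc : ∀ k, sc k ∉ V) {d u : W}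
    {E : QCircuit Vr Vn W} {l₀ l₁ : List W} (hE : Avoids E V) (hd : d ∉ V) (hu : u ∉ V)
    (h₀ : ∀ w ∈ l₀, w ∉ V) (h₁ : ∀ w ∈ l₁, w ∉ V) (g : Bool → Bool → Bool) :
    Avoids (groverC sc d E l₀ l₁ g u) V :=
  (phaseC_avoids hsc hd hu h₁ g).append (hE.cInv.append
    ((phaseC_avoids hsc hd hu h₀ g).append hE))

variable [Fintype Vr] [DecidableEq Vr] [Fintype Vn] [DecidableEq Vn]

/-- The wires of the Grover circuit fit together: the scratch wires `sc k` are distinct from each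
other and from the wires in `l₀` and `l₁`, and they carry zeros. -/
structure GroverWires (sc : ℕ → W) (S : ℕ) (d : W) (l₀ l₁ : List W) (M : Set W)
    (x : W → Bool) : Prop where
  inj : Set.InjOn sc (Set.Iic S)
  dummy : ∀ k ≤ S, d ≠ sc k
  length₀ : 2 * l₀.length ≤ S
  length₁ : 2 * l₁.length ≤ S
  list₀ : ∀ w ∈ l₀, w ≠ d ∧ ∀ k ≤ S, w ≠ sc k
  list₁ : ∀ w ∈ l₁, w ≠ d ∧ ∀ k ≤ S, w ≠ sc k
  scratch : ∀ k ≤ S, sc k ∉ M ∧ x (sc k) = false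

variable {R : QUnitary Vr} {N : QUnitary Vn} {sc : ℕ → W} {S : ℕ} {d : W} {E : QCircuit Vr Vn W}
  {l₀ l₁ : List W} {M : Set W} {x : W → Bool}

theorem cOp_groverC (hw : GroverWires sc S d l₀ l₁ M x) (hE : Pres R N E M x) {u : W} (hud : u ≠ d)
    (hu : ∀ k ≤ S, u ≠ sc k) (g : Bool → Bool → Bool) {ψ : QState W} (hψ : ψ ∈ Agr M x) :
    cOp R N (groverC sc d E l₀ l₁ g u) ψ
      = cOp R N E (phaseOp (fun z => g (l₀.any z) (z u))
        (cOp R N (cInv E) (phaseOp (fun z => g (l₁.any z) (z u)) ψ))) := by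
  simp only [groverC, cOp_append]
  rw [cOp_phaseC R N hw.inj hw.length₁ hw.dummy hu hud hw.list₁ g hw.scratch hψ,
    cOp_phaseC R N hw.inj hw.length₀ hw.dummy hu hud hw.list₀ g hw.scratch
      (hE.inv _ (phaseOp_mem_Supp _ hψ))]

theorem Pres.groverC (hw : GroverWires sc S d l₀ l₁ M x) (hE : Pres R N E M x) {u : W}
    (hud : u ≠ d) (hu : ∀ k ≤ S, u ≠ sc k) (g : Bool → Bool → Bool) :
    Pres R N (groverC sc d E l₀ l₁ g u) M x := by
  intro ψ hψ
  rw [cOp_groverC hw hE hud hu g hψ]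
  exact hE _ (phaseOp_mem_Supp _ (hE.inv _ (phaseOp_mem_Supp _ hψ)))

theorem any_xorMask_bitMask {u : W} {l : List W} (hu : u ∉ l) (z : W → Bool) :
    l.any (xorMask (bitMask u) z) = l.any z := by
  rw [Bool.eq_iff_iff]
  simp only [List.any_eq_true]
  refine exists_congr fun w => and_congr_right fun hw => ?_
  rw [xorMask_bitMask_of_ne (by rintro rfl; exact hu hw)]

/-- The circuit `groverC` with the flag function `and` is the Grover iterate controlled by a qubit:
the circuits `E` and `E⁻¹` need no control, because they cancel when the two reflections are
omitted. -/
theorem isControlled_groverC (hw : GroverWires sc S d l₀ l₁ M x) (hE : Pres R N E M x) {V : Set W}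
    (hVM : V ⊆ M) (hEV : Avoids E V) (hd : d ∉ V) (h₀ : ∀ w ∈ l₀, w ∉ V) (h₁ : ∀ w ∈ l₁, w ∉ V) :
    IsControlled R N (groverC sc d E l₀ l₁ and) (groverOp R N E l₀ l₁) M x V := by
  have hud : ∀ u ∈ V, u ≠ d := fun u hu e => hd (e ▸ hu)
  have hus : ∀ u ∈ V, ∀ k ≤ S, u ≠ sc k := fun u hu k hk e => (hw.scratch k hk).1 (e ▸ hVM hu)
  have hEb : ∀ u ∈ V, ∀ b, ∀ (c : QCircuit Vr Vn W), Avoids c V →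
      ∀ ψ ∈ Supp (fun z : W → Bool => z u = b), cOp R N c ψ ∈ Supp fun z : W → Bool => z u = b :=
    fun u hu b c hc ψ hψ => hc.supp (fun y z hyz hy => by rw [hyz u hu, hy]) hψ
  refine ⟨hVM, ?_, ?_, fun ψ hψ => groverOp_mem hE hψ, ?_, ?_⟩
  · intro u hu ψ hψ hψu
    rw [cOp_groverC hw hE (hud u hu) (hus u hu) _ hψ]
    have e : ∀ (l : List W) (χ : QState W), (χ ∈ Supp fun z : W → Bool => z u = false) →
        phaseOp (fun z => l.any z && z u) χ = χ := fun l χ hχ =>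
      phaseOp_eq_self fun z hz => by rw [hχ z hz, Bool.and_false]
    rw [e _ _ hψu, e _ _ (hEb u hu false _ hEV.cInv _ hψu), cOp_cOp_cInv]
  · intro u hu ψ hψ hψu
    rw [cOp_groverC hw hE (hud u hu) (hus u hu) _ hψ, groverOp_apply]
    have e : ∀ (l : List W) (χ : QState W), (χ ∈ Supp fun z : W → Bool => z u = true) →
        phaseOp (fun z => l.any z && z u) χ = reflOp l χ := by
      intro l χ hχ
      ext z
      rw [reflOp, phaseOp_apply, phaseOp_apply]
      by_cases hz : χ z = 0
      · simp [hz]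
      · have : z u = true := hχ z hz
        simp [this]
    rw [e _ _ hψu]
    exact congrArg _ (e _ _ (hEb u hu true _ hEV.cInv _ (phaseOp_mem_Supp _ hψu)))
  · intro u hu b ψ _ hψu
    exact hEb u hu b _ hEV _ (phaseOp_mem_Supp _ (hEb u hu b _ hEV.cInv _
      (phaseOp_mem_Supp _ hψu)))
  · intro u hu ψ _
    have hm : {w | bitMask u w = true} ⊆ V := by
      intro w hw'
      simp only [bitMask, Set.mem_ofPred_eq, decide_eq_true_eq] at hw'
      exact hw' ▸ hu
    simp only [groverOp_apply, reflOp]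
    rw [phaseOp_flipOp _ (any_xorMask_bitMask fun h => h₁ u h hu),
      cOp_flip R N (hEV.cInv.mono hm),
      phaseOp_flipOp _ (any_xorMask_bitMask fun h => h₀ u h hu), cOp_flip R N (hEV.mono hm)]

/-- The circuit `E`, followed by `r` Grover iterates. -/
def amplifyC (sc : ℕ → W) (d u : W) (E : QCircuit Vr Vn W) (l₀ l₁ : List W) (r : ℕ) :
    QCircuit Vr Vn W :=
  E ++ (List.replicate r (groverC sc d E l₀ l₁ (fun f _ => f) u)).flatten

theorem cOp_amplifyC (hw : GroverWires sc S d l₀ l₁ M x) (hE : Pres R N E M x) {u : W}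
    (hud : u ≠ d) (hu : ∀ k ≤ S, u ≠ sc k) (r : ℕ) :
    cOp R N (amplifyC sc d u E l₀ l₁ r) (ket x)
      = (groverOp R N E l₀ l₁ ^ r) (cOp R N E (ket x)) := by
  have h : ∀ (r : ℕ) (ψ : QState W), ψ ∈ Agr M x →
      cOp R N (List.replicate r (groverC sc d E l₀ l₁ (fun f _ => f) u)).flatten ψ
        = (groverOp R N E l₀ l₁ ^ r) ψ := by
    intro r
    induction r with
    | zero => exact fun ψ _ => rfl
    | succ r ih =>
      intro ψ hψ
      rw [List.replicate_succ, List.flatten_cons, cOp_append, cOp_groverC hw hE hud hu _ hψ]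
      change cOp R N _ (groverOp R N E l₀ l₁ ψ) = _
      rw [ih _ (groverOp_mem hE hψ), pow_succ, Module.End.mul_apply]
  rw [amplifyC, cOp_append, h r _ (hE _ (ket_mem_Agr M x))]

theorem time_amplifyC_le (T : ℝ) (sc : ℕ → W) (d u : W) (E : QCircuit Vr Vn W) (l₀ l₁ : List W)
    (r : ℕ) :
    QCircuit.time T (amplifyC sc d u E l₀ l₁ r) ≤ QCircuit.time T E
      + r * (2 * QCircuit.time T E + 6 * (l₀.length + l₁.length) + 2) := by
  rw [amplifyC, time_append]
  refine add_le_add_right ?_ _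
  induction r with
  | zero => simp [QCircuit.time]
  | succ r ih =>
    rw [List.replicate_succ, List.flatten_cons, time_append, Nat.cast_add, Nat.cast_one]
    have := time_groverC_le T sc d E l₀ l₁ (fun f _ => f) u
    linarith

end GroverCircuit

/-! ### Trigonometric polynomials that approximate a step -/

section Step

/-- The function is a combination of `cos (k x)` for `k ≤ K`. -/
def IsCosPoly (K : ℕ) (f : ℝ → ℝ) : Prop :=
  ∃ κ : ℕ → ℝ, ∀ x, f x = ∑ k ∈ Finset.range (K + 1), κ k * Real.cos (k * x)

theorem IsCosPoly.cos {K k : ℕ} (h : k ≤ K) : IsCosPoly K fun x => Real.cos (k * x) := by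
  refine ⟨fun l => if l = k then 1 else 0, fun x => ?_⟩
  simp [Finset.sum_ite_eq', Nat.lt_succ_of_le h]

theorem IsCosPoly.const_mul {K : ℕ} {f : ℝ → ℝ} (h : IsCosPoly K f) (a : ℝ) :
    IsCosPoly K fun x => a * f x := by
  obtain ⟨κ, hκ⟩ := h
  refine ⟨fun k => a * κ k, fun x => ?_⟩
  simp only [hκ, Finset.mul_sum, mul_assoc]

theorem IsCosPoly.sum {K : ℕ} {ι : Type} (s : Finset ι) {f : ι → ℝ → ℝ}
    (h : ∀ i ∈ s, IsCosPoly K (f i)) : IsCosPoly K fun x => ∑ i ∈ s, f i x := by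
  choose! κ hκ using h
  refine ⟨fun k => ∑ i ∈ s, κ i k, fun x => ?_⟩
  simp only [Finset.sum_mul]
  rw [Finset.sum_comm]
  exact Finset.sum_congr rfl fun i hi => hκ i hi x

theorem cos_natAbs_sub_mul (a b : ℕ) (x : ℝ) :
    Real.cos (((a : ℤ) - b).natAbs * x) = Real.cos (a * x - b * x) := by
  have h : ((((a : ℤ) - b).natAbs : ℕ) : ℝ) = |(a : ℝ) - b| := by
    rw [Nat.cast_natAbs]
    push_cast
    rfl
  rw [h, ← sub_mul]
  rcases abs_choice ((a : ℝ) - b) with h' | h' <;> rw [h']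
  rw [neg_mul, Real.cos_neg]

theorem IsCosPoly.mul {K L : ℕ} {f g : ℝ → ℝ} (hf : IsCosPoly K f) (hg : IsCosPoly L g) :
    IsCosPoly (K + L) fun x => f x * g x := by
  obtain ⟨κ, hκ⟩ := hf
  obtain ⟨μ, hμ⟩ := hg
  have h : IsCosPoly (K + L) fun x => ∑ a ∈ Finset.range (K + 1), ∑ b ∈ Finset.range (L + 1),
      ∑ c : Bool, κ a * μ b / 2 *
        Real.cos (((if c then a + b else ((a : ℤ) - b).natAbs : ℕ) : ℝ) * x) := by
    refine IsCosPoly.sum _ fun a ha => IsCosPoly.sum _ fun b hb => IsCosPoly.sum _ fun c _ =>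
      IsCosPoly.const_mul (IsCosPoly.cos ?_) _
    rw [Finset.mem_range] at ha hb
    split_ifs <;> omega
  obtain ⟨ν, hν⟩ := h
  refine ⟨ν, fun x => ?_⟩
  refine Eq.trans ?_ (hν x)
  simp only []
  rw [hκ, hμ, Finset.sum_mul_sum]
  refine Finset.sum_congr rfl fun a _ => Finset.sum_congr rfl fun b _ => ?_
  simp only [Fintype.sum_bool, if_true, if_false, Bool.false_eq_true]
  rw [cos_natAbs_sub_mul, Real.cos_sub, Nat.cast_add, add_mul, Real.cos_add]
  ring

theorem IsCosPoly.pow {K : ℕ} {f : ℝ → ℝ} (hf : IsCosPoly K f) (m : ℕ) :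
    IsCosPoly (m * K) fun x => f x ^ m := by
  induction m with
  | zero =>
    refine ⟨fun _ => 1, fun x => ?_⟩
    simp
  | succ m ih =>
    have := ih.mul hf
    rw [add_mul, one_mul]
    simpa only [pow_succ] using this

/-- The Fejér kernel, normalized to the value `1` at `0`. -/
def fejer (N : ℕ) (x : ℝ) : ℝ :=
  ((∑ j ∈ Finset.range N, Real.cos (j * x)) ^ 2 + (∑ j ∈ Finset.range N, Real.sin (j * x)) ^ 2)
    / N ^ 2

theorem fejer_nonneg (N : ℕ) (x : ℝ) : 0 ≤ fejer N x := by
  unfold fejer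
  positivity

theorem fejer_zero {N : ℕ} (hN : N ≠ 0) : fejer N 0 = 1 := by
  have : (N : ℝ) ≠ 0 := by exact_mod_cast hN
  simp [fejer, this]

theorem isCosPoly_fejer (N : ℕ) : IsCosPoly N (fejer N) := by
  have h : IsCosPoly N fun x => ∑ a ∈ Finset.range N, ∑ b ∈ Finset.range N,
      (1 / (N : ℝ) ^ 2) * Real.cos (((((a : ℤ) - b).natAbs : ℕ) : ℝ) * x) := by
    refine IsCosPoly.sum _ fun a ha => IsCosPoly.sum _ fun b hb =>
      IsCosPoly.const_mul (IsCosPoly.cos ?_) _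
    rw [Finset.mem_range] at ha hb
    omega
  obtain ⟨κ, hκ⟩ := h
  refine ⟨κ, fun x => ?_⟩
  rw [← hκ x, fejer, pow_two (∑ j ∈ Finset.range N, _), pow_two (∑ j ∈ Finset.range N, _),
    Finset.sum_mul_sum, Finset.sum_mul_sum, ← Finset.sum_add_distrib, Finset.sum_div]
  refine Finset.sum_congr rfl fun a _ => ?_
  rw [← Finset.sum_add_distrib, Finset.sum_div]
  refine Finset.sum_congr rfl fun b _ => ?_
  rw [cos_natAbs_sub_mul, Real.cos_sub]
  ring

theorem fejer_mul_sin_sq_le {N : ℕ} (hN : N ≠ 0) (x : ℝ) :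
    fejer N x * (N * Real.sin (x / 2)) ^ 2 ≤ 1 := by
  have hc : 2 * Real.sin (x / 2) * ∑ j ∈ Finset.range N, Real.cos (j * x)
      = Real.sin (N * x - x / 2) + Real.sin (x / 2) := by
    induction N with
    | zero => simp
    | succ n ih =>
      rw [Finset.sum_range_succ, mul_add]
      rcases eq_or_ne n 0 with rfl | hn
      · simp
        rw [show x - x / 2 = x / 2 by ring]
        ring
      · rw [ih hn]
        push_cast
        rw [show ((n : ℝ) + 1) * x - x / 2 = n * x + x / 2 by ring, Real.sin_add, Real.sin_sub]
        ring
  have hs : 2 * Real.sin (x / 2) * ∑ j ∈ Finset.range N, Real.sin (j * x)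
      = Real.cos (x / 2) - Real.cos (N * x - x / 2) := by
    induction N with
    | zero => simp
    | succ n ih =>
      rw [Finset.sum_range_succ, mul_add]
      rcases eq_or_ne n 0 with rfl | hn
      · simp
        rw [show x - x / 2 = x / 2 by ring]
        ring
      · rw [ih hn (by
          have := hc
          rw [Finset.sum_range_succ, mul_add] at this
          push_cast at this
          rw [show ((n : ℝ) + 1) * x - x / 2 = n * x + x / 2 by ring, Real.sin_add] at this
          rw [Real.sin_sub]
          linarith)]
        push_cast
        rw [show ((n : ℝ) + 1) * x - x / 2 = n * x + x / 2 by ring, Real.cos_add, Real.cos_sub]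
        ring
  have hN' : (N : ℝ) ^ 2 ≠ 0 := by positivity
  have e : 4 * (fejer N x * (N * Real.sin (x / 2)) ^ 2)
      = (2 * Real.sin (x / 2) * ∑ j ∈ Finset.range N, Real.cos (j * x)) ^ 2
        + (2 * Real.sin (x / 2) * ∑ j ∈ Finset.range N, Real.sin (j * x)) ^ 2 := by
    unfold fejer
    generalize (∑ j ∈ Finset.range N, Real.cos (j * x)) = A
    generalize (∑ j ∈ Finset.range N, Real.sin (j * x)) = B
    field_simp
    ring
  rw [hc, hs] at e
  have h1 := Real.sin_sq_add_cos_sq (x / 2)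
  have h2 := Real.sin_sq_add_cos_sq (N * x - x / 2)
  nlinarith [sq_nonneg (Real.sin (N * x - x / 2) - Real.sin (x / 2)),
    sq_nonneg (Real.cos (N * x - x / 2) + Real.cos (x / 2))]

theorem integral_cos_int_mul (j : ℤ) :
    ∫ x in -Real.pi..Real.pi, Real.cos (j * x) = if j = 0 then 2 * Real.pi else 0 := by
  split_ifs with h
  · subst h
    simp
    ring
  · have hj : (j : ℝ) ≠ 0 := by exact_mod_cast h
    rw [intervalIntegral.integral_comp_mul_left (fun x => Real.cos x) hj, integral_cos, mul_neg,
      Real.sin_neg, Real.sin_int_mul_pi]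
    simp

theorem integral_sum_cos_mul_cos (K : ℕ) (κ : ℕ → ℝ) {k : ℕ} (hk : k ≤ K) :
    ∫ x in -Real.pi..Real.pi,
        (∑ l ∈ Finset.range (K + 1), κ l * Real.cos (l * x)) * Real.cos (k * x)
      = if k = 0 then 2 * Real.pi * κ 0 else Real.pi * κ k := by
  have e : ∀ x : ℝ, (∑ l ∈ Finset.range (K + 1), κ l * Real.cos (l * x)) * Real.cos (k * x)
      = ∑ l ∈ Finset.range (K + 1), κ l / 2 * (Real.cos (((l : ℤ) - k : ℤ) * x)
        + Real.cos (((l : ℤ) + k : ℤ) * x)) := by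
    intro x
    rw [Finset.sum_mul]
    refine Finset.sum_congr rfl fun l _ => ?_
    push_cast
    rw [sub_mul, add_mul, Real.cos_sub, Real.cos_add]
    ring
  simp only [e]
  have hc : ∀ j : ℤ, Continuous fun x : ℝ => Real.cos (j * x) := fun j => by fun_prop
  rw [intervalIntegral.integral_finsetSum fun l _ =>
    (Continuous.intervalIntegrable (by fun_prop) _ _)]
  have e2 : ∀ l ∈ Finset.range (K + 1), ∫ x in -Real.pi..Real.pi,
      κ l / 2 * (Real.cos (((l : ℤ) - k : ℤ) * x) + Real.cos (((l : ℤ) + k : ℤ) * x))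
      = if l = k then (if k = 0 then 2 * Real.pi * κ 0 else Real.pi * κ k) else 0 := by
    intro l _
    rw [intervalIntegral.integral_const_mul, intervalIntegral.integral_add
      ((hc _).intervalIntegrable _ _) ((hc _).intervalIntegrable _ _), integral_cos_int_mul,
      integral_cos_int_mul]
    by_cases hlk : l = k
    · subst hlk
      by_cases hl : l = 0
      · subst hl
        simp
        ring
      · have : (l : ℤ) + l ≠ 0 := by omega
        simp only [sub_self, if_true, this, if_false, hl]
        ring
    · have h1 : (l : ℤ) - k ≠ 0 := by omega
      have h2 : (l : ℤ) + k ≠ 0 := by omega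
      simp [h1, h2, hlk]
  rw [Finset.sum_congr rfl e2, Finset.sum_ite_eq', if_pos (Finset.mem_range.2 (by omega))]

/-- A nonnegative cosine polynomial with the value `1` at `0`: its mean is not small, and bounds its
other coefficients. -/
theorem cosPoly_coeff_bounds {K : ℕ} {κ : ℕ → ℝ} {f : ℝ → ℝ}
    (hκ : ∀ x, f x = ∑ k ∈ Finset.range (K + 1), κ k * Real.cos (k * x)) (hf : ∀ x, 0 ≤ f x)
    (hf0 : f 0 = 1) :
    (∀ k ≤ K, |κ k| ≤ 2 * κ 0) ∧ 1 ≤ (2 * K + 1) * κ 0 := by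
  have hπ := Real.pi_pos
  have hcont : Continuous f := by
    have : f = fun x => ∑ k ∈ Finset.range (K + 1), κ k * Real.cos (k * x) := funext hκ
    rw [this]
    fun_prop
  have hint : ∀ k ≤ K, ∫ x in -Real.pi..Real.pi, f x * Real.cos (k * x)
      = if k = 0 then 2 * Real.pi * κ 0 else Real.pi * κ k := by
    intro k hk
    rw [← integral_sum_cos_mul_cos K κ hk]
    simp only [hκ]
  have h0 : ∫ x in -Real.pi..Real.pi, f x = 2 * Real.pi * κ 0 := by
    simpa using hint 0 (Nat.zero_le _)
  have hκ0 : 0 ≤ κ 0 := by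
    have : 0 ≤ ∫ x in -Real.pi..Real.pi, f x :=
      intervalIntegral.integral_nonneg (by linarith) fun x _ => hf x
    rw [h0] at this
    nlinarith
  have hk : ∀ k ≤ K, |κ k| ≤ 2 * κ 0 := by
    intro k hk
    rcases eq_or_ne k 0 with rfl | hk0
    · rw [abs_of_nonneg hκ0]
      linarith
    have e := hint k hk
    rw [if_neg hk0] at e
    have i1 : IntervalIntegrable f MeasureTheory.volume (-Real.pi) Real.pi :=
      hcont.intervalIntegrable _ _
    have i2 : IntervalIntegrable (fun x => f x * Real.cos (k * x)) MeasureTheory.volume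
      (-Real.pi) Real.pi := Continuous.intervalIntegrable (by fun_prop) _ _
    have h1 : 0 ≤ ∫ x in -Real.pi..Real.pi, (f x - f x * Real.cos (k * x)) := by
      refine intervalIntegral.integral_nonneg (by linarith) fun x _ => ?_
      nlinarith [hf x, Real.cos_le_one (k * x)]
    have h2 : 0 ≤ ∫ x in -Real.pi..Real.pi, (f x + f x * Real.cos (k * x)) := by
      refine intervalIntegral.integral_nonneg (by linarith) fun x _ => ?_
      nlinarith [hf x, Real.neg_one_le_cos (k * x)]
    rw [intervalIntegral.integral_sub i1 i2, h0, e] at h1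
    rw [intervalIntegral.integral_add i1 i2, h0, e] at h2
    rw [abs_le]
    constructor <;> nlinarith
  refine ⟨hk, ?_⟩
  have h1 := hκ 0
  rw [hf0, Finset.sum_range_succ'] at h1
  simp only [mul_zero, Real.cos_zero, mul_one] at h1
  have h2 : ∑ k ∈ Finset.range K, κ (k + 1) ≤ ∑ k ∈ Finset.range K, 2 * κ 0 :=
    Finset.sum_le_sum fun k hk' => (le_abs_self _).trans
      (hk (k + 1) (Nat.succ_le_of_lt (Finset.mem_range.1 hk')))
  rw [Finset.sum_const, Finset.card_range, nsmul_eq_mul] at h2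
  linarith

theorem integral_cos_shift {k : ℕ} (hk : k ≠ 0) (θ θ₀ : ℝ) :
    ∫ s in -θ₀..θ₀, Real.cos (k * (θ - s)) = 2 * Real.sin (k * θ₀) / k * Real.cos (k * θ) := by
  have hk' : (k : ℝ) ≠ 0 := by exact_mod_cast hk
  rw [intervalIntegral.integral_comp_sub_left (fun s => Real.cos (k * s)) θ,
    intervalIntegral.integral_comp_mul_left (fun s => Real.cos s) hk', integral_cos,
    smul_eq_mul, show (k : ℝ) * (θ - -θ₀) = k * θ + k * θ₀ by ring,
    show (k : ℝ) * (θ - θ₀) = k * θ - k * θ₀ by ring, Real.sin_sub, Real.sin_add]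
  field_simp
  ring

/-- The convolution of the indicator function of `[-θ₀, θ₀]` with a power of the Fejér kernel. -/
theorem exists_cos_step {N m : ℕ} (hN : N ≠ 0) {Δ τ θ₀ : ℝ} (hΔ : 0 < Δ)
    (hΔ1 : Δ ≤ 1) (hτ : (1 / (N * (Δ / Real.pi)) ^ 2) ^ m * (2 * (m * N : ℕ) + 1) ≤ τ)
    (hθ₀ : 0 < θ₀) (hθ₀' : θ₀ ≤ Real.pi / 2) :
    ∃ c : ℕ → ℝ, c 0 = θ₀ / Real.pi ∧ (∀ k, k ≠ 0 → |c k| ≤ 1 / k) ∧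
      (∀ k : ℕ, k ≠ 0 → Real.sin (k * θ₀) = 0 → c k = 0) ∧ (∀ k, m * N < k → c k = 0) ∧
      ∀ θ, 0 ≤ θ → θ ≤ Real.pi →
        0 ≤ ∑ k ∈ Finset.range (m * N + 1), c k * Real.cos (k * θ) ∧
        ∑ k ∈ Finset.range (m * N + 1), c k * Real.cos (k * θ) ≤ 1 ∧
        (θ ≤ θ₀ - Δ → 1 - ∑ k ∈ Finset.range (m * N + 1), c k * Real.cos (k * θ) ≤ τ) ∧
        (θ₀ + Δ ≤ θ → ∑ k ∈ Finset.range (m * N + 1), c k * Real.cos (k * θ) ≤ τ) := by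
  have hπ := Real.pi_pos
  have hπ3 := Real.pi_gt_three
  set K := m * N with hK
  obtain ⟨κ, hκ⟩ := (isCosPoly_fejer N).pow m
  rw [← hK] at hκ
  set f : ℝ → ℝ := fun x => fejer N x ^ m with hf
  have hf0 : ∀ x, 0 ≤ f x := fun x => pow_nonneg (fejer_nonneg N x) m
  obtain ⟨hκk, hκ0⟩ := cosPoly_coeff_bounds (f := f) hκ hf0 (by simp [hf, fejer_zero hN])
  have hκpos : 0 < κ 0 := by
    by_contra h
    have : (2 * (K : ℝ) + 1) * κ 0 ≤ 0 :=
      mul_nonpos_of_nonneg_of_nonpos (by positivity) (not_lt.1 h)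
    linarith
  have hcont : Continuous f := by
    have : f = fun x => ∑ k ∈ Finset.range (K + 1), κ k * Real.cos (k * x) := funext hκ
    rw [this]
    fun_prop
  set c : ℕ → ℝ := fun k => if k = 0 then θ₀ / Real.pi else
    if k ≤ K then κ k * Real.sin (k * θ₀) / (Real.pi * κ 0 * k) else 0 with hc
  have hsum : ∀ θ, ∑ k ∈ Finset.range (K + 1), c k * Real.cos (k * θ)
      = (∫ s in -θ₀..θ₀, f (θ - s)) / (2 * Real.pi * κ 0) := by
    intro θ
    have e1 : ∫ s in -θ₀..θ₀, f (θ - s) = ∑ k ∈ Finset.range (K + 1),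
        κ k * ∫ s in -θ₀..θ₀, Real.cos (k * (θ - s)) := by
      simp only [hκ]
      rw [intervalIntegral.integral_finsetSum fun l _ =>
        (Continuous.intervalIntegrable (by fun_prop) _ _)]
      simp only [intervalIntegral.integral_const_mul]
    rw [e1, Finset.sum_div]
    refine Finset.sum_congr rfl fun k hk => ?_
    rcases eq_or_ne k 0 with rfl | hk0
    · simp only [hc, if_true, Nat.cast_zero, zero_mul, Real.cos_zero,
        intervalIntegral.integral_const, smul_eq_mul]
      field_simp
      ring
    · rw [integral_cos_shift hk0]
      have hkK : k ≤ K := Nat.lt_succ_iff.1 (Finset.mem_range.1 hk)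
      have hk' : (k : ℝ) ≠ 0 := by exact_mod_cast hk0
      simp only [hc, hk0, if_false, hkK, if_true]
      field_simp
  have hper : Function.Periodic f (2 * Real.pi) := by
    intro x
    simp only [hf, fejer]
    congr 2
    have h1 : ∀ j : ℕ, (j : ℝ) * (x + 2 * Real.pi) = j * x + j * (2 * Real.pi) := fun j => by ring
    simp only [h1, Real.cos_add_nat_mul_two_pi, Real.sin_add_nat_mul_two_pi]
  have htotal : ∀ a, ∫ s in a..a + 2 * Real.pi, f s = 2 * Real.pi * κ 0 := by
    intro a
    rw [hper.intervalIntegral_add_eq a (-Real.pi), show -Real.pi + 2 * Real.pi = Real.pi by ring]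
    have := integral_sum_cos_mul_cos K κ (Nat.zero_le K)
    simp only [Nat.cast_zero, zero_mul, Real.cos_zero, mul_one, if_true] at this
    rw [← this]
    simp only [hκ]
  have hii : ∀ a b, IntervalIntegrable f MeasureTheory.volume a b := fun a b =>
    hcont.intervalIntegrable a b
  have hsub : ∀ θ, ∫ s in -θ₀..θ₀, f (θ - s) = ∫ s in θ - θ₀..θ + θ₀, f s := by
    intro θ
    rw [intervalIntegral.integral_comp_sub_left f θ, sub_neg_eq_add]
  have hrest : ∀ θ, (∫ s in -θ₀..θ₀, f (θ - s)) + ∫ s in θ + θ₀..θ - θ₀ + 2 * Real.pi, f s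
      = 2 * Real.pi * κ 0 := by
    intro θ
    rw [hsub, intervalIntegral.integral_add_adjacent_intervals (hii _ _) (hii _ _), htotal]
  -- Off a neighbourhood of `0` of size `Δ`, the kernel is small.
  set q := (1 / (N * (Δ / Real.pi)) ^ 2) ^ m with hq
  have hsmall : ∀ x, Δ ≤ x → x ≤ 2 * Real.pi - Δ → f x ≤ q := by
    intro x h1 h2
    have hs : Δ / Real.pi ≤ Real.sin (x / 2) := by
      have key : ∀ y, Δ ≤ y → y ≤ Real.pi → Δ / Real.pi ≤ Real.sin (y / 2) := by
        intro y hy1 hy2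
        refine le_trans ?_ (Real.mul_le_sin (by linarith) (by linarith))
        rw [div_le_iff₀ hπ]
        field_simp
        linarith
      rcases le_total x Real.pi with h | h
      · exact key x h1 h
      · have := key (2 * Real.pi - x) (by linarith) (by linarith)
        rwa [show (2 * Real.pi - x) / 2 = Real.pi - x / 2 by ring, Real.sin_pi_sub] at this
    have hN0 : (0 : ℝ) < N := by exact_mod_cast Nat.pos_of_ne_zero hN
    have hpos : 0 < N * (Δ / Real.pi) := by positivity
    have h3 := fejer_mul_sin_sq_le hN x
    refine pow_le_pow_left₀ (fejer_nonneg N x) ?_ m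
    rw [le_div_iff₀ (by positivity)]
    refine le_trans (mul_le_mul_of_nonneg_left ?_ (fejer_nonneg N x)) h3
    gcongr
  have hq0 : 0 ≤ q := by positivity
  have htail : ∀ a b, a ≤ b → b - a ≤ 2 * Real.pi → Δ ≤ a → b ≤ 2 * Real.pi - Δ →
      (∫ s in a..b, f s) / (2 * Real.pi * κ 0) ≤ τ := by
    intro a b hab hab' ha hb
    have h1 : ∫ s in a..b, f s ≤ ∫ s in a..b, q :=
      intervalIntegral.integral_mono_on hab (hii _ _) (by simp)
        fun x hx => hsmall x (by linarith [hx.1]) (by linarith [hx.2])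
    rw [intervalIntegral.integral_const, smul_eq_mul] at h1
    have h2 : (b - a) * q ≤ 2 * Real.pi * q := by gcongr
    rw [div_le_iff₀ (by positivity)]
    have h3 : q ≤ q * ((2 * K + 1) * κ 0) := le_mul_of_one_le_right hq0 hκ0
    have h4 : q * ((2 * K + 1) * κ 0) ≤ τ * κ 0 := by
      rw [← mul_assoc]
      exact mul_le_mul_of_nonneg_right hτ hκpos.le
    have h5 : 2 * Real.pi * q ≤ 2 * Real.pi * (τ * κ 0) := by
      have := h3.trans h4
      gcongr
    calc ∫ s in a..b, f s ≤ 2 * Real.pi * (τ * κ 0) := by linarith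
      _ = _ := by ring
  refine ⟨c, by simp [hc], ?_, ?_, ?_, ?_⟩
  · intro k hk0
    have hkpos : (0 : ℝ) < k := by exact_mod_cast Nat.pos_of_ne_zero hk0
    simp only [hc, hk0, if_false]
    split_ifs with hkK
    · rw [abs_div, abs_mul, abs_of_pos (show 0 < Real.pi * κ 0 * k by positivity),
        div_le_div_iff₀ (by positivity) hkpos, one_mul]
      have h1 := hκk k hkK
      have h2 := Real.abs_sin_le_one (k * θ₀)
      have h3 : |κ k| * |Real.sin (k * θ₀)| ≤ 2 * κ 0 * 1 :=
        mul_le_mul h1 h2 (abs_nonneg _) (by positivity)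
      have h4 : 2 * κ 0 * 1 ≤ Real.pi * κ 0 := by nlinarith
      exact mul_le_mul_of_nonneg_right (h3.trans h4) hkpos.le
    · simp
  · intro k hk0 hs
    simp [hc, hk0, hs]
  · intro k hk
    have h1 : k ≠ 0 := by omega
    have h2 : ¬ k ≤ K := by omega
    simp [hc, h1, h2]
  · intro θ h0 hθπ
    have hD : 0 < 2 * Real.pi * κ 0 := by positivity
    have i1 : 0 ≤ ∫ s in -θ₀..θ₀, f (θ - s) :=
      intervalIntegral.integral_nonneg (by linarith) fun x _ => hf0 _
    have i2 : 0 ≤ ∫ s in θ + θ₀..θ - θ₀ + 2 * Real.pi, f s :=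
      intervalIntegral.integral_nonneg (by linarith) fun x _ => hf0 _
    have i3 := hrest θ
    rw [hsum]
    refine ⟨by positivity, ?_, ?_, ?_⟩
    · rw [div_le_one hD]
      linarith
    · intro h
      have e : 1 - (∫ s in -θ₀..θ₀, f (θ - s)) / (2 * Real.pi * κ 0)
          = (∫ s in θ + θ₀..θ - θ₀ + 2 * Real.pi, f s) / (2 * Real.pi * κ 0) := by
        rw [eq_div_iff hD.ne', sub_mul, div_mul_cancel₀ _ hD.ne']
        linarith
      rw [e]
      exact htail _ _ (by linarith) (by linarith) (by linarith) (by linarith)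
    · intro h
      rw [hsub]
      exact htail _ _ (by linarith) (by linarith) (by linarith) (by linarith)

/-- The parameters of the approximation of a step: degree and precision. -/
theorem exists_step_params {Δ τ : ℝ} (hΔ : 0 < Δ) (hΔ1 : Δ ≤ 1) (hτ : 0 < τ) (hτ1 : τ ≤ 1) :
    ∃ N m : ℕ, N ≠ 0 ∧ m ≠ 0 ∧
      (1 / (N * (Δ / Real.pi)) ^ 2) ^ m * (2 * (m * N : ℕ) + 1) ≤ τ ∧
      ((m * N : ℕ) : ℝ) ≤ 16 / Δ * Real.log (64 / (Δ * τ)) := by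
  have hπ := Real.pi_pos
  have hπ3 := Real.pi_gt_three
  have hπ4 := Real.pi_lt_d2
  set N := ⌈2 * Real.pi / Δ⌉₊ with hN
  have hN1 : 2 * Real.pi / Δ ≤ N := Nat.le_ceil _
  have hN2 : (N : ℝ) < 2 * Real.pi / Δ + 1 := Nat.ceil_lt_add_one (by positivity)
  have hN0 : (0 : ℝ) < N := lt_of_lt_of_le (by positivity) hN1
  have hN1' : (1 : ℝ) ≤ N := by
    have : 0 < N := by exact_mod_cast hN0
    exact_mod_cast this
  have hN8 : (N : ℝ) ≤ 8 / Δ := by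
    refine hN2.le.trans ?_
    rw [div_add_one hΔ.ne']
    gcongr
    linarith
  set m := Nat.clog 2 ⌈3 * N / τ⌉₊ with hm
  have hq : 3 ≤ 3 * N / τ := by
    rw [le_div_iff₀ hτ]
    nlinarith
  have hc2 : 1 < ⌈3 * N / τ⌉₊ := Nat.lt_ceil.2 (by push_cast; linarith)
  have hm0 : m ≠ 0 := (Nat.clog_pos (by norm_num) hc2).ne'
  have hm1 : 3 * N / τ ≤ 2 ^ m := by
    refine (Nat.le_ceil _).trans ?_
    have := Nat.le_pow_clog (b := 2) (by norm_num) ⌈3 * N / τ⌉₊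
    rw [hm]
    have h2 := (Nat.cast_le (α := ℝ)).2 this
    rwa [Nat.cast_pow, Nat.cast_ofNat] at h2
  have hm2 : (2 : ℝ) ^ m ≤ 64 / (Δ * τ) := by
    have h1 : 2 ^ (m - 1) < ⌈3 * N / τ⌉₊ := Nat.pow_pred_clog_lt_self (by norm_num) hc2
    have h2 : ((2 ^ (m - 1) : ℕ) : ℝ) < 3 * N / τ := by
      have := Nat.lt_ceil.1 h1
      exact this
    have h3 : (2 : ℝ) ^ m = 2 * (2 ^ (m - 1) : ℕ) := by
      push_cast
      rw [← pow_succ', Nat.sub_add_cancel (Nat.one_le_iff_ne_zero.2 hm0)]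
    rw [h3]
    have h4 : 2 * (3 * N / τ) ≤ 64 / (Δ * τ) := by
      rw [div_mul_eq_div_div, mul_div_assoc', div_le_div_iff_of_pos_right hτ]
      calc 2 * (3 * (N : ℝ)) ≤ 2 * (3 * (8 / Δ)) := by gcongr
        _ ≤ 64 / Δ := by
          rw [mul_div_assoc', mul_div_assoc']
          gcongr
          norm_num
    linarith
  refine ⟨N, m, by exact_mod_cast hN0.ne', hm0, ?_, ?_⟩
  · have h1 : (2 : ℝ) ≤ N * (Δ / Real.pi) := by
      rw [div_le_iff₀ hΔ] at hN1
      rw [mul_div_assoc', le_div_iff₀ hπ]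
      exact hN1
    have h2 : 1 / (N * (Δ / Real.pi)) ^ 2 ≤ 1 / 2 ^ 2 := by gcongr
    have h3 : (1 / (N * (Δ / Real.pi)) ^ 2) ^ m ≤ (1 / 2 ^ 2) ^ m := by gcongr
    have hmlt : (m : ℝ) ≤ 2 ^ m := by exact_mod_cast (Nat.lt_two_pow_self (n := m)).le
    have hmpos : (1 : ℝ) ≤ m := by exact_mod_cast Nat.one_le_iff_ne_zero.2 hm0
    have h4 : (2 * ((m * N : ℕ) : ℝ) + 1) ≤ 3 * N * 2 ^ m := by
      push_cast
      nlinarith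
    calc (1 / (N * (Δ / Real.pi)) ^ 2) ^ m * (2 * (m * N : ℕ) + 1)
        ≤ (1 / 2 ^ 2) ^ m * (3 * (N : ℝ) * 2 ^ m) := by gcongr
      _ = 3 * (N : ℝ) / 2 ^ m := by
        rw [div_pow, one_pow, ← pow_mul, mul_comm 2 m, pow_mul]
        field_simp
      _ ≤ τ := by
        rw [div_le_iff₀ (by positivity)]
        rw [div_le_iff₀ hτ] at hm1
        linarith
  · have hl2 : 1 / 2 ≤ Real.log 2 := by linarith [Real.log_two_gt_d9]
    have h1 : (m : ℝ) * Real.log 2 ≤ Real.log (64 / (Δ * τ)) := by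
      rw [← Real.log_pow]
      exact Real.log_le_log (by positivity) hm2
    have hm' : (0 : ℝ) ≤ m := by positivity
    have h2 : (m : ℝ) ≤ 2 * Real.log (64 / (Δ * τ)) := by nlinarith
    push_cast
    have h3 : 0 ≤ 2 * Real.log (64 / (Δ * τ)) := hm'.trans h2
    calc (m : ℝ) * N ≤ (2 * Real.log (64 / (Δ * τ))) * (8 / Δ) := by gcongr
      _ = _ := by ring

theorem sum_abs_le_of_le_inv {c : ℕ → ℝ} (h0 : |c 0| ≤ 1) (hc : ∀ k, k ≠ 0 → |c k| ≤ 1 / k)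
    (K : ℕ) : ∑ k ∈ Finset.range (K + 1), |c k| ≤ 2 + Real.log K := by
  rw [Finset.sum_range_succ']
  have h1 : ∑ k ∈ Finset.range K, |c (k + 1)| ≤ (harmonic K : ℝ) := by
    rw [harmonic]
    push_cast
    refine Finset.sum_le_sum fun k _ => ?_
    have := hc (k + 1) (Nat.succ_ne_zero k)
    push_cast at this
    rwa [one_div] at this
  have h2 := harmonic_le_one_add_log K
  linarith

/-- Cosine polynomials with values in `[0, 1]` that approximate the indicator function of `[-θ₀,
θ₀]` outside of windows of width `2 Δ` around the end points. The sum of the absolute values of the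
coefficients is logarithmic in the degree. The coefficients that vanish for the indicator function
vanish here, too; for `θ₀ = π / 2` only odd multiples of the angle remain besides the constant. -/
theorem exists_step {Δ τ θ₀ : ℝ} (hΔ : 0 < Δ) (hΔ1 : Δ ≤ 1) (hτ : 0 < τ) (hτ1 : τ ≤ 1)
    (hθ₀ : 0 < θ₀) (hθ₀' : θ₀ ≤ Real.pi / 2) :
    ∃ (K : ℕ) (c : ℕ → ℝ), K ≠ 0 ∧ (K : ℝ) ≤ 16 / Δ * Real.log (64 / (Δ * τ)) ∧
      c 0 = θ₀ / Real.pi ∧ ∑ k ∈ Finset.range (K + 1), |c k| ≤ 2 + Real.log K ∧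
      (∀ k : ℕ, k ≠ 0 → Real.sin (k * θ₀) = 0 → c k = 0) ∧ (∀ k, K < k → c k = 0) ∧
      ∀ θ, 0 ≤ θ → θ ≤ Real.pi →
        0 ≤ ∑ k ∈ Finset.range (K + 1), c k * Real.cos (k * θ) ∧
        ∑ k ∈ Finset.range (K + 1), c k * Real.cos (k * θ) ≤ 1 ∧
        (θ ≤ θ₀ - Δ → 1 - ∑ k ∈ Finset.range (K + 1), c k * Real.cos (k * θ) ≤ τ) ∧
        (θ₀ + Δ ≤ θ → ∑ k ∈ Finset.range (K + 1), c k * Real.cos (k * θ) ≤ τ) := by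
  obtain ⟨N, m, hN, hm, h1, h2⟩ := exists_step_params hΔ hΔ1 hτ hτ1
  obtain ⟨c, hc0, hc1, hc2, hc3, hc4⟩ := exists_cos_step hN hΔ hΔ1 h1 hθ₀ hθ₀'
  refine ⟨m * N, c, mul_ne_zero hm hN, h2, hc0, sum_abs_le_of_le_inv ?_ hc1 _, hc2, hc3, hc4⟩
  have hπ := Real.pi_pos
  rw [hc0, abs_of_pos (by positivity), div_le_one hπ]
  linarith

/-- Odd cosine polynomials that approximate the sign of `cos φ` away from `φ = π / 2`. -/
theorem exists_sign_poly {Δ τ : ℝ} (hΔ : 0 < Δ) (hΔ1 : Δ ≤ 1) (hτ : 0 < τ) (hτ1 : τ ≤ 1) :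
    ∃ (K : ℕ) (c : ℕ → ℝ), K ≠ 0 ∧ (K : ℝ) ≤ 16 / Δ * Real.log (64 / (Δ * τ)) ∧
      ∑ j ∈ Finset.range (K + 1), |c j| ≤ 2 * (2 + Real.log K) ∧
      ∀ φ, 0 ≤ φ → φ ≤ Real.pi / 2 →
        ∑ j ∈ Finset.range (K + 1), c j * Real.cos ((2 * j + 1) * φ) ≤ 1 ∧
        (φ ≤ Real.pi / 2 - Δ →
          1 - 2 * τ ≤ ∑ j ∈ Finset.range (K + 1), c j * Real.cos ((2 * j + 1) * φ)) := by
  have hπ := Real.pi_pos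
  obtain ⟨K, c, hK, h1, hc0, hc1, hc2, hc3, hc4⟩ :=
    exists_step (θ₀ := Real.pi / 2) hΔ hΔ1 hτ hτ1 (by positivity) le_rfl
  have split : ∀ (g : ℕ → ℝ) (J : ℕ), ∑ k ∈ Finset.range (2 * J), g k
      = ∑ j ∈ Finset.range J, (g (2 * j) + g (2 * j + 1)) := by
    intro g J
    induction J with
    | zero => simp
    | succ J ih =>
      rw [show 2 * (J + 1) = 2 * J + 1 + 1 by ring, Finset.sum_range_succ, Finset.sum_range_succ,
        ih, Finset.sum_range_succ, add_assoc]
  have ext : ∀ g : ℕ → ℝ, (∀ k, K < k → g k = 0) →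
      ∑ k ∈ Finset.range (K + 1), g k
        = ∑ j ∈ Finset.range (K + 1), (g (2 * j) + g (2 * j + 1)) := by
    intro g hg
    rw [← split]
    refine Finset.sum_subset (fun k hk => ?_) fun k _ hk => hg k ?_
    · rw [Finset.mem_range] at hk ⊢
      omega
    · rw [Finset.mem_range] at hk
      omega
  have even : ∀ j : ℕ, j ≠ 0 → c (2 * j) = 0 := by
    intro j hj
    refine hc2 _ (by omega) ?_
    push_cast
    rw [show 2 * (j : ℝ) * (Real.pi / 2) = j * Real.pi by ring, Real.sin_nat_mul_pi]
  refine ⟨K, fun j => 2 * c (2 * j + 1), hK, h1, ?_, fun φ h0 h0' => ?_⟩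
  · refine le_trans ?_ (mul_le_mul_of_nonneg_left hc1 zero_le_two)
    rw [ext (fun k => |c k|) fun k hk => by simp [hc3 k hk], Finset.mul_sum]
    refine Finset.sum_le_sum fun j _ => ?_
    rw [abs_mul, abs_two]
    linarith [abs_nonneg (c (2 * j))]
  · have e : ∑ k ∈ Finset.range (K + 1), c k * Real.cos (k * φ) = 1 / 2 +
        (∑ j ∈ Finset.range (K + 1), 2 * c (2 * j + 1) * Real.cos ((2 * j + 1) * φ)) / 2 := by
      rw [ext (fun k => c k * Real.cos (k * φ)) fun k hk => by simp [hc3 k hk],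
        Finset.sum_add_distrib, Finset.sum_div]
      congr 1
      · rw [Finset.sum_eq_single 0]
        · simp [hc0]
          field_simp
        · intro j _ hj
          rw [even j hj, zero_mul]
        · simp
      · refine Finset.sum_congr rfl fun j _ => ?_
        push_cast
        ring
    obtain ⟨a1, a2, a3, a4⟩ := hc4 φ h0 (by linarith)
    rw [e] at a1 a2 a3
    refine ⟨by linarith, fun h => ?_⟩
    have := a3 h
    linarith

end Step

/-! ### Conjugation by classical circuits, copies, relabelling -/

section Gadgets

variable {W : Type} [Fintype W] [DecidableEq W] {Vr Vn : Type}

/-- `mid` conjugated by `c`. -/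
def conjC (c mid : QCircuit Vr Vn W) : QCircuit Vr Vn W := c ++ (mid ++ cInv c)

theorem time_conjC (T : ℝ) (c mid : QCircuit Vr Vn W) :
    QCircuit.time T (conjC c mid) = 2 * QCircuit.time T c + QCircuit.time T mid := by
  simp only [conjC, time_append, time_cInv]
  ring

theorem Avoids.conjC {c mid : QCircuit Vr Vn W} {V : Set W} (hc : Avoids c V) (hm : Avoids mid V) :
    Avoids (conjC c mid) V := hc.append (hm.append hc.cInv)

/-- The circuit that adds `g (x (a i)) (x (b i))` to the bit on the wire `t i`, for every `i` in the
list. -/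
def copyC {ι : Type} (l : List ι) (a b t : ι → W) (g : Bool → Bool → Bool) : QCircuit Vr Vn W :=
  l.flatMap fun i => xg (a i) (b i) (t i) g

theorem time_copyC_le (T : ℝ) {ι : Type} (l : List ι) (a b t : ι → W) (g : Bool → Bool → Bool) :
    QCircuit.time T (copyC l a b t g : QCircuit Vr Vn W) ≤ l.length := by
  induction l with
  | nil => simp [copyC, QCircuit.time]
  | cons i l ih =>
    have h := time_cg_le (Vr := Vr) (Vn := Vn) T (a i) (b i) (t i) (fun u v => notGate (g u v))
    simp only [copyC, List.flatMap_cons, time_append, List.length_cons, Nat.cast_add,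
      Nat.cast_one, xg] at ih h ⊢
    linarith

theorem copyC_avoids {ι : Type} {l : List ι} {a b t : ι → W} {g : Bool → Bool → Bool} {V : Set W}
    (ha : ∀ i, a i ∉ V) (hb : ∀ i, b i ∉ V) (ht : ∀ i, t i ∉ V) :
    Avoids (copyC l a b t g : QCircuit Vr Vn W) V :=
  Avoids.flatMap fun i _ => cg_avoids (ha i) (hb i) (ht i)

variable [Fintype Vr] [DecidableEq Vr] [Fintype Vn] [DecidableEq Vn]

theorem Local.copyC {R : QUnitary Vr} {N : QUnitary Vn} {ι : Type} {l : List ι} {a b t : ι → W}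
    {g : Bool → Bool → Bool} {M : Set W} (ht : ∀ i, t i ∈ M) : Local R N (copyC l a b t g) M :=
  Local.flatMap fun i _ => Local.cg (ht i)

variable (R : QUnitary Vr) (N : QUnitary Vn)

theorem cOp_copyC_list {ι : Type} [DecidableEq ι] {l : List ι} (hl : l.Nodup) {a b t : ι → W}
    (ht : Function.Injective t) (h : ∀ i, a i ≠ b i ∧ ∀ j, a i ≠ t j ∧ b i ≠ t j)
    (g : Bool → Bool → Bool) (x : W → Bool) :
    cOp R N (copyC l a b t g) (ket x) = ket (Function.extend t
      (fun i => if i ∈ l then xor (x (t i)) (g (x (a i)) (x (b i))) else x (t i)) x) := by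
  induction l generalizing x with
  | nil =>
    have := extend_restrict ⟨t, ht⟩ x
    simp only [Function.Embedding.coeFn_mk] at this
    simp [copyC, this]
  | cons i l ih =>
    obtain ⟨hi, hl⟩ := List.nodup_cons.1 hl
    have e : copyC (i :: l) a b t g = (xg (a i) (b i) (t i) g ++ copyC l a b t g :
      QCircuit Vr Vn W) := rfl
    rw [e, cOp_append, cOp_xg_ket R N ⟨(h i).1, ((h i).2 i).1, ((h i).2 i).2⟩, ih hl]
    congr 1
    funext w
    by_cases hw : ∃ j, t j = w
    · obtain ⟨j, rfl⟩ := hw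
      rw [ht.extend_apply, ht.extend_apply]
      have ea : Function.update x (t i) (xor (x (t i)) (g (x (a i)) (x (b i)))) (a j) = x (a j) :=
        Function.update_of_ne ((h j).2 i).1 _ _
      have eb : Function.update x (t i) (xor (x (t i)) (g (x (a i)) (x (b i)))) (b j) = x (b j) :=
        Function.update_of_ne ((h j).2 i).2 _ _
      rw [ea, eb]
      by_cases hji : j = i
      · subst hji
        simp [hi]
      · rw [Function.update_of_ne (fun e => hji (ht e))]
        simp [hji]
    · rw [Function.extend_apply' _ _ _ hw, Function.extend_apply' _ _ _ hw,
        Function.update_of_ne fun e => hw ⟨i, e.symm⟩]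

theorem cOp_copyC {ι : Type} [DecidableEq ι] {l : List ι} (hl : l.Nodup) (hl' : ∀ i, i ∈ l)
    {a b t : ι → W} (ht : Function.Injective t) (h : ∀ i, a i ≠ b i ∧ ∀ j, a i ≠ t j ∧ b i ≠ t j)
    (g : Bool → Bool → Bool) (x : W → Bool) :
    cOp R N (copyC l a b t g) (ket x) = ket (Function.extend t
      (fun i => xor (x (t i)) (g (x (a i)) (x (b i)))) x) := by
  rw [cOp_copyC_list R N hl ht h]
  simp only [hl', if_true]

variable {R N}

/-- The action of `mid`, conjugated by a circuit `c` that acts classically. -/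
theorem cOp_conjC {c mid : QCircuit Vr Vn W} {M : Set W} {x x' : W → Bool} (hc : Avoids c M)
    (hx : cOp R N c (ket x) = ket x') (hm : Pres R N mid M x') {ψ : QState W} (hψ : ψ ∈ Agr M x) :
    cOp R N (conjC c mid) ψ = flipOp (fun w => xor (x w) (x' w))
      (cOp R N mid (flipOp (fun w => xor (x w) (x' w)) ψ)) := by
  have hx' : cOp R N (cInv c) (ket x') = ket x := by rw [← hx, cOp_cInv_cOp]
  rw [conjC, cOp_append, cOp_append, cOp_transfer hc hx hψ,
    cOp_transfer hc.cInv hx' (hm _ (Agr_flip hψ))]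
  congr 2
  funext w
  rw [Bool.xor_comm]

theorem Pres.conjC {c mid : QCircuit Vr Vn W} {M : Set W} {x x' : W → Bool} (hc : Avoids c M)
    (hx : cOp R N c (ket x) = ket x') (hm : Pres R N mid M x') : Pres R N (conjC c mid) M x := by
  intro ψ hψ
  rw [cOp_conjC hc hx hm hψ]
  have := Agr_flip (x := x') (x' := x) (hm _ (Agr_flip hψ))
  convert this using 3
  funext w
  rw [Bool.xor_comm]

/-- It suffices to check on basis states that a circuit preserves `Agr M x`. -/
theorem Pres.of_ket {c : QCircuit Vr Vn W} {M : Set W} {x : W → Bool}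
    (h : ∀ z, (∀ w, w ∉ M → z w = x w) → cOp R N c (ket z) ∈ Agr M z) : Pres R N c M x := by
  have : Agr M x ≤ (Agr M x).comap (cOp R N c).toLinearEquiv.toLinearMap := by
    refine Supp_le fun z hz => ?_
    change cOp R N c (ket z) ∈ Agr M x
    rw [← Agr_congr (x := z) hz]
    exact h z hz
  exact fun ψ hψ => this hψ

variable (R N)

theorem applyOn_ket_sum {V κ : Type} [Fintype V] [DecidableEq V] [Fintype κ] (e : V ↪ W)
    (U : QUnitary V) (x : W → Bool) {a : κ → ℂ} {y : κ → V → Bool}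
    (h : U (ket fun v => x (e v)) = ∑ j, a j • ket (y j)) :
    applyOn e U (ket x) = ∑ j, a j • ket (Function.extend e (y j) x) := by
  rw [applyOn_ket, h]
  simp only [WithLp.ofLp_sum, WithLp.ofLp_smul, Finset.sum_apply, Pi.smul_apply, ket_apply,
    smul_eq_mul, mul_ite, mul_one, mul_zero, Finset.sum_smul, ite_smul, zero_smul]
  rw [Finset.sum_comm]
  simp

theorem applyOn_ket_ket {V : Type} [Fintype V] [DecidableEq V] (e : V ↪ W)
    (U : QUnitary V) (x : W → Bool) {y : V → Bool} (h : U (ket fun v => x (e v)) = ket y) :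
    applyOn e U (ket x) = ket (Function.extend e y x) := by
  have := applyOn_ket_sum (κ := Unit) e U x (a := fun _ => 1) (y := fun _ => y) (by simpa using h)
  simpa using this

end Gadgets

section Relabel

variable {W W' : Type} [Fintype W] [DecidableEq W] [Fintype W'] [DecidableEq W'] {Vr Vn : Type}

/-- A gate on renamed wires. -/
def relabelGate (σ : W ≃ W') : QGate Vr Vn W → QGate Vr Vn W'
  | .elementary k hk U e => .elementary k hk U (e.trans σ.toEmbedding)
  | .rowCall inv e => .rowCall inv (e.trans σ.toEmbedding)
  | .normCall inv e => .normCall inv (e.trans σ.toEmbedding)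

/-- A circuit on renamed wires. -/
def relabelC (σ : W ≃ W') (c : QCircuit Vr Vn W) : QCircuit Vr Vn W' := c.map (relabelGate σ)

theorem time_relabelC (σ : W ≃ W') (T : ℝ) (c : QCircuit Vr Vn W) :
    QCircuit.time T (relabelC σ c) = QCircuit.time T c := by
  have : ∀ g : QGate Vr Vn W, QGate.time T (relabelGate σ g) = QGate.time T g := by
    intro g
    cases g <;> rfl
  simp [QCircuit.time, relabelC, Function.comp_def, this]

/-- Renaming the qubits of a state. -/
def relabelOp (σ : W ≃ W') : QState W ≃ₗᵢ[ℂ] QState W' :=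
  LinearIsometryEquiv.piLpCongrLeft 2 ℂ ℂ (σ.arrowCongr (Equiv.refl Bool))

theorem relabelOp_apply (σ : W ≃ W') (ψ : QState W) (x : W' → Bool) :
    relabelOp σ ψ x = ψ (fun w => x (σ w)) := rfl

theorem relabelOp_ket (σ : W ≃ W') (x : W → Bool) :
    relabelOp σ (ket x) = ket fun w => x (σ.symm w) := by
  ext z
  simp only [relabelOp_apply, ket_apply]
  congr 1
  rw [eq_iff_iff]
  constructor
  · rintro rfl
    simp
  · rintro rfl
    simp

theorem applyOn_relabelOp {V : Type} [Fintype V] [DecidableEq V] (σ : W ≃ W') (e : V ↪ W)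
    (U : QUnitary V) (ψ : QState W) :
    applyOn (e.trans σ.toEmbedding) U (relabelOp σ ψ) = relabelOp σ (applyOn e U ψ) := by
  ext x
  simp only [applyOn_apply, relabelOp_apply]
  have h : ∀ y : V → Bool, (fun w => Function.extend (e.trans σ.toEmbedding) y x (σ w))
      = Function.extend e y fun w => x (σ w) := by
    intro y
    funext w
    by_cases hw : ∃ v, e v = w
    · obtain ⟨v, rfl⟩ := hw
      rw [e.injective.extend_apply]
      exact (e.trans σ.toEmbedding).injective.extend_apply y x v
    · rw [Function.extend_apply' _ _ _ hw, Function.extend_apply']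
      rintro ⟨v, hv⟩
      exact hw ⟨v, σ.injective hv⟩
  simp only [h]
  rfl

variable [Fintype Vr] [DecidableEq Vr] [Fintype Vn] [DecidableEq Vn]
  (R : QUnitary Vr) (N : QUnitary Vn)

theorem cOp_relabelC (σ : W ≃ W') (c : QCircuit Vr Vn W) (ψ : QState W) :
    cOp R N (relabelC σ c) (relabelOp σ ψ) = relabelOp σ (cOp R N c ψ) := by
  induction c generalizing ψ with
  | nil => rfl
  | cons g c ih =>
    have e : relabelC σ (g :: c) = relabelGate σ g :: relabelC σ c := rfl
    rw [e, cOp_cons, cOp_cons, ← ih]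
    congr 1
    cases g <;> exact applyOn_relabelOp σ _ _ _

end Relabel

/-! ### Polynomials of the Grover iterate -/

section Lcu

variable {W : Type} [Fintype W] [DecidableEq W] {Vr Vn : Type}

/-- The circuit that acts on the state prepared by `E` as `x + s y ∑ₖ c k Tᵏ`, where `T` is the
Grover iterate and `(x, y)` are weights that depend on the bits on the wires `d` and `k`, up to
states in which some of the qubits `u`, `us` are nonzero. -/
def lcuC (sc : ℕ → W) (dm : W) (E : QCircuit Vr Vn W) (l₀ l₁ : List W) (d k : W)
    (xy : Bool → Bool → ℝ × ℝ) (u : W) (us : List W) (s : ℝ) (K : ℕ) (c : ℕ → ℝ) :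
    QCircuit Vr Vn W :=
  stepC d k u xy (chainC (groverC sc dm E l₀ l₁ and) u
    (List.zipWith (fun u p => (u, d, fun _ => p)) us
      (hornerWeights s ((List.range (K + 1)).map c))))

theorem time_lcuC_le (T : ℝ) (hT : 0 ≤ T) (sc : ℕ → W) (dm : W) (E : QCircuit Vr Vn W)
    (l₀ l₁ : List W) (d k : W) (xy : Bool → Bool → ℝ × ℝ) (u : W) (us : List W) (s : ℝ) (K : ℕ)
    (c : ℕ → ℝ) :
    QCircuit.time T (lcuC sc dm E l₀ l₁ d k xy u us s K c) ≤ 2 + (K + 2) *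
      (4 + 2 * QCircuit.time T E + 6 * (l₀.length + l₁.length)) := by
  have hE : 0 ≤ QCircuit.time T E := by
    refine List.sum_nonneg ?_
    intro a ha
    obtain ⟨g, -, rfl⟩ := List.mem_map.1 ha
    cases g <;> simp [QGate.time, hT]
  refine (time_stepC_le T d k u xy _).trans ?_
  refine add_le_add_right ?_ _
  refine (time_chainC_le T (τ := 2 * QCircuit.time T E + 6 * (l₀.length + l₁.length) + 2)
    (fun u => time_groverC_le T sc dm E l₀ l₁ and u) u _).trans ?_
  have h1 : (((List.zipWith (fun u p => (u, d, fun _ => p)) us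
      (hornerWeights s ((List.range (K + 1)).map c)) : List (Link W)).length : ℕ) : ℝ) ≤ K + 2 := by
    have : (List.zipWith (fun u p => (u, d, fun _ => p)) us
      (hornerWeights s ((List.range (K + 1)).map c)) : List (Link W)).length ≤ K + 2 := by
      rw [List.length_zipWith, length_hornerWeights, List.length_map, List.length_range]
      exact min_le_right _ _
    exact_mod_cast this
  calc _ ≤ ((K : ℝ) + 2) * (2 + (2 * QCircuit.time T E + 6 * (l₀.length + l₁.length) + 2)) := by
        gcongr
    _ = _ := by ring

theorem mem_zipWith_link {us : List W} {d : W} {l : List (ℝ × ℝ)} {p : Link W}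
    (hp : p ∈ List.zipWith (fun u p => ((u, d, fun _ => p) : Link W)) us l) :
    p.1 ∈ us ∧ p.2.1 = d ∧ ∃ q ∈ l, ∀ b, p.2.2 b = q := by
  rw [← List.map_uncurry_zip_eq_zipWith, List.mem_map] at hp
  obtain ⟨⟨u, q⟩, h, rfl⟩ := hp
  exact ⟨(List.of_mem_zip h).1, rfl, q, (List.of_mem_zip h).2, fun _ => rfl⟩

theorem map_fst_zipWith_link {us : List W} {d : W} {l : List (ℝ × ℝ)} (h : us.length = l.length) :
    (List.zipWith (fun u p => ((u, d, fun _ => p) : Link W)) us l).map Prod.fst = us := by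
  induction us generalizing l with
  | nil => simp
  | cons a us ih =>
    obtain ⟨b, l, rfl⟩ := List.exists_cons_of_length_eq_add_one h.symm
    simp only [List.zipWith_cons_cons, List.map_cons]
    rw [ih (by simpa using h)]

theorem lcuC_avoids {sc : ℕ → W} {dm : W} {E : QCircuit Vr Vn W}
    {l₀ l₁ : List W} {d k : W} {xy : Bool → Bool → ℝ × ℝ} {u : W} {us : List W} {s : ℝ} {K : ℕ}
    {c : ℕ → ℝ} {V : Set W} (hsc : ∀ k, sc k ∉ V) (hdm : dm ∉ V) (hE : Avoids E V)
    (h₀ : ∀ w ∈ l₀, w ∉ V) (h₁ : ∀ w ∈ l₁, w ∉ V) (hd : d ∉ V) (hk : k ∉ V) (hu : u ∉ V)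
    (hus : ∀ w ∈ us, w ∉ V) : Avoids (lcuC sc dm E l₀ l₁ d k xy u us s K c) V := by
  refine Avoids.stepC hd hk hu (Avoids.chainC _ hu (fun p hp => ?_) fun p hp => ?_)
  · obtain ⟨h1, h2, -⟩ := mem_zipWith_link hp
    exact ⟨hus _ h1, by rwa [h2]⟩
  · exact groverC_avoids hsc hE hdm (hus _ (mem_zipWith_link hp).1) h₀ h₁ _

variable [Fintype Vr] [DecidableEq Vr] [Fintype Vn] [DecidableEq Vn]
variable {R : QUnitary Vr} {N : QUnitary Vn} {sc : ℕ → W} {S : ℕ} {dm : W} {E : QCircuit Vr Vn W}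
  {l₀ l₁ : List W} {M V : Set W} {x : W → Bool}

/-- The hypotheses on the wires of `lcuC`: the qubits in `V` are not used by `E`, which changes only
the qubits in `M`. -/
structure LcuWires (R : QUnitary Vr) (N : QUnitary Vn) (sc : ℕ → W) (S : ℕ) (dm : W)
    (E : QCircuit Vr Vn W) (l₀ l₁ : List W) (d k u : W) (us : List W) (M V : Set W)
    (x : W → Bool) : Prop where
  grover : GroverWires sc S dm l₀ l₁ (M ∪ V) x
  pres : Pres R N E M x
  avoids : Avoids E V
  dummy : dm ∉ V
  list₀ : ∀ w, w ∈ l₀ ↔ w ∈ M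
  list₁ : ∀ w ∈ l₁, w ∈ M
  disj : ∀ w ∈ M, w ∉ V
  mem : ∀ w, w ∈ u :: us ↔ w ∈ V
  nodup : (u :: us).Nodup
  ne : d ≠ k
  fst : d ∉ M ∪ V
  snd : k ∉ M ∪ V
  zero : ∀ w ∈ M ∪ V, x w = false

variable {d k u : W} {us : List W}

theorem Pres.lcuC (h : LcuWires R N sc S dm E l₀ l₁ d k u us M V x) (xy : Bool → Bool → ℝ × ℝ)
    (s : ℝ) (K : ℕ) (c : ℕ → ℝ) :
    Pres R N (lcuC sc dm E l₀ l₁ d k xy u us s K c) (M ∪ V) x := by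
  have hV : ∀ w ∈ V, w ≠ dm ∧ ∀ k ≤ S, w ≠ sc k := fun w hw =>
    ⟨fun e => h.dummy (e ▸ hw), fun k hk e => (h.grover.scratch k hk).1 (Or.inr (e ▸ hw))⟩
  refine Pres.stepC (Or.inr ((h.mem u).1 (by simp))) (Pres.chainC _ _ (fun p hp => ?_) fun p hp =>
      ?_)
  · exact Or.inr ((h.mem _).1 (List.mem_cons_of_mem _ (mem_zipWith_link hp).1))
  · have := hV _ ((h.mem _).1 (List.mem_cons_of_mem _ (mem_zipWith_link hp).1))
    exact Pres.groverC h.grover (h.pres.union h.avoids) this.1 this.2 _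

theorem cOp_lcuC (h : LcuWires R N sc S dm E l₀ l₁ d k u us M V x) {xy : Bool → Bool → ℝ × ℝ}
    {s : ℝ} {K : ℕ} {c : ℕ → ℝ} (hlen : us.length = K + 2)
    (hxy : |(xy (x d) (x k)).1| + |(xy (x d) (x k)).2| ≤ 1)
    (hs : |s| * ∑ k ∈ Finset.range (K + 1), |c k| ≤ 1) :
    ∃ r ∈ Supp (fun z : W → Bool => ∃ w ∈ V, z w = true),
      cOp R N (lcuC sc dm E l₀ l₁ d k xy u us s K c) (cOp R N E (ket x))
        = ((xy (x d) (x k)).1 : ℂ) • cOp R N E (ket x) + ((xy (x d) (x k)).2 : ℂ) • (s : ℂ) •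
          ∑ k ∈ Finset.range (K + 1), (c k : ℂ) • (groverOp R N E l₀ l₁ ^ k) (cOp R N E (ket x))
          + r := by
  have hs' : |s| * (((List.range (K + 1)).map c).map abs).sum ≤ 1 := by
    rw [List.map_map, ← List.sum_toFinset _ List.nodup_range, List.toFinset_range]
    exact hs
  have hctrl := isControlled_groverC h.grover (h.pres.union h.avoids) (Set.subset_union_right)
    h.avoids h.dummy (fun w hw => h.disj w ((h.list₀ w).1 hw)) fun w hw => h.disj w (h.list₁ w hw)
  have hψ : cOp R N E (ket x) ∈ Agr (M ∪ V) x :=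
    Agr_mono Set.subset_union_left x (h.pres _ (ket_mem_Agr M x))
  have hz : ∀ w ∈ V, cOp R N E (ket x) ∈ Supp fun z : W → Bool => z w = false := fun w hw =>
    h.avoids.supp (fun y z hyz hy => by rw [hyz w hw, hy]) (ket_mem_Supp (h.zero w (Or.inr hw)))
  have hlen' : us.length = ((List.range (K + 1)).map c).length + 1 := by simp [hlen]
  obtain ⟨r, hr, e⟩ := cOp_stepC_chainC (R := R) (N := N) hctrl
    (List.zipWith (fun u p => ((u, d, fun _ => p) : Link W)) us
      (hornerWeights s ((List.range (K + 1)).map c)))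
    h.ne h.fst h.snd ((h.mem u).1 (by simp))
    (fun p hp => by
      obtain ⟨h1, h2, -⟩ := mem_zipWith_link hp
      exact ⟨(h.mem _).1 (List.mem_cons_of_mem _ h1), by rw [h2]; exact h.fst⟩)
    (by
      rw [map_fst_zipWith_link (by rw [length_hornerWeights, hlen'])]
      exact h.nodup)
    (fun p hp => by
      obtain ⟨-, -, q, hq, h2⟩ := mem_zipWith_link hp
      rw [h2]
      exact abs_hornerWeights_le hs' q hq)
    (xy := xy) hxy hψ
    (fun p hp => hz _ ((h.mem _).1 (List.mem_cons_of_mem _ (mem_zipWith_link hp).1)))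
    (hz _ ((h.mem u).1 (by simp)))
  refine ⟨r, Supp_mono ?_ hr, ?_⟩
  · rintro z (hz | ⟨p, hp, hz⟩)
    · exact ⟨u, (h.mem u).1 (by simp), hz⟩
    · exact ⟨p.1, (h.mem _).1 (List.mem_cons_of_mem _ (mem_zipWith_link hp).1), hz⟩
  · rw [lcuC, e, hornerOp_hornerWeights x _ d hs' hlen', LinearMap.smul_apply, polyOp_apply,
      List.length_map, List.length_range]
    congr 4
    refine Finset.sum_congr rfl fun k hk => ?_
    rw [List.getD_eq_getElem _ _ (by simpa using hk)]
    simp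

/-- The overlap of the state prepared by `E` with the state that `lcuC` makes of it. -/
theorem inner_cOp_lcuC (h : LcuWires R N sc S dm E l₀ l₁ d k u us M V x)
    {xy : Bool → Bool → ℝ × ℝ} {s : ℝ} {K : ℕ} {c : ℕ → ℝ} (hlen : us.length = K + 2)
    (hxy : |(xy (x d) (x k)).1| + |(xy (x d) (x k)).2| ≤ 1)
    (hs : |s| * ∑ k ∈ Finset.range (K + 1), |c k| ≤ 1) {θ : ℝ}
    (hθ : Real.cos θ = groverCos R N E l₁ x) :
    inner ℂ (cOp R N E (ket x))
      (cOp R N (lcuC sc dm E l₀ l₁ d k xy u us s K c) (cOp R N E (ket x)))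
      = (((xy (x d) (x k)).1 + (xy (x d) (x k)).2 *
        (s * ∑ k ∈ Finset.range (K + 1), c k * Real.cos (k * θ)) : ℝ) : ℂ) := by
  obtain ⟨r, hr, e⟩ := cOp_lcuC h hlen hxy hs
  have hr0 : inner ℂ (cOp R N E (ket x)) r = 0 := by
    rw [PiLp.inner_apply]
    refine Finset.sum_eq_zero fun z _ => ?_
    by_cases hz : r z = 0
    · simp [hz]
    · obtain ⟨w, hw, hzw⟩ := hr z hz
      have h0 : cOp R N E (ket x) z = 0 := by
        by_contra h0
        have := h.avoids.supp (P := fun z => z w = false) (fun y z hyz hy => by rw [hyz w hw, hy])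
          (ket_mem_Supp (h.zero w (Or.inr hw))) z h0
        exact absurd (hzw.symm.trans this) (by simp)
      simp [h0]
  rw [e, inner_add_right, inner_add_right, inner_smul_right, inner_smul_right, inner_smul_right,
    inner_sum, hr0, inner_self_eq_norm_sq_to_K, LinearIsometryEquiv.norm_map, norm_ket]
  simp only [inner_smul_right, inner_groverOp_pow h.pres h.list₀
    (fun w hw => h.zero w (Or.inl hw)) hθ]
  push_cast
  simp

/-- If the weights are `(0, 1)`, the part of the resulting state with zeros on `V` and `l₁` is the
corresponding part of the state prepared by `E`, multiplied by a number. -/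
theorem projOp_cOp_lcuC (h : LcuWires R N sc S dm E l₀ l₁ d k u us M V x) {s : ℝ} {K : ℕ}
    {c : ℕ → ℝ} (hlen : us.length = K + 2) (hs : |s| * ∑ k ∈ Finset.range (K + 1), |c k| ≤ 1)
    {α : ℝ} {g : QState W} (hα : projOp l₁ (cOp R N E (ket x)) = (α : ℂ) • g) (hα0 : 0 < α)
    (hα1 : α ≤ 1) (hg : ‖g‖ = 1) :
    projOp (l₁ ++ u :: us)
      (cOp R N (E ++ lcuC sc dm E l₀ l₁ d k (fun _ _ => (0, 1)) u us s K c) (ket x))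
      = ((s * ∑ j ∈ Finset.range (K + 1), c j * Real.cos ((2 * j + 1) * Real.arccos α) : ℝ) : ℂ)
        • g := by
  obtain ⟨r, hr, e⟩ := cOp_lcuC h (xy := fun _ _ => (0, 1)) hlen (by simp) hs
  have hφ : Real.cos (Real.arccos α) = ‖projOp l₁ (cOp R N E (ket x))‖ := by
    rw [Real.cos_arccos (by linarith) hα1, hα, norm_smul, hg, mul_one, Complex.norm_real,
      Real.norm_eq_abs, abs_of_pos hα0]
  have hαc : (α : ℂ) ≠ 0 := by exact_mod_cast hα0.ne'
  have hpow : ∀ j : ℕ, projOp l₁ ((groverOp R N E l₀ l₁ ^ j) (cOp R N E (ket x)))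
      = (Real.cos ((2 * j + 1) * Real.arccos α) : ℂ) • g := by
    intro j
    have := projOp_groverOp_pow h.pres h.list₀ (fun w hw => h.zero w (Or.inl hw)) hφ j
    rw [hα, smul_comm, Real.cos_arccos (by linarith) hα1] at this
    exact smul_right_injective _ hαc this
  have hAgr : ∀ ψ : QState W, (∀ w ∈ V, ψ ∈ Supp fun z : W → Bool => z w = false) →
      projOp (l₁ ++ u :: us) ψ = projOp l₁ ψ := by
    intro ψ hψ
    ext z
    simp only [projOp_apply, List.any_append]
    by_cases hz : ψ z = 0
    · simp [hz]
    · have : (u :: us).any z = false := by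
        rw [List.any_eq_false]
        intro w hw
        simp [hψ w ((h.mem w).1 hw) z hz]
      rw [this, Bool.or_false]
  have hr0 : projOp (l₁ ++ u :: us) r = 0 := by
    ext z
    simp only [projOp_apply, List.any_append]
    by_cases hz : r z = 0
    · simp [hz]
    · obtain ⟨w, hw, hzw⟩ := hr z hz
      have : (u :: us).any z = true := List.any_eq_true.2 ⟨w, (h.mem w).2 hw, hzw⟩
      simp [this]
  have hctrl := isControlled_groverC h.grover (h.pres.union h.avoids) (Set.subset_union_right)
    h.avoids h.dummy (fun w hw => h.disj w ((h.list₀ w).1 hw)) fun w hw => h.disj w (h.list₁ w hw)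
  have hψ : cOp R N E (ket x) ∈ Agr (M ∪ V) x :=
    Agr_mono Set.subset_union_left x (h.pres _ (ket_mem_Agr M x))
  have hz : ∀ j : ℕ, ∀ w ∈ V, (groverOp R N E l₀ l₁ ^ j) (cOp R N E (ket x)) ∈
      Agr (M ∪ V) x ⊓ Supp fun z : W → Bool => z w = false := by
    intro j w hw
    induction j with
    | zero =>
      exact ⟨hψ, h.avoids.supp (fun y z hyz hy => by rw [hyz w hw, hy])
        (ket_mem_Supp (h.zero w (Or.inr hw)))⟩
    | succ j ih =>
      rw [pow_succ', Module.End.mul_apply]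
      exact ⟨hctrl.pres _ ih.1, hctrl.supp w hw _ _ ih.1 ih.2⟩
  rw [cOp_append, e]
  simp only [Complex.ofReal_zero, zero_smul, zero_add, Complex.ofReal_one, one_smul, map_add,
    map_smul, map_sum, hr0, add_zero]
  simp only [hAgr _ fun w hw => (hz _ w hw).2, hpow, smul_smul, ← Finset.sum_smul]
  push_cast
  rfl

end Lcu

/-! ### Amplification of an unknown amplitude -/

section Amplify

/-- The parameters of `normalizeC`: a sign polynomial of degree `Õ(1 / α₀)` that is almost `1` for
all amplitudes `α ≥ α₀`, and a number `r` of Grover iterates such that the amplitude `sin (π / (2 (2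
r + 1)))`, which `r` iterates bring to `1`, is small enough for its coefficients. -/
theorem exists_amplify_params {α₀ δ : ℝ} (hα₀ : 0 < α₀) (hα₁ : α₀ ≤ 1) (hδ : 0 < δ) (hδ1 : δ < 1) :
    ∃ (K : ℕ) (c : ℕ → ℝ) (r : ℕ), K ≠ 0 ∧ Even r ∧ 1 ≤ r ∧
      (K : ℝ) ≤ 16 / α₀ * Real.log (1024 / (α₀ * δ)) ∧
      (r : ℝ) ≤ 10 + 4 * Real.log K ∧
      |Real.sin (Real.pi / (2 * (2 * r + 1)))| * ∑ j ∈ Finset.range (K + 1), |c j| ≤ 1 ∧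
      ∀ α, α₀ ≤ α → α ≤ 1 →
        ∑ j ∈ Finset.range (K + 1), c j * Real.cos ((2 * j + 1) * Real.arccos α) ≤ 1 ∧
        1 - δ / 8 ≤ ∑ j ∈ Finset.range (K + 1), c j * Real.cos ((2 * j + 1) * Real.arccos α) := by
  have hπ := Real.pi_pos
  have hπ4 := Real.pi_le_four
  obtain ⟨K, c, hK, h1, h2, h3⟩ := exists_sign_poly hα₀ hα₁ (τ := δ / 16) (by positivity)
    (by linarith)
  have hK1 : (1 : ℝ) ≤ K := by exact_mod_cast Nat.one_le_iff_ne_zero.2 hK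
  have hlog : 0 ≤ Real.log K := Real.log_nonneg hK1
  set q := ⌈2 * (2 + Real.log K)⌉₊ with hq
  have hq1 : 2 * (2 + Real.log K) ≤ q := Nat.le_ceil _
  have hq2 : (q : ℝ) < 2 * (2 + Real.log K) + 1 := Nat.ceil_lt_add_one (by positivity)
  have hq0 : (0 : ℝ) < q := by linarith
  refine ⟨K, c, 2 * q, hK, even_two_mul q, ?_, ?_, ?_, ?_, fun α h h' => ?_⟩
  · have : 0 < q := by exact_mod_cast hq0
    omega
  · convert h1 using 3
    rw [mul_div_assoc', div_div_eq_mul_div]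
    norm_num
  · push_cast
    linarith
  · push_cast
    have e : Real.pi / (2 * (2 * (2 * q) + 1)) ≤ 1 / q := by
      rw [div_le_div_iff₀ (by positivity) hq0]
      nlinarith
    have hpos : 0 < Real.pi / (2 * (2 * (2 * (q : ℝ)) + 1)) := by positivity
    have hle : Real.pi / (2 * (2 * (2 * (q : ℝ)) + 1)) ≤ Real.pi := by
      apply div_le_self hπ.le
      linarith
    rw [abs_of_nonneg (Real.sin_nonneg_of_nonneg_of_le_pi hpos.le hle)]
    calc _ ≤ 1 / (q : ℝ) * q := by
          refine mul_le_mul ((Real.sin_le hpos.le).trans e) (h2.trans hq1)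
            (Finset.sum_nonneg fun _ _ => abs_nonneg _) (by positivity)
      _ = 1 := by field_simp
  · have h0 := Real.arccos_nonneg α
    have h4 : Real.arccos α ≤ Real.pi / 2 - α₀ := by
      have e1 := Real.arcsin_eq_pi_div_two_sub_arccos α
      have e2 : α ≤ Real.arcsin α := by
        have := Real.sin_le (Real.arcsin_nonneg.2 (hα₀.le.trans h))
        rwa [Real.sin_arcsin (by linarith) h'] at this
      linarith
    obtain ⟨a1, a2⟩ := h3 _ h0 (by linarith)
    refine ⟨a1, ?_⟩
    have := a2 h4
    linarith

variable {W : Type} [Fintype W] [DecidableEq W] {Vr Vn : Type}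

/-- The circuit that removes the amplitude `α` of the part with zeros on `l₁` of the state prepared
by `E`: a polynomial of the Grover iterate makes it almost independent of `α`, and the result is
amplified. -/
def normalizeC (sc : ℕ → W) (dm d' : W) (E : QCircuit Vr Vn W) (l₀ l₁ : List W) (d k u : W)
    (us : List W) (K : ℕ) (c : ℕ → ℝ) (r : ℕ) : QCircuit Vr Vn W :=
  amplifyC sc dm d' (E ++ lcuC sc dm E l₀ l₁ d k (fun _ _ => (0, 1)) u us
    (Real.sin (Real.pi / (2 * (2 * r + 1)))) K c) (l₀ ++ u :: us) (l₁ ++ u :: us) r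

variable [Fintype Vr] [DecidableEq Vr] [Fintype Vn] [DecidableEq Vn]

theorem time_normalizeC_le (T : ℝ) (hT : 0 ≤ T) (sc : ℕ → W) (dm d' : W) (E : QCircuit Vr Vn W)
    (l₀ l₁ : List W) (d k u : W) {us : List W} {K : ℕ} (hus : us.length = K + 2) (c : ℕ → ℝ) (r : ℕ)
    {X : ℝ} (hX : 1 ≤ X) (hE : QCircuit.time T E ≤ X) (h₀ : (l₀.length : ℝ) ≤ X)
    (h₁ : (l₁.length : ℝ) ≤ X) :
    QCircuit.time T (normalizeC sc dm d' E l₀ l₁ d k u us K c r)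
      ≤ 200 * (r + 1) * (K + 2) * X := by
  have h1 := time_lcuC_le T hT sc dm E l₀ l₁ d k (fun _ _ => (0, 1)) u us
    (Real.sin (Real.pi / (2 * (2 * r + 1)))) K c
  have h2 := time_amplifyC_le T sc dm d' (E ++ lcuC sc dm E l₀ l₁ d k (fun _ _ => (0, 1)) u us
    (Real.sin (Real.pi / (2 * (2 * r + 1)))) K c) (l₀ ++ u :: us) (l₁ ++ u :: us) r
  rw [time_append] at h2
  have hK : (0 : ℝ) ≤ K := by positivity
  have hr : (0 : ℝ) ≤ r := by positivity
  have h3 : QCircuit.time T (lcuC sc dm E l₀ l₁ d k (fun _ _ => (0, 1)) u us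
      (Real.sin (Real.pi / (2 * (2 * r + 1)))) K c) ≤ (K + 2) * (20 * X) := by
    refine h1.trans ?_
    have : ((K : ℝ) + 2) * (4 + 2 * QCircuit.time T E + 6 * (l₀.length + l₁.length))
        ≤ (K + 2) * (18 * X) := by gcongr; linarith
    nlinarith
  have h4 : ((l₀ ++ u :: us).length : ℝ) ≤ 2 * (K + 2) * X := by
    rw [List.length_append, List.length_cons, hus]
    push_cast
    nlinarith
  have h5 : ((l₁ ++ u :: us).length : ℝ) ≤ 2 * (K + 2) * X := by
    rw [List.length_append, List.length_cons, hus]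
    push_cast
    nlinarith
  have h6 : X ≤ (K + 2) * X := by nlinarith
  refine h2.trans ?_
  have h7 : (r : ℝ) * (2 * (QCircuit.time T E + QCircuit.time T (lcuC sc dm E l₀ l₁ d k
      (fun _ _ => (0, 1)) u us (Real.sin (Real.pi / (2 * (2 * r + 1)))) K c)) +
      6 * ((l₀ ++ u :: us).length + (l₁ ++ u :: us).length) + 2) ≤ r * (100 * ((K + 2) * X)) := by
    gcongr
    nlinarith
  nlinarith

variable {R : QUnitary Vr} {N : QUnitary Vn} {sc : ℕ → W} {S : ℕ} {dm d' : W} {E : QCircuit Vr Vn W}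
  {l₀ l₁ : List W} {M V : Set W} {x : W → Bool} {d k u : W} {us : List W}

/-- If the part of `E |x⟩` with zeros on `l₁` is `α • g` with an amplitude `α` at which the
polynomial is almost `1`, then `normalizeC` prepares `g`, without knowing `α`. -/
theorem norm_normalizeC_sub_le (h : LcuWires R N sc S dm E l₀ l₁ d k u us M V x)
    (hS : 2 * (l₀ ++ u :: us).length ≤ S) (hS₁ : 2 * (l₁ ++ u :: us).length ≤ S)
    (hd' : d' ≠ dm ∧ ∀ k ≤ S, d' ≠ sc k) {K : ℕ}
    {c : ℕ → ℝ} {r : ℕ} (hlen : us.length = K + 2) (hr : Even r) (hr1 : 1 ≤ r)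
    (hs : |Real.sin (Real.pi / (2 * (2 * r + 1)))| * ∑ k ∈ Finset.range (K + 1), |c k| ≤ 1)
    {α δ : ℝ} {g : QState W} (hα : projOp l₁ (cOp R N E (ket x)) = (α : ℂ) • g) (hα0 : 0 < α)
    (hα1 : α ≤ 1) (hg : ‖g‖ = 1) (hδ : δ < 1)
    (hc : ∑ j ∈ Finset.range (K + 1), c j * Real.cos ((2 * j + 1) * Real.arccos α) ≤ 1)
    (hc' : 1 - δ / 8
      ≤ ∑ j ∈ Finset.range (K + 1), c j * Real.cos ((2 * j + 1) * Real.arccos α)) :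
    ‖cOp R N (normalizeC sc dm d' E l₀ l₁ d k u us K c r) (ket x) - g‖ ≤ δ := by
  have hπ := Real.pi_pos
  have hπ4 := Real.pi_le_four
  set s := Real.sin (Real.pi / (2 * (2 * r + 1))) with hsdef
  set P := ∑ j ∈ Finset.range (K + 1), c j * Real.cos ((2 * j + 1) * Real.arccos α) with hP
  have hβ : 0 < Real.pi / (2 * (2 * (r : ℝ) + 1)) := by positivity
  have hβ' : Real.pi / (2 * (2 * (r : ℝ) + 1)) < Real.pi := by
    apply div_lt_self hπ
    have : (0 : ℝ) ≤ r := by positivity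
    linarith
  have hs0 : 0 < s := Real.sin_pos_of_pos_of_lt_pi hβ hβ'
  have hsβ : (2 * r + 1) * s ≤ 2 := by
    have e1 : (2 * (r : ℝ) + 1) * s ≤ (2 * r + 1) * (Real.pi / (2 * (2 * r + 1))) := by
      gcongr
      exact Real.sin_le hβ.le
    have e2 : (2 * (r : ℝ) + 1) * (Real.pi / (2 * (2 * r + 1))) = Real.pi / 2 := by
      field_simp
    linarith
  have hproj := projOp_cOp_lcuC h hlen hs hα hα0 hα1 hg
  rw [← hP] at hproj
  have hF : Pres R N (E ++ lcuC sc dm E l₀ l₁ d k (fun _ _ => (0, 1)) u us s K c) (M ∪ V) x :=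
    (h.pres.union h.avoids).append (Pres.lcuC h _ _ _ _)
  have hdm : ∀ w ∈ V, w ≠ dm ∧ ∀ k ≤ S, w ≠ sc k := fun w hw =>
    ⟨fun e => h.dummy (e ▸ hw), fun k hk e => (h.grover.scratch k hk).1 (Or.inr (e ▸ hw))⟩
  have hw : GroverWires sc S dm (l₀ ++ u :: us) (l₁ ++ u :: us) (M ∪ V) x :=
    { inj := h.grover.inj
      dummy := h.grover.dummy
      length₀ := hS
      length₁ := hS₁
      list₀ := fun w hw => (List.mem_append.1 hw).elim (h.grover.list₀ w)
        fun hw => hdm w ((h.mem w).1 hw)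
      list₁ := fun w hw => (List.mem_append.1 hw).elim (h.grover.list₁ w)
        fun hw => hdm w ((h.mem w).1 hw)
      scratch := h.grover.scratch }
  rw [normalizeC, cOp_amplifyC hw hF hd'.1 hd'.2]
  refine (norm_groverOp_pow_sub_le hF (fun w => ?_) h.zero hr hr1 hg hproj ?_ ?_).trans ?_
  · rw [List.mem_append, h.list₀, h.mem]
    rfl
  · have : 0 < P := by linarith
    positivity
  · exact mul_le_of_le_one_right hs0.le hc
  · rw [← hsdef]
    have e : s - s * P ≤ s * (δ / 8) := by nlinarith
    have hδ0 : 0 ≤ δ / 8 := by linarith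
    calc 4 * (2 * (r : ℝ) + 1) * (s - s * P) ≤ 4 * (2 * r + 1) * (s * (δ / 8)) := by gcongr
      _ = 4 * ((2 * r + 1) * s) * (δ / 8) := by ring
      _ ≤ 4 * 2 * (δ / 8) := by gcongr
      _ = δ := by ring

end Amplify

/-! ### Binary numbers in registers -/

section Binary

theorem bits_eq_iff {k x y : ℕ} (hx : x < 2 ^ k) (hy : y < 2 ^ k) :
    bits k x = bits k y ↔ x = y := by
  refine ⟨fun h => Nat.eq_of_testBit_eq fun i => ?_, fun h => by rw [h]⟩
  by_cases hi : i < k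
  · exact congrFun h ⟨i, hi⟩
  · have hk : 2 ^ k ≤ 2 ^ i := Nat.pow_le_pow_right (by norm_num) (not_lt.1 hi)
    rw [Nat.testBit_lt_two_pow (hx.trans_le hk), Nat.testBit_lt_two_pow (hy.trans_le hk)]

theorem bits_zero (k : ℕ) : bits k 0 = fun _ => false := by
  funext j
  simp [bits]

theorem exists_eq_bits {k : ℕ} (y : Fin k → Bool) : ∃ x < 2 ^ k, y = bits k x := by
  have hinj : Function.Injective fun x : Fin (2 ^ k) => bits k x := fun a b h =>
    Fin.ext ((bits_eq_iff a.2 b.2).1 h)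
  have hbij := (Fintype.bijective_iff_injective_and_card _).2 ⟨hinj, by simp⟩
  obtain ⟨x, hx⟩ := hbij.2 y
  exact ⟨x, x.2, hx.symm⟩

theorem lt_two_pow_width {n x : ℕ} (hx : x < n) : x < 2 ^ width n :=
  hx.trans_le (Nat.le_pow_clog (by norm_num) n)

theorem mod_two_pow_succ_eq (x m : ℕ) :
    x % 2 ^ (m + 1) = x % 2 ^ m + 2 ^ m * (x.testBit m).toNat := by
  rw [Nat.mod_pow_succ, Nat.toNat_testBit]

variable {W : Type}

/-- An automaton that reads two numbers, least significant bits first, and compares them. -/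
theorem scanVal_lt {m : ℕ} (x : W → Bool) (A B : ℕ) (p : Fin m → ScanStep W)
    (hp : ∀ j s, (p j).2.2 s (x (p j).1) (x (p j).2.1)
      = if A.testBit j = B.testBit j then s else B.testBit j) :
    scanVal x false ((List.finRange m).map p) = decide (A % 2 ^ m < B % 2 ^ m) := by
  induction m with
  | zero => simp [scanVal, Nat.mod_one]
  | succ m ih =>
    have h := ih (fun j => p j.castSucc) fun j s => hp j.castSucc s
    rw [List.finRange_succ_last, List.map_append, List.map_map]
    unfold scanVal at h ⊢
    rw [List.foldl_append, Function.comp_def, h]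
    simp only [List.map_cons, List.map_nil, List.foldl_cons, List.foldl_nil, hp, Fin.val_last]
    have hA := Nat.mod_lt A (Nat.two_pow_pos m)
    have hB := Nat.mod_lt B (Nat.two_pow_pos m)
    rw [mod_two_pow_succ_eq, mod_two_pow_succ_eq]
    cases A.testBit m <;> cases B.testBit m <;> simp <;> omega

/-- An automaton that reads two numbers and tells whether they are different. -/
theorem scanVal_ne {m : ℕ} (x : W → Bool) (A B : ℕ) (p : Fin m → ScanStep W)
    (hp : ∀ j s, (p j).2.2 s (x (p j).1) (x (p j).2.1)
      = (s || xor (A.testBit j) (B.testBit j))) :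
    scanVal x false ((List.finRange m).map p) = decide (A % 2 ^ m ≠ B % 2 ^ m) := by
  induction m with
  | zero => simp [scanVal, Nat.mod_one]
  | succ m ih =>
    have h := ih (fun j => p j.castSucc) fun j s => hp j.castSucc s
    rw [List.finRange_succ_last, List.map_append, List.map_map]
    unfold scanVal at h ⊢
    rw [List.foldl_append, Function.comp_def, h]
    simp only [List.map_cons, List.map_nil, List.foldl_cons, List.foldl_nil, hp, Fin.val_last]
    have hA := Nat.mod_lt A (Nat.two_pow_pos m)
    have hB := Nat.mod_lt B (Nat.two_pow_pos m)
    rw [mod_two_pow_succ_eq, mod_two_pow_succ_eq]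
    cases A.testBit m <;> cases B.testBit m <;> simp <;> omega

variable [Fintype W] [DecidableEq W] {Vr Vn : Type} [Fintype Vr] [DecidableEq Vr] [Fintype Vn]
  [DecidableEq Vn] {R : QUnitary Vr} {N : QUnitary Vn}

/-- A chain of links with the operator `1` between them. -/
theorem isControlled_nil {M V : Set W} (hVM : V ⊆ M) (x : W → Bool) :
    IsControlled R N (fun _ => []) 1 M x V :=
  ⟨hVM, fun _ _ _ _ _ => rfl, fun _ _ _ _ _ => rfl, fun _ h => h, fun _ _ _ _ _ h => h,
    fun _ _ _ _ => rfl⟩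

/-- The links of the chain that turns a binary number, most significant bit first, into an
amplitude. -/
def amplitudeLinks {m : ℕ} (t src : Fin m → W) : List (Link W) :=
  (List.finRange m).reverse.map fun b => (t b, src b, fun v =>
    if v then (1 / 2, 1 / 2) else (0, 1 / 2))

theorem hornerOp_amplitudeLinks {m : ℕ} (x : W → Bool) (X : ℕ) (t src : Fin m → W)
    (h : ∀ b : Fin m, x (src b) = X.testBit b) :
    hornerOp x 1 (amplitudeLinks t src) = (((X % 2 ^ m + 1 : ℕ) / 2 ^ m : ℝ) : ℂ) • 1 := by
  induction m with
  | zero => simp [amplitudeLinks, hornerOp, Nat.mod_one]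
  | succ m ih =>
    have e : amplitudeLinks t src = (t (Fin.last m), src (Fin.last m),
        fun v => if v then (1 / 2, 1 / 2) else (0, 1 / 2))
        :: amplitudeLinks (fun b => t b.castSucc) fun b => src b.castSucc := by
      simp [amplitudeLinks, List.finRange_succ_last, List.map_reverse, Function.comp_def]
    rw [e, hornerOp, ih _ _ fun b => h b.castSucc]
    simp only [h, Fin.val_last, mul_one, smul_smul, ← add_smul, ← Complex.ofReal_mul,
      ← Complex.ofReal_add]
    congr 2
    rw [mod_two_pow_succ_eq, pow_succ]
    cases X.testBit m
    · simp
      field_simp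
    · simp
      field_simp
      ring

/-- The circuit that multiplies the part of a state with zeros on the wires `t₀`, `t` by `(X + 1) /
2 ^ m`, where `X` is the number on the wires `src`. -/
def amplitudeC {m : ℕ} (d k t₀ : W) (t src : Fin m → W) : QCircuit Vr Vn W :=
  stepC d k t₀ (fun _ _ => (0, 1)) (chainC (fun _ => []) t₀ (amplitudeLinks t src))

theorem time_amplitudeC_le (T : ℝ) {m : ℕ} (d k t₀ : W) (t src : Fin m → W) :
    QCircuit.time T (amplitudeC d k t₀ t src : QCircuit Vr Vn W) ≤ 2 + 2 * m := by
  refine (time_stepC_le T _ _ _ _ _).trans ?_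
  have h := time_chainC_le (Vr := Vr) (Vn := Vn) T (cW := fun _ => []) (τ := 0)
    (fun _ => by simp [QCircuit.time]) t₀ (amplitudeLinks t src)
  have e : (amplitudeLinks t src).length = m := by simp [amplitudeLinks]
  rw [e] at h
  linarith

theorem mem_amplitudeLinks {m : ℕ} {t src : Fin m → W} {p : Link W}
    (hp : p ∈ amplitudeLinks t src) :
    ∃ b, p = (t b, src b, fun v => if v then (1 / 2, 1 / 2) else (0, 1 / 2)) := by
  simp only [amplitudeLinks, List.mem_map] at hp
  obtain ⟨b, -, rfl⟩ := hp
  exact ⟨b, rfl⟩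

theorem amplitudeC_avoids {m : ℕ} {d k t₀ : W} {t src : Fin m → W} {V : Set W} (hd : d ∉ V)
    (hk : k ∉ V) (ht₀ : t₀ ∉ V) (ht : ∀ b, t b ∉ V) (hsrc : ∀ b, src b ∉ V) :
    Avoids (amplitudeC d k t₀ t src : QCircuit Vr Vn W) V := by
  refine Avoids.stepC hd hk ht₀ (Avoids.chainC _ ht₀ (fun p hp => ?_) fun p _ => ?_)
  · obtain ⟨b, rfl⟩ := mem_amplitudeLinks hp
    exact ⟨ht b, hsrc b⟩
  · exact fun g hg => absurd hg (by simp)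

theorem Local.amplitudeC {m : ℕ} {d k t₀ : W} {t src : Fin m → W} {M : Set W} (ht₀ : t₀ ∈ M)
    (ht : ∀ b, t b ∈ M) : Local R N (amplitudeC d k t₀ t src) M := by
  intro x
  refine Pres.stepC ht₀ (Pres.chainC _ _ (fun p hp => ?_) fun p _ => Local.nil M x)
  obtain ⟨b, rfl⟩ := mem_amplitudeLinks hp
  exact ht b

theorem cOp_amplitudeC {m : ℕ} {d k t₀ : W} {t src : Fin m → W} (hdk : d ≠ k) (hd : d ≠ t₀)
    (hk : k ≠ t₀) (hdt : ∀ b, d ≠ t b) (hkt : ∀ b, k ≠ t b) (ht : Function.Injective t)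
    (ht₀ : ∀ b, t₀ ≠ t b) (hsrc : ∀ a, src a ≠ t₀ ∧ ∀ b, src a ≠ t b) {x : W → Bool} {X : ℕ}
    (hX : X < 2 ^ m) (hx : ∀ b : Fin m, x (src b) = X.testBit b) (hx₀ : x t₀ = false)
    (hxt : ∀ b, x (t b) = false) :
    ∃ r ∈ Supp (fun z : W → Bool => z t₀ = true ∨ ∃ b, z (t b) = true),
      cOp R N (amplitudeC d k t₀ t src) (ket x) = (((X + 1) / 2 ^ m : ℝ) : ℂ) • ket x + r := by
  set V : Set W := {w | w = t₀ ∨ ∃ b, w = t b} with hV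
  obtain ⟨r, hr, e⟩ := cOp_stepC_chainC (R := R) (N := N) (isControlled_nil (subset_refl V) x)
    (amplitudeLinks t src) (d := d) (k := k) (u := t₀) hdk
    (by rintro (h | ⟨b, h⟩); exacts [hd h, hdt b h])
    (by rintro (h | ⟨b, h⟩); exacts [hk h, hkt b h]) (Or.inl rfl)
    (fun p hp => by
      obtain ⟨a, rfl⟩ := mem_amplitudeLinks hp
      refine ⟨Or.inr ⟨a, rfl⟩, ?_⟩
      rintro (h | ⟨b, h⟩)
      exacts [(hsrc a).1 h, (hsrc a).2 b h])
    (by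
      simp only [amplitudeLinks, List.map_map, Function.comp_def, List.nodup_cons, List.mem_map,
        List.mem_reverse, not_exists, not_and]
      refine ⟨fun b _ e => ht₀ b e.symm, ?_⟩
      exact List.Nodup.map ht (List.nodup_reverse.2 (List.nodup_finRange m)))
    (fun p hp => by
      obtain ⟨a, rfl⟩ := mem_amplitudeLinks hp
      simp only
      split_ifs <;> norm_num [abs_of_pos])
    (xy := fun _ _ => (0, 1)) (by simp) (ket_mem_Agr V x)
    (fun p hp => by
      obtain ⟨a, rfl⟩ := mem_amplitudeLinks hp
      exact ket_mem_Supp (hxt a))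
    (ket_mem_Supp hx₀)
  refine ⟨r, Supp_mono ?_ hr, ?_⟩
  · rintro z (h | ⟨p, hp, h⟩)
    · exact Or.inl h
    · obtain ⟨a, rfl⟩ := mem_amplitudeLinks hp
      exact Or.inr ⟨a, h⟩
  · rw [amplitudeC, e, hornerOp_amplitudeLinks x X t src hx, Nat.mod_eq_of_lt hX]
    simp

end Binary

/-! ### The registers of the row circuit -/

/-- The parameters of the row circuit: the sizes of the matrix and of the registers of the black
boxes; the number `L` of bits of the norms that are used, starting at bit `sh`; the degree `K` and
the coefficients `c` of the polynomial that decides whether a pair is an edge, and the factor `s`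
that makes their sum at most `1`; the degree `J` and the coefficients `b` of the polynomial that
normalizes the amplitude, and the number `rr` of rounds of the final amplification. -/
structure RowParams : Type where
  (n d w r L sh K J rr : ℕ)
  (c b : ℕ → ℝ)
  (s εB : ℝ)

/-- The length of the scratch register. -/
def RowParams.size (P : RowParams) : ℕ :=
  2 * (3 * width P.n + width P.d + P.w + P.L + P.K + P.J + 20)

/-- The ancillas of the row circuit. -/
inductive RowAnc (P : RowParams) : Type
  | flag (a : Fin 4) (k : Fin (2 * width P.n + 1))
  | valid
  | notq
  | notp
  | fst (j : Fin (width P.n))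
  | snd (j : Fin (width P.n))
  | sel
  | nidx (j : Fin (width P.n))
  | norm (j : Fin P.r)
  | amp (j : Fin (P.L + 1))
  | ridx (j : Fin (width P.n))
  | dat (j : Fin (width P.d))
  | anc (j : Fin P.w)
  | deg (j : Fin (P.K + 3))
  | cod (j : Fin (P.J + 3))
  | scr (j : Fin (P.size + 1))
  | dum (j : Fin 3)
  deriving DecidableEq, Fintype

/-- The wires of the row circuit: an index, two further indices, and ancillas. -/
abbrev RowWires (P : RowParams) : Type :=
  Fin (width P.n) ⊕ (Fin (width P.n) ⊕ Fin (width P.n)) ⊕ RowAnc P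

/-- The wires of the black box for the rows. -/
abbrev RowBox (P : RowParams) : Type := AccessWires P.n (Fin (width P.d)) P.w

/-- The wires of the black box for the norms. -/
abbrev NormBox (P : RowParams) : Type := AccessWires P.n (Fin P.r) 0

section Wires

variable (P : RowParams)

/-- An ancilla as a wire. -/
abbrev ancW (a : RowAnc P) : RowWires P := Sum.inr (Sum.inr a)

/-- The scratch wires. -/
def scrW (k : ℕ) : RowWires P := ancW P (.scr (Fin.ofNat (P.size + 1) k))

/-- The position of the register of the black box for the rows. -/
def rowEmb : RowBox P ↪ RowWires P where
  toFun := Sum.elim (fun j => ancW P (.ridx j))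
    (Sum.elim (fun j => ancW P (.dat j)) fun j => ancW P (.anc j))
  inj' := by
    rintro (a | a | a) (b | b | b) h <;> simp_all

/-- The position of the register of the black box for the norms. -/
def normEmb : NormBox P ↪ RowWires P where
  toFun := Sum.elim (fun j => ancW P (.nidx j))
    (Sum.elim (fun j => ancW P (.norm j)) fun j => j.elim0)
  inj' := by
    rintro (a | a | a) (b | b | b) h <;> first | exact a.elim0 | exact b.elim0 | simp_all

/-- The wire with bit `b` of the part of the norm that is used. -/
def srcW (b : Fin P.L) : RowWires P :=
  if h : P.sh + b < P.r then ancW P (.norm ⟨P.sh + b, h⟩) else ancW P (.dum 2)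

/-- The wires that hold the result of the comparison of two rows. -/
def cmpWires : List (RowWires P) :=
  ancW P .sel :: (List.finRange (P.L + 1)).map fun j => ancW P (.amp j)

/-- The wires that the comparison of two rows changes. -/
def workWires : List (RowWires P) :=
  cmpWires P ++ ((List.finRange (width P.n)).map (fun j => ancW P (.ridx j)) ++
    ((List.finRange (width P.d)).map (fun j => ancW P (.dat j)) ++
      (List.finRange P.w).map fun j => ancW P (.anc j)))

/-- The control wires of the first polynomial. -/
def degWires : List (RowWires P) := (List.finRange (P.K + 3)).map fun j => ancW P (.deg j)

/-- The control wires of the second polynomial. -/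
def codWires : List (RowWires P) := (List.finRange (P.J + 3)).map fun j => ancW P (.cod j)

/-- The wires of the pair `(p, q)`. -/
def pairWires : List (RowWires P) :=
  (List.finRange (width P.n)).map (fun j => Sum.inr (Sum.inl (Sum.inl j))) ++
    (List.finRange (width P.n)).map fun j => Sum.inr (Sum.inl (Sum.inr j))

theorem mem_cmpWires (w : RowWires P) :
    w ∈ cmpWires P ↔ w = ancW P .sel ∨ ∃ j, w = ancW P (.amp j) := by
  simp [cmpWires, eq_comm]

theorem mem_workWires (w : RowWires P) :
    w ∈ workWires P ↔ w ∈ cmpWires P ∨ (∃ j, w = ancW P (.ridx j)) ∨ (∃ j, w = ancW P (.dat j)) ∨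
      ∃ j, w = ancW P (.anc j) := by
  simp [workWires, eq_comm]

theorem mem_degWires (w : RowWires P) : w ∈ degWires P ↔ ∃ j, w = ancW P (.deg j) := by
  simp [degWires, eq_comm]

theorem mem_codWires (w : RowWires P) : w ∈ codWires P ↔ ∃ j, w = ancW P (.cod j) := by
  simp [codWires, eq_comm]

theorem mem_pairWires (w : RowWires P) : w ∈ pairWires P ↔ ∃ j, w = Sum.inr (Sum.inl j) := by
  simp [pairWires, eq_comm]

theorem scrW_injOn : Set.InjOn (scrW P) (Set.Iic P.size) := by
  intro a ha b hb h
  simp only [scrW, ancW, Sum.inr.injEq, RowAnc.scr.injEq, Fin.ext_iff, Fin.val_ofNat] at h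
  rwa [Nat.mod_eq_of_lt (Nat.lt_succ_of_le ha), Nat.mod_eq_of_lt (Nat.lt_succ_of_le hb)] at h

end Wires

/-! ### The comparison of two rows -/

section Compare

variable (P : RowParams)

/-- The circuit that loads one of the two row numbers, selected by the qubit `sel`, to the register
`t`. -/
def loadC (t : Fin (width P.n) → RowWires P) : QCircuit (RowBox P) (NormBox P) (RowWires P) :=
  copyC (List.finRange _) (fun _ => ancW P .sel) (fun j => ancW P (.fst j)) t (fun b u =>
    !b && u) ++
    copyC (List.finRange _) (fun _ => ancW P .sel) (fun j => ancW P (.snd j)) t and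

/-- The circuit that computes the norm of the selected row. -/
def normLoadC : QCircuit (RowBox P) (NormBox P) (RowWires P) :=
  loadC P (fun j => ancW P (.nidx j)) ++ [QGate.normCall false (normEmb P)]

/-- The circuit that multiplies the amplitude by the norm of the selected row, up to a scalar. -/
def normAmpC : QCircuit (RowBox P) (NormBox P) (RowWires P) :=
  conjC (normLoadC P) (amplitudeC (ancW P (.dum 0)) (ancW P (.dum 1)) (ancW P (.amp 0))
    (fun b : Fin P.L => ancW P (.amp b.succ)) (srcW P))

/-- The circuit that prepares the selected row. -/
def rowLoadC : QCircuit (RowBox P) (NormBox P) (RowWires P) :=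
  conjC (loadC P fun j => ancW P (.ridx j)) [QGate.rowCall false (rowEmb P)]

/-- A Hadamard gate, up to signs, on the qubit `sel`. -/
def selC : QCircuit (RowBox P) (NormBox P) (RowWires P) :=
  cg (ancW P (.dum 0)) (ancW P (.dum 1)) (ancW P .sel) fun _ _ => rot (-(Real.pi / 4))

/-- The circuit that prepares the difference of two rows. -/
def diffC : QCircuit (RowBox P) (NormBox P) (RowWires P) :=
  selC P ++ (normAmpC P ++ (rowLoadC P ++ selC P))

theorem time_diffC_le {T : ℝ} (hT : 1 ≤ T) :
    QCircuit.time T (diffC P) ≤ (8 * width P.n + 2 * P.L + 7) * T := by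
  have h1 := time_cg_le (Vr := RowBox P) (Vn := NormBox P) T (ancW P (.dum 0)) (ancW P (.dum 1))
    (ancW P .sel) fun _ _ => rot (-(Real.pi / 4))
  have h2 : ∀ t, QCircuit.time T (loadC P t) ≤ 2 * width P.n := by
    intro t
    have e1 := time_copyC_le (Vr := RowBox P) (Vn := NormBox P) T (List.finRange _)
      (fun _ => ancW P .sel) (fun j => ancW P (.fst j)) t (fun b u => !b && u)
    have e2 := time_copyC_le (Vr := RowBox P) (Vn := NormBox P) T (List.finRange _)
      (fun _ => ancW P .sel) (fun j => ancW P (.snd j)) t and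
    rw [List.length_finRange] at e1 e2
    rw [loadC, time_append]
    linarith
  have h3 := time_amplitudeC_le (Vr := RowBox P) (Vn := NormBox P) T (ancW P (.dum 0))
    (ancW P (.dum 1)) (ancW P (.amp 0)) (fun b : Fin P.L => ancW P (.amp b.succ)) (srcW P)
  have h4 : QCircuit.time T [QGate.normCall (Vr := RowBox P) false (normEmb P)] = T := by
    simp [QCircuit.time, QGate.time]
  have h5 : QCircuit.time T [QGate.rowCall (Vn := NormBox P) false (rowEmb P)] = T := by
    simp [QCircuit.time, QGate.time]
  have h6 := h2 fun j => ancW P (.nidx j)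
  have h7 := h2 fun j => ancW P (.ridx j)
  simp only [diffC, selC, normAmpC, rowLoadC, normLoadC, time_append, time_conjC, h4, h5]
  have h8 : (8 * width P.n + 2 * (P.L : ℝ)) * 1 ≤ (8 * width P.n + 2 * P.L) * T := by gcongr
  linarith

variable {P} {R : QUnitary (RowBox P)} {N : QUnitary (NormBox P)}

theorem loadC_avoids {t : Fin (width P.n) → RowWires P} {V : Set (RowWires P)}
    (h0 : ancW P .sel ∉ V) (h1 : ∀ j, ancW P (.fst j) ∉ V) (h2 : ∀ j, ancW P (.snd j) ∉ V)
    (ht : ∀ j, t j ∉ V) : Avoids (loadC P t) V :=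
  (copyC_avoids (fun _ => h0) h1 ht).append (copyC_avoids (fun _ => h0) h2 ht)

theorem normLoadC_avoids {V : Set (RowWires P)}
    (h0 : ancW P .sel ∉ V) (h1 : ∀ j, ancW P (.fst j) ∉ V) (h2 : ∀ j, ancW P (.snd j) ∉ V)
    (h3 : ∀ j, ancW P (.nidx j) ∉ V) (h4 : ∀ j, ancW P (.norm j) ∉ V) : Avoids (normLoadC P) V := by
  refine (loadC_avoids h0 h1 h2 h3).append fun g hg => ?_
  rw [List.mem_singleton] at hg
  subst hg
  rw [Set.disjoint_left]
  rintro _ ⟨a | a | a, rfl⟩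
  exacts [h3 a, h4 a, a.elim0]

theorem rowLoadC_avoids {V : Set (RowWires P)}
    (h0 : ancW P .sel ∉ V) (h1 : ∀ j, ancW P (.fst j) ∉ V) (h2 : ∀ j, ancW P (.snd j) ∉ V)
    (h3 : ∀ j, ancW P (.ridx j) ∉ V) (h4 : ∀ j, ancW P (.dat j) ∉ V)
    (h5 : ∀ j, ancW P (.anc j) ∉ V) : Avoids (rowLoadC P) V := by
  refine (loadC_avoids h0 h1 h2 h3).conjC fun g hg => ?_
  rw [List.mem_singleton] at hg
  subst hg
  rw [Set.disjoint_left]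
  rintro _ ⟨a | a | a, rfl⟩
  exacts [h3 a, h4 a, h5 a]

theorem srcW_cases (b : Fin P.L) : (∃ j, srcW P b = ancW P (.norm j)) ∨ srcW P b
    = ancW P (.dum 2) := by
  unfold srcW
  split_ifs with h
  · exact Or.inl ⟨_, rfl⟩
  · exact Or.inr rfl

theorem normAmpC_avoids {V : Set (RowWires P)}
    (h0 : ancW P .sel ∉ V) (h1 : ∀ j, ancW P (.fst j) ∉ V) (h2 : ∀ j, ancW P (.snd j) ∉ V)
    (h3 : ∀ j, ancW P (.nidx j) ∉ V) (h4 : ∀ j, ancW P (.norm j) ∉ V)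
    (h5 : ∀ j, ancW P (.dum j) ∉ V) (h6 : ∀ j, ancW P (.amp j) ∉ V) : Avoids (normAmpC P) V := by
  refine (normLoadC_avoids h0 h1 h2 h3 h4).conjC (amplitudeC_avoids (h5 _) (h5 _) (h6 _)
    (fun _ => h6 _) fun b => ?_)
  rcases srcW_cases b with ⟨j, e⟩ | e <;> rw [e]
  exacts [h4 j, h5 2]

theorem diffC_avoids {V : Set (RowWires P)}
    (h : ∀ w ∈ workWires P, w ∉ V) (h1 : ∀ j, ancW P (.fst j) ∉ V) (h2 : ∀ j, ancW P (.snd j) ∉ V)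
    (h3 : ∀ j, ancW P (.nidx j) ∉ V) (h4 : ∀ j, ancW P (.norm j) ∉ V)
    (h5 : ∀ j, ancW P (.dum j) ∉ V) : Avoids (diffC P) V := by
  simp only [mem_workWires, mem_cmpWires] at h
  have hs : Avoids (selC P) V := cg_avoids (h5 _) (h5 _) (h _ (by simp))
  exact hs.append ((normAmpC_avoids (h _ (by simp)) h1 h2 h3 h4 h5 fun j => h _ (by simp)).append
    ((rowLoadC_avoids (h _ (by simp)) h1 h2 (fun j => h _ (by simp)) (fun j => h _ (by simp))
      fun j => h _ (by simp)).append hs))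

theorem cOp_loadC {t : Fin (width P.n) → RowWires P} (ht : Function.Injective t)
    (h0 : ∀ j, ancW P .sel ≠ t j) (h1 : ∀ i j, ancW P (.fst i) ≠ t j)
    (h2 : ∀ i j, ancW P (.snd i) ≠ t j) (x : RowWires P → Bool) :
    cOp R N (loadC P t) (ket x) = ket (Function.extend t (fun j => xor (x (t j))
      (if x (ancW P .sel) then x (ancW P (.snd j)) else x (ancW P (.fst j)))) x) := by
  rw [loadC, cOp_append, cOp_copyC R N (List.nodup_finRange _) (List.mem_finRange) ht
    (fun i => ⟨by simp, fun j => ⟨h0 j, h1 i j⟩⟩),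
    cOp_copyC R N (List.nodup_finRange _) (List.mem_finRange) ht
    (fun i => ⟨by simp, fun j => ⟨h0 j, h2 i j⟩⟩)]
  have hee := extend_extend (W := RowWires P) ⟨t, ht⟩
  simp only [Function.Embedding.coeFn_mk] at hee
  rw [hee]
  congr 2
  funext j
  rw [ht.extend_apply, Function.extend_apply' _ _ _ (by rintro ⟨a, e⟩; exact h0 a e.symm),
    Function.extend_apply' _ _ _ (by rintro ⟨a, e⟩; exact h2 j a e.symm)]
  cases x (ancW P .sel) <;> simp

/-- The two row numbers are loaded, and the registers of the norms are empty. -/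
structure Loaded (P : RowParams) (a : Bool → Fin P.n) (x : RowWires P → Bool) : Prop where
  fst : ∀ j, x (ancW P (.fst j)) = bits (width P.n) (a false) j
  snd : ∀ j, x (ancW P (.snd j)) = bits (width P.n) (a true) j
  nidx : ∀ j, x (ancW P (.nidx j)) = false
  norm : ∀ j, x (ancW P (.norm j)) = false
  dum : x (ancW P (.dum 2)) = false

theorem Loaded.congr {a : Bool → Fin P.n} {x z : RowWires P → Bool} (h : Loaded P a x)
    (hz : ∀ w, w ∉ {w | w ∈ workWires P} → z w = x w) : Loaded P a z := by
  have key : ∀ w, w ∉ workWires P → z w = x w := hz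
  simp only [mem_workWires, mem_cmpWires] at key
  refine ⟨fun j => ?_, fun j => ?_, fun j => ?_, fun j => ?_, ?_⟩ <;> rw [key _ (by simp)]
  exacts [h.fst j, h.snd j, h.nidx j, h.norm j, h.dum]

theorem Loaded.sel {a : Bool → Fin P.n} {x : RowWires P → Bool} (h : Loaded P a x)
    (j : Fin (width P.n)) :
    (if x (ancW P .sel) then x (ancW P (.snd j)) else x (ancW P (.fst j)))
      = bits (width P.n) (a (x (ancW P .sel))) j := by
  cases e : x (ancW P .sel) <;> simp [h.fst, h.snd]

variable {X : Fin P.n → ℕ}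

/-- The basis state after the norm of the selected row has been computed. -/
theorem cOp_normLoadC (hN : ∀ i, N (accessKet 0 i fun _ => false) = accessKet 0 i (bits P.r (X i)))
    {a : Bool → Fin P.n} {x : RowWires P → Bool} (h : Loaded P a x) :
    cOp R N (normLoadC P) (ket x) = ket (Function.extend (normEmb P)
      (Sum.elim (bits (width P.n) (a (x (ancW P .sel))))
        (Sum.elim (bits P.r (X (a (x (ancW P .sel))))) fun _ => false)) x) := by
  have hinj : Function.Injective fun j => ancW P (.nidx j) := fun a b e => by simpa using e
  rw [normLoadC, cOp_append, cOp_loadC hinj (by simp) (by simp) (by simp)]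
  simp only [h.sel, h.nidx, Bool.false_xor]
  change applyOn _ _ _ = _
  rw [applyOn_ket_ket (y := Sum.elim (bits (width P.n) (a (x (ancW P .sel))))
        (Sum.elim (bits P.r (X (a (x (ancW P .sel))))) fun _ => false))]
  · congr 1
    funext w
    by_cases hw : ∃ v, normEmb P v = w
    · obtain ⟨v, rfl⟩ := hw
      rw [(normEmb P).injective.extend_apply, (normEmb P).injective.extend_apply]
    · rw [Function.extend_apply' _ _ _ hw, Function.extend_apply' _ _ _ hw,
        Function.extend_apply' _ _ _ (by rintro ⟨j, e⟩; exact hw ⟨Sum.inl j, e⟩)]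
  · have := hN (a (x (ancW P .sel)))
    rw [accessKet, accessKet] at this
    simp only [Bool.false_eq_true, if_false]
    convert this using 3
    funext v
    rcases v with j | j | j
    · exact hinj.extend_apply _ _ j
    · change Function.extend _ _ _ (ancW P (.norm j)) = _
      rw [Function.extend_apply' _ _ _ (by rintro ⟨a, e⟩; simp at e)]
      exact h.norm j
    · exact j.elim0

end Compare

section Compare

variable {P : RowParams} {R : QUnitary (RowBox P)} {N : QUnitary (NormBox P)} {X : Fin P.n → ℕ}

/-- The wires on which the norm is written as an amplitude. -/
def ampSet (P : RowParams) : Set (RowWires P) := {w | ∃ j, w = ancW P (.amp j)}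

theorem ampSet_subset : ampSet P ⊆ {w | w ∈ workWires P} := by
  rintro w ⟨j, rfl⟩
  rw [Set.mem_ofPred_eq, mem_workWires, mem_cmpWires]
  exact Or.inl (Or.inr ⟨j, rfl⟩)

theorem normLoadC_avoids_ampSet : Avoids (normLoadC P) (ampSet P) := by
  refine normLoadC_avoids ?_ ?_ ?_ ?_ ?_ <;> simp [ampSet]

theorem local_normAmp (P : RowParams) (R : QUnitary (RowBox P)) (N : QUnitary (NormBox P)) :
    Local R N (amplitudeC (Vr := RowBox P) (Vn := NormBox P) (ancW P (.dum 0)) (ancW P (.dum 1))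
      (ancW P (.amp 0)) (fun b : Fin P.L => ancW P (.amp b.succ)) (srcW P)) (ampSet P) :=
  Local.amplitudeC ⟨_, rfl⟩ fun _ => ⟨_, rfl⟩

theorem normEmb_ne {a : RowAnc P} (h : ∀ j, a ≠ .nidx j) (h' : ∀ j, a ≠ .norm j) (v : NormBox P) :
    normEmb P v ≠ ancW P a := by
  intro e
  rcases v with v | v | v
  · exact h v (Sum.inr.inj (Sum.inr.inj e)).symm
  · exact h' v (Sum.inr.inj (Sum.inr.inj e)).symm
  · exact v.elim0

theorem Pres.normAmpC
    (hN : ∀ i, N (accessKet 0 i fun _ => false) = accessKet 0 i (bits P.r (X i)))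
    {a : Bool → Fin P.n} {x : RowWires P → Bool} (h : Loaded P a x) :
    Pres R N (normAmpC P) {w | w ∈ workWires P} x := by
  refine Pres.of_ket fun z hz => ?_
  have hc := cOp_normLoadC (R := R) hN (h.congr hz)
  exact Agr_mono ampSet_subset z
    (Pres.conjC normLoadC_avoids_ampSet hc (local_normAmp P R N _) _ (ket_mem_Agr _ z))

/-- The number that `normAmpC` multiplies the amplitude by. -/
def normAmp (P : RowParams) (X : Fin P.n → ℕ) (i : Fin P.n) : ℝ :=
  ((X i >>> P.sh : ℕ) + 1) / 2 ^ P.L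

theorem cOp_normAmpC
    (hN : ∀ i, N (accessKet 0 i fun _ => false) = accessKet 0 i (bits P.r (X i)))
    (hX : ∀ i, X i < 2 ^ P.r) (hXL : ∀ i, X i >>> P.sh < 2 ^ P.L)
    {a : Bool → Fin P.n} {x : RowWires P → Bool} (h : Loaded P a x)
    (hx : ∀ j, x (ancW P (.amp j)) = false) :
    ∃ r ∈ Supp (fun z : RowWires P → Bool => ∃ j, z (ancW P (.amp j)) = true),
      cOp R N (normAmpC P) (ket x)
        = (normAmp P X (a (x (ancW P .sel))) : ℂ) • ket x + r := by
  have hc := cOp_normLoadC (R := R) hN h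
  set i := a (x (ancW P .sel)) with hi
  set x' := Function.extend (normEmb P)
      (Sum.elim (bits (width P.n) i) (Sum.elim (bits P.r (X i)) fun _ => false)) x with hx'
  have hoff : ∀ w, (∀ v, normEmb P v ≠ w) → x' w = x w := fun w hw =>
    Function.extend_apply' _ _ _ (by rintro ⟨v, e⟩; exact hw v e)
  have hamp : ∀ j, x' (ancW P (.amp j)) = x (ancW P (.amp j)) := by
    exact fun j => hoff _ (normEmb_ne (by simp) (by simp))
  have hsrc : ∀ b : Fin P.L, x' (srcW P b) = (X i >>> P.sh).testBit b := by
    intro b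
    rw [Nat.testBit_shiftRight]
    unfold srcW
    split_ifs with hb
    · exact (normEmb P).injective.extend_apply _ x (Sum.inr (Sum.inl ⟨P.sh + b, hb⟩))
    · rw [hoff, h.dum, Nat.testBit_lt_two_pow]
      · exact (hX i).trans_le (Nat.pow_le_pow_right (by norm_num) (not_lt.1 hb))
      · exact normEmb_ne (by simp) (by simp)
  obtain ⟨r, hr, e⟩ := cOp_amplitudeC (R := R) (N := N) (d := ancW P (.dum 0))
    (k := ancW P (.dum 1)) (t₀ := ancW P (.amp 0)) (t := fun b : Fin P.L => ancW P (.amp b.succ))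
    (src := srcW P) (by simp) (by simp) (by simp) (by simp) (by simp)
    (fun a b e => by simpa using e) (fun b => by simp [Fin.ext_iff])
    (fun a => by
      rcases srcW_cases a with ⟨j, e⟩ | e <;> rw [e] <;> simp)
    (hXL i) hsrc (by rw [hamp, hx]) (fun b => by rw [hamp, hx])
  refine ⟨flipOp (fun w => xor (x w) (x' w)) r, ?_, ?_⟩
  · intro z hz
    have := hr (xorMask (fun w => xor (x w) (x' w)) z) hz
    simp only [xorMask, hamp, Bool.xor_self, Bool.xor_false] at this
    rcases this with h | ⟨b, h⟩
    exacts [⟨_, h⟩, ⟨_, h⟩]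
  · rw [normAmpC, cOp_conjC normLoadC_avoids_ampSet hc (local_normAmp P R N _) (ket_mem_Agr _ x),
      flipOp_ket, xorMask_diff, e, map_add, map_smul, flipOp_ket]
    congr 3
    · rw [xorMask_eq_iff, xorMask_diff]

theorem local_rowLoadC : Local R N (rowLoadC P) {w | w ∈ workWires P} := by
  have h1 : Local R N (loadC P fun j => ancW P (.ridx j)) {w | w ∈ workWires P} := by
    have h : ∀ j, ancW P (.ridx j) ∈ {w | w ∈ workWires P} := fun j => by
      rw [Set.mem_ofPred_eq, mem_workWires]
      exact Or.inr (Or.inl ⟨j, rfl⟩)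
    exact (Local.copyC h).append (Local.copyC h)
  refine h1.append (Local.append (Local.of_wires fun g hg => ?_) h1.inv)
  rw [List.mem_singleton] at hg
  subst hg
  rintro _ ⟨v | v | v, rfl⟩ <;> rw [Set.mem_ofPred_eq, mem_workWires]
  exacts [Or.inr (Or.inl ⟨v, rfl⟩), Or.inr (Or.inr (Or.inl ⟨v, rfl⟩)),
    Or.inr (Or.inr (Or.inr ⟨v, rfl⟩))]

/-- The string `x` with the number `j` in the data register. -/
def withDat (P : RowParams) (j : ℕ) (x : RowWires P → Bool) : RowWires P → Bool :=
  Function.extend (fun k => ancW P (.dat k)) (bits (width P.d) j) x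

theorem withDat_dat (j : ℕ) (x : RowWires P → Bool) (k : Fin (width P.d)) :
    withDat P j x (ancW P (.dat k)) = bits (width P.d) j k :=
  Function.Injective.extend_apply (fun a b e => by simpa using e) _ _ k

theorem withDat_of_ne {j : ℕ} {x : RowWires P → Bool} {w : RowWires P}
    (h : ∀ k, ancW P (.dat k) ≠ w) : withDat P j x w = x w :=
  Function.extend_apply' _ _ _ (by rintro ⟨k, e⟩; exact h k e)

theorem Loaded.withDat {a : Bool → Fin P.n} {x : RowWires P → Bool} (h : Loaded P a x) (j : ℕ) :
    Loaded P a (withDat P j x) := by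
  refine h.congr fun w hw => withDat_of_ne fun k e => hw ?_
  rw [Set.mem_ofPred_eq, mem_workWires]
  exact Or.inr (Or.inr (Or.inl ⟨k, e.symm⟩))

theorem cOp_rowLoadC {σ : Fin P.n → Fin P.d → ℝ} (hR : ∀ i, R (accessKet P.w i fun _ => false)
      = ∑ j, (σ i j : ℂ) • accessKet P.w i (bits (width P.d) j))
    {a : Bool → Fin P.n} {x : RowWires P → Bool} (h : Loaded P a x)
    (h1 : ∀ j, x (ancW P (.ridx j)) = false) (h2 : ∀ j, x (ancW P (.dat j)) = false)
    (h3 : ∀ j, x (ancW P (.anc j)) = false) :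
    cOp R N (rowLoadC P) (ket x)
      = ∑ j, (σ (a (x (ancW P .sel))) j : ℂ) • ket (withDat P j x) := by
  have hinj : Function.Injective fun j => ancW P (.ridx j) := fun a b e => by simpa using e
  have hload : ∀ z, Loaded P a z → (∀ j, z (ancW P (.ridx j)) = false) →
      cOp R N (loadC P fun j => ancW P (.ridx j)) (ket z) = ket (Function.extend
        (fun j => ancW P (.ridx j)) (bits (width P.n) (a (z (ancW P .sel)))) z) := by
    intro z hz hz1
    rw [cOp_loadC hinj (by simp) (by simp) (by simp)]
    simp only [hz.sel, hz1, Bool.false_xor]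
  set i := a (x (ancW P .sel)) with hi
  rw [rowLoadC, conjC, cOp_append, cOp_append, hload x h h1, ← hi]
  have e1 : ∀ φ : QState (RowWires P), cOp R N [QGate.rowCall false (rowEmb P)] φ
      = applyOn (rowEmb P) R φ := fun _ => rfl
  rw [e1, applyOn_ket_sum (a := fun j => (σ i j : ℂ))
    (y := fun j : Fin P.d => Sum.elim (bits (width P.n) i)
      (Sum.elim (bits (width P.d) j) fun _ => false)), map_sum]
  · refine Finset.sum_congr rfl fun j _ => ?_
    rw [map_smul]
    congr 1
    have e2 := hload (withDat P j x) (h.withDat j) fun k => by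
      rw [withDat_of_ne (by simp), h1]
    rw [withDat_of_ne (by simp), ← hi] at e2
    have e3 : Function.extend (rowEmb P) (Sum.elim (bits (width P.n) i)
          (Sum.elim (bits (width P.d) j) fun _ => false))
          (Function.extend (fun j => ancW P (.ridx j)) (bits (width P.n) i) x)
        = Function.extend (fun j => ancW P (.ridx j)) (bits (width P.n) i) (withDat P j x) := by
      funext w
      by_cases hw : ∃ v, rowEmb P v = w
      · obtain ⟨v, rfl⟩ := hw
        rw [(rowEmb P).injective.extend_apply]
        rcases v with v | v | v
        · change bits (width P.n) i v
            = Function.extend (fun j => ancW P (.ridx j)) _ _ (ancW P (.ridx v))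
          exact (hinj.extend_apply _ _ v).symm
        · change _ = Function.extend _ _ _ (ancW P (.dat v))
          rw [Function.extend_apply' _ _ _ (by simp), withDat_dat]
          rfl
        · change _ = Function.extend _ _ _ (ancW P (.anc v))
          rw [Function.extend_apply' _ _ _ (by simp), withDat_of_ne (by simp), h3]
          rfl
      · have hw1 : ¬∃ j, ancW P (.ridx j) = w := fun ⟨j, e⟩ => hw ⟨Sum.inl j, e⟩
        rw [Function.extend_apply' _ _ _ hw, Function.extend_apply' _ _ _ hw1,
          Function.extend_apply' _ _ _ hw1,
          withDat_of_ne fun k e => hw ⟨Sum.inr (Sum.inl k), e⟩]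
    rw [e3, ← e2, cOp_cInv_cOp]
  · have := hR i
    simp only [accessKet] at this
    convert this using 3
    funext v
    rcases v with v | v | v
    · exact hinj.extend_apply _ _ v
    · change Function.extend _ _ _ (ancW P (.dat v)) = _
      rw [Function.extend_apply' _ _ _ (by simp)]
      exact h2 v
    · change Function.extend _ _ _ (ancW P (.anc v)) = _
      rw [Function.extend_apply' _ _ _ (by simp)]
      exact h3 v

theorem Pres.diffC
    (hN : ∀ i, N (accessKet 0 i fun _ => false) = accessKet 0 i (bits P.r (X i)))
    {a : Bool → Fin P.n} {x : RowWires P → Bool} (h : Loaded P a x) :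
    Pres R N (diffC P) {w | w ∈ workWires P} x := by
  have hs : Pres R N (selC P) {w | w ∈ workWires P} x :=
    Local.cg (by rw [Set.mem_ofPred_eq, mem_workWires, mem_cmpWires]; simp) x
  exact hs.append ((Pres.normAmpC hN h).append ((local_rowLoadC x).append hs))

theorem sqrt_two_half_sq : ((√2 / 2 : ℝ) : ℂ) * ((√2 / 2 : ℝ) : ℂ) = ((1 / 2 : ℝ) : ℂ) := by
  rw [← Complex.ofReal_mul]
  congr 1
  have := Real.mul_self_sqrt (show (0 : ℝ) ≤ 2 by norm_num)
  linarith

/-- The part of the state prepared by `diffC` with zeros on `cmpWires` is half of the difference of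
the two rows, up to the factor that is common to all rows. -/
theorem projOp_diffC {σ : Fin P.n → Fin P.d → ℝ} (hR : ∀ i, R (accessKet P.w i fun _ => false)
      = ∑ j, (σ i j : ℂ) • accessKet P.w i (bits (width P.d) j))
    (hN : ∀ i, N (accessKet 0 i fun _ => false) = accessKet 0 i (bits P.r (X i)))
    (hX : ∀ i, X i < 2 ^ P.r) (hXL : ∀ i, X i >>> P.sh < 2 ^ P.L)
    {a : Bool → Fin P.n} {x : RowWires P → Bool} (h : Loaded P a x)
    (hx : ∀ w ∈ workWires P, x w = false) :
    projOp (cmpWires P) (cOp R N (diffC P) (ket x)) = ∑ j,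
      (((normAmp P X (a false) * σ (a false) j - normAmp P X (a true) * σ (a true) j) / 2 : ℝ) : ℂ)
        • ket (withDat P j x) := by
  simp only [mem_workWires, mem_cmpWires] at hx
  set y : Bool → RowWires P → Bool := fun s => Function.update x (ancW P .sel) s with hy
  have hyL : ∀ s, Loaded P a (y s) := fun s => h.congr fun w hw => by
    refine Function.update_of_ne ?_ _ _
    rintro rfl
    rw [Set.mem_ofPred_eq, mem_workWires, mem_cmpWires] at hw
    simp at hw
  have hyne : ∀ s w, w ≠ ancW P .sel → y s w = x w := fun s w hw => Function.update_of_ne hw _ _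
  have hysel : ∀ s, y s (ancW P .sel) = s := fun s => Function.update_self _ _ _
  have hsel : ∀ z : RowWires P → Bool, cOp R N (selC P) (ket z)
      = ∑ s, (rot (-(Real.pi / 4))).1 s (z (ancW P .sel)) •
        ket (Function.update z (ancW P .sel) s) := fun z =>
    cOp_cg_ket R N (by simp) _ z
  -- The last gate, followed by the projection.
  have hlast : ∀ s (j : Fin P.d), projOp (cmpWires P) (cOp R N (selC P) (ket (withDat P j (y s))))
      = ((√2 / 2 : ℝ) : ℂ) • ket (withDat P j x) := by
    intro s j
    have e0 : ∀ s', Function.update (withDat P j (y s)) (ancW P .sel) s' = withDat P j (y s') := by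
      intro s'
      funext w
      by_cases hw : w = ancW P .sel
      · rw [hw, Function.update_self, withDat_of_ne (by simp), hysel]
      · rw [Function.update_of_ne hw]
        by_cases hw' : ∃ k, ancW P (.dat k) = w
        · obtain ⟨k, rfl⟩ := hw'
          rw [withDat_dat, withDat_dat]
        · rw [not_exists] at hw'
          rw [withDat_of_ne hw', withDat_of_ne hw', hyne _ _ hw, hyne _ _ hw]
    have e1 : projOp (cmpWires P) (ket (withDat P j (y true))) = 0 := by
      ext z
      rw [projOp_apply, ket_apply]
      split_ifs with h1 h2
      · rfl
      · exfalso
        apply h1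
        rw [h2]
        refine List.any_eq_true.2 ⟨ancW P .sel, by simp [cmpWires], ?_⟩
        rw [withDat_of_ne (by simp), hysel]
      · rfl
    have e2 : projOp (cmpWires P) (ket (withDat P j (y false))) = ket (withDat P j (y false)) := by
      ext z
      rw [projOp_apply, ket_apply]
      split_ifs with h1 h2
      · exfalso
        obtain ⟨w, hw, hw'⟩ := List.any_eq_true.1 h1
        rw [h2] at hw'
        rw [mem_cmpWires] at hw
        rcases hw with rfl | ⟨k, rfl⟩
        · rw [withDat_of_ne (by simp), hysel] at hw'
          exact absurd hw' (by simp)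
        · rw [withDat_of_ne (by simp), hyne _ _ (by simp), hx _ (by simp)] at hw'
          exact absurd hw' (by simp)
      · rfl
      · rfl
      · rfl
    have e3 : y false = x := by
      rw [hy]
      simp only
      rw [← hx (ancW P .sel) (by simp), Function.update_eq_self]
    rw [hsel, Fintype.sum_bool, map_add, map_smul, map_smul, e0, e0, e1, e2, e3, smul_zero,
        zero_add,
      withDat_of_ne (by simp), hysel]
    congr 1
    cases s <;> simp [rot]
  have hzero : ∀ r ∈ Supp (fun z : RowWires P → Bool => ∃ j, z (ancW P (.amp j)) = true),
      projOp (cmpWires P) (cOp R N (selC P) (cOp R N (rowLoadC P) r)) = 0 := by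
    intro r hr
    have hmem : ∀ c, Avoids c (ampSet P) →
        ∀ r ∈ Supp (fun z : RowWires P → Bool => ∃ j, z (ancW P (.amp j)) = true),
        cOp R N c r ∈ Supp fun z : RowWires P → Bool => ∃ j, z (ancW P (.amp j)) = true := by
      intro c hc r hr
      refine hc.supp ?_ hr
      rintro x z hz ⟨j, hj⟩
      exact ⟨j, by rw [hz _ ⟨j, rfl⟩, hj]⟩
    have := hmem (selC P) (cg_avoids (by simp [ampSet]) (by simp [ampSet]) (by simp [ampSet])) _
      (hmem (rowLoadC P) (rowLoadC_avoids (by simp [ampSet]) (by simp [ampSet]) (by simp [ampSet])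
        (by simp [ampSet]) (by simp [ampSet]) (by simp [ampSet])) r hr)
    ext z
    rw [projOp_apply]
    split_ifs with h1
    · rfl
    · by_contra h2
      obtain ⟨j, hj⟩ := this z h2
      exact h1 (List.any_eq_true.2 ⟨_, by simp [cmpWires], hj⟩)
  have hmid : ∀ s, projOp (cmpWires P) (cOp R N (selC P) (cOp R N (rowLoadC P)
      (cOp R N (normAmpC P) (ket (y s)))))
      = ∑ j, ((√2 / 2 * (normAmp P X (a s) * σ (a s) j) : ℝ) : ℂ) • ket (withDat P j x) := by
    intro s
    obtain ⟨r, hr, e⟩ := cOp_normAmpC (R := R) hN hX hXL (hyL s)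
      (fun j => by rw [hyne _ _ (by simp), hx _ (by simp)])
    rw [e, map_add, map_add, map_add, hzero r hr, add_zero, map_smul,
      cOp_rowLoadC hR (hyL s) (fun j => by rw [hyne _ _ (by simp), hx _ (by simp)])
        (fun j => by rw [hyne _ _ (by simp), hx _ (by simp)])
        (fun j => by rw [hyne _ _ (by simp), hx _ (by simp)]), hysel]
    simp only [map_smul, map_sum, hlast, Finset.smul_sum, smul_smul]
    refine Finset.sum_congr rfl fun j _ => ?_
    congr 1
    push_cast
    ring
  rw [diffC, cOp_append, cOp_append, cOp_append, hsel, Fintype.sum_bool, hx _ (by simp)]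
  simp only [map_add, map_smul]
  rw [hmid, hmid, Finset.smul_sum, Finset.smul_sum, ← Finset.sum_add_distrib]
  refine Finset.sum_congr rfl fun j _ => ?_
  rw [smul_smul, smul_smul, ← add_smul]
  congr 1
  have e1 : (rot (-(Real.pi / 4))).1 true false = -((√2 / 2 : ℝ) : ℂ) := by simp [rot]
  have e2 : (rot (-(Real.pi / 4))).1 false false = ((√2 / 2 : ℝ) : ℂ) := by simp [rot]
  have e3 : ∀ t : ℝ, ((√2 / 2 : ℝ) : ℂ) * ((√2 / 2 * t : ℝ) : ℂ) = ((1 / 2 * t : ℝ) : ℂ) := by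
    intro t
    rw [Complex.ofReal_mul, ← mul_assoc, sqrt_two_half_sq, Complex.ofReal_mul]
  rw [e1, e2, neg_mul, e3, e3]
  push_cast
  ring

end Compare

/-! ### The classical part of the row circuit -/

section Pairs

variable (P : RowParams)

/-- The wires of the flag number `a`. -/
def flagW (a : Fin 4) (k : ℕ) : RowWires P := ancW P (.flag a (Fin.ofNat (2 * width P.n + 1) k))

/-- The automata that compute the flags `p < q`, `n - 1 < q`, `i ≠ p` and `i ≠ q`. -/
def flagStep (a : Fin 4) (j : Fin (width P.n)) : ScanStep (RowWires P) :=
  match a with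
  | 0 => (Sum.inr (Sum.inl (Sum.inl j)), Sum.inr (Sum.inl (Sum.inr j)), fun s u v =>
        if u = v then s else v)
  | 1 => (Sum.inr (Sum.inl (Sum.inr j)), ancW P (.dum 0),
      fun s u _ => if (P.n - 1).testBit j = u then s else u)
  | 2 => (Sum.inl j, Sum.inr (Sum.inl (Sum.inl j)), fun s u v => s || xor u v)
  | 3 => (Sum.inl j, Sum.inr (Sum.inl (Sum.inr j)), fun s u v => s || xor u v)

/-- The circuit that computes a flag. -/
def flagC (a : Fin 4) : QCircuit (RowBox P) (NormBox P) (RowWires P) :=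
  scanC (flagW P a) 0 ((List.finRange _).map (flagStep P a))

/-- The circuit that decides whether `(p, q)` is a pair, whether it is incident to `i`, and copies
`p` and `q`, if it is a pair. -/
def pairC : QCircuit (RowBox P) (NormBox P) (RowWires P) :=
  (flagC P 0 ++ (flagC P 1 ++ (flagC P 2 ++ flagC P 3))) ++
  (xg (flagW P 0 (2 * width P.n)) (flagW P 1 (2 * width P.n)) (ancW P .valid) (fun u v =>
    u && !v) ++
  (xg (ancW P .valid) (flagW P 3 (2 * width P.n)) (ancW P .notq) and ++
  (xg (ancW P .valid) (flagW P 2 (2 * width P.n)) (ancW P .notp) and ++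
  (copyC (List.finRange _) (fun _ => ancW P .valid) (fun j => Sum.inr (Sum.inl (Sum.inl j)))
    (fun j => ancW P (.fst j)) and ++
  copyC (List.finRange _) (fun _ => ancW P .valid) (fun j => Sum.inr (Sum.inl (Sum.inr j)))
    (fun j => ancW P (.snd j)) and))))

theorem time_pairC_le (T : ℝ) : QCircuit.time T (pairC P) ≤ 14 * width P.n + 3 := by
  have h : ∀ a, QCircuit.time T (flagC P a) ≤ 3 * width P.n := by
    intro a
    have := time_scanC_le (Vr := RowBox P) (Vn := NormBox P) T (flagW P a) 0
      ((List.finRange _).map (flagStep P a))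
    simpa [flagC] using this
  have hx : ∀ (a b t : RowWires P) g,
      QCircuit.time T (xg (Vr := RowBox P) (Vn := NormBox P) a b t g) ≤ 1 := fun a b t g =>
    time_cg_le T a b t fun u v => notGate (g u v)
  have hc : ∀ (a b t : Fin (width P.n) → RowWires P) g, QCircuit.time T
      (copyC (Vr := RowBox P) (Vn := NormBox P) (List.finRange _) a b t g) ≤ width P.n := by
    intro a b t g
    have := time_copyC_le (Vr := RowBox P) (Vn := NormBox P) T (List.finRange _) a b t g
    rwa [List.length_finRange] at this
  simp only [pairC, time_append]
  have h0 := h 0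
  have h1 := h 1
  have h2 := h 2
  have h3 := h 3
  have x1 := hx (flagW P 0 (2 * width P.n)) (flagW P 1 (2 * width P.n)) (ancW P .valid)
    (fun u v => u && !v)
  have x2 := hx (ancW P .valid) (flagW P 3 (2 * width P.n)) (ancW P .notq) and
  have x3 := hx (ancW P .valid) (flagW P 2 (2 * width P.n)) (ancW P .notp) and
  have c1 := hc (fun _ => ancW P .valid) (fun j => Sum.inr (Sum.inl (Sum.inl j)))
    (fun j => ancW P (.fst j)) and
  have c2 := hc (fun _ => ancW P .valid) (fun j => Sum.inr (Sum.inl (Sum.inr j)))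
    (fun j => ancW P (.snd j)) and
  linarith

variable {P}

theorem flagC_avoids (a : Fin 4) {V : Set (RowWires P)} (h0 : ∀ j, Sum.inl j ∉ V)
    (h1 : ∀ j, Sum.inr (Sum.inl j) ∉ V) (h2 : ancW P (.dum 0) ∉ V)
    (h3 : ∀ a j, ancW P (.flag a j) ∉ V) : Avoids (flagC P a) V := by
  refine scanC_avoids (fun k => h3 _ _) 0 fun p hp => ?_
  obtain ⟨j, -, rfl⟩ := List.mem_map.1 hp
  fin_cases a
  exacts [⟨h1 _, h1 _⟩, ⟨h1 _, h2⟩, ⟨h0 _, h1 _⟩, ⟨h0 _, h1 _⟩]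

theorem pairC_avoids {V : Set (RowWires P)} (h0 : ∀ j, Sum.inl j ∉ V)
    (h1 : ∀ j, Sum.inr (Sum.inl j) ∉ V) (h2 : ancW P (.dum 0) ∉ V)
    (h3 : ∀ a j, ancW P (.flag a j) ∉ V) (h4 : ancW P .valid ∉ V) (h5 : ancW P .notq ∉ V)
    (h6 : ancW P .notp ∉ V) (h7 : ∀ j, ancW P (.fst j) ∉ V) (h8 : ∀ j, ancW P (.snd j) ∉ V) :
    Avoids (pairC P) V := by
  have hf := fun a => flagC_avoids a h0 h1 h2 h3
  exact ((hf 0).append ((hf 1).append ((hf 2).append (hf 3)))).append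
    ((cg_avoids (h3 _ _) (h3 _ _) h4).append ((cg_avoids h4 (h3 _ _) h5).append
      ((cg_avoids h4 (h3 _ _) h6).append ((copyC_avoids (fun _ => h4) (fun _ => h1 _) h7).append
        (copyC_avoids (fun _ => h4) (fun _ => h1 _) h8)))))

variable {R : QUnitary (RowBox P)} {N : QUnitary (NormBox P)}

theorem flagW_injOn (a : Fin 4) : Set.InjOn (flagW P a) (Set.Iic (2 * width P.n)) := by
  intro i hi j hj h
  simp only [flagW, ancW, Sum.inr.injEq, RowAnc.flag.injEq, Fin.ext_iff, Fin.val_ofNat,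
    true_and] at h
  rwa [Nat.mod_eq_of_lt (Nat.lt_succ_of_le hi), Nat.mod_eq_of_lt (Nat.lt_succ_of_le hj)] at h

theorem cOp_flagC (a : Fin 4) {x : RowWires P → Bool}
    (hx : ∀ j, x (ancW P (.flag a j)) = false) :
    ∃ x' : RowWires P → Bool, (∀ w, (∀ j, w ≠ ancW P (.flag a j)) → x' w = x w) ∧
      x' (flagW P a (2 * width P.n)) = scanVal x false ((List.finRange _).map (flagStep P a)) ∧
      cOp R N (flagC P a) (ket x) = ket x' := by
  obtain ⟨x', h1, h2, h3⟩ := cOp_scanC_ket R N (flagW_injOn a)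
    ((List.finRange _).map (flagStep P a)) 0 (by simp)
    (by
      intro p hp
      obtain ⟨j, -, rfl⟩ := List.mem_map.1 hp
      fin_cases a <;> exact ⟨by simp [flagStep], fun k _ => ⟨by simp [flagStep, flagW],
        by simp [flagStep, flagW]⟩⟩) x (fun k _ _ => hx _)
  refine ⟨x', fun w hw => h1 w fun k _ _ => hw _, ?_, h3⟩
  rw [← hx (Fin.ofNat _ 0), ← flagW, ← h2]
  simp

/-- The result of `pairC` on the index `i` and the pair `(p, q)`. -/
theorem cOp_pairC {x : RowWires P → Bool} {i p q : ℕ} (hi : i < P.n) (hp : p < 2 ^ width P.n)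
    (hq : q < 2 ^ width P.n) (hxi : ∀ j, x (Sum.inl j) = bits (width P.n) i j)
    (hxp : ∀ j, x (Sum.inr (Sum.inl (Sum.inl j))) = bits (width P.n) p j)
    (hxq : ∀ j, x (Sum.inr (Sum.inl (Sum.inr j))) = bits (width P.n) q j)
    (hx : ∀ a, x (ancW P a) = false) :
    ∃ x' : RowWires P → Bool,
      (∀ w, (∀ a j, w ≠ ancW P (.flag a j)) → w ≠ ancW P .valid → w ≠ ancW P .notq →
        w ≠ ancW P .notp → (∀ j, w ≠ ancW P (.fst j)) → (∀ j, w ≠ ancW P (.snd j)) →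
        x' w = x w) ∧
      x' (ancW P .notq) = (decide (p < q ∧ q < P.n) && decide (i ≠ q)) ∧
      x' (ancW P .notp) = (decide (p < q ∧ q < P.n) && decide (i ≠ p)) ∧
      (∀ j, x' (ancW P (.fst j)) = (decide (p < q ∧ q < P.n) && bits (width P.n) p j)) ∧
      (∀ j, x' (ancW P (.snd j)) = (decide (p < q ∧ q < P.n) && bits (width P.n) q j)) ∧
      cOp R N (pairC P) (ket x) = ket x' := by
  have hi' := lt_two_pow_width hi
  have hn' := lt_two_pow_width (show P.n - 1 < P.n by omega)
  obtain ⟨x1, a1, b1, c1⟩ := cOp_flagC (R := R) (N := N) 0 (x := x) (fun j => hx _)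
  obtain ⟨x2, a2, b2, c2⟩ := cOp_flagC (R := R) (N := N) 1 (x := x1)
    (fun j => by rw [a1 _ (by simp), hx])
  obtain ⟨x3, a3, b3, c3⟩ := cOp_flagC (R := R) (N := N) 2 (x := x2)
    (fun j => by rw [a2 _ (by simp), a1 _ (by simp), hx])
  obtain ⟨x4, a4, b4, c4⟩ := cOp_flagC (R := R) (N := N) 3 (x := x3)
    (fun j => by rw [a3 _ (by simp), a2 _ (by simp), a1 _ (by simp), hx])
  have k0 : x4 (flagW P 0 (2 * width P.n)) = decide (p < q) := by
    rw [a4 _ (by simp [flagW]), a3 _ (by simp [flagW]), a2 _ (by simp [flagW]), b1,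
      scanVal_lt x p q (flagStep P 0) fun j s => by simp [flagStep, hxp, hxq, bits],
      Nat.mod_eq_of_lt hp, Nat.mod_eq_of_lt hq]
  have k1 : x4 (flagW P 1 (2 * width P.n)) = decide (P.n - 1 < q) := by
    rw [a4 _ (by simp [flagW]), a3 _ (by simp [flagW]), b2,
      scanVal_lt x1 (P.n - 1) q (flagStep P 1) fun j s => by
        simp only [flagStep]
        rw [a1 _ (by simp), hxq, bits],
      Nat.mod_eq_of_lt hn', Nat.mod_eq_of_lt hq]
  have k2 : x4 (flagW P 2 (2 * width P.n)) = decide (i ≠ p) := by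
    rw [a4 _ (by simp [flagW]), b3,
      scanVal_ne x2 i p (flagStep P 2) fun j s => by
        simp only [flagStep]
        rw [a2 _ (by simp), a1 _ (by simp), a2 _ (by simp), a1 _ (by simp), hxi, hxp, bits, bits],
      Nat.mod_eq_of_lt hi', Nat.mod_eq_of_lt hp]
  have k3 : x4 (flagW P 3 (2 * width P.n)) = decide (i ≠ q) := by
    rw [b4,
      scanVal_ne x3 i q (flagStep P 3) fun j s => by
        simp only [flagStep]
        rw [a3 _ (by simp), a2 _ (by simp), a1 _ (by simp), a3 _ (by simp), a2 _ (by simp),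
          a1 _ (by simp), hxi, hxq, bits, bits],
      Nat.mod_eq_of_lt hi', Nat.mod_eq_of_lt hq]
  have k : ∀ w, (∀ a j, w ≠ ancW P (.flag a j)) → x4 w = x w := fun w hw => by
    rw [a4 w (hw 3), a3 w (hw 2), a2 w (hw 1), a1 w (hw 0)]
  have hv : (decide (p < q) && !decide (P.n - 1 < q)) = decide (p < q ∧ q < P.n) := by
    rw [Bool.eq_iff_iff]
    simp only [Bool.and_eq_true, Bool.not_eq_true', decide_eq_true_eq, decide_eq_false_iff_not]
    omega
  have inj1 : Function.Injective fun j => ancW P (.fst j) := fun a b e => by simpa using e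
  have inj2 : Function.Injective fun j => ancW P (.snd j) := fun a b e => by simpa using e
  set x5 := Function.update x4 (ancW P .valid) (decide (p < q ∧ q < P.n)) with e5
  set x6 := Function.update x5 (ancW P .notq) (decide (p < q ∧ q < P.n) && decide (i ≠ q)) with e6
  set x7 := Function.update x6 (ancW P .notp) (decide (p < q ∧ q < P.n) && decide (i ≠ p)) with e7
  set x8 := Function.extend (fun j => ancW P (.fst j))
    (fun j => decide (p < q ∧ q < P.n) && bits (width P.n) p j) x7 with e8
  set x9 := Function.extend (fun j => ancW P (.snd j))
    (fun j => decide (p < q ∧ q < P.n) && bits (width P.n) q j) x8 with e9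
  have l9 : ∀ w, (∀ j, w ≠ ancW P (.snd j)) → x9 w = x8 w := fun w hw =>
    Function.extend_apply' _ _ _ (by rintro ⟨j, e⟩; exact hw j e.symm)
  have l8 : ∀ w, (∀ j, w ≠ ancW P (.fst j)) → x8 w = x7 w := fun w hw =>
    Function.extend_apply' _ _ _ (by rintro ⟨j, e⟩; exact hw j e.symm)
  have l7 : ∀ w, w ≠ ancW P .notp → x7 w = x6 w := fun w hw => Function.update_of_ne hw _ _
  have l6 : ∀ w, w ≠ ancW P .notq → x6 w = x5 w := fun w hw => Function.update_of_ne hw _ _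
  have l5 : ∀ w, w ≠ ancW P .valid → x5 w = x4 w := fun w hw => Function.update_of_ne hw _ _
  have v5 : x5 (ancW P .valid) = decide (p < q ∧ q < P.n) := Function.update_self _ _ _
  refine ⟨x9, ?_, ?_, ?_, ?_, ?_, ?_⟩
  · intro w h1 h2 h3 h4 h5 h6
    rw [l9 w h6, l8 w h5, l7 w h4, l6 w h3, l5 w h2, k w h1]
  · rw [l9 _ (by simp), l8 _ (by simp), l7 _ (by simp), e6, Function.update_self]
  · rw [l9 _ (by simp), l8 _ (by simp), e7, Function.update_self]
  · intro j
    rw [l9 _ (by simp)]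
    exact inj1.extend_apply _ _ j
  · intro j
    exact inj2.extend_apply _ _ j
  · have g5 : cOp R N (xg (flagW P 0 (2 * width P.n)) (flagW P 1 (2 * width P.n)) (ancW P .valid)
        (fun u v => u && !v)) (ket x4) = ket x5 := by
      rw [cOp_xg_ket R N (by simp [flagW]), k _ (by simp), hx, k0, k1, hv, Bool.false_xor]
    have g6 : cOp R N (xg (ancW P .valid) (flagW P 3 (2 * width P.n)) (ancW P .notq) and) (ket x5)
        = ket x6 := by
      rw [cOp_xg_ket R N (by simp [flagW]), l5 _ (by simp), k _ (by simp), hx, v5,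
        l5 _ (by simp [flagW]), k3, Bool.false_xor]
    have g7 : cOp R N (xg (ancW P .valid) (flagW P 2 (2 * width P.n)) (ancW P .notp) and) (ket x6)
        = ket x7 := by
      rw [cOp_xg_ket R N (by simp [flagW]), l6 _ (by simp), l6 _ (by simp), v5, l5 _ (by simp),
        k _ (by simp), hx, l6 _ (by simp [flagW]), l5 _ (by simp [flagW]), k2, Bool.false_xor]
    have g8 : cOp R N (copyC (List.finRange _) (fun _ => ancW P .valid)
        (fun j => Sum.inr (Sum.inl (Sum.inl j))) (fun j => ancW P (.fst j)) and) (ket x7)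
        = ket x8 := by
      rw [cOp_copyC R N (List.nodup_finRange _) (List.mem_finRange) inj1 (by simp)]
      congr 2
      funext j
      rw [l7 _ (by simp), l6 _ (by simp), l5 _ (by simp), k _ (by simp), hx, l7 _ (by simp),
        l6 _ (by simp), v5, l7 _ (by simp), l6 _ (by simp), l5 _ (by simp), k _ (by simp), hxp,
        Bool.false_xor]
    have g9 : cOp R N (copyC (List.finRange _) (fun _ => ancW P .valid)
        (fun j => Sum.inr (Sum.inl (Sum.inr j))) (fun j => ancW P (.snd j)) and) (ket x8)
        = ket x9 := by
      rw [cOp_copyC R N (List.nodup_finRange _) (List.mem_finRange) inj2 (by simp)]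
      congr 2
      funext j
      rw [l8 _ (by simp), l7 _ (by simp), l6 _ (by simp), l5 _ (by simp), k _ (by simp), hx,
        l8 _ (by simp), l7 _ (by simp), l6 _ (by simp), v5, l8 _ (by simp), l7 _ (by simp),
        l6 _ (by simp), l5 _ (by simp), k _ (by simp), hxq, Bool.false_xor]
    simp only [pairC, cOp_append, c1, c2, c3, c4, g5, g6, g7, g8, g9]

end Pairs

/-! ### The state of a row -/

section Row

variable (P : RowParams)

/-- The weights of an entry of row `i` in the column `(p, q)`, multiplied by `s / 4`: the constant
part, and the part that is multiplied by `s` and by the indicator of an edge. The bits `u`, `v` say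
that `(p, q)` is a pair and `i ≠ q`, respectively `i ≠ p`. -/
def entryWeights (u v : Bool) : ℝ × ℝ :=
  if u then (P.s * P.εB / 4, if v then 0 else (1 - P.εB) / 4)
  else if v then (P.s * P.εB / 4, -(1 + P.εB) / 4) else (0, 0)

/-- The circuit that multiplies the amplitude by the entry of the matrix. -/
def entryC : QCircuit (RowBox P) (NormBox P) (RowWires P) :=
  conjC (diffC P) (lcuC (scrW P) (ancW P (.dum 0)) (diffC P) (workWires P) (cmpWires P)
    (ancW P .notq) (ancW P .notp) (entryWeights P) (ancW P (.deg 0))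
    ((List.finRange (P.K + 2)).map fun j => ancW P (.deg j.succ)) P.s P.K P.c)

/-- The circuit that prepares an unnormalized row. -/
def unscaledRowC : QCircuit (RowBox P) (NormBox P) (RowWires P) :=
  uniformC (ancW P (.dum 0)) (ancW P (.dum 1)) (pairWires P) ++ conjC (pairC P) (entryC P)

/-- The circuit that prepares a row. -/
def rowC : QCircuit (RowBox P) (NormBox P) (RowWires P) :=
  normalizeC (scrW P) (ancW P (.dum 0)) (ancW P (.dum 1)) (unscaledRowC P)
    (pairWires P ++ (workWires P ++ degWires P)) (workWires P ++ degWires P) (ancW P (.dum 1))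
    (ancW P (.dum 2)) (ancW P (.cod 0)) ((List.finRange (P.J + 2)).map fun j =>
      ancW P (.cod j.succ))
    P.J P.b P.rr

/-- The basis state with index `i`, the bits `y` in the registers of the pair, and zero ancillas. -/
def rowStr (i : Fin P.n) (y : Fin (width P.n) ⊕ Fin (width P.n) → Bool) : RowWires P → Bool :=
  Sum.elim (bits (width P.n) i) (Sum.elim y fun _ => false)

variable {P}

/-- The parameters of the polynomial that decides whether a pair is an edge are admissible. -/
structure RowParams.Good (P : RowParams) : Prop where
  s_nonneg : 0 ≤ P.s
  s_le : P.s ≤ 1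
  sum_le : P.s * ∑ k ∈ Finset.range (P.K + 1), |P.c k| ≤ 1
  εB_nonneg : 0 ≤ P.εB
  εB_le : P.εB ≤ 1

theorem abs_entryWeights_le (hP : P.Good) (u v : Bool) :
    |(entryWeights P u v).1| + |(entryWeights P u v).2| ≤ 1 := by
  have h1 : P.s * P.εB ≤ 1 := by nlinarith [hP.s_nonneg, hP.s_le, hP.εB_nonneg, hP.εB_le]
  have h2 : 0 ≤ P.s * P.εB := mul_nonneg hP.s_nonneg hP.εB_nonneg
  have h3 := hP.εB_nonneg
  have h4 := hP.εB_le
  cases u <;> cases v <;> simp only [entryWeights, if_true, if_false, Bool.false_eq_true]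
  · simp
  · rw [abs_of_nonneg (by positivity), abs_of_nonpos (by linarith)]
    linarith
  · rw [abs_of_nonneg (by positivity), abs_of_nonneg (by linarith)]
    linarith
  · rw [abs_of_nonneg (by positivity)]
    simp
    linarith

theorem degWires_eq : ancW P (.deg 0) :: (List.finRange (P.K + 2)).map (fun j =>
    ancW P (.deg j.succ))
    = degWires P := by
  rw [degWires, List.finRange_succ (n := P.K + 2), List.map_cons, List.map_map]
  rfl

theorem codWires_eq : ancW P (.cod 0) :: (List.finRange (P.J + 2)).map (fun j =>
    ancW P (.cod j.succ))
    = codWires P := by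
  rw [codWires, List.finRange_succ (n := P.J + 2), List.map_cons, List.map_map]
  rfl

theorem degWires_nodup : (degWires P).Nodup :=
  List.Nodup.map (fun a b e => by simpa using e) (List.nodup_finRange _)

theorem codWires_nodup : (codWires P).Nodup :=
  List.Nodup.map (fun a b e => by simpa using e) (List.nodup_finRange _)

theorem pairWires_nodup : (pairWires P).Nodup := by
  refine List.Nodup.append (List.Nodup.map (fun a b e => by simpa using e) (List.nodup_finRange _))
    (List.Nodup.map (fun a b e => by simpa using e) (List.nodup_finRange _)) ?_
  intro w h1 h2
  obtain ⟨a, -, rfl⟩ := List.mem_map.1 h1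
  obtain ⟨b, -, e⟩ := List.mem_map.1 h2
  simp at e

theorem length_cmpWires : (cmpWires P).length = P.L + 2 := by simp [cmpWires]

theorem length_workWires :
    (workWires P).length = P.L + 2 + (width P.n + (width P.d + P.w)) := by
  simp [workWires, cmpWires]
  omega

theorem length_degWires : (degWires P).length = P.K + 3 := by simp [degWires]

theorem length_pairWires : (pairWires P).length = width P.n + width P.n := by simp [pairWires]

variable {R : QUnitary (RowBox P)} {N : QUnitary (NormBox P)} {X : Fin P.n → ℕ}

/-- The scratch wires are not among the other wires. -/
theorem scrW_ne (k : ℕ) : scrW P k ∉ workWires P ∧ scrW P k ∉ degWires P ∧ scrW P k ∉ codWires P ∧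
    scrW P k ∉ pairWires P ∧ ∀ j, scrW P k ≠ ancW P (.dum j) := by
  simp [mem_workWires, mem_cmpWires, mem_degWires, mem_codWires, mem_pairWires, scrW]

theorem lcuWires_entry
    (hN : ∀ i, N (accessKet 0 i fun _ => false) = accessKet 0 i (bits P.r (X i)))
    {a : Bool → Fin P.n} {x : RowWires P → Bool} (h : Loaded P a x)
    (hx : ∀ w, w ∈ workWires P ∨ w ∈ degWires P → x w = false)
    (hs : ∀ k, x (scrW P k) = false) :
    LcuWires R N (scrW P) P.size (ancW P (.dum 0)) (diffC P) (workWires P) (cmpWires P)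
      (ancW P .notq) (ancW P .notp) (ancW P (.deg 0))
      ((List.finRange (P.K + 2)).map fun j => ancW P (.deg j.succ)) {w | w ∈ workWires P}
      {w | w ∈ degWires P} x where
  grover :=
    { inj := scrW_injOn P
      dummy := fun k _ => ((scrW_ne k).2.2.2.2 0).symm
      length₀ := by rw [length_workWires, RowParams.size]; omega
      length₁ := by rw [length_cmpWires, RowParams.size]; omega
      list₀ := fun w hw => ⟨by rintro rfl; simp [mem_workWires, mem_cmpWires] at hw,
        fun k _ e => (scrW_ne k).1 (e ▸ hw)⟩
      list₁ := fun w hw => ⟨by rintro rfl; simp [mem_cmpWires] at hw,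
        fun k _ e => (scrW_ne k).1 ((mem_workWires P _).2 (Or.inl (e ▸ hw)))⟩
      scratch := fun k _ => ⟨by
        rintro (h | h)
        exacts [(scrW_ne k).1 h, (scrW_ne k).2.1 h], hs k⟩ }
  pres := Pres.diffC hN h
  avoids := by
    refine diffC_avoids (fun w hw => ?_) ?_ ?_ ?_ ?_ ?_
    · simp only [mem_workWires, mem_cmpWires] at hw
      rcases hw with (rfl | ⟨j, rfl⟩) | ⟨j, rfl⟩ | ⟨j, rfl⟩ | ⟨j, rfl⟩ <;> simp [mem_degWires]
    all_goals simp [mem_degWires]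
  dummy := by simp [mem_degWires]
  list₀ := fun w => Iff.rfl
  list₁ := fun w hw => (mem_workWires P _).2 (Or.inl hw)
  disj := by
    simp only [Set.mem_ofPred_eq, mem_workWires, mem_cmpWires, mem_degWires]
    rintro w ((rfl | ⟨j, rfl⟩) | ⟨j, rfl⟩ | ⟨j, rfl⟩ | ⟨j, rfl⟩) <;> simp
  mem := fun w => by rw [degWires_eq]; rfl
  nodup := by rw [degWires_eq]; exact degWires_nodup
  ne := by simp
  fst := by simp [mem_degWires, mem_workWires, mem_cmpWires]
  snd := by simp [mem_degWires, mem_workWires, mem_cmpWires]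
  zero := hx

theorem Pres.entryC
    (hN : ∀ i, N (accessKet 0 i fun _ => false) = accessKet 0 i (bits P.r (X i)))
    {a : Bool → Fin P.n} {x : RowWires P → Bool} (h : Loaded P a x)
    (hx : ∀ w, w ∈ workWires P ∨ w ∈ degWires P → x w = false)
    (hs : ∀ k, x (scrW P k) = false) :
    Pres R N (entryC P) ({w | w ∈ workWires P} ∪ {w | w ∈ degWires P}) x := by
  have hw := lcuWires_entry (R := R) hN h hx hs
  have hd := hw.pres.union hw.avoids
  exact hd.append ((Pres.lcuC hw _ _ _ _).append hd.inv)

theorem norm_sq_sum_ket {W κ : Type} [Fintype W] [DecidableEq W] [Fintype κ] {f : κ → W → Bool}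
    (hf : Function.Injective f) (a : κ → ℂ) :
    ‖∑ j, a j • ket (f j)‖ ^ 2 = ∑ j, ‖a j‖ ^ 2 := by
  have key : ∀ z, (∑ j, a j • ket (f j) : QState W) z = ∑ j, if z = f j then a j else 0 := by
    intro z
    simp [ket_apply]
  rw [EuclideanSpace.norm_sq_eq]
  symm
  refine Fintype.sum_of_injective f hf _ _ (fun z hz => ?_) fun j => ?_
  · rw [key, Finset.sum_eq_zero, norm_zero, zero_pow two_ne_zero]
    intro j _
    rw [if_neg]
    rintro rfl
    exact hz ⟨j, rfl⟩
  · rw [key, Finset.sum_eq_single j]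
    · simp
    · intro i _ hi
      rw [if_neg fun e => hi (hf e).symm]
    · simp

theorem withDat_injective (x : RowWires P → Bool) :
    Function.Injective fun j : Fin P.d => withDat P j x := by
  intro i j h
  refine Fin.ext ((bits_eq_iff (lt_two_pow_width i.2) (lt_two_pow_width j.2)).1 ?_)
  funext k
  have := congrFun h (ancW P (.dat k))
  simpa only [withDat_dat] using this

/-- The cosine of the angle that belongs to a pair of rows. -/
def pairCos (P : RowParams) (σ : Fin P.n → Fin P.d → ℝ) (X : Fin P.n → ℕ) (p q : Fin P.n) : ℝ :=
  (∑ j, (normAmp P X p * σ p j - normAmp P X q * σ q j) ^ 2) / 2 - 1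

theorem groverCos_diffC {σ : Fin P.n → Fin P.d → ℝ} (hR : ∀ i, R (accessKet P.w i fun _ => false)
      = ∑ j, (σ i j : ℂ) • accessKet P.w i (bits (width P.d) j))
    (hN : ∀ i, N (accessKet 0 i fun _ => false) = accessKet 0 i (bits P.r (X i)))
    (hX : ∀ i, X i < 2 ^ P.r) (hXL : ∀ i, X i >>> P.sh < 2 ^ P.L)
    {a : Bool → Fin P.n} {x : RowWires P → Bool} (h : Loaded P a x)
    (hx : ∀ w ∈ workWires P, x w = false) :
    groverCos R N (diffC P) (cmpWires P) x = pairCos P σ X (a false) (a true) := by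
  rw [groverCos, projOp_diffC hR hN hX hXL h hx, norm_sq_sum_ket (withDat_injective x), pairCos]
  simp only [Complex.norm_real, Real.norm_eq_abs, sq_abs, div_pow, ← Finset.sum_div]
  ring

theorem abs_groverCos_le {W Vr Vn : Type} [Fintype W] [DecidableEq W] [Fintype Vr] [DecidableEq Vr]
    [Fintype Vn] [DecidableEq Vn] (R : QUnitary Vr) (N : QUnitary Vn) (E : QCircuit Vr Vn W)
    (l : List W) (x : W → Bool) : -1 ≤ groverCos R N E l x ∧ groverCos R N E l x ≤ 1 := by
  have h := norm_sq_projOp_add l (cOp R N E (ket x))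
  rw [LinearIsometryEquiv.norm_map, norm_ket] at h
  have h1 := sq_nonneg ‖projOp l (cOp R N E (ket x))‖
  have h2 := sq_nonneg ‖cOp R N E (ket x) - projOp l (cOp R N E (ket x))‖
  rw [groverCos]
  constructor <;> linarith

/-- The value of the polynomial at the angle of a pair. -/
def edgeValue (P : RowParams) (σ : Fin P.n → Fin P.d → ℝ) (X : Fin P.n → ℕ) (p q : Fin P.n) : ℝ :=
  ∑ k ∈ Finset.range (P.K + 1), P.c k * Real.cos (k * Real.arccos (pairCos P σ X p q))

/-- The diagonal entry of `entryC`: the polynomial of the Grover iterate, conjugated by `diffC`, is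
the component along the state that `diffC` prepares, and this is the value of the polynomial. -/
theorem entryC_apply (hP : P.Good) {σ : Fin P.n → Fin P.d → ℝ}
    (hR : ∀ i, R (accessKet P.w i fun _ => false)
      = ∑ j, (σ i j : ℂ) • accessKet P.w i (bits (width P.d) j))
    (hN : ∀ i, N (accessKet 0 i fun _ => false) = accessKet 0 i (bits P.r (X i)))
    (hX : ∀ i, X i < 2 ^ P.r) (hXL : ∀ i, X i >>> P.sh < 2 ^ P.L)
    {a : Bool → Fin P.n} {x : RowWires P → Bool} (h : Loaded P a x)
    (hx : ∀ w, w ∈ workWires P ∨ w ∈ degWires P → x w = false)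
    (hs : ∀ k, x (scrW P k) = false) :
    cOp R N (entryC P) (ket x) x
      = (((entryWeights P (x (ancW P .notq)) (x (ancW P .notp))).1
        + (entryWeights P (x (ancW P .notq)) (x (ancW P .notp))).2
          * (P.s * edgeValue P σ X (a false) (a true)) : ℝ) : ℂ) := by
  have hw := lcuWires_entry (R := R) hN h hx hs
  have hcos := groverCos_diffC hR hN hX hXL h fun w hw => hx w (Or.inl hw)
  have hb := abs_groverCos_le R N (diffC P) (cmpWires P) x
  rw [← inner_ket_left, entryC, conjC, cOp_append, cOp_append,
    ← LinearIsometryEquiv.inner_map_map (cOp R N (diffC P)), cOp_cOp_cInv]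
  rw [hcos] at hb
  rw [inner_cOp_lcuC hw (by simp) (abs_entryWeights_le hP _ _)
    (by rw [abs_of_nonneg hP.s_nonneg]; exact hP.sum_le)
    ((Real.cos_arccos hb.1 hb.2).trans hcos.symm)]
  rfl

/-- The bits in the registers of the pair, as two numbers. -/
theorem exists_pair_bits {m : ℕ} (y : Fin m ⊕ Fin m → Bool) :
    ∃ p < 2 ^ m, ∃ q < 2 ^ m, y = Sum.elim (bits m p) (bits m q) := by
  obtain ⟨p, hp, e1⟩ := exists_eq_bits fun j => y (Sum.inl j)
  obtain ⟨q, hq, e2⟩ := exists_eq_bits fun j => y (Sum.inr j)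
  refine ⟨p, hp, q, hq, ?_⟩
  funext j
  rcases j with j | j
  exacts [congrFun e1 j, congrFun e2 j]

/-- The basis state after the classical part of the circuit. -/
structure Prepared (P : RowParams) (i : Fin P.n) (p q : ℕ) (a : Bool → Fin P.n)
    (x : RowWires P → Bool) : Prop where
  loaded : Loaded P a x
  zero : ∀ w, w ∈ workWires P ∨ w ∈ degWires P → x w = false
  scratch : ∀ k, x (scrW P k) = false
  notq : x (ancW P .notq) = (decide (p < q ∧ q < P.n) && decide ((i : ℕ) ≠ q))
  notp : x (ancW P .notp) = (decide (p < q ∧ q < P.n) && decide ((i : ℕ) ≠ p))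
  pair : p < q ∧ q < P.n → ((a false : Fin P.n) : ℕ) = p ∧ ((a true : Fin P.n) : ℕ) = q

theorem exists_prepared (i : Fin P.n) {p q : ℕ} (hp : p < 2 ^ width P.n) (hq : q < 2 ^ width P.n) :
    ∃ a x, Prepared P i p q a x ∧ cOp R N (pairC P)
      (ket (rowStr P i (Sum.elim (bits (width P.n) p) (bits (width P.n) q)))) = ket x := by
  obtain ⟨x, h1, h2, h3, h4, h5, h6⟩ := cOp_pairC (R := R) (N := N)
    (x := rowStr P i (Sum.elim (bits (width P.n) p) (bits (width P.n) q))) i.2 hp hq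
    (fun _ => rfl) (fun _ => rfl) (fun _ => rfl) fun _ => rfl
  have hz : ∀ b, (∀ a j, b ≠ .flag a j) → b ≠ .valid → b ≠ .notq → b ≠ .notp →
      (∀ j, b ≠ .fst j) → (∀ j, b ≠ .snd j) → x (ancW P b) = false := by
    intro b e1 e2 e3 e4 e5 e6
    rw [h1] <;> simp_all [rowStr]
  have hL : ∀ a : Bool → Fin P.n, (∀ j, x (ancW P (.fst j)) = bits (width P.n) (a false) j) →
      (∀ j, x (ancW P (.snd j)) = bits (width P.n) (a true) j) → Loaded P a x := fun a e1 e2 =>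
    ⟨e1, e2, fun j => hz _ (by simp) (by simp) (by simp) (by simp) (by simp) (by simp),
      fun j => hz _ (by simp) (by simp) (by simp) (by simp) (by simp) (by simp),
      hz _ (by simp) (by simp) (by simp) (by simp) (by simp) (by simp)⟩
  have hZ : ∀ w, w ∈ workWires P ∨ w ∈ degWires P → x w = false := by
    simp only [mem_workWires, mem_cmpWires, mem_degWires]
    rintro w (((rfl | ⟨j, rfl⟩) | ⟨j, rfl⟩ | ⟨j, rfl⟩ | ⟨j, rfl⟩) | ⟨j, rfl⟩) <;>
      exact hz _ (by simp) (by simp) (by simp) (by simp) (by simp) (by simp)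
  have hS : ∀ k, x (scrW P k) = false := fun k =>
    hz _ (by simp) (by simp) (by simp) (by simp) (by simp) (by simp)
  by_cases hv : p < q ∧ q < P.n
  · refine ⟨fun b => if b then ⟨q, hv.2⟩ else ⟨p, hv.1.trans hv.2⟩, x, ⟨hL _ ?_ ?_, hZ, hS, h2, h3,
      fun _ => ⟨rfl, rfl⟩⟩, h6⟩
    · intro j
      rw [h4]
      simp [hv]
    · intro j
      rw [h5]
      simp [hv]
  · have hn : 0 < P.n := Nat.lt_of_le_of_lt (Nat.zero_le _) i.2
    refine ⟨fun _ => ⟨0, hn⟩, x, ⟨hL _ ?_ ?_, hZ, hS, h2, h3, fun h => absurd h hv⟩, h6⟩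
    · intro j
      rw [h4]
      simp [hv, bits_zero]
    · intro j
      rw [h5]
      simp [hv, bits_zero]

theorem pairC_avoids_work :
    Avoids (pairC P) ({w | w ∈ workWires P} ∪ {w | w ∈ degWires P}) := by
  refine pairC_avoids ?_ ?_ ?_ ?_ ?_ ?_ ?_ ?_ ?_ <;>
    simp [mem_workWires, mem_cmpWires, mem_degWires]

theorem rowStr_work {i : Fin P.n} {y : Fin (width P.n) ⊕ Fin (width P.n) → Bool} {w : RowWires P}
    (h : w ∈ workWires P ∨ w ∈ degWires P) : rowStr P i y w = false := by
  revert h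
  simp only [mem_workWires, mem_cmpWires, mem_degWires]
  rintro (((rfl | ⟨j, rfl⟩) | ⟨j, rfl⟩ | ⟨j, rfl⟩ | ⟨j, rfl⟩) | ⟨j, rfl⟩) <;> rfl

/-- The entry of the matrix that belongs to the polynomial. -/
def polyEntry (P : RowParams) (σ : Fin P.n → Fin P.d → ℝ) (X : Fin P.n → ℕ) (i : Fin P.n)
    (e : NodePair P.n) : ℝ :=
  if i = e.1.1 then P.εB + (1 - P.εB) * edgeValue P σ X e.1.1 e.1.2
  else if i = e.1.2 then P.εB - (1 + P.εB) * edgeValue P σ X e.1.1 e.1.2 else P.εB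

/-- `entryC` multiplies the amplitude of a pair by its entry in the row of `i`, up to a common
factor, and removes the strings that do not encode a pair. -/
theorem projOp_entryC (hP : P.Good) {σ : Fin P.n → Fin P.d → ℝ}
    (hR : ∀ i, R (accessKet P.w i fun _ => false)
      = ∑ j, (σ i j : ℂ) • accessKet P.w i (bits (width P.d) j))
    (hN : ∀ i, N (accessKet 0 i fun _ => false) = accessKet 0 i (bits P.r (X i)))
    (hX : ∀ i, X i < 2 ^ P.r) (hXL : ∀ i, X i >>> P.sh < 2 ^ P.L) (i : Fin P.n) {p q : ℕ}
    (hp : p < 2 ^ width P.n) (hq : q < 2 ^ width P.n) :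
    ∃ t : ℝ, projOp (workWires P ++ degWires P) (cOp R N (conjC (pairC P) (entryC P))
        (ket (rowStr P i (Sum.elim (bits (width P.n) p) (bits (width P.n) q)))))
      = (t : ℂ) • ket (rowStr P i (Sum.elim (bits (width P.n) p) (bits (width P.n) q))) ∧
      (¬(p < q ∧ q < P.n) → t = 0) ∧
      ∀ e : NodePair P.n, p = e.1.1 → q = e.1.2 → t = P.s / 4 * polyEntry P σ X i e := by
  obtain ⟨a, x, h, hx⟩ := exists_prepared (R := R) (N := N) i hp hq
  set x₀ := rowStr P i (Sum.elim (bits (width P.n) p) (bits (width P.n) q)) with hx₀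
  have hpres := Pres.entryC (R := R) hN h.loaded h.zero h.scratch
  have hmem := Agr_flip (x := x) (x' := x₀) (hpres _ (ket_mem_Agr _ x))
  refine ⟨(entryWeights P (x (ancW P .notq)) (x (ancW P .notp))).1
        + (entryWeights P (x (ancW P .notq)) (x (ancW P .notp))).2
          * (P.s * edgeValue P σ X (a false) (a true)), ?_, fun hv => ?_, fun e hpe hqe => ?_⟩
  · have hcomm : (fun w => xor (x₀ w) (x w)) = fun w => xor (x w) (x₀ w) := by
      funext w
      rw [Bool.xor_comm]
    rw [cOp_conjC pairC_avoids_work hx hpres (ket_mem_Agr _ _), flipOp_ket, xorMask_diff, hcomm,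
      projOp_of_mem_Agr (M := {w | w ∈ workWires P} ∪ {w | w ∈ degWires P})
        (fun w => by rw [List.mem_append]; rfl) (fun w hw => rowStr_work hw) hmem, flipOp_apply,
      ← hcomm, xorMask_diff, entryC_apply hP hR hN hX hXL h.loaded h.zero h.scratch]
  · rw [h.notq, h.notp]
    simp [hv, entryWeights]
  · have hv : p < q ∧ q < P.n := by
      rw [hpe, hqe]
      exact ⟨e.2, e.1.2.2⟩
    obtain ⟨ha, ha'⟩ := h.pair hv
    have ea : a false = e.1.1 := Fin.ext (ha.trans hpe)
    have ea' : a true = e.1.2 := Fin.ext (ha'.trans hqe)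
    have hne : e.1.1 ≠ e.1.2 := ne_of_lt e.2
    rw [h.notq, h.notp, ea, ea', polyEntry]
    simp only [hv, decide_true, Bool.true_and, and_self]
    rw [hpe, hqe]
    by_cases h1 : i = e.1.1
    · have h2 : (i : ℕ) ≠ (e.1.2 : ℕ) := by
        rw [h1]
        exact fun h => hne (Fin.ext h)
      rw [← h1]
      simp only [h2, entryWeights, ne_eq, not_false_eq_true, decide_true, not_true_eq_false,
        decide_false, if_true, if_false, Bool.false_eq_true]
      ring
    · have h1' : (i : ℕ) ≠ (e.1.1 : ℕ) := fun h => h1 (Fin.ext h)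
      by_cases h2 : i = e.1.2
      · rw [← h2]
        simp only [h1, h1', entryWeights, ne_eq, not_false_eq_true, decide_true, not_true_eq_false,
          decide_false, if_true, if_false, Bool.false_eq_true]
        ring
      · have h2' : (i : ℕ) ≠ (e.1.2 : ℕ) := fun h => h2 (Fin.ext h)
        simp only [h1, h1', h2, h2', entryWeights, ne_eq, not_false_eq_true, decide_true, if_true,
          if_false]
        ring

theorem rowStr_injective (i : Fin P.n) : Function.Injective (rowStr P i) := by
  intro y y' h
  funext j
  exact congrFun h (Sum.inr (Sum.inl j))

theorem pairBits_injective {n : ℕ} : Function.Injective (pairBits (n := n)) := by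
  intro e e' h
  refine Subtype.ext (Prod.ext (Fin.ext ?_) (Fin.ext ?_))
  · refine (bits_eq_iff (lt_two_pow_width e.1.1.2) (lt_two_pow_width e'.1.1.2)).1 ?_
    funext j
    exact congrFun h (Sum.inl j)
  · refine (bits_eq_iff (lt_two_pow_width e.1.2.2) (lt_two_pow_width e'.1.2.2)).1 ?_
    funext j
    exact congrFun h (Sum.inr j)

theorem cOp_uniformC_pair (i : Fin P.n) :
    cOp R N (uniformC (ancW P (.dum 0)) (ancW P (.dum 1)) (pairWires P))
        (ket (rowStr P i fun _ => false))
      = ∑ y, ((1 / 2 ^ width P.n : ℝ) : ℂ) • ket (rowStr P i y) := by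
  have hne : ∀ w ∈ pairWires P, ancW P (.dum 0) ≠ w ∧ ancW P (.dum 1) ≠ w := by
    intro w hw
    obtain ⟨j, rfl⟩ := (mem_pairWires P w).1 hw
    simp
  ext z
  rw [cOp_uniformC_apply R N (by simp) pairWires_nodup hne]
  · have hc : (((1 / √2 : ℝ) : ℝ) : ℂ) ^ (pairWires P).length = ((1 / 2 ^ width P.n : ℝ) : ℂ) := by
      rw [length_pairWires, ← two_mul, pow_mul, ← Complex.ofReal_pow, ← Complex.ofReal_pow, div_pow,
        one_pow, Real.sq_sqrt zero_le_two, div_pow, one_pow]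
    rw [hc]
    simp only [WithLp.ofLp_sum, WithLp.ofLp_smul, Finset.sum_apply, Pi.smul_apply, ket_apply,
      smul_eq_mul, mul_ite, mul_one, mul_zero]
    split_ifs with h
    · have e : ∀ y, z = rowStr P i y ↔ y = fun j => z (Sum.inr (Sum.inl j)) := by
        intro y
        constructor
        · rintro rfl
          rfl
        · rintro rfl
          funext w
          rcases w with w | w | w
          · exact h _ (by simp [mem_pairWires])
          · rfl
          · exact h _ (by simp [mem_pairWires])
      simp [e]
    · symm
      refine Finset.sum_eq_zero fun y _ => ?_
      rw [if_neg]
      rintro rfl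
      apply h
      intro w hw
      rcases w with w | w | w
      · rfl
      · exact absurd ((mem_pairWires P _).2 ⟨w, rfl⟩) hw
      · rfl
  · intro w hw
    obtain ⟨j, rfl⟩ := (mem_pairWires P w).1 hw
    rfl

/-- The part of the state prepared by `unscaledRowC` with zero ancillas is a multiple of the row. -/
theorem projOp_unscaledRowC (hP : P.Good) {σ : Fin P.n → Fin P.d → ℝ}
    (hR : ∀ i, R (accessKet P.w i fun _ => false)
      = ∑ j, (σ i j : ℂ) • accessKet P.w i (bits (width P.d) j))
    (hN : ∀ i, N (accessKet 0 i fun _ => false) = accessKet 0 i (bits P.r (X i)))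
    (hX : ∀ i, X i < 2 ^ P.r) (hXL : ∀ i, X i >>> P.sh < 2 ^ P.L) (i : Fin P.n) :
    projOp (workWires P ++ degWires P) (cOp R N (unscaledRowC P) (ket (rowStr P i fun _ => false)))
      = ∑ e, ((1 / 2 ^ width P.n * (P.s / 4 * polyEntry P σ X i e) : ℝ) : ℂ)
        • ket (rowStr P i (pairBits e)) := by
  rw [unscaledRowC, cOp_append, cOp_uniformC_pair, map_sum, map_sum]
  symm
  refine Fintype.sum_of_injective pairBits pairBits_injective _ _ (fun y hy => ?_) fun e => ?_
  · obtain ⟨p, hp, q, hq, rfl⟩ := exists_pair_bits y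
    obtain ⟨t, h1, h2, -⟩ := projOp_entryC hP hR hN hX hXL i hp hq
    rw [map_smul, map_smul, h1, h2, Complex.ofReal_zero, zero_smul, smul_zero]
    intro hv
    exact hy ⟨⟨(⟨p, hv.1.trans hv.2⟩, ⟨q, hv.2⟩), hv.1⟩, rfl⟩
  · obtain ⟨t, h1, -, h3⟩ := projOp_entryC hP hR hN hX hXL i (lt_two_pow_width e.1.1.2)
      (lt_two_pow_width e.1.2.2)
    rw [map_smul, map_smul, pairBits, h1, h3 e rfl rfl, smul_smul, ← Complex.ofReal_mul]

theorem Pres.unscaledRowC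
    (hN : ∀ i, N (accessKet 0 i fun _ => false) = accessKet 0 i (bits P.r (X i))) (i : Fin P.n) :
    Pres R N (unscaledRowC P) {w | w ∈ pairWires P ++ (workWires P ++ degWires P)}
      (rowStr P i fun _ => false) := by
  refine Pres.append (Local.uniformC (fun w hw => List.mem_append_left _ hw) _)
    (Pres.of_ket fun z hz => ?_)
  obtain ⟨p, hp, q, hq, e⟩ := exists_pair_bits fun j => z (Sum.inr (Sum.inl j))
  obtain ⟨a, x, h, hx⟩ := exists_prepared (R := R) (N := N) i hp hq
  have hAgr : Agr ({w | w ∈ workWires P} ∪ {w | w ∈ degWires P}) z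
      = Agr ({w | w ∈ workWires P} ∪ {w | w ∈ degWires P})
        (rowStr P i (Sum.elim (bits (width P.n) p) (bits (width P.n) q))) := by
    refine Agr_congr fun w hw => ?_
    by_cases hpw : w ∈ pairWires P
    · obtain ⟨j, rfl⟩ := (mem_pairWires P w).1 hpw
      exact congrFun e j
    · rw [hz w]
      · rcases w with w | w | w
        · rfl
        · exact absurd ((mem_pairWires P _).2 ⟨w, rfl⟩) hpw
        · rfl
      · intro hw'
        rcases List.mem_append.1 hw' with h' | h'
        · exact hpw h'
        · exact hw (List.mem_append.1 h')
  have := Pres.conjC pairC_avoids_work hx (Pres.entryC (R := R) hN h.loaded h.zero h.scratch)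
      (ket z)
    (by rw [← hAgr]; exact ket_mem_Agr _ z)
  rw [← hAgr] at this
  refine Agr_mono (fun w hw => ?_) z this
  exact List.mem_append_right _ (List.mem_append.2 hw)

theorem entryC_avoids {V : Set (RowWires P)}
    (h : ∀ w ∈ workWires P, w ∉ V) (hd : ∀ w ∈ degWires P, w ∉ V) (h1 : ∀ j, ancW P (.fst j) ∉ V)
    (h2 : ∀ j, ancW P (.snd j) ∉ V) (h3 : ∀ j, ancW P (.nidx j) ∉ V)
    (h4 : ∀ j, ancW P (.norm j) ∉ V) (h5 : ∀ j, ancW P (.dum j) ∉ V) (h6 : ∀ k, scrW P k ∉ V)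
    (h7 : ancW P .notq ∉ V) (h8 : ancW P .notp ∉ V) : Avoids (entryC P) V := by
  have hA := diffC_avoids h h1 h2 h3 h4 h5
  refine hA.conjC (lcuC_avoids h6 (h5 0) hA h (fun w hw => h w ((mem_workWires P w).2 (Or.inl hw)))
    h7 h8 (hd _ ?_) fun w hw => hd w ?_)
  · rw [← degWires_eq]
    simp
  · rw [← degWires_eq]
    exact List.mem_cons_of_mem _ hw

theorem lcuWires_row
    (hN : ∀ i, N (accessKet 0 i fun _ => false) = accessKet 0 i (bits P.r (X i))) (i : Fin P.n) :
    LcuWires R N (scrW P) P.size (ancW P (.dum 0)) (unscaledRowC P)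
      (pairWires P ++ (workWires P ++ degWires P)) (workWires P ++ degWires P)
      (ancW P (.dum 1)) (ancW P (.dum 2)) (ancW P (.cod 0))
      ((List.finRange (P.J + 2)).map fun j => ancW P (.cod j.succ))
      {w | w ∈ pairWires P ++ (workWires P ++ degWires P)} {w | w ∈ codWires P}
      (rowStr P i fun _ => false) where
  grover :=
    { inj := scrW_injOn P
      dummy := fun k _ => ((scrW_ne k).2.2.2.2 0).symm
      length₀ := by
        rw [List.length_append, List.length_append, length_workWires, length_pairWires,
          length_degWires, RowParams.size]
        omega
      length₁ := by
        rw [List.length_append, length_workWires, length_degWires, RowParams.size]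
        omega
      list₀ := fun w hw => by
        simp only [List.mem_append] at hw
        refine ⟨?_, fun k _ e => ?_⟩
        · rintro rfl
          simp [mem_workWires, mem_cmpWires, mem_pairWires, mem_degWires] at hw
        · have := scrW_ne (P := P) k
          rw [← e] at this
          tauto
      list₁ := fun w hw => by
        simp only [List.mem_append] at hw
        refine ⟨?_, fun k _ e => ?_⟩
        · rintro rfl
          simp [mem_workWires, mem_cmpWires, mem_degWires] at hw
        · have := scrW_ne (P := P) k
          rw [← e] at this
          tauto
      scratch := fun k _ => ⟨by
        have := scrW_ne (P := P) k
        simp only [Set.mem_union, Set.mem_ofPred_eq, List.mem_append]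
        tauto, rfl⟩ }
  pres := Pres.unscaledRowC hN i
  avoids := by
    refine (uniformC_avoids ?_ ?_ ?_).append (Avoids.conjC (pairC_avoids ?_ ?_ ?_ ?_ ?_ ?_ ?_ ?_ ?_)
      (entryC_avoids ?_ ?_ ?_ ?_ ?_ ?_ ?_ ?_ ?_ ?_)) <;>
      simp [mem_codWires, mem_pairWires, mem_workWires, mem_cmpWires, mem_degWires, scrW]
    · rintro w ((rfl | ⟨j, rfl⟩) | ⟨j, rfl⟩ | ⟨j, rfl⟩ | ⟨j, rfl⟩) <;> simp
  dummy := by simp [mem_codWires]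
  list₀ := fun w => Iff.rfl
  list₁ := fun w hw => List.mem_append_right _ hw
  disj := by
    simp only [Set.mem_ofPred_eq, List.mem_append, mem_workWires, mem_cmpWires, mem_codWires,
      mem_degWires, mem_pairWires]
    rintro w (⟨j, rfl⟩ | ((rfl | ⟨j, rfl⟩) | ⟨j, rfl⟩ | ⟨j, rfl⟩ | ⟨j, rfl⟩) | ⟨j, rfl⟩) <;> simp
  mem := fun w => by rw [codWires_eq]; rfl
  nodup := by rw [codWires_eq]; exact codWires_nodup
  ne := by simp
  fst := by simp [mem_codWires, mem_degWires, mem_workWires, mem_cmpWires, mem_pairWires]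
  snd := by simp [mem_codWires, mem_degWires, mem_workWires, mem_cmpWires, mem_pairWires]
  zero := by
    simp only [Set.mem_union, Set.mem_ofPred_eq, List.mem_append, mem_pairWires, mem_codWires]
    rintro w ((⟨j, rfl⟩ | h) | ⟨j, rfl⟩)
    exacts [rfl, rowStr_work h, rfl]

end Row

section RowState

variable {P : RowParams} {R : QUnitary (RowBox P)} {N : QUnitary (NormBox P)} {X : Fin P.n → ℕ}

theorem norm_sum_ket {W κ : Type} [Fintype W] [DecidableEq W] [Fintype κ] {f : κ → W → Bool}
    (hf : Function.Injective f) (a : EuclideanSpace ℝ κ) :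
    ‖∑ j, ((a j : ℝ) : ℂ) • ket (f j)‖ = ‖a‖ := by
  have h := norm_sq_sum_ket hf fun j => ((a j : ℝ) : ℂ)
  rw [← abs_norm, ← abs_norm a, ← sq_eq_sq_iff_abs_eq_abs, h, EuclideanSpace.norm_sq_eq]
  simp only [Complex.norm_real]

theorem norm_projOp_le {W : Type} [Fintype W] [DecidableEq W] (l : List W) (ψ : QState W) :
    ‖projOp l ψ‖ ≤ ‖ψ‖ := by
  have h := norm_sq_projOp_add l ψ
  have h2 := sq_nonneg ‖ψ - projOp l ψ‖
  exact le_of_sq_le_sq (by linarith) (norm_nonneg _)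

/-- The normalized state that belongs to a row vector. -/
def unitState {W κ : Type} [Fintype W] [DecidableEq W] [Fintype κ] (f : κ → W → Bool)
    (a : EuclideanSpace ℝ κ) : QState W := ∑ j, ((a j / ‖a‖ : ℝ) : ℂ) • ket (f j)

theorem norm_unitState {W κ : Type} [Fintype W] [DecidableEq W] [Fintype κ] {f : κ → W → Bool}
    (hf : Function.Injective f) {a : EuclideanSpace ℝ κ} (ha : 0 < ‖a‖) : ‖unitState f a‖ = 1 := by
  have := norm_sum_ket hf (‖a‖⁻¹ • a)
  rw [norm_smul, norm_inv, norm_norm, inv_mul_cancel₀ ha.ne'] at this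
  rw [← this, unitState]
  congr 1
  refine Finset.sum_congr rfl fun e _ => ?_
  rw [PiLp.smul_apply, smul_eq_mul, div_eq_inv_mul]

theorem smul_unitState {W κ : Type} [Fintype W] [DecidableEq W] [Fintype κ] (f : κ → W → Bool)
    {a : EuclideanSpace ℝ κ} (ha : 0 < ‖a‖) (t : ℝ) :
    ((t * ‖a‖ : ℝ) : ℂ) • unitState f a = ∑ j, ((t * a j : ℝ) : ℂ) • ket (f j) := by
  rw [unitState, Finset.smul_sum]
  refine Finset.sum_congr rfl fun e _ => ?_
  rw [smul_smul, ← Complex.ofReal_mul]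
  congr 2
  field_simp

/-- The row circuit prepares the normalized row of the matrix `polyEntry`, provided that the
amplitude of the row is at least the bound `α₀` from which on the polynomial with the coefficients
`b` is almost `1`. -/
theorem norm_rowC_sub_le (hP : P.Good) (hs : 0 < P.s) {σ : Fin P.n → Fin P.d → ℝ}
    (hR : ∀ i, R (accessKet P.w i fun _ => false)
      = ∑ j, (σ i j : ℂ) • accessKet P.w i (bits (width P.d) j))
    (hN : ∀ i, N (accessKet 0 i fun _ => false) = accessKet 0 i (bits P.r (X i)))
    (hX : ∀ i, X i < 2 ^ P.r) (hXL : ∀ i, X i >>> P.sh < 2 ^ P.L) {α₀ δ : ℝ} (hδ : δ < 1)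
    (hrr : Even P.rr) (hrr1 : 1 ≤ P.rr)
    (hb : |Real.sin (Real.pi / (2 * (2 * P.rr + 1)))| * ∑ j ∈ Finset.range (P.J + 1), |P.b j| ≤ 1)
    (hc : ∀ α, α₀ ≤ α → α ≤ 1 →
      ∑ j ∈ Finset.range (P.J + 1), P.b j * Real.cos ((2 * j + 1) * Real.arccos α) ≤ 1 ∧
      1 - δ / 8 ≤ ∑ j ∈ Finset.range (P.J + 1), P.b j * Real.cos ((2 * j + 1) * Real.arccos α))
    (i : Fin P.n) (hrow : 0 < ‖rowVec (polyEntry P σ X) i‖)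
    (hα : α₀ ≤ P.s / (4 * 2 ^ width P.n) * ‖rowVec (polyEntry P σ X) i‖) :
    ‖cOp R N (rowC P) (ket (rowStr P i fun _ => false))
      - unitState (fun e => rowStr P i (pairBits e)) (rowVec (polyEntry P σ X) i)‖ ≤ δ := by
  have hinj : Function.Injective fun e : NodePair P.n => rowStr P i (pairBits e) :=
    (rowStr_injective i).comp pairBits_injective
  have hg := norm_unitState hinj hrow
  have hproj : projOp (workWires P ++ degWires P)
      (cOp R N (unscaledRowC P) (ket (rowStr P i fun _ => false)))
      = ((P.s / (4 * 2 ^ width P.n) * ‖rowVec (polyEntry P σ X) i‖ : ℝ) : ℂ)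
        • unitState (fun e => rowStr P i (pairBits e)) (rowVec (polyEntry P σ X) i) := by
    rw [projOp_unscaledRowC hP hR hN hX hXL, smul_unitState _ hrow]
    refine Finset.sum_congr rfl fun e _ => ?_
    congr 2
    change _ = _ * polyEntry P σ X i e
    field_simp
  generalize unitState (fun e => rowStr P i (pairBits e)) (rowVec (polyEntry P σ X) i) = g at *
  generalize ‖rowVec (polyEntry P σ X) i‖ = A at *
  have hpos : 0 < P.s / (4 * 2 ^ width P.n) * A := by positivity
  have hle : P.s / (4 * 2 ^ width P.n) * A ≤ 1 := by
    have h := norm_projOp_le (workWires P ++ degWires P)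
      (cOp R N (unscaledRowC P) (ket (rowStr P i fun _ => false)))
    rwa [LinearIsometryEquiv.norm_map, norm_ket, hproj, norm_smul, hg, mul_one, Complex.norm_real,
      Real.norm_eq_abs, abs_of_pos hpos] at h
  obtain ⟨hc1, hc2⟩ := hc _ hα hle
  have key := norm_normalizeC_sub_le (lcuWires_row (R := R) hN i) (l₁ := workWires P ++ degWires P)
    (by
      simp only [List.length_append, List.length_cons, length_workWires, length_pairWires,
        length_degWires, List.length_map, List.length_finRange, RowParams.size]
      omega)
    (by
      simp only [List.length_append, List.length_cons, length_workWires,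
        length_degWires, List.length_map, List.length_finRange, RowParams.size]
      omega)
    (d' := ancW P (.dum 1)) ⟨by simp, fun k _ => ((scrW_ne k).2.2.2.2 1).symm⟩ (K := P.J)
    (by rw [List.length_map, List.length_finRange])
    hrr hrr1 hb hproj hpos hle hg hδ hc1 hc2
  rw [rowC]
  convert key using 3

/-- The ancillas are numbered. -/
def rowEquiv (P : RowParams) :
    RowWires P ≃ AccessWires P.n (Fin (width P.n) ⊕ Fin (width P.n)) (Fintype.card (RowAnc P)) :=
  Equiv.sumCongr (Equiv.refl _) (Equiv.sumCongr (Equiv.refl _) (Fintype.equivFin _))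

theorem relabelOp_rowStr (i : Fin P.n) (y : Fin (width P.n) ⊕ Fin (width P.n) → Bool) :
    relabelOp (rowEquiv P) (ket (rowStr P i y)) = accessKet (Fintype.card (RowAnc P)) i y := by
  rw [relabelOp_ket, accessKet]
  congr 1
  funext w
  rcases w with w | w | w <;> rfl

theorem time_unscaledRowC_le {T : ℝ} (hT : 1 ≤ T) :
    QCircuit.time T (unscaledRowC P) ≤ 30 * width P.n + 6
      + 2 * ((8 * width P.n + 2 * P.L + 7) * T)
      + (2 + (P.K + 2) * (4 + 2 * ((8 * width P.n + 2 * P.L + 7) * T)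
        + 6 * (2 * P.L + 4 + width P.n + width P.d + P.w))) := by
  have h1 := time_uniformC_le (Vr := RowBox P) (Vn := NormBox P) T (ancW P (.dum 0))
      (ancW P (.dum 1))
    (pairWires P)
  rw [length_pairWires] at h1
  have h2 := time_pairC_le (P := P) T
  have h3 := time_diffC_le P hT
  have h4 := time_lcuC_le T (zero_le_one.trans hT) (scrW P) (ancW P (.dum 0)) (diffC P)
      (workWires P)
    (cmpWires P) (ancW P .notq) (ancW P .notp) (entryWeights P) (ancW P (.deg 0))
    ((List.finRange (P.K + 2)).map fun j => ancW P (.deg j.succ)) P.s P.K P.c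
  rw [length_workWires, length_cmpWires] at h4
  have h5 : ((P.K : ℝ) + 2) * (4 + 2 * QCircuit.time T (diffC P)
      + 6 * (((P.L + 2 + (width P.n + (width P.d + P.w)) : ℕ) : ℝ) + ((P.L + 2 : ℕ) : ℝ)))
      ≤ (P.K + 2) * (4 + 2 * ((8 * width P.n + 2 * P.L + 7) * T)
        + 6 * (2 * P.L + 4 + width P.n + width P.d + P.w)) := by
    push_cast
    gcongr ?_ * ?_
    linarith
  rw [unscaledRowC, time_append, time_conjC, entryC, time_conjC]
  push_cast at h1
  linarith

end RowState

/-! ### The precision of the norms and of the distances -/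

/-- Only `f'` of the fractional digits of the norms are used: as few as the precision of the
distances allows. Hence the number `L` of binary digits is logarithmic, however large `f` is. The
unit of the amplitudes is `2 ^ L / 2 ^ f'`, a bound of the norms that is of the order of `√η`. -/
theorem exists_norm_precision {η ε : ℝ} (hη : 1 ≤ η) (hε : 0 < ε) {f : ℕ}
    (hf : 32 * √η ≤ ε * 2 ^ f) :
    ∃ f' ≤ f, ∃ L : ℕ, 32 * √η ≤ ε * 2 ^ f' ∧ 4 * √η * 2 ^ f' ≤ 2 ^ L ∧
      (2 : ℝ) ^ L ≤ 8 * √η * 2 ^ f' ∧ (2 : ℝ) ^ L ≤ 8 * η + 512 * (η / ε) := by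
  classical
  have hex : ∃ g : ℕ, 32 * √η ≤ ε * 2 ^ g := ⟨f, hf⟩
  have hs1 : 1 ≤ √η := Real.one_le_sqrt.2 hη
  have hss : √η * √η = η := Real.mul_self_sqrt (by linarith)
  set g := Nat.find hex with hg
  have hg1 : 32 * √η ≤ ε * 2 ^ g := Nat.find_spec hex
  have h2 : (1 : ℝ) ≤ 2 ^ g := one_le_pow₀ one_le_two
  obtain ⟨l, hl1, hl2⟩ := exists_nat_pow_near (x := 4 * √η * 2 ^ g) (y := 2)
    (by nlinarith) one_lt_two
  have hl3 : (2 : ℝ) ^ (l + 1) ≤ 8 * √η * 2 ^ g := by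
    rw [pow_succ]
    linarith
  refine ⟨g, Nat.find_min' hex hf, l + 1, hg1, hl2.le, hl3, hl3.trans ?_⟩
  rcases Nat.eq_zero_or_pos g with h0 | h0
  · have hq : 0 ≤ η / ε := by positivity
    rw [h0]
    nlinarith
  · have h3 := Nat.find_min hex (m := g - 1) (by omega)
    have h4 : ε * 2 ^ g < 64 * √η := by
      have : (2 : ℝ) ^ g = 2 ^ (g - 1) * 2 := by rw [← pow_succ, Nat.sub_add_cancel h0]
      rw [this]
      linarith
    have h5 : (2 : ℝ) ^ g ≤ 64 * √η / ε := by
      rw [le_div_iff₀ hε]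
      linarith
    calc 8 * √η * 2 ^ g ≤ 8 * √η * (64 * √η / ε) := by gcongr
      _ = 512 * (η / ε) := by rw [← hss, Real.sqrt_mul_self (Real.sqrt_nonneg _)]; ring
      _ ≤ 8 * η + 512 * (η / ε) := by linarith

theorem row_norm_bounds {n d : ℕ} (hn : 0 < n) {S : Matrix (Fin n) (Fin d) ℝ} {η : ℝ}
    (h1 : (⨅ i, ‖rowVec S i‖) = 1) (h2 : eta S ≤ η) (i : Fin n) :
    1 ≤ ‖rowVec S i‖ ∧ ‖rowVec S i‖ ≤ √η := by
  have : Nonempty (Fin n) := ⟨⟨0, hn⟩⟩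
  have hlow : ∀ i, 1 ≤ ‖rowVec S i‖ := fun i =>
    h1 ▸ ciInf_le (Set.finite_range _).bddBelow i
  have hinf : (⨅ i, ‖rowVec S i‖ ^ 2) = 1 := by
    obtain ⟨j, hj⟩ := exists_eq_ciInf_of_finite (f := fun i => ‖rowVec S i‖)
    refine le_antisymm ?_ (le_ciInf fun i => one_le_pow₀ (hlow i))
    refine (ciInf_le (Set.finite_range _).bddBelow j).trans ?_
    rw [hj.trans h1, one_pow]
  rw [eta, hinf, div_one] at h2
  refine ⟨hlow i, Real.le_sqrt_of_sq_le ?_⟩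
  exact (le_ciSup (f := fun i => ‖rowVec S i‖ ^ 2) (Set.finite_range _).bddAbove i).trans h2

/-- Cutting off the last bits of a norm and adding one unit changes it by at most two units. -/
theorem abs_shiftRight_sub_le {f f' X : ℕ} (hf : f' ≤ f) {a : ℝ}
    (hX : |(X : ℝ) / 2 ^ f - a| ≤ 1 / 2 ^ f) :
    |(((X >>> (f - f') : ℕ) : ℝ) + 1) / 2 ^ f' - a| ≤ 2 / 2 ^ f' := by
  have e : (2 : ℝ) ^ f = 2 ^ (f - f') * 2 ^ f' := by rw [← pow_add, Nat.sub_add_cancel hf]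
  have h1 : ((X >>> (f - f') : ℕ) : ℝ) * 2 ^ (f - f') ≤ X := by
    rw [Nat.shiftRight_eq_div_pow]
    exact_mod_cast Nat.div_mul_le_self X (2 ^ (f - f'))
  have h2 : (X : ℝ) ≤ (((X >>> (f - f') : ℕ) : ℝ) + 1) * 2 ^ (f - f') := by
    rw [Nat.shiftRight_eq_div_pow]
    have := Nat.lt_div_mul_add (a := X) (b := 2 ^ (f - f')) (by positivity)
    have h : X ≤ (X / 2 ^ (f - f') + 1) * 2 ^ (f - f') := by
      rw [add_mul, one_mul]
      exact this.le
    exact_mod_cast h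
  set q : ℝ := ((X >>> (f - f') : ℕ) : ℝ)
  have h3 : q / 2 ^ f' ≤ X / 2 ^ f := by
    rw [e, div_le_div_iff₀ (by positivity) (by positivity)]
    nlinarith [pow_pos (zero_lt_two' ℝ) f']
  have h4 : (X : ℝ) / 2 ^ f ≤ (q + 1) / 2 ^ f' := by
    rw [e, div_le_div_iff₀ (by positivity) (by positivity)]
    nlinarith [pow_pos (zero_lt_two' ℝ) f']
  have h5 : (1 : ℝ) / 2 ^ f ≤ 1 / 2 ^ f' :=
    one_div_le_one_div_of_le (by positivity) (pow_le_pow_right₀ one_le_two hf)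
  have h6 : (q + 1) / 2 ^ f' = q / 2 ^ f' + 1 / 2 ^ f' := add_div _ _ _
  have h7 : (2 : ℝ) / 2 ^ f' = 1 / 2 ^ f' + 1 / 2 ^ f' := by rw [← add_div]; norm_num
  rw [abs_le] at hX ⊢
  constructor <;> linarith [hX.1, hX.2]

theorem abs_sq_dist_sub_le {E : Type*} [SeminormedAddCommGroup E] {u v u' v' : E} {κ D : ℝ}
    (hu : ‖u' - u‖ ≤ κ / 2) (hv : ‖v' - v‖ ≤ κ / 2) (hD : ‖u - v‖ ≤ D) :
    |‖u' - v'‖ ^ 2 - ‖u - v‖ ^ 2| ≤ κ * (2 * D + κ) := by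
  have h1 : |‖u' - v'‖ - ‖u - v‖| ≤ κ := by
    refine (abs_norm_sub_norm_le _ _).trans ?_
    rw [show u' - v' - (u - v) = (u' - u) - (v' - v) by abel]
    exact (norm_sub_le _ _).trans (by linarith)
  have h2 := abs_le.1 h1
  have h3 : 0 ≤ ‖u' - v'‖ + ‖u - v‖ := by positivity
  rw [sq_sub_sq, abs_mul, abs_of_nonneg h3, mul_comm]
  have hκ : 0 ≤ κ := (abs_nonneg _).trans h1
  exact mul_le_mul h1 (by linarith) h3 hκ

/-- The approximate squared distance of two rows. -/
theorem sum_sq_normAmp {P : RowParams} {S : Matrix (Fin P.n) (Fin P.d) ℝ} {X : Fin P.n → ℕ} {f' : ℕ}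
    (p q : Fin P.n) :
    ∑ j, (normAmp P X p * (S p j / ‖rowVec S p‖) - normAmp P X q * (S q j / ‖rowVec S q‖)) ^ 2
      = ‖((((X p >>> P.sh : ℕ) : ℝ) + 1) / 2 ^ f' / ‖rowVec S p‖) • rowVec S p
        - ((((X q >>> P.sh : ℕ) : ℝ) + 1) / 2 ^ f' / ‖rowVec S q‖) • rowVec S q‖ ^ 2
        / (2 ^ P.L / 2 ^ f') ^ 2 := by
  rw [EuclideanSpace.norm_sq_eq, Finset.sum_div]
  refine Finset.sum_congr rfl fun j _ => ?_
  rw [PiLp.sub_apply, PiLp.smul_apply, PiLp.smul_apply, Real.norm_eq_abs, sq_abs, ← div_pow]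
  congr 1
  simp only [normAmp, smul_eq_mul, rowVec]
  have h1 : (2 : ℝ) ^ f' ≠ 0 := by positivity
  have h2 : (2 : ℝ) ^ P.L ≠ 0 := by positivity
  generalize ‖(WithLp.toLp 2 (S p) : EuclideanSpace ℝ (Fin P.d))‖ = a
  generalize ‖(WithLp.toLp 2 (S q) : EuclideanSpace ℝ (Fin P.d))‖ = b
  simp only [div_eq_mul_inv, mul_inv, inv_inv]
  have h3 := mul_inv_cancel₀ h1
  linear_combination
    ((-(((X p >>> P.sh : ℕ) : ℝ) + 1) * S p j * a⁻¹ + (((X q >>> P.sh : ℕ) : ℝ) + 1) * S q j * b⁻¹)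
      * (2 ^ P.L)⁻¹) * h3

theorem norm_rescale_sub {E : Type*} [NormedAddCommGroup E] [NormedSpace ℝ E] {v : E} (hv : 0 < ‖v‖)
    (t : ℝ) : ‖(t / ‖v‖) • v - v‖ = |t - ‖v‖| := by
  have : (t / ‖v‖) • v - v = ((t - ‖v‖) / ‖v‖) • v := by
    rw [sub_div, div_self hv.ne', sub_smul, one_smul]
  rw [this, norm_smul, Real.norm_eq_abs, abs_div, abs_norm, div_mul_cancel₀ _ hv.ne']

/-! ### The decision between edges and non-edges -/

theorem arccos_add_le {x x' t : ℝ} (hx : -1 ≤ x) (hx' : x' ≤ 1) (ht : 0 ≤ t) (h : x + t ≤ x') :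
    Real.arccos x' + t ≤ Real.arccos x := by
  have h1 := Real.cos_arccos hx (by linarith)
  have h2 := Real.cos_arccos (x := x') (by linarith) hx'
  have h3 : Real.arccos x' ≤ Real.arccos x := Real.arccos_le_arccos (by linarith)
  have h4 : |Real.cos (Real.arccos x') - Real.cos (Real.arccos x)|
      ≤ |Real.arccos x' - Real.arccos x| := Real.abs_cos_sub_cos_le _ _
  rw [h1, h2, abs_of_nonneg (by linarith), abs_of_nonpos (by linarith)] at h4
  linarith

/-- The angle of a pair lies on the side of the threshold angle that its squared distance `D`, known
up to `9 / 16 * ε`, asks for. -/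
theorem angle_of_sq_dist {η ε D D' m Λ : ℝ} (hε : 0 < ε) (hεη : ε ≤ 4 * η) (hD : D ≤ 4 * η)
    (hDD : |D' - D| ≤ 9 / 16 * ε) (hΛ : 16 * η ≤ Λ) (hm : 0 < m) (hy : -1 ≤ D' / Λ / 2 - 1)
    (hy' : D' / Λ / 2 - 1 ≤ 1) :
    (D < m - ε → Real.pi - Real.arccos (D' / Λ / 2 - 1)
      ≤ Real.arccos (max (1 - m / Λ / 2) 0) - ε / (8 * Λ)) ∧
    (m + ε < D → Real.arccos (max (1 - m / Λ / 2) 0) + ε / (8 * Λ)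
      ≤ Real.pi - Real.arccos (D' / Λ / 2 - 1)) := by
  have hΛ0 : 0 < Λ := by linarith
  have hd := abs_le.1 hDD
  have ht : 0 ≤ ε / (8 * Λ) := by positivity
  have hmΛ : 0 < m / Λ := by positivity
  have e8 : ε / (8 * Λ) = ε / 4 / Λ / 2 := by field_simp; ring
  rw [← Real.arccos_neg]
  constructor
  · intro h
    rw [le_sub_iff_add_le]
    refine arccos_add_le ((by norm_num : (-1 : ℝ) ≤ 0).trans (le_max_right _ _)) (by linarith) ht ?_
    rw [← le_sub_iff_add_le, e8]
    refine max_le ?_ ?_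
    · have : (D' + ε / 4) / Λ ≤ m / Λ := by gcongr; linarith
      rw [add_div] at this
      linarith
    · have : (D' + ε / 4) / Λ ≤ 1 := by rw [div_le_one hΛ0]; linarith
      rw [add_div] at this
      linarith
  · intro h
    refine arccos_add_le (by linarith) ?_ ht ?_
    · exact max_le (by linarith) zero_le_one
    · rw [e8]
      refine le_trans ?_ (le_max_left _ _)
      have : (m + ε / 4) / Λ ≤ D' / Λ := by gcongr; linarith
      rw [add_div] at this
      linarith

/-- The angle of a pair decreases with the distance, and the step polynomials are close to `1` for
small angles. With alternating signs of the coefficients they are evaluated at the supplementary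
angle, and distinguish the small distances. -/
theorem edgeValue_eq {P : RowParams} {c : ℕ → ℝ} (hc : ∀ k, P.c k = (-1) ^ k * c k)
    (σ : Fin P.n → Fin P.d → ℝ) (X : Fin P.n → ℕ) (p q : Fin P.n) :
    edgeValue P σ X p q = ∑ k ∈ Finset.range (P.K + 1),
      c k * Real.cos (k * (Real.pi - Real.arccos (pairCos P σ X p q))) := by
  refine Finset.sum_congr rfl fun k _ => ?_
  rw [hc, mul_sub, Real.cos_nat_mul_pi_sub]
  ring

/-! ### Incidence matrices whose columns are convex combinations -/

/-- The matrix whose column `e` is a convex combination, with weight `t e`, of the column of an edge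
and the column of a non-edge. -/
def mixRows {n : ℕ} (ε : ℝ) (t : NodePair n → ℝ) : Matrix (Fin n) (NodePair n) ℝ := fun i e =>
  (1 - t e) * fillZeros ε (incidence fun _ _ => 0) i e
    + t e * fillZeros ε (incidence fun _ _ => 1) i e

section Mix

variable {n : ℕ} {ε : ℝ} {i : Fin n} {e : NodePair n}

theorem fillZeros_incidence_of_eq_zero {a : Matrix (Fin n) (Fin n) ℝ} (h : a e.1.1 e.1.2 = 0) :
    fillZeros ε (incidence a) i e = ε := by
  rw [fillZeros, incidence, h]
  simp

theorem fillZeros_incidence_of_eq_one {a : Matrix (Fin n) (Fin n) ℝ} (h : a e.1.1 e.1.2 = 1) :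
    fillZeros ε (incidence a) i e = if i = e.1.1 then 1 else if i = e.1.2 then -1 else ε := by
  rw [fillZeros, incidence, h]
  split_ifs <;> simp_all

theorem fillZeros_incidence_zero :
    fillZeros ε (incidence fun _ _ => 0) i e = ε :=
  fillZeros_incidence_of_eq_zero (a := fun _ _ => 0) rfl

theorem fillZeros_incidence_one : fillZeros ε (incidence fun _ _ => 1) i e
    = if i = e.1.1 then 1 else if i = e.1.2 then -1 else ε :=
  fillZeros_incidence_of_eq_one (a := fun _ _ => 1) rfl

theorem mixRows_apply (t : NodePair n → ℝ) :
    mixRows ε t i e = (1 - t e) * ε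
      + t e * if i = e.1.1 then 1 else if i = e.1.2 then -1 else ε := by
  rw [mixRows, fillZeros_incidence_zero, fillZeros_incidence_one]

theorem polyEntry_eq_mixRows (P : RowParams) (σ : Fin P.n → Fin P.d → ℝ) (X : Fin P.n → ℕ) :
    polyEntry P σ X = mixRows P.εB fun e => edgeValue P σ X e.1.1 e.1.2 := by
  funext i e
  rw [mixRows_apply, polyEntry]
  split_ifs <;> ring

/-- Weights that are almost right for the pairs with a clear distance are close to weights that are
exactly right for these pairs. -/
theorem exists_isSimilarityIncidence {d : ℕ} {S : Matrix (Fin n) (Fin d) ℝ} {dmin εdist τ : ℝ}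
    (hd : 0 < dmin) (hε : 0 < εdist) (hτ : 0 ≤ τ) {h : NodePair n → ℝ} (h0 : ∀ e, 0 ≤ h e)
      (h1 : ∀ e, h e ≤ 1)
    (hl : ∀ e : NodePair n, dist (rowVec S e.1.1) (rowVec S e.1.2) ^ 2 < dmin ^ 2 - εdist →
      1 - h e ≤ τ)
    (hg : ∀ e : NodePair n, dmin ^ 2 + εdist < dist (rowVec S e.1.1) (rowVec S e.1.2) ^ 2 →
      h e ≤ τ) :
    ∃ t : NodePair n → ℝ, (∀ e, |h e - t e| ≤ τ) ∧
      IsSimilarityIncidence S dmin εdist ε (mixRows ε t) := by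
  classical
  refine ⟨fun e => if εdist < |dist (rowVec S e.1.1) (rowVec S e.1.2) ^ 2 - dmin ^ 2| then
    similarity S dmin e.1.1 e.1.2 else h e, fun e => ?_, fun e => ⟨fun he i => ?_, ?_⟩⟩
  · have hne : e.1.1 ≠ e.1.2 := ne_of_lt e.2
    dsimp only
    split_ifs with he
    · rcases lt_abs.1 he with hlt | hlt
      · have : ¬dist (rowVec S e.1.1) (rowVec S e.1.2) ≤ dmin := fun hle => by
          have := pow_le_pow_left₀ dist_nonneg hle 2
          linarith
        rw [similarity, if_neg (by tauto), sub_zero, abs_of_nonneg (h0 e)]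
        exact hg e (by linarith)
      · have : dist (rowVec S e.1.1) (rowVec S e.1.2) ≤ dmin := by
          by_contra hle
          have := pow_le_pow_left₀ hd.le (not_le.1 hle).le 2
          linarith
        rw [similarity, if_pos ⟨hne, this⟩, abs_sub_comm, abs_of_nonneg (by linarith [h1 e])]
        exact hl e (by linarith)
    · rwa [sub_self, abs_zero]
  · rw [mixRows, if_pos he]
    by_cases hs : e.1.1 ≠ e.1.2 ∧ dist (rowVec S e.1.1) (rowVec S e.1.2) ≤ dmin
    · have hs' : similarity S dmin e.1.1 e.1.2 = 1 := by rw [similarity, if_pos hs]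
      rw [hs', fillZeros_incidence_of_eq_one hs', fillZeros_incidence_one]
      ring
    · have hs' : similarity S dmin e.1.1 e.1.2 = 0 := by rw [similarity, if_neg hs]
      rw [hs', fillZeros_incidence_of_eq_zero hs', fillZeros_incidence_zero]
      ring
  · refine ⟨_, ?_, ?_, fun i => rfl⟩
    · dsimp only
      split_ifs
      · rw [similarity]
        split_ifs <;> norm_num
      · exact h0 e
    · dsimp only
      split_ifs
      · rw [similarity]
        split_ifs <;> norm_num
      · exact h1 e

/-- The number of pairs that do not contain a given node. -/
theorem card_nodePair_ne (i : Fin n) :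
    2 * (Finset.univ.filter fun e : NodePair n => i ≠ e.1.1 ∧ i ≠ e.1.2).card
      = (n - 1) * (n - 1) - (n - 1) := by
  classical
  have h1 : ((Finset.univ.erase i).offDiag).card = (n - 1) * (n - 1) - (n - 1) := by
    rw [Finset.offDiag_card, Finset.card_erase_of_mem (Finset.mem_univ _), Finset.card_univ,
      Fintype.card_fin]
  have h2 : (Finset.univ.erase i).offDiag
      = (Finset.univ.filter fun e : NodePair n => i ≠ e.1.1 ∧ i ≠ e.1.2).image (fun e => e.1)
        ∪ (Finset.univ.filter fun e : NodePair n => i ≠ e.1.1 ∧ i ≠ e.1.2).image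
          (fun e => e.1.swap) := by
    ext ⟨p, q⟩
    simp only [Finset.mem_offDiag, Finset.mem_erase, Finset.mem_univ, and_true, Finset.mem_union,
      Finset.mem_image, Finset.mem_filter, true_and, Subtype.exists, Prod.exists]
    constructor
    · rintro ⟨hp, hq, hpq⟩
      rcases lt_or_gt_of_ne hpq with h | h
      · exact Or.inl ⟨p, q, h, ⟨hp.symm, hq.symm⟩, rfl⟩
      · exact Or.inr ⟨q, p, h, ⟨hq.symm, hp.symm⟩, rfl⟩
    · rintro (⟨a, b, h, ⟨h1, h2⟩, e⟩ | ⟨a, b, h, ⟨h1, h2⟩, e⟩) <;>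
        simp only [Prod.swap_prod_mk, Prod.mk.injEq] at e <;> obtain ⟨rfl, rfl⟩ := e
      · exact ⟨h1.symm, h2.symm, ne_of_lt h⟩
      · exact ⟨h2.symm, h1.symm, (ne_of_lt h).symm⟩
  rw [← h1, h2, Finset.card_union_of_disjoint, Finset.card_image_of_injective _
      Subtype.val_injective,
    Finset.card_image_of_injective (f := fun e : NodePair n => e.1.swap) _
      (Prod.swap_injective.comp Subtype.val_injective), two_mul]
  rw [Finset.disjoint_left]
  intro x hx hx'
  obtain ⟨a, -, rfl⟩ := Finset.mem_image.1 hx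
  obtain ⟨b, -, e⟩ := Finset.mem_image.1 hx'
  have h1 := a.2
  have h2 := b.2
  rw [← e, Prod.fst_swap, Prod.snd_swap] at h1
  exact lt_asymm h1 h2

/-- There are `(n - 1) (n - 2) / 2` entries of a row that are equal to `ε`. -/
theorem le_norm_mixRows (hn : 3 ≤ n) (t : NodePair n → ℝ) :
    n / 3 * ε ≤ ‖rowVec (mixRows ε t) i‖ := by
  classical
  rw [← abs_of_nonneg (norm_nonneg (rowVec (mixRows ε t) i))]
  refine le_of_sq_le_sq ?_ (abs_nonneg _)
  rw [sq_abs, EuclideanSpace.norm_sq_eq]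
  have h1 : ∑ e ∈ Finset.univ.filter (fun e : NodePair n => i ≠ e.1.1 ∧ i ≠ e.1.2),
      ‖rowVec (mixRows ε t) i e‖ ^ 2 ≤ ∑ e, ‖rowVec (mixRows ε t) i e‖ ^ 2 :=
    Finset.sum_le_sum_of_subset_of_nonneg (Finset.filter_subset _ _) fun _ _ _ => sq_nonneg _
  have h2 : ∑ e ∈ Finset.univ.filter (fun e : NodePair n => i ≠ e.1.1 ∧ i ≠ e.1.2),
      ‖rowVec (mixRows ε t) i e‖ ^ 2
      = (Finset.univ.filter fun e : NodePair n => i ≠ e.1.1 ∧ i ≠ e.1.2).card * ε ^ 2 := by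
    rw [← nsmul_eq_mul]
    refine Finset.sum_eq_card_nsmul fun e he => ?_
    obtain ⟨h1, h2⟩ := (Finset.mem_filter.1 he).2
    change ‖mixRows ε t i e‖ ^ 2 = _
    rw [mixRows_apply, if_neg h1, if_neg h2, Real.norm_eq_abs, sq_abs]
    ring
  refine le_trans ?_ (h2.symm.le.trans h1)
  have h3 := card_nodePair_ne i
  obtain ⟨m, rfl⟩ : ∃ m, n = m + 3 := ⟨n - 3, by omega⟩
  have h4 : (m + 3 - 1) * (m + 3 - 1) - (m + 3 - 1) = (m + 2) * (m + 1) := by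
    rw [Nat.sub_eq_iff_eq_add (by nlinarith [show m + 3 - 1 = m + 2 by omega])]
    rw [show m + 3 - 1 = m + 2 by omega]
    ring
  rw [h4] at h3
  have h5 : 2 * ((Finset.univ.filter fun e : NodePair (m + 3) => i ≠ e.1.1 ∧ i ≠ e.1.2).card : ℝ)
      = (m + 2) * (m + 1) := by exact_mod_cast h3
  rw [mul_pow]
  gcongr
  push_cast
  nlinarith [(Nat.cast_nonneg m : (0 : ℝ) ≤ m)]

theorem norm_mixRows_sub_le (hε : 0 ≤ ε) (hε1 : ε ≤ 1) {t t' : NodePair n → ℝ} {τ : ℝ}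
    (hτ : 0 ≤ τ) (h : ∀ e, |t e - t' e| ≤ τ) :
    ‖rowVec (mixRows ε t) i - rowVec (mixRows ε t') i‖ ≤ 2 * τ * n := by
  refine le_of_sq_le_sq ?_ (by positivity)
  rw [EuclideanSpace.norm_sq_eq]
  have h1 : ∀ e ∈ Finset.univ, ‖(rowVec (mixRows ε t) i - rowVec (mixRows ε t') i) e‖ ^ 2
      ≤ (2 * τ) ^ 2 := by
    intro e _
    refine pow_le_pow_left₀ (norm_nonneg _) ?_ 2
    have e1 : (rowVec (mixRows ε t) i - rowVec (mixRows ε t') i) e = (t e - t' e)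
        * ((if i = e.1.1 then 1 else if i = e.1.2 then -1 else ε) - ε) := by
      rw [PiLp.sub_apply]
      change mixRows ε t i e - mixRows ε t' i e = _
      rw [mixRows_apply, mixRows_apply]
      ring
    rw [e1, Real.norm_eq_abs, abs_mul, mul_comm]
    refine mul_le_mul ?_ (h e) (abs_nonneg _) zero_le_two
    split_ifs <;> rw [abs_le] <;> constructor <;> linarith
  refine (Finset.sum_le_card_nsmul _ _ _ h1).trans ?_
  have h2 : Fintype.card (NodePair n) ≤ n * n := by
    refine (Fintype.card_subtype_le _).trans ?_
    rw [Fintype.card_prod, Fintype.card_fin]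
  have h3 : (Fintype.card (NodePair n) : ℝ) ≤ n * n := by exact_mod_cast h2
  rw [nsmul_eq_mul, Finset.card_univ]
  calc (Fintype.card (NodePair n) : ℝ) * (2 * τ) ^ 2 ≤ n * n * (2 * τ) ^ 2 := by gcongr
    _ = (2 * τ * n) ^ 2 := by ring

end Mix

theorem norm_normalize_sub_le {E : Type*} [NormedAddCommGroup E] [NormedSpace ℝ E] {u v : E}
    (hu : 0 < ‖u‖) (hv : 0 < ‖v‖) : ‖‖u‖⁻¹ • u - ‖v‖⁻¹ • v‖ ≤ 2 * ‖u - v‖ / ‖v‖ := by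
  have h1 : ‖u‖⁻¹ • u - ‖v‖⁻¹ • v = ‖v‖⁻¹ • (u - v) + ((‖v‖ - ‖u‖) / ‖v‖) • ‖u‖⁻¹ • u := by
    rw [smul_sub, smul_smul]
    have : (‖v‖ - ‖u‖) / ‖v‖ * ‖u‖⁻¹ = ‖u‖⁻¹ - ‖v‖⁻¹ := by field_simp
    rw [this, sub_smul]
    abel
  rw [h1]
  refine (norm_add_le _ _).trans ?_
  rw [norm_smul, norm_smul, norm_smul, norm_inv, norm_inv, norm_norm, norm_norm,
    inv_mul_cancel₀ hu.ne', mul_one, norm_div, norm_norm, Real.norm_eq_abs, ← div_eq_inv_mul,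
    two_mul, add_div]
  gcongr
  rw [abs_sub_comm]
  exact abs_norm_sub_norm_le u v

theorem norm_unitState_sub_le {W κ : Type} [Fintype W] [DecidableEq W] [Fintype κ]
    {f : κ → W → Bool} (hf : Function.Injective f) {a b : EuclideanSpace ℝ κ} (ha : 0 < ‖a‖)
    (hb : 0 < ‖b‖) : ‖unitState f a - unitState f b‖ ≤ 2 * ‖a - b‖ / ‖b‖ := by
  refine le_trans (le_of_eq ?_) (norm_normalize_sub_le ha hb)
  rw [← norm_sum_ket hf, unitState, unitState, ← Finset.sum_sub_distrib]
  congr 1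
  refine Finset.sum_congr rfl fun e _ => ?_
  rw [← sub_smul, ← Complex.ofReal_sub, PiLp.sub_apply, PiLp.smul_apply, PiLp.smul_apply,
    smul_eq_mul, smul_eq_mul, div_eq_inv_mul, div_eq_inv_mul]

theorem norm_rowVec_normalizeRows {n : ℕ} {κ : Type} [Fintype κ] {A : Matrix (Fin n) κ ℝ}
    {i : Fin n} (h : 0 < ‖rowVec A i‖) : ‖rowVec (normalizeRows A) i‖ = 1 := by
  have : rowVec (normalizeRows A) i = ‖rowVec A i‖⁻¹ • rowVec A i := by
    ext j
    change A i j / _ = _ * A i j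
    rw [div_eq_inv_mul]
  rw [this, norm_smul, norm_inv, norm_norm, inv_mul_cancel₀ h.ne']

theorem relabelOp_unitState {P : RowParams} (i : Fin P.n) {A : Matrix (Fin P.n) (NodePair P.n) ℝ}
    (h : 0 < ‖rowVec A i‖) :
    relabelOp (rowEquiv P) (unitState (fun e => rowStr P i (pairBits e)) (rowVec A i))
      = ∑ e, ((normalizeRows A i e / ‖rowVec (normalizeRows A) i‖ : ℝ) : ℂ)
        • accessKet (Fintype.card (RowAnc P)) i (pairBits e) := by
  rw [unitState, map_sum, norm_rowVec_normalizeRows h]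
  refine Finset.sum_congr rfl fun e _ => ?_
  rw [map_smul, relabelOp_rowStr, div_one]
  rfl

/-! ### The row circuit -/

/-- The edge polynomial is almost right for the pairs with a clear distance. -/
theorem edgeValue_spec {P : RowParams} {f f' : ℕ} {η ε dmin τ : ℝ} (hη : 1 ≤ η) (hε : 0 < ε)
    (hεη : ε ≤ 4 * η) (hd : 0 < dmin) (hf : f' ≤ f) (hsh : P.sh = f - f')
    (hf' : 32 * √η ≤ ε * 2 ^ f') (hL : 4 * √η * 2 ^ f' ≤ 2 ^ P.L) {c : ℕ → ℝ}
    (hc : ∀ k, P.c k = (-1) ^ k * c k)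
    (hstep : ∀ θ, 0 ≤ θ → θ ≤ Real.pi →
      0 ≤ ∑ k ∈ Finset.range (P.K + 1), c k * Real.cos (k * θ) ∧
      ∑ k ∈ Finset.range (P.K + 1), c k * Real.cos (k * θ) ≤ 1 ∧
      (θ ≤ Real.arccos (max (1 - dmin ^ 2 / (2 ^ P.L / 2 ^ f') ^ 2 / 2) 0)
          - ε / (8 * (2 ^ P.L / 2 ^ f') ^ 2) →
        1 - ∑ k ∈ Finset.range (P.K + 1), c k * Real.cos (k * θ) ≤ τ) ∧
      (Real.arccos (max (1 - dmin ^ 2 / (2 ^ P.L / 2 ^ f') ^ 2 / 2) 0)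
          + ε / (8 * (2 ^ P.L / 2 ^ f') ^ 2) ≤ θ →
        ∑ k ∈ Finset.range (P.K + 1), c k * Real.cos (k * θ) ≤ τ))
    {S : Matrix (Fin P.n) (Fin P.d) ℝ} (hS : ∀ i, 1 ≤ ‖rowVec S i‖ ∧ ‖rowVec S i‖ ≤ √η)
    {X : Fin P.n → ℕ} (hX : ∀ i, |(X i : ℝ) / 2 ^ f - ‖rowVec S i‖| ≤ 1 / 2 ^ f)
    {p q : Fin P.n} (hy : -1 ≤ pairCos P (fun i j => S i j / ‖rowVec S i‖) X p q)
    (hy' : pairCos P (fun i j => S i j / ‖rowVec S i‖) X p q ≤ 1) :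
    0 ≤ edgeValue P (fun i j => S i j / ‖rowVec S i‖) X p q ∧
    edgeValue P (fun i j => S i j / ‖rowVec S i‖) X p q ≤ 1 ∧
    (dist (rowVec S p) (rowVec S q) ^ 2 < dmin ^ 2 - ε →
      1 - edgeValue P (fun i j => S i j / ‖rowVec S i‖) X p q ≤ τ) ∧
    (dmin ^ 2 + ε < dist (rowVec S p) (rowVec S q) ^ 2 →
      edgeValue P (fun i j => S i j / ‖rowVec S i‖) X p q ≤ τ) := by
  have hs1 : 1 ≤ √η := Real.one_le_sqrt.2 hη
  have hs0 : 0 < √η := by linarith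
  have hss : √η * √η = η := Real.mul_self_sqrt (by linarith)
  have h2f : (0 : ℝ) < 2 ^ f' := by positivity
  set v : Fin P.n → EuclideanSpace ℝ (Fin P.d) := fun i =>
    ((((X i >>> P.sh : ℕ) : ℝ) + 1) / 2 ^ f' / ‖rowVec S i‖) • rowVec S i with hv
  have hκ : (2 : ℝ) / 2 ^ f' ≤ ε / (8 * √η) / 2 := by
    rw [div_div, div_le_div_iff₀ h2f (by positivity)]
    linarith
  have hvi : ∀ i, ‖v i - rowVec S i‖ ≤ ε / (8 * √η) / 2 := by
    intro i
    rw [hv]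
    dsimp only
    rw [norm_rescale_sub (by linarith [(hS i).1]), hsh]
    exact (abs_shiftRight_sub_le hf (hX i)).trans hκ
  have hdist : ‖rowVec S p - rowVec S q‖ ≤ 2 * √η :=
    (norm_sub_le _ _).trans (by linarith [(hS p).2, (hS q).2])
  have hDD : |‖v p - v q‖ ^ 2 - dist (rowVec S p) (rowVec S q) ^ 2| ≤ 9 / 16 * ε := by
    rw [dist_eq_norm]
    refine (abs_sq_dist_sub_le (hvi p) (hvi q) hdist).trans ?_
    have e1 : ε / (8 * √η) * (2 * (2 * √η) + ε / (8 * √η)) = ε / 2 + ε * ε / (64 * (√η * √η)) := by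
      field_simp
      ring
    rw [e1, hss]
    have : ε * ε / (64 * η) ≤ ε / 16 := by
      rw [div_le_div_iff₀ (by positivity) (by norm_num)]
      nlinarith
    linarith
  have hD : dist (rowVec S p) (rowVec S q) ^ 2 ≤ 4 * η := by
    rw [dist_eq_norm]
    nlinarith [norm_nonneg (rowVec S p - rowVec S q)]
  have hΛ : 16 * η ≤ (2 ^ P.L / 2 ^ f') ^ 2 := by
    have h : 4 * √η ≤ 2 ^ P.L / 2 ^ f' := (le_div_iff₀ h2f).2 hL
    nlinarith
  have hpc : pairCos P (fun i j => S i j / ‖rowVec S i‖) X p q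
      = ‖v p - v q‖ ^ 2 / (2 ^ P.L / 2 ^ f') ^ 2 / 2 - 1 := by
    rw [pairCos, sum_sq_normAmp]
  rw [edgeValue_eq hc]
  rw [hpc] at hy hy' ⊢
  obtain ⟨h1, h2⟩ := angle_of_sq_dist hε hεη hD hDD hΛ (by positivity : 0 < dmin ^ 2) hy hy'
  obtain ⟨a1, a2, a3, a4⟩ := hstep _ (sub_nonneg.2 (Real.arccos_le_pi _))
    (by linarith [Real.arccos_nonneg (‖v p - v q‖ ^ 2 / (2 ^ P.L / 2 ^ f') ^ 2 / 2 - 1)])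
  exact ⟨a1, a2, fun h => a3 (h1 h), fun h => a4 (h2 h)⟩

theorem two_pow_width_le {n : ℕ} (hn : 1 ≤ n) : 2 ^ width n ≤ 2 * n := by
  rcases hn.lt_or_eq with h | rfl
  · have h1 := Nat.pow_pred_clog_lt_self (b := 2) one_lt_two h
    have h2 : 0 < Nat.clog 2 n := Nat.clog_pos one_lt_two h
    have h3 : 2 ^ Nat.clog 2 n = 2 ^ (Nat.clog 2 n).pred * 2 := by
      rw [← pow_succ, Nat.pred_eq_sub_one, Nat.sub_add_cancel h2]
    rw [width, h3]
    omega
  · simp [width]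

theorem shiftRight_lt_two_pow {η ε a : ℝ} (hη : 1 ≤ η) (hε : ε ≤ 4 * η) {f f' L X : ℕ}
    (hf : f' ≤ f) (hf' : 32 * √η ≤ ε * 2 ^ f') (hL : 4 * √η * 2 ^ f' ≤ 2 ^ L) (ha : a ≤ √η)
    (hX : |(X : ℝ) / 2 ^ f - a| ≤ 1 / 2 ^ f) : X >>> (f - f') < 2 ^ L := by
  have hs1 : 1 ≤ √η := Real.one_le_sqrt.2 hη
  have hss : √η * √η = η := Real.mul_self_sqrt (by linarith)
  have h2f : (0 : ℝ) < 2 ^ f' := by positivity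
  have h1 := (abs_le.1 (abs_shiftRight_sub_le hf hX)).2
  have h2 : (2 : ℝ) ≤ √η * 2 ^ f' := by nlinarith
  have h3 : (((X >>> (f - f') : ℕ) : ℝ) + 1) / 2 ^ f' ≤ √η + 2 / 2 ^ f' := by linarith
  rw [div_le_iff₀ h2f, add_mul, div_mul_cancel₀ _ h2f.ne'] at h3
  have h4 : ((X >>> (f - f') : ℕ) : ℝ) < 2 ^ L := by linarith
  exact_mod_cast h4

/-- The rows that the circuit prepares are close to the rows of an incidence matrix. -/
theorem exists_preparesRows_rowC {P : RowParams} (hP : P.Good) (hs : 0 < P.s) (hεB : 0 < P.εB)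
    (hn : 3 ≤ P.n) {f f' : ℕ} {η ε dmin δ : ℝ}
    (hη : 1 ≤ η) (hε : 0 < ε) (hεη : ε ≤ 4 * η) (hd : 0 < dmin) (hδ : 0 < δ) (hδ1 : δ < 1)
    (hf : f' ≤ f) (hsh : P.sh = f - f')
    (hf' : 32 * √η ≤ ε * 2 ^ f') (hL : 4 * √η * 2 ^ f' ≤ 2 ^ P.L) {c : ℕ → ℝ}
    (hc : ∀ k, P.c k = (-1) ^ k * c k)
    (hstep : ∀ θ, 0 ≤ θ → θ ≤ Real.pi →
      0 ≤ ∑ k ∈ Finset.range (P.K + 1), c k * Real.cos (k * θ) ∧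
      ∑ k ∈ Finset.range (P.K + 1), c k * Real.cos (k * θ) ≤ 1 ∧
      (θ ≤ Real.arccos (max (1 - dmin ^ 2 / (2 ^ P.L / 2 ^ f') ^ 2 / 2) 0)
          - ε / (8 * (2 ^ P.L / 2 ^ f') ^ 2) →
        1 - ∑ k ∈ Finset.range (P.K + 1), c k * Real.cos (k * θ) ≤ δ * P.εB / 24) ∧
      (Real.arccos (max (1 - dmin ^ 2 / (2 ^ P.L / 2 ^ f') ^ 2 / 2) 0)
          + ε / (8 * (2 ^ P.L / 2 ^ f') ^ 2) ≤ θ →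
        ∑ k ∈ Finset.range (P.K + 1), c k * Real.cos (k * θ) ≤ δ * P.εB / 24))
    (hrr : Even P.rr) (hrr1 : 1 ≤ P.rr)
    (hb : |Real.sin (Real.pi / (2 * (2 * P.rr + 1)))| * ∑ j ∈ Finset.range (P.J + 1), |P.b j| ≤ 1)
    (hcb : ∀ α, P.s * P.εB / 24 ≤ α → α ≤ 1 →
      ∑ j ∈ Finset.range (P.J + 1), P.b j * Real.cos ((2 * j + 1) * Real.arccos α) ≤ 1 ∧
      1 - δ / 2 / 8
        ≤ ∑ j ∈ Finset.range (P.J + 1), P.b j * Real.cos ((2 * j + 1) * Real.arccos α))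
    {S : Matrix (Fin P.n) (Fin P.d) ℝ} {R : QUnitary (RowBox P)} {N : QUnitary (NormBox P)}
    (hS : ∀ i, 1 ≤ ‖rowVec S i‖ ∧ ‖rowVec S i‖ ≤ √η)
    (hR : PreparesRows R S (fun j => bits (width P.d) j) 0) (hN : WritesNorms N S f) :
    ∃ B : Matrix (Fin P.n) (NodePair P.n) ℝ, IsSimilarityIncidence S dmin ε P.εB B ∧
      (∀ i, 0 < ‖rowVec B i‖) ∧
      PreparesRows ((relabelC (rowEquiv P) (rowC P)).run R N) (normalizeRows B) pairBits δ := by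
  choose X hXr hXa hXN using hN
  have hR' : ∀ i, R (accessKet P.w i fun _ => false)
      = ∑ j, ((S i j / ‖rowVec S i‖ : ℝ) : ℂ) • accessKet P.w i (bits (width P.d) j) := fun i =>
    sub_eq_zero.1 (norm_le_zero_iff.1 (hR i))
  have hXL : ∀ i, X i >>> P.sh < 2 ^ P.L := fun i =>
    hsh ▸ shiftRight_lt_two_pow hη hεη hf hf' hL (hS i).2 (hXa i)
  set σ : Fin P.n → Fin P.d → ℝ := fun i j => S i j / ‖rowVec S i‖ with hσ
  have hcos : ∀ p q, -1 ≤ pairCos P σ X p q ∧ pairCos P σ X p q ≤ 1 := by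
    intro p q
    have hz : Loaded P (fun b => if b then q else p) (fun w => match w with
        | Sum.inr (Sum.inr (.fst j)) => bits (width P.n) p j
        | Sum.inr (Sum.inr (.snd j)) => bits (width P.n) q j
        | _ => false) := ⟨fun j => rfl, fun j => rfl, fun j => rfl, fun j => rfl, rfl⟩
    have := groverCos_diffC hR' hXN hXr hXL hz fun w hw => by
      revert hw
      simp only [mem_workWires, mem_cmpWires]
      rintro ((rfl | ⟨j, rfl⟩) | ⟨j, rfl⟩ | ⟨j, rfl⟩ | ⟨j, rfl⟩) <;> rfl
    have h2 := abs_groverCos_le R N (diffC P) (cmpWires P) (fun w => match w with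
        | Sum.inr (Sum.inr (.fst j)) => bits (width P.n) p j
        | Sum.inr (Sum.inr (.snd j)) => bits (width P.n) q j
        | _ => false)
    rw [this] at h2
    exact h2
  have hspec := fun p q => edgeValue_spec hη hε hεη hd hf hsh hf' hL hc hstep hS hXa
    (hcos p q).1 (hcos p q).2
  obtain ⟨t, ht, hB⟩ := exists_isSimilarityIncidence (ε := P.εB) (S := S) hd hε
    (by positivity : 0 ≤ δ * P.εB / 24)
    (h := fun e => edgeValue P σ X e.1.1 e.1.2) (fun e => (hspec _ _).1) (fun e => (hspec _ _).2.1)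
    (fun e => (hspec _ _).2.2.1) fun e => (hspec _ _).2.2.2
  have hn0 : (0 : ℝ) < P.n := by
    have : 0 < P.n := by omega
    exact_mod_cast this
  have hlow : 0 < (P.n : ℝ) / 3 * P.εB := by positivity
  have hpos : ∀ i, 0 < ‖rowVec (mixRows P.εB t) i‖ := fun i =>
    hlow.trans_le (le_norm_mixRows hn t)
  refine ⟨mixRows P.εB t, hB, hpos, fun i => ?_⟩
  have hpos' : (P.n : ℝ) / 3 * P.εB ≤ ‖rowVec (polyEntry P σ X) i‖ := by
    rw [polyEntry_eq_mixRows]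
    exact le_norm_mixRows hn _
  have hα : P.s * P.εB / 24 ≤ P.s / (4 * 2 ^ width P.n) * ‖rowVec (polyEntry P σ X) i‖ := by
    have hw : (2 : ℝ) ^ width P.n ≤ 2 * P.n := by
      exact_mod_cast two_pow_width_le (n := P.n) (by omega)
    calc P.s * P.εB / 24 = P.s / (4 * (2 * P.n)) * (P.n / 3 * P.εB) := by field_simp; norm_num
      _ ≤ P.s / (4 * 2 ^ width P.n) * ‖rowVec (polyEntry P σ X) i‖ := by gcongr
  have h1 := norm_rowC_sub_le hP hs hR' hXN hXr hXL (δ := δ / 2) (by linarith) hrr hrr1 hb hcb i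
    (hlow.trans_le hpos') hα
  have hinj : Function.Injective fun e : NodePair P.n => rowStr P i (pairBits e) :=
    (rowStr_injective i).comp pairBits_injective
  have h2 := norm_unitState_sub_le hinj (hlow.trans_le hpos') (hpos i)
  have h3 : ‖rowVec (polyEntry P σ X) i - rowVec (mixRows P.εB t) i‖
      ≤ 2 * (δ * P.εB / 24) * P.n := by
    rw [polyEntry_eq_mixRows]
    exact norm_mixRows_sub_le hεB.le hP.εB_le (by positivity) ht
  have h4 : 2 * ‖rowVec (polyEntry P σ X) i - rowVec (mixRows P.εB t) i‖
      / ‖rowVec (mixRows P.εB t) i‖ ≤ δ / 2 := by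
    rw [div_le_iff₀ (hpos i)]
    have := le_norm_mixRows (ε := P.εB) hn t (i := i)
    nlinarith
  rw [run_eq_cOp, ← relabelOp_rowStr, cOp_relabelC, ← relabelOp_unitState i (hpos i), ← map_sub,
    LinearIsometryEquiv.norm_map]
  refine (norm_sub_le_norm_sub_add_norm_sub _
    (unitState (fun e => rowStr P i (pairBits e)) (rowVec (polyEntry P σ X) i)) _).trans ?_
  linarith

/-! ### The running time of the row circuit -/

/-- The running time of the row circuit is the product of the time of `diffC` and of the degrees `K`
and `J` of the two polynomials, up to logarithms. -/
theorem time_rowC_le {P : RowParams} {T ℓ a b : ℝ} (hT : 1 ≤ T) (hℓ : 1 ≤ ℓ) (ha : 1 ≤ 4 * a)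
    (hb : 1 ≤ b) (hw : (P.w : ℝ) ≤ T) (hn : (width P.n : ℝ) ≤ 4 * ℓ) (hd : (width P.d : ℝ) ≤ 4 * ℓ)
    (hL : (P.L : ℝ) ≤ 12 * ℓ) (hK : (P.K : ℝ) ≤ 98304 * a * ℓ) (hJ : (P.J : ℝ) ≤ 50688 * b * ℓ ^ 2)
    (hr : (P.rr : ℝ) ≤ 50 * ℓ) :
    QCircuit.time T (rowC P) ≤ 10 ^ 17 * (T * a * b) * ℓ ^ 5 := by
  have hT0 : 0 < T := by linarith
  have hℓ0 : 0 < ℓ := by linarith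
  have ha0 : 0 < a := by linarith
  have hℓT : ℓ ≤ ℓ * T := le_mul_of_one_le_right hℓ0.le hT
  have hTℓ : T ≤ ℓ * T := le_mul_of_one_le_left hT0.le hℓ
  have hK0 : (0 : ℝ) ≤ P.K := Nat.cast_nonneg _
  have hKℓ : 0 ≤ P.K * (ℓ * T) := by positivity
  have h1 : (8 * width P.n + 2 * (P.L : ℝ) + 7) * T ≤ 63 * (ℓ * T) := by
    rw [← mul_assoc]
    gcongr
    linarith
  have h2 : ((P.K : ℝ) + 2) * (4 + 2 * ((8 * width P.n + 2 * P.L + 7) * T)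
        + 6 * (2 * P.L + 4 + width P.n + width P.d + P.w)) ≤ (P.K + 2) * (352 * (ℓ * T)) := by
    gcongr
    linarith
  have hE := time_unscaledRowC_le (P := P) hT
  have hE' : QCircuit.time T (unscaledRowC P) ≤ (P.K + 4) * (352 * (ℓ * T)) := by
    rw [add_mul] at h2 ⊢
    linarith
  have hK1 : (P.K : ℝ) ≤ P.K * (ℓ * T) :=
    le_mul_of_one_le_right hK0 (by linarith)
  have hl₁ : (((workWires P ++ degWires P).length : ℕ) : ℝ) ≤ (P.K + 4) * (352 * (ℓ * T)) := by
    rw [List.length_append, length_workWires, length_degWires]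
    push_cast
    rw [add_mul]
    linarith
  have hl₀ : (((pairWires P ++ (workWires P ++ degWires P)).length : ℕ) : ℝ)
      ≤ (P.K + 4) * (352 * (ℓ * T)) := by
    rw [List.length_append, List.length_append, length_workWires, length_degWires, length_pairWires]
    push_cast
    rw [add_mul]
    linarith
  have hX1 : 1 ≤ ((P.K : ℝ) + 4) * (352 * (ℓ * T)) := by
    rw [add_mul]
    linarith
  refine (time_normalizeC_le T hT0.le (scrW P) (ancW P (.dum 0)) (ancW P (.dum 1)) (unscaledRowC P)
    _ _ (ancW P (.dum 1)) (ancW P (.dum 2)) (ancW P (.cod 0)) (K := P.J) (by simp) P.b P.rr hX1 hE'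
    hl₀ hl₁).trans ?_
  have haℓ : a ≤ a * ℓ := le_mul_of_one_le_right ha0.le hℓ
  have hbℓ : 1 ≤ b * ℓ ^ 2 := one_le_mul_of_one_le_of_one_le hb (one_le_pow₀ hℓ)
  have g1 : (P.K : ℝ) + 4 ≤ 98320 * (a * ℓ) := by linarith
  have g2 : (P.J : ℝ) + 2 ≤ 50690 * (b * ℓ ^ 2) := by linarith
  have g3 : (P.rr : ℝ) + 1 ≤ 51 * ℓ := by linarith
  have hb0 : 0 < b := by linarith
  calc 200 * ((P.rr : ℝ) + 1) * (P.J + 2) * ((P.K + 4) * (352 * (ℓ * T)))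
      ≤ 200 * (51 * ℓ) * (50690 * (b * ℓ ^ 2)) * ((98320 * (a * ℓ)) * (352 * (ℓ * T))) := by gcongr
    _ = 17893982008320000 * ((T * a * b) * ℓ ^ 5) := by ring
    _ ≤ 10 ^ 17 * ((T * a * b) * ℓ ^ 5) := by gcongr; norm_num
    _ = 10 ^ 17 * (T * a * b) * ℓ ^ 5 := by ring

theorem log_le_of_le_pow {M x : ℝ} {k : ℕ} (hx : 0 < x) (h : x ≤ M ^ k) :
    Real.log x ≤ k * Real.log M := by
  rw [← Real.log_pow]
  exact Real.log_le_log hx h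

theorem cast_le_of_two_pow_le {M : ℝ} {k j : ℕ} (h : (2 : ℝ) ^ k ≤ M ^ j) :
    (k : ℝ) ≤ 2 * j * Real.log M := by
  have h1 := log_le_of_le_pow (by positivity) h
  rw [Real.log_pow] at h1
  have h2 := Real.log_two_gt_d9
  nlinarith [(Nat.cast_nonneg k : (0 : ℝ) ≤ k)]

theorem two_pow_width_le' (n : ℕ) : 2 ^ width n ≤ 2 * n + 1 := by
  rcases Nat.eq_zero_or_pos n with rfl | h
  · simp [width]
  · exact (two_pow_width_le h).trans (Nat.le_succ _)

theorem one_le_log {M : ℝ} (hM : 6 ≤ M) : 1 ≤ Real.log M := by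
  rw [Real.le_log_iff_exp_le (by linarith)]
  linarith [Real.exp_one_lt_d9]

/-- The degree of the polynomial that recognizes the edges. -/
theorem exists_edge_poly {M η ε εB δ m Λ : ℝ} (hM : 6 ≤ M) (hηε : η / ε ≤ M ^ 2)
    (hεBM : 1 / εB ≤ M) (hδM : 1 / δ ≤ M) (hε : 0 < ε) (hεη : ε ≤ 4 * η) (hεB : 0 < εB)
    (hεB1 : εB ≤ 1) (hδ : 0 < δ) (hδ1 : δ < 1) (hm : 0 < m) (hΛ1 : 16 * η ≤ Λ) (hΛ2 : Λ ≤ 64 * η) :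
    ∃ (K : ℕ) (c : ℕ → ℝ), 0 ≤ Real.log K ∧ (K : ℝ) ≤ 98304 * (η / ε) * Real.log M ∧
      Real.log K ≤ 10 * Real.log M ∧ ∑ k ∈ Finset.range (K + 1), |c k| ≤ 2 + Real.log K ∧
      ∀ θ, 0 ≤ θ → θ ≤ Real.pi →
        0 ≤ ∑ k ∈ Finset.range (K + 1), c k * Real.cos (k * θ) ∧
        ∑ k ∈ Finset.range (K + 1), c k * Real.cos (k * θ) ≤ 1 ∧
        (θ ≤ Real.arccos (max (1 - m / Λ / 2) 0) - ε / (8 * Λ) →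
          1 - ∑ k ∈ Finset.range (K + 1), c k * Real.cos (k * θ) ≤ δ * εB / 24) ∧
        (Real.arccos (max (1 - m / Λ / 2) 0) + ε / (8 * Λ) ≤ θ →
          ∑ k ∈ Finset.range (K + 1), c k * Real.cos (k * θ) ≤ δ * εB / 24) := by
  have hℓ := one_le_log hM
  have hℓM : Real.log M ≤ M :=
    (Real.log_le_sub_one_of_pos (by linarith)).trans (by linarith)
  have hpow : ∀ k : ℕ, (6 : ℝ) ^ k ≤ M ^ k := fun k => by gcongr
  have hη : 0 < η := by linarith
  have hΛ0 : 0 < Λ := by linarith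
  have hM0 : 0 < M := by linarith
  have hΔ0 : 0 < ε / (8 * Λ) := by positivity
  have hΔ1 : ε / (8 * Λ) ≤ 1 := by
    rw [div_le_one (by positivity)]
    linarith
  have hτ0 : 0 < δ * εB / 24 := by positivity
  have hτ1 : δ * εB / 24 ≤ 1 := by nlinarith
  have hmΛ : 0 < m / Λ / 2 := by positivity
  obtain ⟨K, c, hK0, hK, -, hcs, -, -, hstep⟩ := exists_step
    (θ₀ := Real.arccos (max (1 - m / Λ / 2) 0)) hΔ0 hΔ1 hτ0 hτ1
    (Real.arccos_pos.2 (max_lt (by linarith) one_pos))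
    (Real.arccos_le_pi_div_two.2 (le_max_right _ _))
  have hK1 : (1 : ℝ) ≤ K := by exact_mod_cast Nat.one_le_iff_ne_zero.2 hK0
  have hΔ : 1 / (ε / (8 * Λ)) ≤ 512 * (η / ε) := by
    rw [one_div_div, mul_div_assoc']
    exact div_le_div_of_nonneg_right (by linarith) hε.le
  have hlog1 : Real.log (64 / (ε / (8 * Λ) * (δ * εB / 24))) ≤ (12 : ℕ) * Real.log M := by
    refine log_le_of_le_pow (by positivity) ?_
    calc 64 / (ε / (8 * Λ) * (δ * εB / 24))
        = 1536 * (1 / (ε / (8 * Λ))) * (1 / δ) * (1 / εB) := by field_simp; norm_num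
      _ ≤ 1536 * (512 * M ^ 2) * M * M := by
        have : 1 / (ε / (8 * Λ)) ≤ 512 * M ^ 2 := hΔ.trans (by linarith)
        gcongr
      _ = 786432 * M ^ 4 := by ring
      _ ≤ M ^ 8 * M ^ 4 := by
        gcongr
        exact le_trans (by norm_num) (hpow 8)
      _ = M ^ 12 := by ring
  push_cast at hlog1
  have hKℓ : (K : ℝ) ≤ 98304 * (η / ε) * Real.log M := by
    refine hK.trans ?_
    have e : 16 / (ε / (8 * Λ)) = 16 * (1 / (ε / (8 * Λ))) := by ring
    rw [e]
    calc 16 * (1 / (ε / (8 * Λ))) * Real.log (64 / (ε / (8 * Λ) * (δ * εB / 24)))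
        ≤ 16 * (1 / (ε / (8 * Λ))) * (12 * Real.log M) := by gcongr
      _ ≤ 16 * (512 * (η / ε)) * (12 * Real.log M) := by gcongr
      _ = 98304 * (η / ε) * Real.log M := by ring
  have hKM : Real.log K ≤ (10 : ℕ) * Real.log M := by
    refine log_le_of_le_pow (by linarith) ?_
    calc (K : ℝ) ≤ 98304 * (η / ε) * Real.log M := hKℓ
      _ ≤ M ^ 7 * M ^ 2 * M := by
        gcongr
        exact le_trans (by norm_num) (hpow 7)
      _ = M ^ 10 := by ring
  push_cast at hKM
  exact ⟨K, c, Real.log_nonneg hK1, hKℓ, hKM, hcs, hstep⟩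

/-- The degree of the polynomial that normalizes the amplitude. -/
theorem exists_normalizing_poly {M εB δ t : ℝ} (hM : 6 ≤ M) (hεBM : 1 / εB ≤ M) (hδM : 1 / δ ≤ M)
    (hεB : 0 < εB) (hεB1 : εB ≤ 1) (hδ : 0 < δ) (hδ1 : δ < 1) (ht : 0 ≤ t)
    (htM : t ≤ 10 * Real.log M) :
    ∃ (J : ℕ) (b : ℕ → ℝ) (r : ℕ), Even r ∧ 1 ≤ r ∧
      (J : ℝ) ≤ 50688 * (1 / εB) * Real.log M ^ 2 ∧ (r : ℝ) ≤ 50 * Real.log M ∧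
      |Real.sin (Real.pi / (2 * (2 * r + 1)))| * ∑ j ∈ Finset.range (J + 1), |b j| ≤ 1 ∧
      ∀ α, 1 / (2 + t) * εB / 24 ≤ α → α ≤ 1 →
        ∑ j ∈ Finset.range (J + 1), b j * Real.cos ((2 * j + 1) * Real.arccos α) ≤ 1 ∧
        1 - δ / 2 / 8 ≤ ∑ j ∈ Finset.range (J + 1),
          b j * Real.cos ((2 * j + 1) * Real.arccos α) := by
  have hℓ := one_le_log hM
  have hℓM : Real.log M ≤ M :=
    (Real.log_le_sub_one_of_pos (by linarith)).trans (by linarith)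
  have hpow : ∀ k : ℕ, (6 : ℝ) ^ k ≤ M ^ k := fun k => by gcongr
  have hM0 : 0 < M := by linarith
  have hα0 : 0 < 1 / (2 + t) * εB / 24 := by positivity
  have hα1 : 1 / (2 + t) * εB / 24 ≤ 1 := by
    have h : 1 / (2 + t) ≤ 1 := by
      rw [div_le_one (by positivity)]
      linarith
    have : 1 / (2 + t) * εB ≤ 1 := mul_le_one₀ h hεB.le hεB1
    linarith
  obtain ⟨J, b, rr, hJ0, hrr, hrr1, hJ, hrrJ, hb, hcb⟩ := exists_amplify_params hα0 hα1
    (half_pos hδ) (by linarith)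
  have hα : 1 / (1 / (2 + t) * εB / 24) ≤ 288 * (1 / εB) * Real.log M := by
    calc 1 / (1 / (2 + t) * εB / 24) = 24 * (1 / εB) * (2 + t) := by field_simp
      _ ≤ 24 * (1 / εB) * (12 * Real.log M) := by gcongr; linarith
      _ = 288 * (1 / εB) * Real.log M := by ring
  have hlog2 : Real.log (1024 / (1 / (2 + t) * εB / 24 * (δ / 2))) ≤ (11 : ℕ) * Real.log M := by
    refine log_le_of_le_pow (by positivity) ?_
    calc 1024 / (1 / (2 + t) * εB / 24 * (δ / 2))
        = 2048 * (1 / (1 / (2 + t) * εB / 24)) * (1 / δ) := by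
          generalize 1 / (2 + t) * εB / 24 = α at hα0
          field_simp
          norm_num
      _ ≤ 2048 * (288 * M * M) * M := by
        have : 1 / (1 / (2 + t) * εB / 24) ≤ 288 * M * M := hα.trans (by gcongr)
        gcongr
      _ = 589824 * M ^ 3 := by ring
      _ ≤ M ^ 8 * M ^ 3 := by
        gcongr
        exact le_trans (by norm_num) (hpow 8)
      _ = M ^ 11 := by ring
  push_cast at hlog2
  have hJℓ : (J : ℝ) ≤ 50688 * (1 / εB) * Real.log M ^ 2 := by
    refine hJ.trans ?_
    generalize 1 / (2 + t) * εB / 24 = α at *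
    have e : 16 / α = 16 * (1 / α) := by ring
    rw [e]
    calc 16 * (1 / α) * Real.log (1024 / (α * (δ / 2)))
        ≤ 16 * (1 / α) * (11 * Real.log M) := by gcongr
      _ ≤ 16 * (288 * (1 / εB) * Real.log M) * (11 * Real.log M) := by gcongr
      _ = 50688 * (1 / εB) * Real.log M ^ 2 := by ring
  have hJ1 : (0 : ℝ) < J := by exact_mod_cast Nat.pos_of_ne_zero hJ0
  have hJM : Real.log J ≤ (10 : ℕ) * Real.log M := by
    refine log_le_of_le_pow hJ1 ?_
    calc (J : ℝ) ≤ 50688 * (1 / εB) * Real.log M ^ 2 := hJℓ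
      _ ≤ M ^ 7 * M * M ^ 2 := by
        gcongr
        exact le_trans (by norm_num) (hpow 7)
      _ = M ^ 10 := by ring
  push_cast at hJM
  exact ⟨J, b, rr, hrr, hrr1, hJℓ, by linarith, hb, hcb⟩

theorem width_le_log {n : ℕ} {M : ℝ} (hn : (n : ℝ) ≤ M) (hM : 6 ≤ M) :
    (width n : ℝ) ≤ 4 * Real.log M := by
  have h : (2 : ℝ) ^ width n ≤ 2 * n + 1 := by exact_mod_cast two_pow_width_le' n
  have h2 : (2 : ℝ) ^ width n ≤ M ^ 2 := by nlinarith
  have h3 := cast_le_of_two_pow_le h2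
  push_cast at h3
  linarith

theorem le_log_of_two_pow_le {L : ℕ} {M : ℝ} (hM : 6 ≤ M)
    (hL : (2 : ℝ) ^ L ≤ 8 * M + 512 * M ^ 2) : (L : ℝ) ≤ 12 * Real.log M := by
  have h6 : (6 : ℝ) ^ 4 ≤ M ^ 4 := pow_le_pow_left₀ (by norm_num) hM 4
  have h2 : (2 : ℝ) ^ L ≤ M ^ 6 := by
    calc (2 : ℝ) ^ L ≤ 8 * M + 512 * M ^ 2 := hL
      _ ≤ 6 ^ 4 * M ^ 2 := by nlinarith
      _ ≤ M ^ 4 * M ^ 2 := mul_le_mul_of_nonneg_right h6 (by positivity)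
      _ = M ^ 6 := by ring
  have h3 := cast_le_of_two_pow_le h2
  push_cast at h3
  linarith

/-- The row circuit: there are parameters for which it is fast and correct. -/
theorem exists_rowCircuit {n d w r f : ℕ} {TS η ε εB dmin δ : ℝ} (hn : 3 ≤ n) (hT : 1 ≤ TS)
    (hw : (w : ℝ) ≤ TS) (hε : 0 < ε) (hεη : ε ≤ 4 * η) (hεB : 0 < εB) (hεB1 : εB ≤ 1)
    (hd : 0 < dmin) (hδ : 0 < δ) (hδ1 : δ < 1) (hη : 1 ≤ η) (hf : 32 * √η ≤ ε * 2 ^ f) :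
    ∃ (m : ℕ) (C : QCircuit (AccessWires n (Fin (width d)) w) (AccessWires n (Fin r) 0)
        (AccessWires n (Fin (width n) ⊕ Fin (width n)) m)),
      C.time TS ≤ 10 ^ 17 * (TS * (η / ε) * (1 / εB))
        * Real.log (n + d + η + 1 / ε + 1 / εB + 1 / δ) ^ 5 ∧
      ∀ (S : Matrix (Fin n) (Fin d) ℝ) (R : QUnitary (AccessWires n (Fin (width d)) w))
        (N : QUnitary (AccessWires n (Fin r) 0)),
        (∀ i, 1 ≤ ‖rowVec S i‖ ∧ ‖rowVec S i‖ ≤ √η) →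
        PreparesRows R S (fun j => bits (width d) j) 0 → WritesNorms N S f →
        ∃ B : Matrix (Fin n) (NodePair n) ℝ, IsSimilarityIncidence S dmin ε εB B ∧
          (∀ i, 0 < ‖rowVec B i‖) ∧ PreparesRows (C.run R N) (normalizeRows B) pairBits δ := by
  -- all parameters are bounded by powers of `M`
  obtain ⟨M, hM⟩ : ∃ M : ℝ, n + d + η + 1 / ε + 1 / εB + 1 / δ = M := ⟨_, rfl⟩
  rw [hM]
  have hnR : (3 : ℝ) ≤ n := by exact_mod_cast hn
  have hdR : (0 : ℝ) ≤ d := Nat.cast_nonneg d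
  have hε' : 0 < 1 / ε := by positivity
  have hεB' : 1 ≤ 1 / εB := one_le_one_div hεB hεB1
  have hδ' : 1 ≤ 1 / δ := one_le_one_div hδ hδ1.le
  have hM6 : 6 ≤ M := by linarith
  have hM0 : 0 < M := by linarith
  have hηM : η ≤ M := by linarith
  have hεM : 1 / ε ≤ M := by linarith
  have hεBM : 1 / εB ≤ M := by linarith
  have hδM : 1 / δ ≤ M := by linarith
  have hηε : η / ε ≤ M ^ 2 := by
    rw [div_eq_mul_one_div, sq]
    gcongr
  have hℓ := one_le_log hM6
  have ha : 1 ≤ 4 * (η / ε) := by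
    rw [mul_div_assoc', le_div_iff₀ hε]
    linarith
  obtain ⟨f', hff, L, hf', hL1, hL2, hL3⟩ := exists_norm_precision hη hε hf
  have hs1 : 1 ≤ √η := Real.one_le_sqrt.2 hη
  have hss : √η * √η = η := Real.mul_self_sqrt (by linarith)
  have h2f : (0 : ℝ) < 2 ^ f' := by positivity
  have hΛ1 : 16 * η ≤ (2 ^ L / 2 ^ f') ^ 2 := by
    have h : 4 * √η ≤ 2 ^ L / 2 ^ f' := (le_div_iff₀ h2f).2 hL1
    nlinarith
  have hΛ2 : (2 ^ L / 2 ^ f') ^ 2 ≤ 64 * η := by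
    have h : 2 ^ L / 2 ^ f' ≤ 8 * √η := (div_le_iff₀ h2f).2 hL2
    have h' : (0 : ℝ) ≤ 2 ^ L / 2 ^ f' := by positivity
    nlinarith
  obtain ⟨K, c, hK0, hKℓ, hKM, hcs, hstep⟩ := exists_edge_poly (m := dmin ^ 2) hM6 hηε hεBM hδM hε
      hεη
    hεB hεB1 hδ hδ1 (by positivity) hΛ1 hΛ2
  obtain ⟨J, b, rr, hrr, hrr1, hJℓ, hrrJ, hb, hcb⟩ := exists_normalizing_poly hM6 hεBM hδM hεB hεB1
    hδ hδ1 hK0 hKM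
  have hs0 : 0 < 1 / (2 + Real.log K) := by positivity
  have hwn : (width n : ℝ) ≤ 4 * Real.log M := width_le_log (by linarith) hM6
  have hwd : (width d : ℝ) ≤ 4 * Real.log M := width_le_log (by linarith) hM6
  have hLM : (L : ℝ) ≤ 12 * Real.log M := by
    refine le_log_of_two_pow_le hM6 (hL3.trans ?_)
    linarith
  let P : RowParams :=
    { n := n, d := d, w := w, r := r, L := L, sh := f - f', K := K, J := J, rr := rr
      c := fun k => (-1) ^ k * c k, b := b, s := 1 / (2 + Real.log K), εB := εB }
  have hgood : P.Good :=
    { s_nonneg := hs0.le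
      s_le := by
        change 1 / (2 + Real.log K) ≤ 1
        rw [div_le_one (by positivity)]
        linarith
      sum_le := by
        have e : ∑ k ∈ Finset.range (K + 1), |(-1) ^ k * c k|
            = ∑ k ∈ Finset.range (K + 1), |c k| := by simp [abs_mul]
        change 1 / (2 + Real.log K) * ∑ k ∈ Finset.range (K + 1), |(-1) ^ k * c k| ≤ 1
        rw [e, one_div_mul_eq_div, div_le_one (by positivity)]
        exact hcs
      εB_nonneg := hεB.le
      εB_le := hεB1 }
  refine ⟨Fintype.card (RowAnc P), relabelC (rowEquiv P) (rowC P), ?_, fun S R N hS hR hN => ?_⟩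
  · rw [time_relabelC]
    exact time_rowC_le (P := P) hT hℓ ha hεB' hw hwn hwd hLM hKℓ hJℓ hrrJ
  · exact exists_preparesRows_rowC (P := P) hgood hs0 hεB hn hη hε hεη hd hδ hδ1 hff rfl hf' hL1
      (fun k => rfl) hstep hrr hrr1 hb hcb hS hR hN

/-! ### The norm circuit -/

section NormCircuit

/-- The wires of the norm circuit: an index and ancillas. -/
abbrev NormWires (n : ℕ) : Type := Fin (width n) ⊕ (Fin 3 ⊕ Fin (2 * width n + 3))

variable (n : ℕ)

/-- The scratch wires of the norm circuit. -/
def countW (k : ℕ) : NormWires n := Sum.inr (Sum.inr (Fin.ofNat (2 * width n + 3) k))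

/-- The wires of the index. -/
def indexWires : List (NormWires n) := (List.finRange (width n)).map fun j => Sum.inl j

variable {n}

/-- The basis state with the bits `y` in the index register and zero ancillas. -/
def indexStr (y : Fin (width n) → Bool) : NormWires n → Bool :=
  Sum.elim y fun _ => false

theorem indexStr_injective : Function.Injective (indexStr (n := n)) := fun y y' h => by
  funext j
  exact congrFun h (Sum.inl j)

theorem mem_indexWires (w : NormWires n) : w ∈ indexWires n ↔ ∃ j, w = Sum.inl j := by
  simp [indexWires, eq_comm]

theorem countW_injOn : Set.InjOn (countW n) (Set.Iic (2 * width n + 2)) := by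
  intro i hi j hj h
  simp only [countW, Sum.inr.injEq, Fin.ext_iff, Fin.val_ofNat] at h
  rwa [Nat.mod_eq_of_lt (Nat.lt_succ_of_le hi), Nat.mod_eq_of_lt (Nat.lt_succ_of_le hj)] at h

variable {Vr Vn : Type} [Fintype Vr] [DecidableEq Vr] [Fintype Vn] [DecidableEq Vn]

variable (n) in
/-- The circuit that decides whether the index is at least `n`. -/
def overflowC : QCircuit Vr Vn (NormWires n) :=
  scanC (countW n) 0 ((List.finRange _).map fun j => (Sum.inl j, Sum.inr (Sum.inl 0),
    fun s u _ => if (n - 1).testBit j = u then s else u))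

variable (n) in
/-- The circuit that prepares a superposition of the indices, with amplitude `cos θ` for the indices
below `n`. -/
def dampedC (θ : ℝ) : QCircuit Vr Vn (NormWires n) :=
  uniformC (Sum.inr (Sum.inl 0)) (Sum.inr (Sum.inl 1)) (indexWires n) ++
    conjC (overflowC n) (cg (countW n (2 * width n)) (Sum.inr (Sum.inl 0)) (Sum.inr (Sum.inl 2))
      fun u _ => if u then rot (Real.pi / 2) else rot θ)

variable (n) in
/-- The circuit that prepares the uniform superposition of the indices below `n`. -/
def normC (θ : ℝ) : QCircuit Vr Vn (NormWires n) :=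
  amplifyC (countW n) (Sum.inr (Sum.inl 0)) (Sum.inr (Sum.inl 1)) (dampedC n θ)
    (indexWires n ++ [Sum.inr (Sum.inl 2)]) [Sum.inr (Sum.inl 2)] 2

theorem time_normC_le (T θ : ℝ) :
    QCircuit.time T (normC n θ : QCircuit Vr Vn (NormWires n)) ≤ 47 * width n + 33 := by
  have h1 := time_uniformC_le (Vr := Vr) (Vn := Vn) T (Sum.inr (Sum.inl 0)) (Sum.inr (Sum.inl 1))
    (indexWires n)
  have h2 := time_scanC_le (Vr := Vr) (Vn := Vn) T (countW n) 0 ((List.finRange (width n)).map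
    fun j => ((Sum.inl j, Sum.inr (Sum.inl 0),
      fun s u _ => if (n - 1).testBit j = u then s else u) : ScanStep (NormWires n)))
  have h3 := time_cg_le (Vr := Vr) (Vn := Vn) T (countW n (2 * width n)) (Sum.inr (Sum.inl 0))
    (Sum.inr (Sum.inl 2)) fun u _ => if u then rot (Real.pi / 2) else rot θ
  have h4 := time_amplifyC_le (Vr := Vr) (Vn := Vn) T (countW n) (Sum.inr (Sum.inl 0))
    (Sum.inr (Sum.inl 1)) (dampedC n θ) (indexWires n ++ [Sum.inr (Sum.inl 2)])
    [Sum.inr (Sum.inl 2)] 2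
  have h5 : (indexWires n).length = width n := by simp [indexWires]
  rw [h5] at h1
  rw [List.length_map, List.length_finRange] at h2
  have h6 : QCircuit.time T (dampedC n θ : QCircuit Vr Vn (NormWires n)) ≤ 7 * width n + 1 := by
    rw [dampedC, time_append, time_conjC, overflowC]
    linarith
  refine h4.trans ?_
  rw [List.length_append, h5]
  simp only [List.length_cons, List.length_nil]
  push_cast
  linarith

variable (R : QUnitary Vr)
  (N : QUnitary Vn)

theorem cOp_overflowC {i : ℕ} (hi : i < 2 ^ width n) (hn : 0 < n) :
    ∃ x' : NormWires n → Bool, (∀ w, (∀ k, w ≠ countW n k) → x' w = indexStr (bits (width n) i) w) ∧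
      x' (countW n (2 * width n)) = decide (n - 1 < i) ∧
      cOp R N (overflowC n) (ket (indexStr (bits (width n) i))) = ket x' := by
  obtain ⟨x', h1, h2, h3⟩ := cOp_scanC_ket R N (S := 2 * width n) (countW_injOn.mono
    (Set.Iic_subset_Iic.2 (Nat.le_add_right _ 2)))
    ((List.finRange (width n)).map fun j => ((Sum.inl j, Sum.inr (Sum.inl 0),
      fun s u _ => if (n - 1).testBit j = u then s else u) : ScanStep (NormWires n))) 0 (by simp)
    (by
      intro p hp
      obtain ⟨j, -, rfl⟩ := List.mem_map.1 hp
      exact ⟨by simp, fun k _ => ⟨by simp [countW], by simp [countW]⟩⟩)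
    (indexStr (bits (width n) i)) (fun k _ _ => rfl)
  refine ⟨x', fun w hw => h1 w fun k _ _ => hw k, ?_, h3⟩
  have h4 := scanVal_lt (indexStr (bits (width n) i)) (n - 1) i (fun j : Fin (width n) =>
    ((Sum.inl j, Sum.inr (Sum.inl 0),
      fun s u _ => if (n - 1).testBit j = u then s else u) : ScanStep (NormWires n)))
    fun j s => rfl
  rw [Nat.mod_eq_of_lt hi, Nat.mod_eq_of_lt (lt_two_pow_width (Nat.sub_lt hn one_pos))] at h4
  rw [← h4]
  simpa [indexStr, countW] using h2

theorem overflowC_avoids :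
    Avoids (overflowC n : QCircuit Vr Vn (NormWires n)) {Sum.inr (Sum.inl 2)} := by
  refine scanC_avoids (fun k => by simp [countW]) 0 fun p hp => ?_
  obtain ⟨j, -, rfl⟩ := List.mem_map.1 hp
  simp

theorem pres_damp {θ : ℝ} {i : ℕ} (hi : i < 2 ^ width n) (hn : 0 < n) :
    Pres R N (conjC (overflowC n) (cg (countW n (2 * width n)) (Sum.inr (Sum.inl 0))
      (Sum.inr (Sum.inl 2)) fun u _ => if u then rot (Real.pi / 2) else rot θ))
      {Sum.inr (Sum.inl 2)} (indexStr (bits (width n) i)) := by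
  obtain ⟨x', -, -, h3⟩ := cOp_overflowC R N hi hn
  exact Pres.conjC overflowC_avoids h3 (Local.cg (Set.mem_singleton _) x')

theorem projOp_damp {θ : ℝ} {i : ℕ} (hi : i < 2 ^ width n) (hn : 0 < n) :
    projOp [Sum.inr (Sum.inl 2)] (cOp R N (conjC (overflowC n)
      (cg (countW n (2 * width n)) (Sum.inr (Sum.inl 0)) (Sum.inr (Sum.inl 2))
        fun u _ => if u then rot (Real.pi / 2) else rot θ)) (ket (indexStr (bits (width n) i))))
      = (((if i < n then Real.cos θ else 0 : ℝ)) : ℂ) • ket (indexStr (bits (width n) i)) := by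
  obtain ⟨x', h1, h2, h3⟩ := cOp_overflowC R N hi hn
  have hmem := pres_damp R N (θ := θ) hi hn _ (ket_mem_Agr _ _)
  rw [projOp_of_mem_Agr (M := {Sum.inr (Sum.inl 2)}) (by simp) (by rintro w rfl; rfl) hmem]
  congr 1
  set x := indexStr (bits (width n) i) with hx
  have hcomm : (fun w => xor (x' w) (x w)) = fun w => xor (x w) (x' w) := by
    funext w
    rw [Bool.xor_comm]
  rw [cOp_conjC overflowC_avoids h3 (Local.cg (Set.mem_singleton _) x') (ket_mem_Agr _ _),
      flipOp_ket,
    xorMask_diff, flipOp_apply, xorMask_diff, cOp_cg_ket R N (by simp [countW]), h2]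
  have hd : x' (Sum.inr (Sum.inl 2)) = false := h1 _ (by simp [countW])
  simp only [Fintype.sum_bool, hd, PiLp.add_apply, PiLp.smul_apply, ket_apply, smul_eq_mul]
  have e1 : x' = Function.update x' (Sum.inr (Sum.inl 2)) false :=
    (Function.update_eq_self_iff.2 hd.symm).symm
  have e2 : ¬x' = Function.update x' (Sum.inr (Sum.inl 2)) true := fun e => by
    have := congrFun e (Sum.inr (Sum.inl 2))
    rw [hd] at this
    simp at this
  have hlt : (n - 1 < i) ↔ ¬i < n := by omega
  rw [if_pos e1, if_neg e2]
  by_cases hin : i < n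
  · simp [hlt, hin, rot]
  · simp [hlt, hin, rot]

theorem cOp_uniformC_index : cOp R N (uniformC (Sum.inr (Sum.inl 0)) (Sum.inr (Sum.inl 1))
      (indexWires n)) (ket (indexStr fun _ => false))
      = ∑ y, (((1 / √2) ^ width n : ℝ) : ℂ) • ket (indexStr y) := by
  have hne : ∀ w ∈ indexWires n, (Sum.inr (Sum.inl 0) : NormWires n) ≠ w ∧
      (Sum.inr (Sum.inl 1) : NormWires n) ≠ w := by
    intro w hw
    obtain ⟨j, rfl⟩ := (mem_indexWires w).1 hw
    simp
  have hnd : (indexWires n).Nodup :=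
    List.Nodup.map (fun a b e => by simpa using e) (List.nodup_finRange _)
  ext z
  rw [cOp_uniformC_apply R N (by simp) hnd hne]
  · have hl : (indexWires n).length = width n := by simp [indexWires]
    rw [hl, ← Complex.ofReal_pow]
    simp only [WithLp.ofLp_sum, WithLp.ofLp_smul, Finset.sum_apply, Pi.smul_apply, ket_apply,
      smul_eq_mul, mul_ite, mul_one, mul_zero]
    split_ifs with h
    · have e : ∀ y, z = indexStr y ↔ y = fun j => z (Sum.inl j) := by
        intro y
        constructor
        · rintro rfl
          rfl
        · rintro rfl
          funext w
          rcases w with w | w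
          · rfl
          · exact h _ (by simp [mem_indexWires])
      simp [e]
    · symm
      refine Finset.sum_eq_zero fun y _ => ?_
      rw [if_neg]
      rintro rfl
      apply h
      intro w hw
      rcases w with w | w
      · exact absurd ((mem_indexWires _).2 ⟨w, rfl⟩) hw
      · rfl
  · intro w hw
    obtain ⟨j, rfl⟩ := (mem_indexWires w).1 hw
    rfl

/-- The part of the state with a zero on the damping qubit: indices from `n` on do not occur in it.
-/
theorem projOp_dampedC (θ : ℝ) (hn : 0 < n) :
    projOp [Sum.inr (Sum.inl 2)] (cOp R N (dampedC n θ) (ket (indexStr fun _ => false)))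
      = ∑ i : Fin n, (((1 / √2) ^ width n * Real.cos θ : ℝ) : ℂ)
        • ket (indexStr (bits (width n) i)) := by
  have hinj : Function.Injective fun i : Fin n => bits (width n) i := fun i j h =>
    Fin.ext ((bits_eq_iff (lt_two_pow_width i.2) (lt_two_pow_width j.2)).1 h)
  rw [dampedC, cOp_append, cOp_uniformC_index, map_sum, map_sum]
  symm
  refine Fintype.sum_of_injective _ hinj _ _ (fun y hy => ?_) fun i => ?_
  · obtain ⟨p, hp, rfl⟩ := exists_eq_bits y
    rw [map_smul, map_smul, projOp_damp R N hp hn, if_neg, Complex.ofReal_zero, zero_smul,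
        smul_zero]
    intro h
    exact hy ⟨⟨p, h⟩, rfl⟩
  · rw [map_smul, map_smul, projOp_damp R N (lt_two_pow_width i.2) hn, if_pos i.2, smul_smul,
      ← Complex.ofReal_mul]

theorem Pres.dampedC (θ : ℝ) (hn : 0 < n) : Pres R N (dampedC n θ)
    {w | w ∈ indexWires n ++ [Sum.inr (Sum.inl 2)]} (indexStr fun _ => false) := by
  refine Pres.append (Local.uniformC (fun w hw => List.mem_append_left _ hw) _)
    (Pres.of_ket fun z hz => ?_)
  obtain ⟨p, hp, e⟩ := exists_eq_bits fun j => z (Sum.inl j)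
  have hAgr : Agr {Sum.inr (Sum.inl 2)} z
      = Agr {Sum.inr (Sum.inl 2)} (indexStr (bits (width n) p)) := by
    refine Agr_congr fun w hw => ?_
    rcases w with w | w
    · exact congrFun e w
    · refine hz _ ?_
      simp only [Set.mem_ofPred_eq, List.mem_append, mem_indexWires, List.mem_singleton]
      rintro (⟨j, h⟩ | h)
      · simp at h
      · exact hw h
  have := pres_damp R N (θ := θ) hp hn (ket z) (by rw [← hAgr]; exact ket_mem_Agr _ z)
  rw [← hAgr] at this
  refine Agr_mono (fun w hw => ?_) z this
  rw [Set.mem_singleton_iff.1 hw]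
  simp

theorem groverWires_dampedC : GroverWires (countW n) (2 * width n + 2) (Sum.inr (Sum.inl 0))
    (indexWires n ++ [Sum.inr (Sum.inl 2)]) [Sum.inr (Sum.inl 2)]
    {w | w ∈ indexWires n ++ [Sum.inr (Sum.inl 2)]} (indexStr fun _ => false) where
  inj := countW_injOn
  dummy := fun k _ => by simp [countW]
  length₀ := by
    simp [indexWires]
    omega
  length₁ := by simp
  list₀ := fun w hw => by
    rw [List.mem_append, mem_indexWires, List.mem_singleton] at hw
    rcases hw with ⟨j, rfl⟩ | rfl <;> simp [countW]
  list₁ := fun w hw => by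
    rw [List.mem_singleton] at hw
    subst hw
    simp [countW]
  scratch := fun k _ => ⟨by simp [countW, mem_indexWires], rfl⟩

/-- The angle for which two rounds of amplification give exactly the uniform superposition. -/
theorem exists_damping_angle (hn : 0 < n) :
    ∃ θ : ℝ, (1 / √2) ^ width n * Real.cos θ
      = Real.sin (Real.pi / (2 * (2 * (2 : ℕ) + 1))) * (1 / √n) := by
  have hn0 : (0 : ℝ) < n := by exact_mod_cast hn
  set s := Real.sin (Real.pi / (2 * (2 * (2 : ℕ) + 1)))
  have hπ := Real.pi_pos
  have hβ : Real.pi / (2 * (2 * ((2 : ℕ) : ℝ) + 1)) ≤ 1 / 2 := by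
    rw [div_le_iff₀ (by positivity)]
    push_cast
    linarith [Real.pi_le_four]
  have hs0 : 0 ≤ s := Real.sin_nonneg_of_nonneg_of_le_pi (by positivity)
    (by linarith [Real.pi_gt_three])
  have hs1 : s ≤ 1 / 2 := (Real.sin_le (by positivity)).trans hβ
  have hw : (2 : ℝ) ^ width n ≤ 2 * n := by exact_mod_cast two_pow_width_le hn
  have hx : √2 ^ width n / √n ≤ √2 := by
    rw [div_le_iff₀ (by positivity), ← Real.sqrt_mul zero_le_two]
    refine Real.le_sqrt_of_sq_le ?_
    rw [← pow_mul, mul_comm, pow_mul, Real.sq_sqrt zero_le_two]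
    exact hw
  have hx0 : 0 ≤ √2 ^ width n / √n := by positivity
  have h2 : √2 ≤ 2 := by
    rw [Real.sqrt_le_left zero_le_two]
    norm_num
  refine ⟨Real.arccos (s * (√2 ^ width n / √n)), ?_⟩
  rw [Real.cos_arccos (by linarith [mul_nonneg hs0 hx0]) (by nlinarith)]
  have h3 : (1 / √2) ^ width n * √2 ^ width n = 1 := by
    rw [← mul_pow, one_div_mul_cancel (by positivity), one_pow]
  linear_combination (s / √n) * h3

/-- With the amplitude `sin (π / 10)` before the amplification, two Grover iterates turn the state
by exactly the missing angle, so there is no error. -/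
theorem cOp_normC {θ : ℝ} (hn : 0 < n) (hθ : (1 / √2) ^ width n * Real.cos θ
      = Real.sin (Real.pi / (2 * (2 * (2 : ℕ) + 1))) * (1 / √n)) :
    cOp R N (normC n θ) (ket (indexStr fun _ => false))
      = ∑ i : Fin n, ((1 / √n : ℝ) : ℂ) • ket (indexStr (bits (width n) i)) := by
  have hn0 : (0 : ℝ) < n := by exact_mod_cast hn
  have hinj : Function.Injective fun i : Fin n => indexStr (n := n) (bits (width n) i) :=
      fun i j h =>
    Fin.ext ((bits_eq_iff (lt_two_pow_width i.2) (lt_two_pow_width j.2)).1 (indexStr_injective h))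
  have hg : ‖∑ i : Fin n, ((1 / √n : ℝ) : ℂ) • ket (indexStr (n := n) (bits (width n) i))‖ = 1 := by
    have h := norm_sq_sum_ket hinj fun _ => ((1 / √n : ℝ) : ℂ)
    rw [Finset.sum_const, Finset.card_univ, Fintype.card_fin, Complex.norm_real, Real.norm_eq_abs,
      sq_abs, div_pow, Real.sq_sqrt hn0.le, one_pow, nsmul_eq_mul, mul_one_div_cancel hn0.ne'] at h
    exact (pow_eq_one_iff_of_nonneg (norm_nonneg _) two_ne_zero).1 h
  have hβ : 0 < Real.sin (Real.pi / (2 * (2 * ((2 : ℕ) : ℝ) + 1))) := by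
    refine Real.sin_pos_of_pos_of_lt_pi (by positivity) (div_lt_self Real.pi_pos ?_)
    push_cast
    norm_num
  have h := norm_groverOp_pow_sub_le (Pres.dampedC R N θ hn) (fun w => Iff.rfl) (fun w hw => by
    revert hw
    simp only [Set.mem_ofPred_eq, List.mem_append, mem_indexWires, List.mem_singleton]
    rintro (⟨j, rfl⟩ | rfl) <;> rfl) (l₁ := [Sum.inr (Sum.inl 2)]) even_two one_le_two hg
    (α := Real.sin (Real.pi / (2 * (2 * (2 : ℕ) + 1)))) (by
      rw [projOp_dampedC R N θ hn, Finset.smul_sum]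
      refine Finset.sum_congr rfl fun i _ => ?_
      rw [smul_smul, ← Complex.ofReal_mul, hθ]) hβ le_rfl
  rw [sub_self, mul_zero] at h
  rw [normC, cOp_amplifyC groverWires_dampedC (Pres.dampedC R N θ hn) (by simp) (by simp [countW])]
  exact sub_eq_zero.1 (norm_le_zero_iff.1 h)

variable (n) in
/-- The ancillas of the norm circuit are numbered. -/
def normEquiv : NormWires n ≃ AccessWires n (Fin 0) (3 + (2 * width n + 3)) :=
  Equiv.sumCongr (Equiv.refl _) (finSumFinEquiv.trans (Equiv.emptySum _ _).symm)

theorem relabelOp_indexStr (i : Fin n) : relabelOp (normEquiv n) (ket (indexStr (bits (width n) i)))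
    = accessKet (3 + (2 * width n + 3)) i Fin.elim0 := by
  rw [relabelOp_ket, accessKet]
  congr 1
  funext w
  rcases w with w | w | w
  · rfl
  · exact w.elim0
  · rfl

theorem relabelOp_indexStr_zero : relabelOp (normEquiv n) (ket (indexStr fun _ => false))
    = ket fun _ => false := by
  rw [relabelOp_ket]
  congr 1
  funext w
  rcases w with w | w | w
  · rfl
  · exact w.elim0
  · rfl

/-- The circuit prepares the norms of the rows of a matrix whose rows have norm one. -/
theorem preparesNormState_normC {κ : Type} [Fintype κ] {θ δ : ℝ} (hn : 0 < n) (hδ : 0 ≤ δ)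
    (hθ : (1 / √2) ^ width n * Real.cos θ
      = Real.sin (Real.pi / (2 * (2 * (2 : ℕ) + 1))) * (1 / √n)) {A : Matrix (Fin n) κ ℝ}
    (hA : ∀ i, ‖rowVec A i‖ = 1) :
    PreparesNormState ((relabelC (normEquiv n) (normC n θ)).run R N) A δ := by
  have hF : frobNorm A = √n := by
    have h : ∀ i, ∑ j, A i j ^ 2 = 1 := fun i => by
      have := EuclideanSpace.norm_sq_eq (rowVec A i)
      rw [hA, one_pow] at this
      rw [this]
      exact Finset.sum_congr rfl fun j _ => (sq_abs (A i j)).symm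
    rw [frobNorm, Finset.sum_congr rfl fun i _ => h i, Finset.sum_const, Finset.card_univ,
      Fintype.card_fin, nsmul_eq_mul, mul_one]
  rw [PreparesNormState, run_eq_cOp, ← relabelOp_indexStr_zero, cOp_relabelC, cOp_normC R N hn hθ,
    map_sum, hF]
  simp only [hA, map_smul, relabelOp_indexStr]
  rw [sub_self, norm_zero]
  exact hδ

end NormCircuit

/-! ### Quantum access to the normalized incidence matrix -/

theorem one_le_eta {n d : ℕ} (hn : 0 < n) {S : Matrix (Fin n) (Fin d) ℝ}
    (h1 : (⨅ i, ‖rowVec S i‖) = 1) : 1 ≤ eta S := by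
  have : Nonempty (Fin n) := ⟨⟨0, hn⟩⟩
  obtain ⟨h2, h3⟩ := row_norm_bounds hn h1 le_rfl ⟨0, hn⟩
  exact Real.one_le_sqrt.1 (h2.trans h3)

theorem mainTheorem3 :
    ∃ (C : ℝ) (K : ℕ),
      ∀ (n d w r f : ℕ) (TS η εdist εB dmin δ : ℝ),
        3 ≤ n → 1 ≤ TS → (w : ℝ) ≤ TS →
        0 < εdist → εdist ≤ 4 * η → 0 < εB → εB ≤ 1 → 0 < dmin → 0 < δ → δ < 1 →
        32 * √η ≤ εdist * 2 ^ f →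
        ∃ (m₁ m₂ : ℕ)
          (rowCircuit : QCircuit (AccessWires n (Fin (width d)) w) (AccessWires n (Fin r) 0)
            (AccessWires n (Fin (width n) ⊕ Fin (width n)) m₁))
          (normCircuit : QCircuit (AccessWires n (Fin (width d)) w) (AccessWires n (Fin r) 0)
            (AccessWires n (Fin 0) m₂)),
          rowCircuit.time TS + normCircuit.time TS ≤
            C * (TS * (η / εdist) * (1 / εB)) *
              Real.log (n + d + η + 1 / εdist + 1 / εB + 1 / δ) ^ K ∧
          ∀ (S : Matrix (Fin n) (Fin d) ℝ)
            (R : QUnitary (AccessWires n (Fin (width d)) w))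
            (N : QUnitary (AccessWires n (Fin r) 0)),
            (⨅ i, ‖rowVec S i‖) = 1 → eta S ≤ η →
            PreparesRows R S (fun j => bits (width d) j) 0 → WritesNorms N S f →
            ∃ B : Matrix (Fin n) (NodePair n) ℝ,
              IsSimilarityIncidence S dmin εdist εB B ∧
              (∀ i, ‖rowVec (normalizeRows B) i‖ = 1) ∧
              PreparesRows (rowCircuit.run R N) (normalizeRows B) pairBits δ ∧
              PreparesNormState (normCircuit.run R N) (normalizeRows B) δ := by
  refine ⟨10 ^ 18, 5, ?_⟩
  intro n d w r f TS η εdist εB dmin δ hn hT hw hε hεη hεB hεB1 hd hδ hδ1 hf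
  have hn0 : 0 < n := by omega
  have hnR : (3 : ℝ) ≤ n := by exact_mod_cast hn
  have hdR : (0 : ℝ) ≤ d := Nat.cast_nonneg d
  have hη0 : 0 < η := by linarith
  rcases lt_or_ge η 1 with hη | hη
  · -- no matrix has `η(S) < 1`
    refine ⟨0, 0, [], [], ?_, fun S R N h1 h2 => absurd (one_le_eta hn0 h1) (by linarith)⟩
    have hM : 1 ≤ (n : ℝ) + d + η + 1 / εdist + 1 / εB + 1 / δ := by
      have : 0 < 1 / εdist + 1 / εB + 1 / δ := by positivity
      linarith
    have := Real.log_nonneg hM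
    simp only [QCircuit.time, List.map_nil, List.sum_nil, add_zero]
    positivity
  · obtain ⟨m, C, hC, hrows⟩ := exists_rowCircuit (d := d) (r := r) hn hT hw hε hεη hεB hεB1 hd hδ
      hδ1 hη hf
    obtain ⟨θ, hθ⟩ := exists_damping_angle hn0
    refine ⟨m, _, C, relabelC (normEquiv n) (normC n θ), ?_, fun S R N h1 h2 hR hN => ?_⟩
    · have hεB' : 1 ≤ 1 / εB := one_le_one_div hεB hεB1
      have hδ' : 1 ≤ 1 / δ := one_le_one_div hδ hδ1.le
      have hε' : 0 < 1 / εdist := by positivity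
      generalize hMdef : (n : ℝ) + d + η + 1 / εdist + 1 / εB + 1 / δ = M at hC ⊢
      have hM : 6 ≤ M := by linarith
      have hℓ := one_le_log hM
      have hwn : (width n : ℝ) ≤ 4 * Real.log M := width_le_log (by linarith) hM
      have ha : 1 / 4 ≤ η / εdist := by
        rw [le_div_iff₀ hε]
        linarith
      have h3 : 1 / 4 ≤ TS * (η / εdist) * (1 / εB) := by
        have : 1 / 4 ≤ TS * (η / εdist) := by nlinarith
        nlinarith
      have h4 : Real.log M ≤ Real.log M ^ 5 := le_self_pow₀ hℓ (by norm_num)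
      have h5 := time_normC_le (Vr := AccessWires n (Fin (width d)) w)
        (Vn := AccessWires n (Fin r) 0) (n := n) TS θ
      have h6 : 1 / 4 * Real.log M ≤ TS * (η / εdist) * (1 / εB) * Real.log M ^ 5 :=
        mul_le_mul h3 h4 (by linarith) (by linarith)
      rw [time_relabelC]
      calc C.time TS + QCircuit.time TS (normC n θ)
          ≤ 10 ^ 17 * (TS * (η / εdist) * (1 / εB)) * Real.log M ^ 5 + 221 * Real.log M := by
            linarith
        _ ≤ 10 ^ 18 * (TS * (η / εdist) * (1 / εB)) * Real.log M ^ 5 := by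
          rw [mul_assoc, mul_assoc (10 ^ 18 : ℝ)]
          linarith
    · obtain ⟨B, hB, hpos, hprep⟩ := hrows S R N (row_norm_bounds hn0 h1 h2) hR hN
      have hnorm := fun i => norm_rowVec_normalizeRows (hpos i)
      exact ⟨B, hB, hnorm, hprep, preparesNormState_normC R N hn0 hδ.le hθ hnorm⟩


end
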